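/- **Notation.** Throughout, $p$ denotes a prime, $\gamma$ is the Euler--Mascheroni constant, $\chi_4$ is the non-trivial Dirichlet character modulo $4$, and $$K=\frac1{\sqrt2}\prod_{p\equiv 3\,(4)}(1-p^{-2})^{-1/2},\qquad \omega=\log\frac{2}{\pi^2}+\frac{L'(1,\chi_4)}{L(1,\chi_4)}+2\sum_{p\equiv3\,(4)}\frac{\log p}{p^2-1}.$$ For a finite set $\mathcal H\subset\mathbb Z$ of $k$ integers put $$\delta_{\mathcal H}(p)=\lim_{\alpha\to\infty}\frac{\#\{0\le a<p^\alpha:\ \text{for all } h\in\mathcal H,\ a+h \text{ is a sum of two squares modulo } p^\alpha\}}{p^\alpha},\qquad \mathfrak S(\mathcal H)=\prod_{p\not\equiv1\,(4)}\frac{\delta_{\mathcal H}(p)}{\delta_{\{0\}}(p)^k}.$$ For a prime $q\equiv 1 \pmod 4$ and a non-principal Dirichlet character $\chi$ modulo $q$ put $$C_{q,\chi}=L(0,\chi)\,L(1,\chi)^{1/2}L(1,\chi\chi_4)^{-1/2}\,(1-\chi(2)+\chi(4))\,(1-\tfrac12\chi(2))^{-1/2}\prod_{p\equiv3\,(4)}(1-\chi(p)^2p^{-2})^{-1/2}.$$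 Here $L(1,\psi)^{1/2}$ is the limit as $s\to1^+$ of $\exp\big(-\tfrac12\sum_p\log(1-\psi(p)p^{-s})\big)$ with principal logarithms (that is, the value at $1$ of the branch of $L(s,\psi)^{1/2}$ that tends to $1$ as $s\to+\infty$), $L(1,\psi)^{-1/2}$ is its inverse, and all other powers are principal. Near $s=0$ put $$M(s)=(1-2^{-s}+2^{-2s})\,L(s+1,\chi_4)^{-1/2}(1-2^{-(s+1)})^{-1/2}\prod_{p\equiv3\,(4)}(1-p^{-2(s+1)})^{-1/2},\qquad G(s)=s\,\Gamma(s)\,\zeta(s)\,(s\zeta(s+1))^{1/2}M(s),$$ where the removable singularities at $s=0$ are removed and the powers are principal. For $g$ analytic at $0$ write $[s^j]g$ for its $j$-th Taylor coefficient at $0$. **Theorem 1.2.** There are absolute real constants $c(j)$, $j\ge1$, and, for each prime $q\equiv1\pmod 4$, real constants $c_0(j),c_1(j)$, $j\ge1$, that depend only on $q$ and $j$, such that for every $J\ge1$, as $H\to\infty$, $$\sum_{h\ge1}\mathfrak S(\{0,h\})e^{-h/H}=H-\frac{2}{K\pi}\sqrt{\log H}+\sum_{j=1}^Jc(j)(\log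 H)^{1/2-j}+O\big((\log H)^{-1/2-J}\big),$$ $$\sum_{\substack{h\ge1\\ h\equiv0\,(q)}}\mathfrak S(\{0,h\})e^{-h/H}=\frac Hq-\frac{2}{K\pi}\sqrt{\log H}+\sum_{j=1}^Jc_0(j)(\log H)^{1/2-j}+O\big((\log H)^{-1/2-J}\big),$$ and, for every $v\not\equiv0\pmod q$, $$\sum_{\substack{h\ge1\\ h\equiv v\,(q)}}\mathfrak S(\{0,h\})e^{-h/H}=\frac Hq+\frac{1}{2K^2\varphi(q)}\sum_{\substack{\chi \bmod q\\ \chi\ne\chi_0}}\overline\chi(v)\,C_{q,\chi}+\sum_{j=1}^Jc_1(j)(\log H)^{1/2-j}+O\big((\log H)^{-1/2-J}\big);$$ the implied constants depend on $J$, and in the last two formulas also on $q$. For all $j\ge1$ one has $c_0(j)+\varphi(q)c_1(j)=c(j)$, and the constants are explicit: $$c(j)=\frac{[s^j]\,G(s)}{2K^2\Gamma(\frac32-j)},\qquad c_0(j)=\frac{[s^j]\,q^{-s}G(s)}{2K^2\Gamma(\frac32-j)},\qquad c_1(j)=\frac{[s^j]\,(1-q^{-s})G(s)}{2K^2\varphi(q)\Gamma(\frac32-j)}.$$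 In particular $$c(1)=\frac{\omega+\gamma}{2\pi K},\qquad c_0(1)=\frac1{K\pi}\Big(\frac{\omega+\gamma}2+\log q\Big),\qquad c_1(1)=-\frac{\log q}{K\varphi(q)\pi}.$$ -/

import Mathlib

open Filter Topology Asymptotics

noncomputable section

namespace TwoSquares

/-- The primes congruent to `3` modulo `4`. -/
abbrev PrimesThree : Type := {p : ℕ // p.Prime ∧ p % 4 = 3}

/-- The primes not congruent to `1` modulo `4`. -/
abbrev PrimesNotOne : Type := {p : ℕ // p.Prime ∧ p % 4 ≠ 1}

/-- The Landau--Ramanujan constant `K`. -/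
def landauRamanujan : ℝ :=
  (1 / Real.sqrt 2) * ∏' p : PrimesThree, (1 - (p : ℝ) ^ (-2 : ℝ)) ^ (-(1 / 2) : ℝ)

/-- The number of `0 ≤ a < p ^ α` such that, for every `h ∈ 𝓗`, the number `a + h` is a sum of two
squares modulo `p ^ α`. -/
def localCount (𝓗 : Finset ℤ) (p α : ℕ) : ℕ :=
  Set.ncard {a : ℕ | a < p ^ α ∧
    ∀ h ∈ 𝓗, ∃ x y : ℤ, (a : ℤ) + h ≡ x ^ 2 + y ^ 2 [ZMOD ((p : ℤ) ^ α)]}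

/-- The local density `δ_𝓗(p)`. -/
def localDensity (𝓗 : Finset ℤ) (p : ℕ) : ℝ :=
  limUnder atTop (fun α : ℕ => (localCount 𝓗 p α : ℝ) / (p : ℝ) ^ α)

/-- The Hardy--Littlewood constant (singular series) `𝔖(𝓗)` for sums of two squares. -/
def singularSeries (𝓗 : Finset ℤ) : ℝ :=
  ∏' p : PrimesNotOne, localDensity 𝓗 p / localDensity {0} p ^ 𝓗.card

/-- The sum of `𝔖({0, h}) e^{-h/H}` over the natural numbers `h` in `A`. -/
def weightedSum (A : Set ℕ) (H : ℝ) : ℝ :=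
  ∑' h : A, singularSeries {0, ((h : ℕ) : ℤ)} * Real.exp (-((h : ℕ) : ℝ) / H)

/-- The non-trivial Dirichlet character modulo `4`, with complex values. -/
def chiFour : DirichletCharacter ℂ 4 := ZMod.χ₄.ringHomComp (Int.castRingHom ℂ)

/-- The character `χ · χ₄`, modulo `4 q`. -/
def mulChiFour {q : ℕ} (χ : DirichletCharacter ℂ q) : DirichletCharacter ℂ (4 * q) :=
  DirichletCharacter.changeLevel (dvd_mul_left q 4) χ *
    DirichletCharacter.changeLevel (dvd_mul_right 4 q) chiFour

/-- The square root `L(1, χ) ^ (1 / 2)` for a non-principal character `χ`. It is the value at `1` of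
the branch of `L(s, χ) ^ (1 / 2)` that is given for `s > 1` by the Euler product with principal
logarithms of the factors (the branch that tends to `1` as `s → ∞`). This need not be the
principal square root of the number `L(1, χ)`. -/
def sqrtLOne {N : ℕ} (χ : DirichletCharacter ℂ N) : ℂ :=
  limUnder (𝓝[>] (1 : ℝ)) (fun s : ℝ =>
    Complex.exp ((1 / 2) *
      ∑' p : Nat.Primes, -Complex.log (1 - χ ((p : ℕ) : ZMod N) * ((p : ℕ) : ℂ) ^ (-(s : ℂ)))))

/-- The constant `C_{q,χ}` of a non-principal character `χ` modulo `q`. -/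
def charConst {q : ℕ} [NeZero q] (χ : DirichletCharacter ℂ q) : ℂ :=
  χ.LFunction 0 * sqrtLOne χ * (sqrtLOne (mulChiFour χ))⁻¹ *
    (1 - χ 2 + χ 4) * (1 - χ 2 / 2) ^ (-(1 / 2) : ℂ) *
    ∏' p : PrimesThree, (1 - χ ((p : ℕ) : ZMod q) ^ 2 * ((p : ℕ) : ℂ) ^ (-2 : ℂ)) ^ (-(1 / 2) : ℂ)

/-- The constant `ω`. -/
def omegaConst : ℂ :=
  (Real.log (2 / Real.pi ^ 2) : ℂ) + deriv chiFour.LFunction 1 / chiFour.LFunction 1 +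
    2 * ((∑' p : PrimesThree, Real.log (p : ℕ) / (((p : ℕ) : ℝ) ^ 2 - 1) : ℝ) : ℂ)

/-- The function `M(s)`, near `s = 0`. -/
def auxM (s : ℂ) : ℂ :=
  (1 - (2 : ℂ) ^ (-s) + (2 : ℂ) ^ (-(2 * s))) * chiFour.LFunction (s + 1) ^ (-(1 / 2) : ℂ) *
    (1 - (2 : ℂ) ^ (-(s + 1))) ^ (-(1 / 2) : ℂ) *
    ∏' p : PrimesThree, (1 - ((p : ℕ) : ℂ) ^ (-(2 * (s + 1)))) ^ (-(1 / 2) : ℂ)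

/-- The entire function `s ↦ s ζ(s + 1)`, whose value at `0` is `1`. -/
def zetaShift : ℂ → ℂ := Function.update (fun s => s * riemannZeta (s + 1)) 0 1

/-- The regular part `s ^ (3 / 2) D(s) Γ(s)` at `s = 0`, where
`D(s) = ζ(s) ζ(s + 1) ^ (1 / 2) M(s)`; it is written with `s Γ(s) = Γ(s + 1)`. -/
def regularPart (s : ℂ) : ℂ :=
  Complex.Gamma (s + 1) * riemannZeta s * zetaShift s ^ (1 / 2 : ℂ) * auxM s

/-- For `g(s) = ∑ g_j s ^ j` near `0`, the number `g_j / (2 K ^ 2 Γ(3 / 2 - j))`. -/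
def expansionCoeff (g : ℂ → ℂ) (j : ℕ) : ℂ :=
  (iteratedDeriv j g 0 / (j.factorial : ℂ)) /
    (2 * (landauRamanujan : ℂ) ^ 2 * Complex.Gamma (3 / 2 - (j : ℂ)))

end TwoSquares

end

/-!
The singular series of a pair is a multiplicative function of `h`: recursions for the number of
`a < p ^ α` such that `a` and `a + h` are sums of two squares give all local densities, and
`𝔖({0, h}) = F(h) / (2 K ^ 2)` with `F = ζ * e * μ₂`, where `e(d) = 1 / d` on the integers `d`
without prime factor `1` modulo `4`, and `μ₂` is supported on `{1, 2, 4}` (`singularSeries_pair`).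
Its twist by a character `χ` has the Dirichlet series `L(s, χ) A_χ(s) P_χ(s)`, where `P_χ` is a
polynomial in `2 ^ (-s)` and `A_χ(s)` is, up to factors that are harmless to the right of
`Re s = -1 / 2`, the ratio `L(s + 1, χ) ^ (1 / 2) L(s + 1, χ χ₄) ^ (-1 / 2)`
(`restrictedSeries_eq`). The smoothed sums of `χ F` are therefore inverse Mellin transforms of
`Γ(s) L(s, χ) A_χ(s) P_χ(s)`. Orthogonality of characters, and the fact that `F` does not see a
prime factor `q ≡ 1` modulo `4`, reduce the sums over residue classes to these twisted sums
(`weightedSum_class`, `weightedSum_zero_class`).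

The line of integration is moved to `Re s = 1 / L` with `L = log H`; only the pole of `ζ` at `s = 1`
is crossed, and it gives the main term `H` (`twistedSum_eq_add`). Because of the square roots the
integrand cannot be continued past zeros of `L(s + 1, χ)`, but there is no need to go to the left of
`Re s = 0`. On the line `Re s = 1 / L` the factor `H ^ s` is bounded, and each integration by parts
saves a factor `L`; so an integrand all of whose derivatives are bounded by `(1 + |s|) ^ (-3 / 2)`
on the strip `0 < Re s < 1 / 2` contributes less than every power of `1 / L`
(`TameOn.integral_isBigO`). That the derivatives grow at most polynomially away from `s = 0` follows
from Cauchy's estimates for the entire factors, and for the square roots from the identity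
`g' = (h' / 2 h) g` for `g ^ 2 = h` (`PolyTameOn.of_sq`), once `1 / L(s + 1, χ)` is known to grow
polynomially. The last fact is the quantitative form of nonvanishing on the line `Re s = 1`, from
the `3-4-1` inequality (`growthOn_inv_of_three_four_one`). The factor `Γ(s) L(s, χ)` supplies rapid
decay (`growthOn_Gamma_mul_LFunction`).

The expansion thus comes from the singularity at `s = 0` alone. For a nonprincipal `χ` it is a
simple pole, and subtracting a multiple of `Γ(s)`, which is the transform of `e ^ (-1 / H)`, leaves
the constant `C_{q,χ}` (`inverseLaplace_one`, `twistedSum_nonprincipal`). For the trivial character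
it is a power series times `s ^ (-3 / 2)`; subtracting a combination of `e ^ (-k s) s ^ (-3 / 2)`,
whose transforms are multiples of `√(L - k)`, leaves a smooth function, and expanding the square
roots gives the powers `L ^ (1 / 2 - j)` with the Taylor coefficients of the regular part
(`inverseLaplace_three_halves`, `twistedSum_principal`). The square roots of Euler products are
identified near `0` by continuity from the real axis: with the limit that defines
`L(1, χ) ^ (1 / 2)` in general (`sqrtLOne_eq`), with principal powers for the real characters
(`eventually_eq_cpow_half`). The sums over all `h` and over the multiples of `q` are real, hence so
are the coefficients (`im_eq_zero_of_expansion`). The first two coefficients are computed from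
`ζ(0)`, `ζ'(0)`, `L(1, χ₄) = π / 4` and Euler's constant (`regularPart_zero`,
`hasDerivAt_regularPart`).
-/

noncomputable section

namespace TwoSquares

/-! ### Sums of two squares modulo prime powers -/

/-- `n` is a sum of two squares modulo `m`. -/
def SumTwoSqMod (m n : ℕ) : Prop := ∃ x y : ℤ, (n : ℤ) ≡ x ^ 2 + y ^ 2 [ZMOD (m : ℤ)]

lemma SumTwoSqMod.congr {m n n' : ℕ} (h : n ≡ n' [MOD m]) :
    SumTwoSqMod m n ↔ SumTwoSqMod m n' := by
  have h' : (n : ℤ) ≡ n' [ZMOD m] := (Int.natCast_modEq_iff).2 h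
  constructor
  · rintro ⟨x, y, hxy⟩; exact ⟨x, y, h'.symm.trans hxy⟩
  · rintro ⟨x, y, hxy⟩; exact ⟨x, y, h'.trans hxy⟩

lemma sumTwoSqMod_of_prime {m n l : ℕ} (hl : l.Prime) (h1 : l % 4 = 1) (h : l ≡ n [MOD m]) :
    SumTwoSqMod m n := by
  have : Fact l.Prime := ⟨hl⟩
  obtain ⟨a, b, hab⟩ := Nat.Prime.sq_add_sq (p := l) (by omega)
  refine (SumTwoSqMod.congr h).1 ⟨a, b, ?_⟩
  rw [← hab]; push_cast; rfl

/-- By Dirichlet's theorem, a residue coprime to an odd modulus contains a prime that is `1`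
modulo `4`, hence a sum of two squares. -/
lemma sumTwoSqMod_of_coprime {m n : ℕ} (hm : m.Coprime 4) (hm0 : m ≠ 0) (h : n.Coprime m) :
    SumTwoSqMod m n := by
  obtain ⟨k, hk1, hk2⟩ := Nat.chineseRemainder hm n 1
  have hc : k.Coprime (m * 4) := by
    refine Nat.Coprime.mul_right ?_ ?_
    · rw [Nat.Coprime, hk1.gcd_eq]; exact h
    · rw [Nat.Coprime, hk2.gcd_eq]; simp
  obtain ⟨l, -, hl, hlk⟩ := Nat.forall_exists_prime_gt_and_modEq 0 (by positivity) hc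
  refine sumTwoSqMod_of_prime hl ?_ ((hlk.of_mul_right 4).trans hk1)
  exact (hlk.of_mul_left m).trans hk2

lemma sumTwoSqMod_two_pow_of_one_mod_four {α n : ℕ} (hα : 2 ≤ α) (h : n % 4 = 1) :
    SumTwoSqMod (2 ^ α) n := by
  have hc : n.Coprime (2 ^ α) := by
    apply Nat.Coprime.pow_right
    rw [Nat.coprime_two_right]; exact Nat.odd_iff.2 (by omega)
  obtain ⟨l, -, hl, hlk⟩ := Nat.forall_exists_prime_gt_and_modEq 0 (by positivity) hc
  refine sumTwoSqMod_of_prime hl ?_ hlk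
  have : l ≡ n [MOD 4] := hlk.of_dvd (pow_dvd_pow 2 hα)
  rw [this]; exact h

/-- Since `-1` is not a square modulo a prime `p ≡ 3` modulo `4`, a sum of two squares is divisible
by `p` only if both squares are. -/
lemma dvd_of_dvd_sq_add_sq {p : ℕ} (hp : p.Prime) (h3 : p % 4 = 3) {x y : ℤ}
    (h : (p : ℤ) ∣ x ^ 2 + y ^ 2) : (p : ℤ) ∣ x ∧ (p : ℤ) ∣ y := by
  have : Fact p.Prime := ⟨hp⟩
  have key : (x : ZMod p) ^ 2 + (y : ZMod p) ^ 2 = 0 := by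
    have := (ZMod.intCast_zmod_eq_zero_iff_dvd (x ^ 2 + y ^ 2) p).2 h
    exact_mod_cast this
  have hy : (y : ZMod p) = 0 := by
    by_contra hy
    exact ZMod.mod_four_ne_three_of_sq_eq_neg_sq' hy (eq_neg_of_add_eq_zero_left key) h3
  have hx : (x : ZMod p) = 0 := by
    rw [hy] at key; simpa using key
  exact ⟨(ZMod.intCast_zmod_eq_zero_iff_dvd x p).1 hx, (ZMod.intCast_zmod_eq_zero_iff_dvd y p).1 hy⟩

lemma sq_dvd_of_sumTwoSqMod {p α n : ℕ} (hp : p.Prime) (h3 : p % 4 = 3) (hα : 2 ≤ α)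
    (hn : p ∣ n) (h : SumTwoSqMod (p ^ α) n) : p ^ 2 ∣ n := by
  obtain ⟨x, y, hxy⟩ := h
  have h2 : (n : ℤ) ≡ x ^ 2 + y ^ 2 [ZMOD ((p : ℤ) ^ 2)] :=
    hxy.of_dvd (by push_cast; exact pow_dvd_pow _ hα)
  have h1 : (n : ℤ) ≡ x ^ 2 + y ^ 2 [ZMOD (p : ℤ)] := h2.of_dvd (dvd_pow_self _ two_ne_zero)
  have : (p : ℤ) ∣ x ^ 2 + y ^ 2 := h1.dvd_iff.1 (by exact_mod_cast hn)
  obtain ⟨⟨a, rfl⟩, ⟨b, rfl⟩⟩ := dvd_of_dvd_sq_add_sq hp h3 this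
  have : (p : ℤ) ^ 2 ∣ n := h2.dvd_iff.2 ⟨a ^ 2 + b ^ 2, by ring⟩
  exact_mod_cast this

/-- Both squares in a representation of a multiple of `p ≡ 3` modulo `4` are multiples of `p ^ 2`,
so a representation of `p ^ 2 * n` can be divided by `p ^ 2`. -/
lemma sumTwoSqMod_sq_mul {p α n : ℕ} (hp : p.Prime) (h3 : p % 4 = 3) :
    SumTwoSqMod (p ^ (α + 2)) (p ^ 2 * n) ↔ SumTwoSqMod (p ^ α) n := by
  have hp0 : (p : ℤ) ^ 2 ≠ 0 := by have := hp.ne_zero; positivity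
  have e : ((p ^ (α + 2) : ℕ) : ℤ) = (p : ℤ) ^ 2 * ((p ^ α : ℕ) : ℤ) := by push_cast; ring
  constructor
  · rintro ⟨x, y, hxy⟩
    have h1 : ((p ^ 2 * n : ℕ) : ℤ) ≡ x ^ 2 + y ^ 2 [ZMOD (p : ℤ)] := by
      refine hxy.of_dvd ?_
      push_cast; exact dvd_pow_self _ (by omega)
    have : (p : ℤ) ∣ x ^ 2 + y ^ 2 := h1.dvd_iff.1 (by push_cast; exact ⟨p * n, by ring⟩)
    obtain ⟨⟨a, rfl⟩, ⟨b, rfl⟩⟩ := dvd_of_dvd_sq_add_sq hp h3 this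
    refine ⟨a, b, ?_⟩
    rw [e] at hxy
    have h2 : (p : ℤ) ^ 2 * n ≡ (p : ℤ) ^ 2 * (a ^ 2 + b ^ 2)
        [ZMOD (p : ℤ) ^ 2 * ((p ^ α : ℕ) : ℤ)] := by
      convert hxy using 1 <;> push_cast <;> ring
    exact Int.ModEq.mul_left_cancel' hp0 h2
  · rintro ⟨a, b, hab⟩
    refine ⟨p * a, p * b, ?_⟩
    rw [e]
    have h2 := hab.mul_left' (c := (p : ℤ) ^ 2)
    convert h2 using 1 <;> push_cast <;> ring

/-- The identity `(a + b) ^ 2 + (a - b) ^ 2 = 2 (a ^ 2 + b ^ 2)`, read in both directions. -/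
lemma sumTwoSqMod_two_mul {α n : ℕ} :
    SumTwoSqMod (2 ^ (α + 1)) (2 * n) ↔ SumTwoSqMod (2 ^ α) n := by
  have e : ((2 ^ (α + 1) : ℕ) : ℤ) = 2 * ((2 ^ α : ℕ) : ℤ) := by push_cast; ring
  constructor
  · rintro ⟨x, y, hxy⟩
    rw [e] at hxy
    have h1 : ((2 * n : ℕ) : ℤ) ≡ x ^ 2 + y ^ 2 [ZMOD 2] := hxy.of_mul_right _
    have h2 : (2 : ℤ) ∣ x ^ 2 + y ^ 2 := h1.dvd_iff.1 ⟨n, by push_cast; ring⟩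
    have h3 : Even (x + y) := by
      have := even_iff_two_dvd.2 h2
      simp only [Int.even_add, Int.even_pow] at this ⊢
      simpa using this
    obtain ⟨u, hu⟩ := h3
    obtain rfl : y = u + u - x := by linarith
    refine ⟨u, x - u, ?_⟩
    have h4 : (2 : ℤ) * n ≡ 2 * (u ^ 2 + (x - u) ^ 2) [ZMOD 2 * ((2 ^ α : ℕ) : ℤ)] := by
      convert hxy using 1 <;> push_cast <;> ring
    exact Int.ModEq.mul_left_cancel' two_ne_zero h4
  · rintro ⟨a, b, hab⟩
    refine ⟨a + b, a - b, ?_⟩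
    rw [e]
    have h2 := hab.mul_left' (c := (2 : ℤ))
    convert h2 using 1 <;> push_cast <;> ring

lemma one_mod_four_of_sumTwoSqMod {α n : ℕ} (hα : 2 ≤ α) (hn : n % 2 = 1)
    (h : SumTwoSqMod (2 ^ α) n) : n % 4 = 1 := by
  obtain ⟨x, y, hxy⟩ := h
  have h2 : (n : ℤ) ≡ x ^ 2 + y ^ 2 [ZMOD 4] :=
    hxy.of_dvd (by push_cast; exact pow_dvd_pow (2 : ℤ) hα)
  have hx : x ^ 2 % 4 = 0 ∨ x ^ 2 % 4 = 1 := by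
    rcases Int.even_or_odd' x with ⟨k, rfl | rfl⟩ <;> ring_nf <;> omega
  have hy : y ^ 2 % 4 = 0 ∨ y ^ 2 % 4 = 1 := by
    rcases Int.even_or_odd' y with ⟨k, rfl | rfl⟩ <;> ring_nf <;> omega
  unfold Int.ModEq at h2
  omega

open scoped Classical in
/-- The number of `a < p ^ α` such that `a` and `a + h` are sums of two squares modulo `p ^ α`. -/
def pairCount (p α h : ℕ) : ℕ :=
  ((Finset.range (p ^ α)).filter
    (fun a => SumTwoSqMod (p ^ α) a ∧ SumTwoSqMod (p ^ α) (a + h))).card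

lemma localCount_pair (p α h : ℕ) : localCount {0, (h : ℤ)} p α = pairCount p α h := by
  classical
  rw [localCount, pairCount, ← Set.ncard_coe_finset]
  congr 1
  ext a
  simp [SumTwoSqMod]

lemma localCount_singleton (p α : ℕ) : localCount {0} p α = pairCount p α 0 := by
  classical
  rw [localCount, pairCount, ← Set.ncard_coe_finset]
  congr 1
  ext a
  simp [SumTwoSqMod]

lemma card_filter_dvd {m n : ℕ} (hm : 0 < m) (P : ℕ → Prop) [DecidablePred P] :
    ((Finset.range (m * n)).filter (fun a => m ∣ a ∧ P a)).card =
      ((Finset.range n).filter (fun b => P (m * b))).card := by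
  symm
  refine Finset.card_bij (fun b _ => m * b) ?_ ?_ ?_
  · intro b hb
    simp only [Finset.mem_filter, Finset.mem_range] at hb ⊢
    exact ⟨Nat.mul_lt_mul_of_pos_left hb.1 hm, dvd_mul_right _ _, hb.2⟩
  · intro a _ b _ h
    exact Nat.eq_of_mul_eq_mul_left hm h
  · intro a ha
    simp only [Finset.mem_filter, Finset.mem_range] at ha
    obtain ⟨h1, ⟨b, rfl⟩, h3⟩ := ha
    exact ⟨b, by simpa using ⟨lt_of_mul_lt_mul_left h1 hm.le, h3⟩, rfl⟩

lemma card_filter_not_dvd {m n : ℕ} (hm : 0 < m) :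
    ((Finset.range (m * n)).filter (fun a => ¬ m ∣ a)).card = m * n - n := by
  have h := Finset.card_filter_add_card_filter_not (s := Finset.range (m * n)) (fun a => m ∣ a)
  have h2 := card_filter_dvd (n := n) hm (fun _ => True)
  simp only [and_true, Finset.filter_true, Finset.card_range] at h h2
  omega

lemma card_filter_shift {n : ℕ} (h : ℕ)
    (P : ℕ → Prop) [DecidablePred P] (hP : ∀ a, P (a + n) ↔ P a) :
    ((Finset.range n).filter (fun a => P (a + h))).card =
      ((Finset.range n).filter P).card := by
  have h1 := Nat.filter_Ico_card_eq_of_periodic h n P (fun a => propext (hP a))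
  rw [← Nat.count_eq_card_filter_range P n, ← h1]
  refine Finset.card_bij (fun b _ => b + h) ?_ ?_ ?_
  · intro b hb
    simp only [Finset.mem_filter, Finset.mem_range, Finset.mem_Ico] at hb ⊢
    exact ⟨⟨by omega, by omega⟩, hb.2⟩
  · intro a _ b _ hab
    simpa using hab
  · intro a ha
    simp only [Finset.mem_filter, Finset.mem_Ico] at ha
    refine ⟨a - h, ?_, by omega⟩
    simp only [Finset.mem_filter, Finset.mem_range]
    exact ⟨by omega, by rw [Nat.sub_add_cancel ha.1.1]; exact ha.2⟩

/-! ### The local densities at primes congruent to three modulo four -/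

lemma sumTwoSqMod_add_iff {m a : ℕ} : SumTwoSqMod m (a + m) ↔ SumTwoSqMod m a :=
  SumTwoSqMod.congr (by simp [Nat.ModEq])

lemma dvd_of_not_sumTwoSqMod {p α a : ℕ} (hp : p.Prime) (h3 : p % 4 = 3)
    (h : ¬ SumTwoSqMod (p ^ α) a) : p ∣ a := by
  by_contra hpa
  refine h (sumTwoSqMod_of_coprime ?_ (pow_ne_zero _ hp.ne_zero) ?_)
  · refine Nat.Coprime.pow_left _ ((Nat.coprime_primes hp Nat.prime_two).2 ?_ |>.pow_right 2)
    omega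
  · exact (Nat.Coprime.pow_left _ ((Nat.Prime.coprime_iff_not_dvd hp).2 hpa)).symm

/-- Inclusion and exclusion: a residue that is not a sum of two squares is divisible by `p`, so `a`
and `a + h` are never both of this kind when `p ∤ h`. -/
lemma pairCount_add_of_not_dvd {p : ℕ} (α : ℕ) {h : ℕ} (hp : p.Prime) (h3 : p % 4 = 3)
    (hh : ¬ p ∣ h) : pairCount p α h + p ^ α = 2 * pairCount p α 0 := by
  classical
  have e0 : pairCount p α 0 = ((Finset.range (p ^ α)).filter (SumTwoSqMod (p ^ α))).card := by
    simp [pairCount]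
  have e1 := card_filter_shift (n := p ^ α) h (SumTwoSqMod (p ^ α)) (fun a => sumTwoSqMod_add_iff)
  have e2 := Finset.card_union_add_card_inter
    ((Finset.range (p ^ α)).filter (SumTwoSqMod (p ^ α)))
    ((Finset.range (p ^ α)).filter (fun a => SumTwoSqMod (p ^ α) (a + h)))
  rw [← Finset.filter_or, ← Finset.filter_and] at e2
  rw [Finset.filter_true_of_mem (fun a _ => ?_), Finset.card_range] at e2
  · have : pairCount p α h = ((Finset.range (p ^ α)).filter
      (fun a => SumTwoSqMod (p ^ α) a ∧ SumTwoSqMod (p ^ α) (a + h))).card := rfl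
    omega
  · by_contra hc
    push Not at hc
    exact hh ((Nat.dvd_add_right (dvd_of_not_sumTwoSqMod hp h3 hc.1)).1
      (dvd_of_not_sumTwoSqMod hp h3 hc.2))

/-- If `p` divides `h` exactly once, the residues that count are those prime to `p`: a sum of two
squares that is divisible by `p` is divisible by `p ^ 2`, and `a` and `a + h` are not both. -/
lemma pairCount_of_dvd_of_not_sq_dvd {p α h : ℕ} (hp : p.Prime) (h3 : p % 4 = 3)
    (hh : p ∣ h) (hh2 : ¬ p ^ 2 ∣ h) : pairCount p (α + 2) h = p ^ (α + 2) - p ^ (α + 1) := by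
  classical
  have e := card_filter_not_dvd (m := p) (n := p ^ (α + 1)) hp.pos
  rw [← pow_succ'] at e
  rw [← e, pairCount]
  congr 1
  apply Finset.filter_congr
  intro a _
  constructor
  · rintro ⟨h1, h2⟩ hpa
    have d1 := sq_dvd_of_sumTwoSqMod hp h3 (by omega) hpa h1
    have d2 := sq_dvd_of_sumTwoSqMod hp h3 (by omega) (dvd_add hpa hh) h2
    exact hh2 ((Nat.dvd_add_right d1).1 d2)
  · intro hpa
    constructor
    · by_contra hc; exact hpa (dvd_of_not_sumTwoSqMod hp h3 hc)
    · by_contra hc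
      exact hpa ((Nat.dvd_add_left hh).1 (dvd_of_not_sumTwoSqMod hp h3 hc))

/-- The residues prime to `p` all count, the multiples of `p ^ 2` reduce to the exponent `α`, and no
other multiple of `p` is a sum of two squares. -/
lemma pairCount_sq_mul {p : ℕ} (α h : ℕ) (hp : p.Prime) (h3 : p % 4 = 3) :
    pairCount p (α + 2) (p ^ 2 * h) = (p ^ (α + 2) - p ^ (α + 1)) + pairCount p α h := by
  classical
  have e := card_filter_not_dvd (m := p) (n := p ^ (α + 1)) hp.pos
  rw [← pow_succ'] at e
  have e2 := card_filter_dvd (m := p ^ 2) (n := p ^ α) (by have := hp.pos; positivity)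
    (fun a => SumTwoSqMod (p ^ (α + 2)) a ∧ SumTwoSqMod (p ^ (α + 2)) (a + p ^ 2 * h))
  simp only [← mul_add, sumTwoSqMod_sq_mul hp h3] at e2
  rw [← pow_add, add_comm 2 α] at e2
  rw [← e, pairCount, pairCount, ← e2, ← Finset.card_union_of_disjoint]
  · congr 1
    ext a
    simp only [Finset.mem_union, Finset.mem_filter]
    constructor
    · rintro ⟨h1, h2, h4⟩
      by_cases hpa : p ∣ a
      · exact Or.inr ⟨h1, sq_dvd_of_sumTwoSqMod hp h3 (by omega) hpa h2, h2, h4⟩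
      · exact Or.inl ⟨h1, hpa⟩
    · rintro (⟨h1, h2⟩ | ⟨h1, -, h2, h4⟩)
      · refine ⟨h1, ?_, ?_⟩
        · by_contra hc; exact h2 (dvd_of_not_sumTwoSqMod hp h3 hc)
        · by_contra hc
          exact h2 ((Nat.dvd_add_left ⟨p * h, by ring⟩).1 (dvd_of_not_sumTwoSqMod hp h3 hc))
      · exact ⟨h1, h2, h4⟩
  · rw [Finset.disjoint_filter]
    rintro a - h1 ⟨h2, -⟩
    exact h1 ((dvd_pow_self p two_ne_zero).trans h2)

/-- A sequence with an affine recursion of step `2` and ratio `ρ ^ 2 < 1` tends to its fixed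
point. -/
lemma tendsto_of_affine_recursion {u : ℕ → ℝ} {c ρ l : ℝ} (h0 : 0 < ρ) (h1 : ρ < 1)
    (hl : l = c + ρ ^ 2 * l) (hu : ∀ n, u (n + 2) = c + ρ ^ 2 * u n) :
    Tendsto u atTop (𝓝 l) := by
  set C := max |u 0 - l| (|u 1 - l| / ρ)
  have key : ∀ n, |u n - l| ≤ C * ρ ^ n ∧ |u (n + 1) - l| ≤ C * ρ ^ (n + 1) := by
    intro n
    induction n with
    | zero =>
      refine ⟨by simp [C], ?_⟩
      have : |u 1 - l| / ρ ≤ C := le_max_right _ _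
      rw [div_le_iff₀ h0] at this
      simpa using this
    | succ n ih =>
      refine ⟨ih.2, ?_⟩
      have e : u (n + 1 + 1) - l = ρ ^ 2 * (u n - l) := by
        rw [hu]; linear_combination -hl
      rw [e, abs_mul, abs_of_pos (by positivity : 0 < ρ ^ 2)]
      calc ρ ^ 2 * |u n - l| ≤ ρ ^ 2 * (C * ρ ^ n) := by gcongr; exact ih.1
        _ = _ := by ring
  rw [tendsto_iff_norm_sub_tendsto_zero]
  refine squeeze_zero (fun _ => norm_nonneg _) (fun n => (key n).1) ?_
  simpa using (tendsto_pow_atTop_nhds_zero_of_lt_one h0.le h1).const_mul C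

lemma tendsto_pairCount_zero {p : ℕ} (hp : p.Prime) (h3 : p % 4 = 3) :
    Tendsto (fun α => (pairCount p α 0 : ℝ) / (p : ℝ) ^ α) atTop (𝓝 (1 / (1 + 1 / (p : ℝ)))) := by
  have hp1 : (1 : ℝ) < p := by exact_mod_cast hp.one_lt
  refine tendsto_of_affine_recursion (c := 1 - 1 / p) (ρ := 1 / p) (by positivity)
    (by rw [div_lt_one (by linarith)]; exact hp1) ?_ ?_
  · field_simp; ring
  · intro n
    have := pairCount_sq_mul n 0 hp h3
    rw [mul_zero] at this
    rw [this, Nat.cast_add, Nat.cast_sub (Nat.pow_le_pow_right hp.pos (by omega))]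
    push_cast
    field_simp
    ring

/-- The local density of `{0, h}` at `p`, where `p` divides `h` exactly `k` times. By
`pairCount_sq_mul` the exponent `k` can be lowered by `2`, which leaves `k = 0` and `k = 1`. -/
lemma tendsto_pairCount_pow_mul {p : ℕ} (hp : p.Prime) (h3 : p % 4 = 3) {m : ℕ} (hm : ¬ p ∣ m)
    (k : ℕ) :
    Tendsto (fun α => (pairCount p α (p ^ k * m) : ℝ) / (p : ℝ) ^ α) atTop
      (𝓝 ((1 - (1 / (p : ℝ)) ^ (k + 1)) / (1 + 1 / (p : ℝ)))) := by
  have hp1 : (1 : ℝ) < p := by exact_mod_cast hp.one_lt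
  have hp0 : (p : ℝ) ≠ 0 := by positivity
  induction k using Nat.twoStepInduction with
  | zero =>
    have h := ((tendsto_pairCount_zero hp h3).const_mul 2).sub_const 1
    have e : 2 * (1 / (1 + 1 / (p : ℝ))) - 1 =
        (1 - (1 / (p : ℝ)) ^ (0 + 1)) / (1 + 1 / (p : ℝ)) := by
      rw [zero_add, pow_one]; field_simp; ring
    rw [e] at h
    refine h.congr fun α => ?_
    have := pairCount_add_of_not_dvd α hp h3 hm
    have h' : (pairCount p α m : ℝ) + (p : ℝ) ^ α = 2 * pairCount p α 0 := by exact_mod_cast this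
    rw [pow_zero, one_mul]
    field_simp
    linarith
  | one =>
    rw [← tendsto_add_atTop_iff_nat 2]
    refine tendsto_const_nhds.congr fun α => ?_
    rw [pairCount_of_dvd_of_not_sq_dvd hp h3 (by simp) (by
      rw [pow_one, pow_two]
      intro h; exact hm (Nat.dvd_of_mul_dvd_mul_left hp.pos h)),
      Nat.cast_sub (Nat.pow_le_pow_right hp.pos (by omega))]
    push_cast
    field_simp
    ring
  | more k ih _ =>
    rw [← tendsto_add_atTop_iff_nat 2]
    have h := (ih.const_mul ((1 / (p : ℝ)) ^ 2)).const_add (1 - 1 / (p : ℝ))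
    have e : 1 - 1 / (p : ℝ) + (1 / (p : ℝ)) ^ 2 *
        ((1 - (1 / (p : ℝ)) ^ (k + 1)) / (1 + 1 / (p : ℝ)))
        = (1 - (1 / (p : ℝ)) ^ (k + 2 + 1)) / (1 + 1 / (p : ℝ)) := by
      have hx : 1 + 1 / (p : ℝ) ≠ 0 := by positivity
      generalize 1 / (p : ℝ) = x at hx ⊢
      field_simp
      ring
    rw [e] at h
    refine h.congr fun α => ?_
    rw [show p ^ (k + 2) * m = p ^ 2 * (p ^ k * m) by ring, pairCount_sq_mul _ _ hp h3,
      Nat.cast_add, Nat.cast_sub (Nat.pow_le_pow_right hp.pos (by omega))]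
    push_cast
    field_simp
    ring

/-! ### The local densities at two -/

lemma sumTwoSqMod_two_pow_odd_iff {α n : ℕ} (hα : 2 ≤ α) (hn : n % 2 = 1) :
    SumTwoSqMod (2 ^ α) n ↔ n % 4 = 1 :=
  ⟨one_mod_four_of_sumTwoSqMod hα hn, sumTwoSqMod_two_pow_of_one_mod_four hα⟩

lemma card_filter_mod_eq {m r : ℕ} (n : ℕ) (hr : r < m) :
    ((Finset.range (m * n)).filter (fun a => a % m = r)).card = n := by
  conv_rhs => rw [← Finset.card_range n]
  symm
  refine Finset.card_bij (fun b _ => m * b + r) ?_ ?_ ?_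
  · intro b hb
    simp only [Finset.mem_filter, Finset.mem_range] at hb ⊢
    refine ⟨?_, by rw [Nat.mul_add_mod, Nat.mod_eq_of_lt hr]⟩
    calc m * b + r < m * (b + 1) := by rw [mul_add]; omega
      _ ≤ m * n := Nat.mul_le_mul_left _ hb
  · intro a _ b _ h
    have : m * a = m * b := by simpa using h
    exact Nat.eq_of_mul_eq_mul_left (by omega) this
  · intro a ha
    simp only [Finset.mem_filter, Finset.mem_range] at ha
    refine ⟨a / m, ?_, ?_⟩
    · rw [Finset.mem_range]; exact Nat.div_lt_of_lt_mul ha.1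
    · rw [← ha.2]; exact Nat.div_add_mod a m

/-- An odd residue `a` counts if and only if `a` and `a + 2 h` are `1` modulo `4`; the even residues
are halved. -/
lemma pairCount_two_even (α h : ℕ) : pairCount 2 (α + 2) (2 * h) =
    (if h % 2 = 0 then 2 ^ α else 0) + pairCount 2 (α + 1) h := by
  classical
  have e2 := card_filter_dvd (m := 2) (n := 2 ^ (α + 1)) two_pos
    (fun a => SumTwoSqMod (2 ^ (α + 2)) a ∧ SumTwoSqMod (2 ^ (α + 2)) (a + 2 * h))
  simp only [← mul_add, show α + 2 = (α + 1) + 1 from rfl, sumTwoSqMod_two_mul] at e2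
  rw [← pow_succ'] at e2
  have e1 : ((Finset.range (2 ^ (α + 2))).filter (fun a => a % 4 = 1 ∧ h % 2 = 0)).card =
      if h % 2 = 0 then 2 ^ α else 0 := by
    split_ifs with hh
    · simp only [hh, and_true]
      rw [show 2 ^ (α + 2) = 4 * 2 ^ α by ring]
      exact card_filter_mod_eq _ (by norm_num)
    · simp [hh]
  rw [← e1, pairCount, pairCount, ← e2, ← Finset.card_union_of_disjoint]
  · congr 1
    ext a
    simp only [Finset.mem_union, Finset.mem_filter]
    rcases Nat.mod_two_eq_zero_or_one a with ha | ha
    · have : 2 ∣ a := Nat.dvd_of_mod_eq_zero ha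
      have h4 : a % 4 ≠ 1 := by omega
      simp [this, h4]
    · have : ¬ 2 ∣ a := by omega
      have h4 : (a + 2 * h) % 2 = 1 := by omega
      simp only [this, sumTwoSqMod_two_pow_odd_iff (show 2 ≤ α + 1 + 1 by omega) ha,
        sumTwoSqMod_two_pow_odd_iff (show 2 ≤ α + 1 + 1 by omega) h4]
      constructor
      · rintro ⟨h5, h6, h7⟩; exact Or.inl ⟨h5, h6, by omega⟩
      · rintro (⟨h5, h6, h7⟩ | h5)
        · exact ⟨h5, h6, by omega⟩
        · exact absurd h5.2.1 (by simp)
  · rw [Finset.disjoint_filter]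
    rintro a - h1 ⟨h2, -⟩
    omega

lemma sumTwoSqMod_two_pow_of_mod_four {α n : ℕ} (hn : n % 4 = 2) :
    SumTwoSqMod (2 ^ (α + 3)) n ↔ n % 8 = 2 := by
  obtain ⟨b, rfl⟩ : 2 ∣ n := by omega
  rw [sumTwoSqMod_two_mul, sumTwoSqMod_two_pow_odd_iff (by omega) (by omega)]
  omega

lemma card_four_dvd_sumTwoSqMod (α : ℕ) [DecidablePred (SumTwoSqMod (2 ^ (α + 3)))] :
    ((Finset.range (2 ^ (α + 3))).filter
      (fun a => 4 ∣ a ∧ SumTwoSqMod (2 ^ (α + 3)) a)).card = pairCount 2 (α + 1) 0 := by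
  classical
  have e2 := card_filter_dvd (m := 4) (n := 2 ^ (α + 1)) (by norm_num)
    (fun a => SumTwoSqMod (2 ^ (α + 3)) a)
  rw [show 4 * 2 ^ (α + 1) = 2 ^ (α + 3) by ring] at e2
  rw [e2, pairCount]
  congr 1
  apply Finset.filter_congr
  intro a _
  rw [show 4 * a = 2 * (2 * a) by ring, sumTwoSqMod_two_mul, sumTwoSqMod_two_mul]
  simp

/-- One of `a` and `a + h` is odd and has to be `1` modulo `4`. This determines the other one modulo
`4`: it is divisible by `4` or congruent to `2` modulo `4`, according to which of the two is odd and
to the class of `h`. In the second case it has to be `2` modulo `8`. -/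
lemma pairCount_two_odd (α h : ℕ) (hh : h % 2 = 1) : pairCount 2 (α + 3) h =
    pairCount 2 (α + 1) 0 + 2 ^ α := by
  classical
  have e0 := card_four_dvd_sumTwoSqMod α
  have hper : (2 : ℕ) ^ (α + 3) = 8 * 2 ^ α := by ring
  have hα : 2 ≤ α + 3 := by omega
  have h4 : h % 4 = 1 ∨ h % 4 = 3 := by omega
  rcases h4 with h4 | h4
  · have e1 : ((Finset.range (2 ^ (α + 3))).filter (fun a => (a + h) % 8 = 2)).card = 2 ^ α := by
      rw [card_filter_shift h (fun a => a % 8 = 2) (fun a => by rw [hper]; omega), hper]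
      exact card_filter_mod_eq _ (by norm_num)
    rw [← e0, ← e1, pairCount, ← Finset.card_union_of_disjoint]
    · congr 1
      ext a
      simp only [Finset.mem_union, Finset.mem_filter]
      rcases Nat.mod_two_eq_zero_or_one a with ha | ha
      · rw [sumTwoSqMod_two_pow_odd_iff (n := a + h) hα (by omega)]
        constructor
        · rintro ⟨h5, h6, h7⟩; exact Or.inl ⟨h5, by omega, h6⟩
        · rintro (⟨h5, h6, h7⟩ | ⟨h5, h6⟩)
          · exact ⟨h5, h7, by omega⟩
          · omega
      · rw [sumTwoSqMod_two_pow_odd_iff (n := a) hα ha]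
        constructor
        · rintro ⟨h5, h6, h7⟩
          rw [sumTwoSqMod_two_pow_of_mod_four (by omega)] at h7
          exact Or.inr ⟨h5, h7⟩
        · rintro (⟨h5, h6, h7⟩ | ⟨h5, h6⟩)
          · omega
          · exact ⟨h5, by omega, by rwa [sumTwoSqMod_two_pow_of_mod_four (by omega)]⟩
    · rw [Finset.disjoint_filter]
      rintro a - ⟨h1, -⟩ h2
      omega
  · have e1 : ((Finset.range (2 ^ (α + 3))).filter (fun a => a % 8 = 2)).card = 2 ^ α := by
      rw [hper]
      exact card_filter_mod_eq _ (by norm_num)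
    rw [← card_filter_shift h (fun a => 4 ∣ a ∧ SumTwoSqMod (2 ^ (α + 3)) a)
      (fun a => by rw [sumTwoSqMod_add_iff, hper]; simp only [and_congr_left_iff]; omega)] at e0
    rw [← e0, ← e1, pairCount, ← Finset.card_union_of_disjoint]
    · congr 1
      ext a
      simp only [Finset.mem_union, Finset.mem_filter]
      rcases Nat.mod_two_eq_zero_or_one a with ha | ha
      · rw [sumTwoSqMod_two_pow_odd_iff (n := a + h) hα (by omega)]
        constructor
        · rintro ⟨h5, h6, h7⟩
          rw [sumTwoSqMod_two_pow_of_mod_four (by omega)] at h6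
          exact Or.inr ⟨h5, h6⟩
        · rintro (⟨h5, h6, h7⟩ | ⟨h5, h6⟩)
          · omega
          · exact ⟨h5, by rwa [sumTwoSqMod_two_pow_of_mod_four (by omega)], by omega⟩
      · rw [sumTwoSqMod_two_pow_odd_iff (n := a) hα ha]
        constructor
        · rintro ⟨h5, h6, h7⟩
          exact Or.inl ⟨h5, by omega, h7⟩
        · rintro (⟨h5, h6, h7⟩ | ⟨h5, h6⟩)
          · exact ⟨h5, by omega, h7⟩
          · omega
    · rw [Finset.disjoint_filter]
      rintro a - ⟨h1, -⟩ h2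
      omega

lemma tendsto_pairCount_two_zero :
    Tendsto (fun α => (pairCount 2 α 0 : ℝ) / (2 : ℝ) ^ α) atTop (𝓝 (1 / 2)) := by
  rw [← tendsto_add_atTop_iff_nat 1]
  have step : ∀ n : ℕ, (pairCount 2 (n + 2) 0 : ℝ) / 2 ^ (n + 2) =
      1 / 4 + 1 / 2 * ((pairCount 2 (n + 1) 0 : ℝ) / 2 ^ (n + 1)) := by
    intro n
    have := pairCount_two_even n 0
    rw [mul_zero] at this
    rw [this]
    push_cast
    field_simp
    ring
  refine tendsto_of_affine_recursion (c := 3 / 8) (ρ := 1 / 2) (by norm_num) (by norm_num)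
    (by norm_num) fun n => ?_
  rw [step (n + 1), step n]
  ring

lemma tendsto_pairCount_two_odd {m : ℕ} (hm : m % 2 = 1) :
    Tendsto (fun α => (pairCount 2 α m : ℝ) / (2 : ℝ) ^ α) atTop (𝓝 (1 / 4)) := by
  rw [← tendsto_add_atTop_iff_nat 3]
  have h := (((tendsto_add_atTop_iff_nat 1).2 tendsto_pairCount_two_zero).const_mul
    (1 / 4)).add_const (1 / 8)
  norm_num at h
  refine h.congr fun α => ?_
  rw [pairCount_two_odd _ _ hm]
  push_cast
  field_simp
  ring

lemma tendsto_pairCount_two_pow_mul {m : ℕ} (hm : m % 2 = 1) (k : ℕ) :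
    Tendsto (fun α => (pairCount 2 α (2 ^ (k + 1) * m) : ℝ) / (2 : ℝ) ^ α) atTop
      (𝓝 ((2 - 3 * (1 / 2) ^ (k + 1)) / 4)) := by
  induction k with
  | zero =>
    rw [← tendsto_add_atTop_iff_nat 2]
    have h := ((tendsto_add_atTop_iff_nat 1).2 (tendsto_pairCount_two_odd hm)).const_mul (1 / 2)
    norm_num at h ⊢
    refine h.congr fun α => ?_
    rw [pairCount_two_even, if_neg (by omega)]
    push_cast
    field_simp
    ring
  | succ k ih =>
    rw [← tendsto_add_atTop_iff_nat 2]
    have h := (((tendsto_add_atTop_iff_nat 1).2 ih).const_mul (1 / 2)).const_add (1 / 4)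
    have e : 1 / 4 + 1 / 2 * ((2 - 3 * (1 / 2) ^ (k + 1)) / 4) =
      (2 - 3 * (1 / 2 : ℝ) ^ (k + 1 + 1)) / 4 := by ring
    rw [e] at h
    refine h.congr fun α => ?_
    rw [show 2 ^ (k + 1 + 1) * m = 2 * (2 ^ (k + 1) * m) by ring, pairCount_two_even,
      if_pos (by rw [pow_succ', mul_assoc]; exact Nat.mul_mod_right _ _)]
    push_cast
    field_simp
    ring

/-! ### The singular series of a pair as an arithmetic function -/

open scoped Classical in
/-- The completely multiplicative function `d ↦ 1 / d`, restricted to the `d` that have no prime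
factor congruent to `1` modulo `4`. Its value at `0` is `0`, since `0` is divisible by every
prime. -/
def restrictedInv : ℕ →*₀ ℝ where
  toFun d := if ∀ p : ℕ, p.Prime → p ∣ d → p % 4 ≠ 1 then 1 / (d : ℝ) else 0
  map_zero' := by simp
  map_one' := by
    rw [if_pos]
    · simp
    · intro p hp h
      exact absurd (Nat.dvd_one.1 h) hp.one_lt.ne'
  map_mul' m n := by
    by_cases hm : ∀ p : ℕ, p.Prime → p ∣ m → p % 4 ≠ 1
    · by_cases hn : ∀ p : ℕ, p.Prime → p ∣ n → p % 4 ≠ 1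
      · rw [if_pos hm, if_pos hn, if_pos]
        · push_cast; rw [one_div_mul_one_div]
        · intro p hp h
          rcases (Nat.Prime.dvd_mul hp).1 h with h | h
          exacts [hm p hp h, hn p hp h]
      · rw [if_neg hn, mul_zero, if_neg]
        exact fun h => hn fun p hp hpn => h p hp (hpn.mul_left m)
    · rw [if_neg hm, zero_mul, if_neg]
      exact fun h => hm fun p hp hpn => h p hp (hpn.mul_right n)

lemma restrictedInv_prime_of_ne {p : ℕ} (hp : p.Prime) (h : p % 4 ≠ 1) :
    restrictedInv p = 1 / (p : ℝ) := by
  refine if_pos fun l hl hlp => ?_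
  rwa [(Nat.prime_dvd_prime_iff_eq hl hp).1 hlp]

lemma restrictedInv_prime_of_eq {p : ℕ} (hp : p.Prime) (h : p % 4 = 1) : restrictedInv p = 0 :=
  if_neg fun hc => hc p hp dvd_rfl h

lemma restrictedInv_nonneg (d : ℕ) : 0 ≤ restrictedInv d := by
  classical
  change 0 ≤ (if _ then _ else _ : ℝ)
  split_ifs <;> positivity

lemma restrictedInv_le (d : ℕ) : restrictedInv d ≤ 1 / d := by
  classical
  change (if _ then _ else _ : ℝ) ≤ _
  split_ifs
  · rfl
  · positivity

/-- `restrictedInv` as an arithmetic function. -/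
def restrictedInvArith : ArithmeticFunction ℝ := ⟨restrictedInv, map_zero _⟩

lemma restrictedInvArith_isMultiplicative : restrictedInvArith.IsMultiplicative :=
  ⟨map_one restrictedInv, fun {m n} _ => map_mul restrictedInv m n⟩

/-- The arithmetic function with Dirichlet series `1 - 2 ^ (-s) + 2 ^ (-2 s)`; it accounts for the
local densities at the prime `2`. -/
def twoCorrection : ArithmeticFunction ℝ :=
  ⟨fun n => if n = 1 then 1 else if n = 2 then -1 else if n = 4 then 1 else 0, by simp⟩

lemma twoCorrection_apply (n : ℕ) : twoCorrection n =
    if n = 1 then 1 else if n = 2 then -1 else if n = 4 then 1 else 0 := rfl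

lemma twoCorrection_isMultiplicative : twoCorrection.IsMultiplicative := by
  refine ⟨by simp [twoCorrection_apply], fun {m n} hmn => ?_⟩
  by_cases h : m ≤ 4 ∧ n ≤ 4
  · obtain ⟨hm, hn⟩ := h
    interval_cases m <;> interval_cases n <;> simp [twoCorrection_apply] at hmn ⊢ <;>
      exact absurd hmn (by decide)
  · rcases Nat.eq_zero_or_pos m with rfl | hm
    · simp
    rcases Nat.eq_zero_or_pos n with rfl | hn
    · simp
    have h1 : 4 < m * n := by
      rcases not_and_or.1 h with h | h <;> nlinarith
    have h2 : twoCorrection (m * n) = 0 := by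
      simp only [twoCorrection_apply]; split_ifs <;> first | omega | rfl
    rw [h2]
    rcases not_and_or.1 h with h | h
    · have : twoCorrection m = 0 := by
        simp only [twoCorrection_apply]; split_ifs <;> first | omega | rfl
      rw [this, zero_mul]
    · have : twoCorrection n = 0 := by
        simp only [twoCorrection_apply]; split_ifs <;> first | omega | rfl
      rw [this, mul_zero]

open scoped ArithmeticFunction.zeta in
/-- The multiplicative part of the singular series: `𝔖({0, h}) = pairArith h / (2 K ^ 2)`. -/
def pairArith : ArithmeticFunction ℝ :=
  (ζ : ArithmeticFunction ℝ) * restrictedInvArith * twoCorrection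

lemma pairArith_isMultiplicative : pairArith.IsMultiplicative :=
  ((ArithmeticFunction.isMultiplicative_zeta.natCast).mul
    restrictedInvArith_isMultiplicative).mul twoCorrection_isMultiplicative

open scoped ArithmeticFunction.zeta in
lemma zeta_mul_restrictedInvArith_prime_pow {p : ℕ} (hp : p.Prime) (k : ℕ) :
    ((ζ : ArithmeticFunction ℝ) * restrictedInvArith) (p ^ k) =
      ∑ j ∈ Finset.range (k + 1), restrictedInv p ^ j := by
  rw [ArithmeticFunction.coe_zeta_mul_apply, Nat.sum_divisors_prime_pow hp]
  exact Finset.sum_congr rfl fun j _ => map_pow restrictedInv p j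

lemma arithmeticFunction_mul_prime_pow (f g : ArithmeticFunction ℝ) {p : ℕ} (hp : p.Prime) (k : ℕ) :
    (f * g) (p ^ k) = ∑ j ∈ Finset.range (k + 1), f (p ^ (k - j)) * g (p ^ j) := by
  rw [ArithmeticFunction.mul_apply, Nat.sum_divisorsAntidiagonal' (fun x y => f x * g y),
    Nat.sum_divisors_prime_pow hp]
  refine Finset.sum_congr rfl fun j hj => ?_
  rw [Nat.pow_div (by simpa [Nat.lt_succ_iff] using hj) hp.pos]

lemma pairArith_prime_pow_of_ne_two {p : ℕ} (hp : p.Prime) (h2 : p ≠ 2) (k : ℕ) :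
    pairArith (p ^ k) = ∑ j ∈ Finset.range (k + 1), restrictedInv p ^ j := by
  rw [pairArith, arithmeticFunction_mul_prime_pow _ _ hp, Finset.sum_eq_single 0]
  · rw [Nat.sub_zero, zeta_mul_restrictedInvArith_prime_pow hp]
    simp [twoCorrection_apply]
  · intro j _ hj
    have hodd : Odd (p ^ j) := (hp.odd_of_ne_two h2).pow
    have h1 : p ^ j ≠ 1 := (Nat.one_lt_pow hj hp.one_lt).ne'
    have : twoCorrection (p ^ j) = 0 := by
      rw [twoCorrection_apply, if_neg h1, if_neg, if_neg]
      · intro h; rw [h] at hodd; exact absurd hodd (by decide)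
      · intro h; rw [h] at hodd; exact absurd hodd (by decide)
    rw [this, mul_zero]
  · simp

lemma pairArith_two_pow (k : ℕ) : pairArith (2 ^ (k + 1)) = 2 - 3 * (1 / 2) ^ (k + 1) := by
  have e : ∀ k : ℕ, ∑ j ∈ Finset.range (k + 1), (restrictedInv 2) ^ j = 2 - (1 / 2 : ℝ) ^ k := by
    intro k
    have h2 : restrictedInv 2 = 1 / 2 := by
      have := restrictedInv_prime_of_ne Nat.prime_two (by norm_num)
      simpa using this
    rw [h2, geom_sum_eq (by norm_num)]
    rw [pow_succ]; ring
  rw [pairArith, arithmeticFunction_mul_prime_pow _ _ Nat.prime_two]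
  simp only [zeta_mul_restrictedInvArith_prime_pow Nat.prime_two, e]
  rcases k with _ | k
  · simp [Finset.sum_range_succ, twoCorrection_apply]; norm_num
  · rw [Finset.sum_range_succ', Finset.sum_range_succ', Finset.sum_range_succ',
      Finset.sum_eq_zero]
    · have h1 : k + 1 + 1 - (0 + 1 + 1) = k := by omega
      have h2 : k + 1 + 1 - (0 + 1) = k + 1 := by omega
      simp only [h1, h2, twoCorrection_apply]
      norm_num
      ring
    · intro j _
      have : twoCorrection (2 ^ (j + 1 + 1 + 1)) = 0 := by
        have h8 : 8 ≤ 2 ^ (j + 1 + 1 + 1) := by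
          calc 8 = 2 ^ 3 := by norm_num
            _ ≤ _ := Nat.pow_le_pow_right (by norm_num) (by omega)
        rw [twoCorrection_apply, if_neg (by omega), if_neg (by omega), if_neg (by omega)]
      rw [this, mul_zero]

/-- The quotient of the density of `{0, h}` by the squared density of `{0}` at `p`, for `h` prime to
`p`. -/
def localBase (p : ℕ) : ℝ := if p = 2 then 1 else 1 - (p : ℝ) ^ (-2 : ℝ)

/-- The quotient of local densities in the Euler product of the singular series depends on `h` only
through the value of `pairArith` at the power of `p` that divides `h`. -/
lemma localDensity_ratio {p h : ℕ} (hp : p.Prime) (h1 : p % 4 ≠ 1) (hh : h ≠ 0) :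
    localDensity {0, (h : ℤ)} p / localDensity {0} p ^ 2 =
      localBase p * pairArith (p ^ h.factorization p) := by
  obtain ⟨k, m, hpm, rfl⟩ := Nat.exists_eq_pow_mul_and_not_dvd hh p hp.ne_one
  have hm0 : m ≠ 0 := by rintro rfl; simp at hpm
  have hk : (p ^ k * m).factorization p = k := by
    rw [Nat.factorization_mul (pow_ne_zero _ hp.ne_zero) hm0]
    simp [hp.factorization_self, Nat.factorization_eq_zero_of_not_dvd hpm]
  rw [hk]
  simp only [localDensity, localCount_pair, localCount_singleton]
  by_cases hp2 : p = 2
  · subst hp2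
    have hm : m % 2 = 1 := by omega
    have e0 := tendsto_pairCount_two_zero.limUnder_eq
    rw [Nat.cast_ofNat, e0, localBase, if_pos rfl]
    rcases k with _ | k
    · have := (tendsto_pairCount_two_odd hm).limUnder_eq
      rw [pow_zero, one_mul, this, pairArith_isMultiplicative.1]
      norm_num
    · rw [(tendsto_pairCount_two_pow_mul hm k).limUnder_eq, pairArith_two_pow]
      ring
  · have h3 : p % 4 = 3 := by
      have := hp.eq_two_or_odd
      omega
    rw [(tendsto_pairCount_zero hp h3).limUnder_eq,
      (tendsto_pairCount_pow_mul hp h3 hpm k).limUnder_eq, localBase, if_neg hp2,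
      pairArith_prime_pow_of_ne_two hp hp2, restrictedInv_prime_of_ne hp h1]
    have hp1 : (1 : ℝ) < p := by exact_mod_cast hp.one_lt
    have hx1 : 1 / (p : ℝ) < 1 := by rw [div_lt_one (by linarith)]; exact hp1
    have hx0 : 0 < 1 / (p : ℝ) := by positivity
    have e : (p : ℝ) ^ (-2 : ℝ) = (1 / (p : ℝ)) ^ 2 := by
      rw [Real.rpow_neg (by positivity)]; norm_num
    rw [e, geom_sum_eq hx1.ne]
    generalize 1 / (p : ℝ) = x at hx0 hx1
    have : x - 1 ≠ 0 := by linarith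
    field_simp
    ring

lemma summable_primesThree_rpow : Summable (fun p : PrimesThree => ((p : ℕ) : ℝ) ^ (-2 : ℝ)) :=
  (Real.summable_nat_rpow.2 (by norm_num : (-2 : ℝ) < -1)).comp_injective Subtype.val_injective

lemma one_sub_rpow_pos (p : PrimesThree) : 0 < 1 - ((p : ℕ) : ℝ) ^ (-2 : ℝ) := by
  have hp1 : (1 : ℝ) < (p : ℕ) := by exact_mod_cast p.2.1.one_lt
  linarith [Real.rpow_lt_one_of_one_lt_of_neg hp1 (by norm_num : (-2 : ℝ) < 0)]

lemma summable_log_primesThree :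
    Summable (fun p : PrimesThree => Real.log (1 - ((p : ℕ) : ℝ) ^ (-2 : ℝ))) := by
  have := Real.summable_log_one_add_of_summable summable_primesThree_rpow.neg
  simpa [sub_eq_add_neg] using this

lemma landauRamanujan_eq : landauRamanujan = 1 / Real.sqrt 2 *
    Real.exp (-(1 / 2) * ∑' p : PrimesThree, Real.log (1 - ((p : ℕ) : ℝ) ^ (-2 : ℝ))) := by
  rw [landauRamanujan, ← tsum_mul_left]
  congr 1
  have e : ∀ p : PrimesThree, -(1 / 2) * Real.log (1 - ((p : ℕ) : ℝ) ^ (-2 : ℝ)) =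
      Real.log ((1 - ((p : ℕ) : ℝ) ^ (-2 : ℝ)) ^ (-(1 / 2) : ℝ)) := fun p => by
    rw [Real.log_rpow (one_sub_rpow_pos p)]
  rw [tsum_congr e, Real.rexp_tsum_eq_tprod]
  · intro p; exact Real.rpow_pos_of_pos (one_sub_rpow_pos p) _
  · exact (summable_log_primesThree.mul_left (-(1 / 2))).congr e

lemma landauRamanujan_pos : 0 < landauRamanujan := by
  rw [landauRamanujan_eq]; positivity

lemma exp_tsum_log_primesThree :
    Real.exp (∑' p : PrimesThree, Real.log (1 - ((p : ℕ) : ℝ) ^ (-2 : ℝ))) =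
      1 / (2 * landauRamanujan ^ 2) := by
  rw [landauRamanujan_eq, mul_pow, ← Real.exp_nat_mul, div_pow, Real.sq_sqrt (by norm_num)]
  set S := ∑' p : PrimesThree, Real.log (1 - ((p : ℕ) : ℝ) ^ (-2 : ℝ))
  have : ((2 : ℕ) : ℝ) * (-(1 / 2) * S) = -S := by push_cast; ring
  rw [this, Real.exp_neg]
  field_simp

/-- The part of the singular series that does not depend on `h`. -/
lemma tprod_localBase : Multipliable (fun p : PrimesNotOne => localBase p) ∧
    ∏' p : PrimesNotOne, localBase p = 1 / (2 * landauRamanujan ^ 2) := by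
  have hs : Summable (fun p : PrimesNotOne => localBase p - 1) := by
    have h := (Real.summable_nat_rpow.2 (by norm_num : (-2 : ℝ) < -1)).comp_injective
      (i := fun p : PrimesNotOne => (p : ℕ)) Subtype.val_injective
    refine Summable.of_norm_bounded h fun p => ?_
    rw [localBase]
    split_ifs
    · simp
    · simp
  refine ⟨by simpa using Real.multipliable_one_add_of_summable hs, ?_⟩
  rw [← exp_tsum_log_primesThree, Real.rexp_tsum_eq_tprod one_sub_rpow_pos summable_log_primesThree]
  let i : PrimesThree → PrimesNotOne := fun p => ⟨p, p.2.1, by have := p.2.2; omega⟩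
  have hi : Function.Injective i := fun a b h => Subtype.ext (congrArg (fun x => x.1) h)
  rw [← hi.tprod_eq]
  · refine tprod_congr fun p => if_neg fun h => ?_
    have := p.2.2
    change (p : ℕ) = 2 at h
    omega
  · intro p hp
    have hp2 : (p : ℕ) ≠ 2 := by
      exact fun h => hp (if_pos h)
    refine ⟨⟨p, p.2.1, ?_⟩, rfl⟩
    have := p.2.1.eq_two_or_odd
    have := p.2.2
    omega

/-- The singular series of `{0, h}`, as a multiplicative function of `h`. For `h = 0` the set has
one element, and the formula fails. -/
lemma singularSeries_pair {h : ℕ} (hh : h ≠ 0) :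
    singularSeries {0, (h : ℤ)} = 1 / (2 * landauRamanujan ^ 2) * pairArith h := by
  have hcard : ({0, (h : ℤ)} : Finset ℤ).card = 2 := by
    rw [Finset.card_pair]; exact_mod_cast hh.symm
  rw [singularSeries, hcard,
    tprod_congr (fun p : PrimesNotOne => localDensity_ratio p.2.1 p.2.2 hh)]
  have hsupp : ∀ p : ℕ, p ∉ h.primeFactors → pairArith (p ^ h.factorization p) = 1 := by
    intro p hp
    rw [← Nat.support_factorization, Finsupp.notMem_support_iff] at hp
    rw [hp, pow_zero, pairArith_isMultiplicative.1]
  have hfin : (Function.mulSupport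
      fun p : PrimesNotOne => pairArith ((p : ℕ) ^ h.factorization p)).Finite := by
    refine (Set.Finite.preimage Subtype.val_injective.injOn
      (h.primeFactors.finite_toSet)).subset fun p hp => ?_
    by_contra hc
    exact hp (hsupp p hc)
  rw [Multipliable.tprod_mul tprod_localBase.1 (multipliable_of_hasFiniteMulSupport hfin),
    tprod_localBase.2]
  congr 1
  have e := tprod_subtype {p : ℕ | p.Prime ∧ p % 4 ≠ 1} (fun p : ℕ =>
      pairArith (p ^ h.factorization p))
  refine e.trans ?_
  rw [tprod_eq_prod (s := h.primeFactors),
    pairArith_isMultiplicative.multiplicative_factorization _ hh,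
    Nat.prod_factorization_eq_prod_primeFactors]
  · refine Finset.prod_congr rfl fun p hp => ?_
    have hpp := Nat.prime_of_mem_primeFactors hp
    by_cases h1 : p % 4 = 1
    · rw [Set.mulIndicator_of_notMem (by simp [h1]),
        pairArith_prime_pow_of_ne_two hpp (by rintro rfl; omega), restrictedInv_prime_of_eq hpp h1]
      simp [Finset.sum_range_succ']
    · rw [Set.mulIndicator_of_mem (by exact ⟨hpp, h1⟩)]
  · intro p hp
    by_cases hm : p ∈ {p : ℕ | p.Prime ∧ p % 4 ≠ 1}
    · rw [Set.mulIndicator_of_mem hm, hsupp p hp]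
    · rw [Set.mulIndicator_of_notMem hm]

/-- A prime factor congruent to `1` modulo `4` does not affect the singular series. -/
lemma pairArith_mul_of_one_mod_four {q m : ℕ} (hq : q.Prime) (h1 : q % 4 = 1) :
    pairArith (q * m) = pairArith m := by
  rcases eq_or_ne m 0 with rfl | hm
  · simp
  have hpow : ∀ k, pairArith (q ^ k) = 1 := fun k => by
    rw [pairArith_prime_pow_of_ne_two hq (by rintro rfl; omega), restrictedInv_prime_of_eq hq h1]
    simp [Finset.sum_range_succ']
  obtain ⟨k, n, hqn, rfl⟩ := Nat.exists_eq_pow_mul_and_not_dvd hm q hq.ne_one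
  have hc : ∀ k, (q ^ k).Coprime n := fun k =>
    Nat.Coprime.pow_left _ ((Nat.Prime.coprime_iff_not_dvd hq).2 hqn)
  rw [← mul_assoc, ← pow_succ', pairArith_isMultiplicative.2 (hc _),
    pairArith_isMultiplicative.2 (hc _), hpow, hpow]

/-! ### Holomorphic functions with controlled derivatives on a strip -/

/-- `f` is holomorphic on `Ω` and its derivatives of order at most `n` are `O((1 + |s|) ^ A)`
uniformly on `Ω`. -/
def TameOn (Ω : Set ℂ) (n : ℕ) (A : ℝ) (f : ℂ → ℂ) : Prop :=
  DifferentiableOn ℂ f Ω ∧ ∀ k ≤ n, ∃ C : ℝ, ∀ s ∈ Ω, ‖iteratedDeriv k f s‖ ≤ C * (1 + ‖s‖) ^ A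

variable {Ω Ω' S : Set ℂ} {n m : ℕ} {A B : ℝ} {f g h R Z : ℂ → ℂ} {N N' : ℕ}

lemma one_add_norm_pos (s : ℂ) : 0 < 1 + ‖s‖ := by positivity

lemma TameOn.congr (hf : TameOn Ω n A f) (hΩ : IsOpen Ω) (hfg : Set.EqOn g f Ω) :
    TameOn Ω n A g := by
  refine ⟨hf.1.congr hfg, fun k hk => ?_⟩
  obtain ⟨C, hC⟩ := hf.2 k hk
  refine ⟨C, fun s hs => ?_⟩
  rw [hfg.iteratedDeriv_of_isOpen hΩ k hs]
  exact hC s hs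

lemma TameOn.mono_set (hf : TameOn Ω n A f) (h : Ω' ⊆ Ω) : TameOn Ω' n A f :=
  ⟨hf.1.mono h, fun k hk => let ⟨C, hC⟩ := hf.2 k hk; ⟨C, fun s hs => hC s (h hs)⟩⟩

lemma TameOn.mono_order (hf : TameOn Ω n A f) (h : m ≤ n) : TameOn Ω m A f :=
  ⟨hf.1, fun k hk => hf.2 k (hk.trans h)⟩

lemma TameOn.mono_exponent (hf : TameOn Ω n A f) (h : A ≤ B) : TameOn Ω n B f := by
  refine ⟨hf.1, fun k hk => ?_⟩
  obtain ⟨C, hC⟩ := hf.2 k hk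
  refine ⟨|C|, fun s hs => (hC s hs).trans ?_⟩
  have : (1 + ‖s‖) ^ A ≤ (1 + ‖s‖) ^ B :=
    Real.rpow_le_rpow_of_exponent_le (by linarith [norm_nonneg s]) h
  calc C * (1 + ‖s‖) ^ A ≤ |C| * (1 + ‖s‖) ^ A := by gcongr; exact le_abs_self C
    _ ≤ _ := by gcongr

lemma TameOn.union (hf : TameOn Ω n A f) (hf' : TameOn Ω' n A f) (hΩ : IsOpen Ω)
    (hΩ' : IsOpen Ω') : TameOn (Ω ∪ Ω') n A f := by
  refine ⟨hf.1.union_of_isOpen hf'.1 hΩ hΩ', fun k hk => ?_⟩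
  obtain ⟨C, hC⟩ := hf.2 k hk
  obtain ⟨C', hC'⟩ := hf'.2 k hk
  refine ⟨max C C', fun s hs => ?_⟩
  have := one_add_norm_pos s
  rcases hs with hs | hs
  · exact (hC s hs).trans (by gcongr; exact le_max_left _ _)
  · exact (hC' s hs).trans (by gcongr; exact le_max_right _ _)

lemma tameOn_zero_iff : TameOn Ω 0 A f ↔
    DifferentiableOn ℂ f Ω ∧ ∃ C : ℝ, ∀ s ∈ Ω, ‖f s‖ ≤ C * (1 + ‖s‖) ^ A := by
  simp [TameOn]

lemma tameOn_succ_iff (hΩ : IsOpen Ω) : TameOn Ω (n + 1) A f ↔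
    TameOn Ω 0 A f ∧ TameOn Ω n A (deriv f) := by
  constructor
  · intro hf
    refine ⟨hf.mono_order (Nat.zero_le _), hf.1.deriv hΩ, fun k hk => ?_⟩
    obtain ⟨C, hC⟩ := hf.2 (k + 1) (by omega)
    exact ⟨C, fun s hs => by rw [← iteratedDeriv_succ']; exact hC s hs⟩
  · rintro ⟨h0, h1⟩
    refine ⟨h0.1, fun k hk => ?_⟩
    rcases k with _ | k
    · exact h0.2 0 le_rfl
    · rw [iteratedDeriv_succ']
      exact h1.2 k (by omega)

lemma TameOn.add (hΩ : IsOpen Ω) (hf : TameOn Ω n A f) (hg : TameOn Ω n A g) :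
    TameOn Ω n A (fun s => f s + g s) := by
  refine ⟨hf.1.add hg.1, fun k hk => ?_⟩
  obtain ⟨C, hC⟩ := hf.2 k hk
  obtain ⟨C', hC'⟩ := hg.2 k hk
  refine ⟨C + C', fun s hs => ?_⟩
  have h1 := (hf.1.contDiffOn hΩ (n := k)).contDiffAt (hΩ.mem_nhds hs)
  have h2 := (hg.1.contDiffOn hΩ (n := k)).contDiffAt (hΩ.mem_nhds hs)
  rw [iteratedDeriv_fun_add h1 h2, add_mul]
  exact (norm_add_le _ _).trans (add_le_add (hC s hs) (hC' s hs))

lemma TameOn.mul (hΩ : IsOpen Ω) (hf : TameOn Ω n A f) (hg : TameOn Ω n B g) :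
    TameOn Ω n (A + B) (fun s => f s * g s) := by
  induction n generalizing f g with
  | zero =>
    rw [tameOn_zero_iff] at hf hg ⊢
    obtain ⟨hf, C, hC⟩ := hf
    obtain ⟨hg, C', hC'⟩ := hg
    refine ⟨hf.mul hg, C * C', fun s hs => ?_⟩
    rw [norm_mul, Real.rpow_add (one_add_norm_pos s)]
    calc ‖f s‖ * ‖g s‖ ≤ (C * (1 + ‖s‖) ^ A) * (C' * (1 + ‖s‖) ^ B) :=
          mul_le_mul (hC s hs) (hC' s hs) (norm_nonneg _) ((norm_nonneg _).trans (hC s hs))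
      _ = _ := by ring
  | succ n ih =>
    have h0 := ih (hf.mono_order n.le_succ) (hg.mono_order n.le_succ)
    rw [tameOn_succ_iff hΩ] at hf hg ⊢
    refine ⟨h0.mono_order (Nat.zero_le _), ?_⟩
    have hf' := hf.1.1
    have hg' := hg.1.1
    rw [← tameOn_succ_iff hΩ] at hf hg
    have h1 := ih ((tameOn_succ_iff hΩ).1 hf).2 (hg.mono_order n.le_succ)
    have h2 := ih (hf.mono_order n.le_succ) ((tameOn_succ_iff hΩ).1 hg).2
    refine (h1.add hΩ h2).congr hΩ fun s hs => ?_
    exact deriv_fun_mul (hf'.differentiableAt (hΩ.mem_nhds hs))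
      (hg'.differentiableAt (hΩ.mem_nhds hs))

lemma tameOn_const (c : ℂ) : TameOn Ω n 0 (fun _ => c) := by
  refine ⟨differentiableOn_const c, fun k _ => ⟨‖c‖, fun s _ => ?_⟩⟩
  rw [iteratedDeriv_const]
  split_ifs <;> simp

lemma TameOn.const_mul (hΩ : IsOpen Ω) (c : ℂ) (hf : TameOn Ω n A f) :
    TameOn Ω n A (fun s => c * f s) := by
  simpa using (tameOn_const c).mul hΩ hf

lemma TameOn.sub (hΩ : IsOpen Ω) (hf : TameOn Ω n A f) (hg : TameOn Ω n A g) :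
    TameOn Ω n A (fun s => f s - g s) := by
  simpa [sub_eq_add_neg] using hf.add hΩ (hg.const_mul hΩ (-1))

lemma TameOn.sum (hΩ : IsOpen Ω) {ι : Type*} (S : Finset ι) {F : ι → ℂ → ℂ}
    (hA : 0 ≤ A) (hF : ∀ i ∈ S, TameOn Ω n A (F i)) : TameOn Ω n A (fun s => ∑ i ∈ S, F i s) := by
  classical
  induction S using Finset.induction_on with
  | empty => simpa using (tameOn_const (Ω := Ω) (n := n) 0).mono_exponent hA
  | insert i S hi ih =>
    simp only [Finset.sum_insert hi]
    exact (hF i (by simp)).add hΩ (ih fun j hj => hF j (by simp [hj]))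

/-- The weight `(1 + |s|) ^ A`, for `A` of either sign, changes by a bounded factor on a unit
disc. -/
lemma rpow_one_add_norm_le {s z : ℂ} (hz : ‖z - s‖ ≤ 1) (A : ℝ) :
    (1 + ‖z‖) ^ A ≤ 2 ^ |A| * (1 + ‖s‖) ^ A := by
  have hs0 := one_add_norm_pos s
  have hz0 := one_add_norm_pos z
  have h1 : ‖z‖ ≤ ‖s‖ + 1 := by
    have := norm_sub_norm_le z s
    linarith
  have h2 : ‖s‖ ≤ ‖z‖ + 1 := by
    have := norm_sub_norm_le s z
    rw [norm_sub_rev] at this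
    linarith
  rcases le_total 0 A with hA | hA
  · rw [abs_of_nonneg hA, ← Real.mul_rpow (by norm_num) hs0.le]
    exact Real.rpow_le_rpow hz0.le (by linarith [norm_nonneg s]) hA
  · rw [abs_of_nonpos hA, Real.rpow_neg (by norm_num), ← Real.inv_rpow (by norm_num),
      ← Real.mul_rpow (by norm_num) hs0.le]
    exact Real.rpow_le_rpow_of_nonpos (by positivity) (by linarith [norm_nonneg z]) hA

/-- Cauchy's estimates: a bound on a neighbourhood of `Ω` of fixed width bounds all derivatives
on `Ω`. -/
lemma tameOn_of_bound {r : ℝ} (hr : 0 < r) (hr1 : r ≤ 1) (hd : DifferentiableOn ℂ f Ω')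
    (hsub : ∀ s ∈ Ω, Metric.closedBall s r ⊆ Ω')
    {C : ℝ} (hC : ∀ s ∈ Ω', ‖f s‖ ≤ C * (1 + ‖s‖) ^ A) (n : ℕ) : TameOn Ω n A f := by
  refine ⟨hd.mono fun s hs => hsub s hs (Metric.mem_closedBall_self hr.le), fun k _ => ?_⟩
  refine ⟨k.factorial * (|C| * 2 ^ |A|) / r ^ k, fun s hs => ?_⟩
  have h1 : DiffContOnCl ℂ f (Metric.ball s r) := by
    refine DifferentiableOn.diffContOnCl ?_
    rw [closure_ball s hr.ne']
    exact hd.mono (hsub s hs)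
  have h2 : ∀ z ∈ Metric.sphere s r, ‖f z‖ ≤ |C| * (2 ^ |A| * (1 + ‖s‖) ^ A) := by
    intro z hz
    have hz' : ‖z - s‖ = r := by simpa [dist_eq_norm] using hz
    refine (hC z (hsub s hs (Metric.sphere_subset_closedBall hz))).trans ?_
    have := one_add_norm_pos z
    calc C * (1 + ‖z‖) ^ A ≤ |C| * (1 + ‖z‖) ^ A := by gcongr; exact le_abs_self C
      _ ≤ _ := by gcongr; exact rpow_one_add_norm_le (hz'.le.trans hr1) A
  refine (Complex.norm_iteratedDeriv_le_of_forall_mem_sphere_norm_le k hr h1 h2).trans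
    (le_of_eq ?_)
  ring

/-- Every derivative has polynomial growth on `Ω`. -/
def PolyTameOn (Ω : Set ℂ) (f : ℂ → ℂ) : Prop := ∀ n : ℕ, ∃ A : ℝ, TameOn Ω n A f

/-- Every derivative decays faster than any power of `|s|` on `Ω`. -/
def RapidOn (Ω : Set ℂ) (f : ℂ → ℂ) : Prop := ∀ (n : ℕ) (A : ℝ), TameOn Ω n A f

lemma PolyTameOn.congr (hf : PolyTameOn Ω f) (hΩ : IsOpen Ω) (hfg : Set.EqOn g f Ω) :
    PolyTameOn Ω g := fun n => let ⟨A, hA⟩ := hf n; ⟨A, hA.congr hΩ hfg⟩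

lemma PolyTameOn.mul (hΩ : IsOpen Ω) (hf : PolyTameOn Ω f) (hg : PolyTameOn Ω g) :
    PolyTameOn Ω (fun s => f s * g s) := fun n =>
  let ⟨_, hA⟩ := hf n; let ⟨_, hB⟩ := hg n; ⟨_, hA.mul hΩ hB⟩

lemma PolyTameOn.mul_rapid (hΩ : IsOpen Ω) (hf : PolyTameOn Ω f) (hg : RapidOn Ω g) :
    RapidOn Ω (fun s => f s * g s) := fun n A => by
  obtain ⟨B, hB⟩ := hf n
  have := hB.mul hΩ (hg n (A - B))
  rwa [add_sub_cancel] at this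

lemma PolyTameOn.deriv (hΩ : IsOpen Ω) (hf : PolyTameOn Ω f) : PolyTameOn Ω (deriv f) := fun n =>
  let ⟨A, hA⟩ := hf (n + 1); ⟨A, ((tameOn_succ_iff hΩ).1 hA).2⟩

/-- If `f` is tame and `1 / f` has polynomial growth, then all derivatives of `1 / f` have
polynomial growth, by induction from `(1 / f)' = - f' / f ^ 2`. -/
lemma PolyTameOn.inv (hΩ : IsOpen Ω) (hf : PolyTameOn Ω f) (h0 : ∀ s ∈ Ω, f s ≠ 0)
    {C : ℝ} (hC : ∀ s ∈ Ω, ‖(f s)⁻¹‖ ≤ C * (1 + ‖s‖) ^ B) : PolyTameOn Ω (fun s => (f s)⁻¹) := by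
  obtain ⟨A, hA⟩ := hf 0
  have hd : DifferentiableOn ℂ (fun s => (f s)⁻¹) Ω := hA.1.inv h0
  have hz : TameOn Ω 0 B (fun s => (f s)⁻¹) := tameOn_zero_iff.2 ⟨hd, C, hC⟩
  intro n
  induction n with
  | zero => exact ⟨B, hz⟩
  | succ n ih =>
    obtain ⟨A₁, h1⟩ := ih
    obtain ⟨A₂, h2⟩ := (hf.deriv hΩ) n
    have h3 := ((h1.mul hΩ h1).mul hΩ h2).const_mul hΩ (-1)
    refine ⟨max B (A₁ + A₁ + A₂), (tameOn_succ_iff hΩ).2 ⟨hz.mono_exponent (le_max_left _ _), ?_⟩⟩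
    refine (h3.congr hΩ fun s hs => ?_).mono_exponent (le_max_right _ _)
    have hfs : DifferentiableAt ℂ f s := hA.1.differentiableAt (hΩ.mem_nhds hs)
    rw [(hfs.hasDerivAt.fun_inv (h0 s hs)).deriv]
    have := h0 s hs
    field_simp

/-- A holomorphic square root of a tame function with tame inverse is tame, because
`g' = (h' / 2 h) g` when `g ^ 2 = h`. -/
lemma PolyTameOn.of_sq (hΩ : IsOpen Ω) (hh : PolyTameOn Ω h) (hi : PolyTameOn Ω (fun s => (h s)⁻¹))
    (h0 : ∀ s ∈ Ω, h s ≠ 0) (hg : DifferentiableOn ℂ g Ω) (hsq : ∀ s ∈ Ω, g s ^ 2 = h s) :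
    PolyTameOn Ω g := by
  obtain ⟨A, hA⟩ := hh 0
  have hz : TameOn Ω 0 (max A 0) g := by
    obtain ⟨-, C, hC⟩ := tameOn_zero_iff.1 (hA.mono_exponent (le_max_left A 0))
    refine tameOn_zero_iff.2 ⟨hg, 1 + C, fun s hs => ?_⟩
    have h1 : ‖g s‖ ^ 2 ≤ C * (1 + ‖s‖) ^ max A 0 := by
      rw [← norm_pow, hsq s hs]; exact hC s hs
    have h2 : (1 : ℝ) ≤ (1 + ‖s‖) ^ max A 0 :=
      Real.one_le_rpow (by linarith [norm_nonneg s]) (le_max_right _ _)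
    nlinarith [sq_nonneg (‖g s‖ - 1), norm_nonneg (g s)]
  intro n
  induction n with
  | zero => exact ⟨_, hz⟩
  | succ n ih =>
    obtain ⟨A₁, h1⟩ := ih
    obtain ⟨A₂, h2⟩ := (hh.deriv hΩ) n
    obtain ⟨A₃, h3⟩ := hi n
    have h4 := ((h2.mul hΩ h3).mul hΩ h1).const_mul hΩ (1 / 2)
    refine ⟨max (max A 0) (A₂ + A₃ + A₁),
      (tameOn_succ_iff hΩ).2 ⟨hz.mono_exponent (le_max_left _ _), ?_⟩⟩
    refine (h4.congr hΩ fun s hs => ?_).mono_exponent (le_max_right _ _)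
    have hgs : DifferentiableAt ℂ g s := hg.differentiableAt (hΩ.mem_nhds hs)
    have hev : h =ᶠ[𝓝 s] fun z => g z ^ 2 := by
      filter_upwards [hΩ.mem_nhds hs] with z hz using (hsq z hz).symm
    have hd : _root_.deriv h s = 2 * g s * _root_.deriv g s := by
      rw [hev.deriv_eq, (hgs.hasDerivAt.fun_pow 2).deriv]; simp
    have hgne : g s ≠ 0 := by
      intro hc
      apply h0 s hs
      rw [← hsq s hs, hc]; ring
    rw [hd, ← hsq s hs]
    field_simp

/-- The open strip `0 < Re s < 1 / 2`. -/
def strip : Set ℂ := {s : ℂ | 0 < s.re ∧ s.re < 1 / 2}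

lemma isOpen_strip : IsOpen strip :=
  (isOpen_lt continuous_const Complex.continuous_re).inter
    (isOpen_lt Complex.continuous_re continuous_const)

/-- The point `c + i t` of the vertical line `Re s = c`. -/
def vline (c t : ℝ) : ℂ := c + t * Complex.I

@[simp] lemma vline_re (c t : ℝ) : (vline c t).re = c := by simp [vline]
@[simp] lemma vline_im (c t : ℝ) : (vline c t).im = t := by simp [vline]

lemma continuous_vline (c : ℝ) : Continuous (vline c) := by unfold vline; fun_prop

lemma hasDerivAt_vline (c t : ℝ) : HasDerivAt (vline c) Complex.I t := by
  unfold vline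
  simpa using ((Complex.ofRealCLM.hasDerivAt (x := t)).mul_const Complex.I).const_add (c : ℂ)

lemma rpow_norm_vline_le {c t A : ℝ} (hA : A ≤ 0) :
    (1 + ‖vline c t‖) ^ A ≤ (1 + ‖t‖) ^ A := by
  refine Real.rpow_le_rpow_of_nonpos (by positivity) ?_ hA
  have := Complex.abs_im_le_norm (vline c t)
  rw [vline_im] at this
  simpa using this

lemma integrable_of_vline_bound {F : ℝ → ℂ} {C : ℝ} (hF : Continuous F)
    (hb : ∀ t, ‖F t‖ ≤ C * (1 + ‖t‖) ^ (-(3 / 2) : ℝ)) : MeasureTheory.Integrable F := by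
  refine ((integrable_one_add_norm (E := ℝ) (μ := MeasureTheory.volume)
    (r := 3 / 2) ?_).const_mul C).mono' hF.aestronglyMeasurable (Eventually.of_forall hb)
  norm_num

lemma norm_exp_mul_vline (L c t : ℝ) : ‖Complex.exp (L * vline c t)‖ = Real.exp (L * c) := by
  rw [Complex.norm_exp]; simp

lemma TameOn.continuous_vline (hf : TameOn strip n A f) {c : ℝ} (hc : 0 < c) (hc2 : c < 1 / 2) :
    Continuous (fun t => f (vline c t)) :=
  hf.1.continuousOn.comp_continuous (TwoSquares.continuous_vline c) fun t =>
    by simp [strip, hc]; linarith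

lemma TameOn.exists_bound_vline (hf : TameOn strip n (-(3 / 2)) f) (L : ℝ) : ∃ C : ℝ, ∀ c t : ℝ,
    0 < c → c < 1 / 2 → ‖f (vline c t) * Complex.exp (L * vline c t)‖ ≤
      (C * Real.exp (L * c)) * (1 + ‖t‖) ^ (-(3 / 2) : ℝ) := by
  obtain ⟨-, C, hC⟩ := tameOn_zero_iff.1 (hf.mono_order (Nat.zero_le n))
  refine ⟨|C|, fun c t hc hc2 => ?_⟩
  rw [norm_mul, norm_exp_mul_vline]
  have h1 := hC (vline c t) (by simp [strip, hc]; linarith)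
  have h2 := rpow_norm_vline_le (c := c) (t := t) (A := -(3 / 2)) (by norm_num)
  have := one_add_norm_pos (vline c t)
  calc ‖f (vline c t)‖ * Real.exp (L * c)
      ≤ (C * (1 + ‖vline c t‖) ^ (-(3 / 2) : ℝ)) * Real.exp (L * c) := by gcongr
    _ ≤ (|C| * (1 + ‖vline c t‖) ^ (-(3 / 2) : ℝ)) * Real.exp (L * c) := by
        gcongr; exact le_abs_self C
    _ ≤ (|C| * (1 + ‖t‖) ^ (-(3 / 2) : ℝ)) * Real.exp (L * c) := by gcongr
    _ = _ := by ring

lemma TameOn.integrable_vline (hf : TameOn strip n (-(3 / 2)) f) (L : ℝ) {c : ℝ} (hc : 0 < c)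
    (hc2 : c < 1 / 2) :
    MeasureTheory.Integrable (fun t : ℝ => f (vline c t) * Complex.exp (L * vline c t)) := by
  obtain ⟨C, hC⟩ := hf.exists_bound_vline L
  refine integrable_of_vline_bound ((hf.continuous_vline hc hc2).mul ?_) (hC c · hc hc2)
  exact Complex.continuous_exp.comp (continuous_const.mul (TwoSquares.continuous_vline c))

/-- Integration by parts on a vertical line. The boundary terms vanish because `f` decays. -/
lemma TameOn.integral_by_parts (hf : TameOn strip (n + 1) (-(3 / 2)) f) {L : ℝ} (hL : L ≠ 0) {c : ℝ}
    (hc : 0 < c) (hc2 : c < 1 / 2) :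
    ∫ t : ℝ, f (vline c t) * Complex.exp (L * vline c t) =
      -(1 / L) * ∫ t : ℝ, deriv f (vline c t) * Complex.exp (L * vline c t) := by
  have hf' := ((tameOn_succ_iff isOpen_strip).1 hf).2
  have hu : ∀ t, HasDerivAt (fun t => f (vline c t)) (deriv f (vline c t) * Complex.I) t := by
    intro t
    have h1 : HasDerivAt f (deriv f (vline c t)) (vline c t) :=
      (hf.1.differentiableAt (isOpen_strip.mem_nhds (by simp [strip, hc]; linarith))).hasDerivAt
    exact h1.comp t (hasDerivAt_vline c t)
  have hv : ∀ t, HasDerivAt (fun t => Complex.exp (L * vline c t))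
      (Complex.exp (L * vline c t) * (L * Complex.I)) t := by
    intro t
    exact ((hasDerivAt_vline c t).const_mul (L : ℂ)).cexp
  have h := MeasureTheory.integral_mul_deriv_eq_deriv_mul_of_integrable (u := fun t =>
      f (vline c t))
    (v := fun t => Complex.exp (L * vline c t)) (fun t _ => hu t) (fun t _ => hv t) ?_ ?_ ?_
  · have e1 : ∫ t : ℝ, f (vline c t) * (Complex.exp (L * vline c t) * (L * Complex.I)) =
        (L * Complex.I) * ∫ t : ℝ, f (vline c t) * Complex.exp (L * vline c t) := by
      rw [← MeasureTheory.integral_const_mul]; congr 1; ext t; ring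
    have e2 : ∫ t : ℝ, deriv f (vline c t) * Complex.I * Complex.exp (L * vline c t) =
        Complex.I * ∫ t : ℝ, deriv f (vline c t) * Complex.exp (L * vline c t) := by
      rw [← MeasureTheory.integral_const_mul]; congr 1; ext t; ring
    rw [e1, e2] at h
    have hL' : (L : ℂ) ≠ 0 := by exact_mod_cast hL
    have hI := Complex.I_ne_zero
    field_simp
    apply mul_left_cancel₀ hI
    linear_combination h
  · have := (hf.integrable_vline L hc hc2).mul_const (L * Complex.I)
    refine this.congr (Eventually.of_forall fun t => ?_)
    simp only [Pi.mul_apply]; ring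
  · have := (hf'.integrable_vline L hc hc2).mul_const Complex.I
    refine this.congr (Eventually.of_forall fun t => ?_)
    simp only [Pi.mul_apply]; ring
  · exact hf.integrable_vline L hc hc2

/-- On the line `Re s = 1 / L` the factor `e ^ (L s)` is bounded, so `n` integrations by parts
save `L ^ n`. -/
lemma TameOn.integral_isBigO (hf : TameOn strip n (-(3 / 2)) f) :
    (fun L : ℝ => ∫ t : ℝ, f (vline (1 / L) t) * Complex.exp (L * vline (1 / L) t))
      =O[atTop] fun L => L ^ (-(n : ℝ)) := by
  induction n generalizing f with
  | zero =>
    obtain ⟨-, C, hC⟩ := tameOn_zero_iff.1 hf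
    refine IsBigO.of_bound (∫ t : ℝ, |C| * Real.exp 1 * (1 + ‖t‖) ^ (-(3 / 2) : ℝ)) ?_
    filter_upwards [eventually_gt_atTop 3] with L hL
    have hc : 0 < 1 / L := by positivity
    have hc2 : 1 / L < 1 / 2 := by
      rw [div_lt_div_iff₀ (by linarith) two_pos]; linarith
    simp only [Nat.cast_zero, neg_zero, Real.rpow_zero, norm_one, mul_one]
    refine MeasureTheory.norm_integral_le_of_norm_le ?_ (Eventually.of_forall fun t => ?_)
    · exact (integrable_one_add_norm (E := ℝ) (r := 3 / 2) (by norm_num)).const_mul _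
    · rw [norm_mul, norm_exp_mul_vline, mul_one_div_cancel (by linarith)]
      have h1 := hC (vline (1 / L) t) ⟨by simpa using hc, by simpa using hc2⟩
      have h2 := rpow_norm_vline_le (c := 1 / L) (t := t) (A := -(3 / 2)) (by norm_num)
      have := one_add_norm_pos (vline (1 / L) t)
      calc ‖f (vline (1 / L) t)‖ * Real.exp 1
          ≤ (C * (1 + ‖vline (1 / L) t‖) ^ (-(3 / 2) : ℝ)) * Real.exp 1 := by gcongr
        _ ≤ (|C| * (1 + ‖vline (1 / L) t‖) ^ (-(3 / 2) : ℝ)) * Real.exp 1 := by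
            gcongr; exact le_abs_self C
        _ ≤ (|C| * (1 + ‖t‖) ^ (-(3 / 2) : ℝ)) * Real.exp 1 := by gcongr
        _ = _ := by ring
  | succ n ih =>
    have hf' := ((tameOn_succ_iff isOpen_strip).1 hf).2
    have h1 : (fun L : ℝ => (-(1 / L) : ℂ)) =O[atTop] fun L : ℝ => L ^ (-1 : ℝ) := by
      refine IsBigO.of_bound 1 ?_
      filter_upwards [eventually_gt_atTop 0] with L hL
      simp [Real.rpow_neg_one]
    have h2 := h1.mul (ih hf')
    refine (h2.congr' ?_ ?_)
    · filter_upwards [eventually_gt_atTop 3] with L hL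
      have hc2 : 1 / L < 1 / 2 := by
        rw [div_lt_div_iff₀ (by linarith) two_pos]; linarith
      exact (hf.integral_by_parts (by linarith) (by positivity) hc2).symm
    · filter_upwards [eventually_gt_atTop 0] with L hL
      rw [← Real.rpow_add hL]; congr 1; push_cast; ring

/-! ### Powers of the variable and the inverse Laplace transform of a power -/

lemma deriv_cpow_const_of_re_pos {s : ℂ} (hs : 0 < s.re) (a : ℝ) :
    deriv (fun z : ℂ => z ^ (a : ℂ)) s = a * s ^ ((a - 1 : ℝ) : ℂ) := by
  have := ((hasDerivAt_id s).cpow_const (c := (a : ℂ)) (Or.inl hs)).deriv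
  simpa using this

lemma differentiableOn_cpow_const (hΩ : ∀ s ∈ Ω, 0 < s.re) (a : ℝ) :
    DifferentiableOn ℂ (fun z : ℂ => z ^ (a : ℂ)) Ω := fun s hs =>
  (((hasDerivAt_id s).cpow_const (c := (a : ℂ)) (Or.inl (hΩ s hs)))
    |>.differentiableAt).differentiableWithinAt

/-- Away from `0`, every derivative of `s ^ a` is bounded by a multiple of `|s| ^ a`. -/
lemma tameOn_cpow_of_norm_gt (hΩ : IsOpen Ω) {ρ : ℝ} (hρ : 0 < ρ) (h0 : ∀ s ∈ Ω, 0 < s.re)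
    (h1 : ∀ s ∈ Ω, ρ < ‖s‖) (n : ℕ) (a : ℝ) : TameOn Ω n a (fun s => s ^ (a : ℂ)) := by
  have hz : ∀ a : ℝ, TameOn Ω 0 a (fun s => s ^ (a : ℂ)) := by
    intro a
    refine tameOn_zero_iff.2 ⟨differentiableOn_cpow_const h0 a, max 1 ((ρ / (1 + ρ)) ^ a),
      fun s hs => ?_⟩
    rw [Complex.norm_cpow_real]
    have hs1 := h1 s hs
    have hpos : 0 < ‖s‖ := hρ.trans hs1
    have := one_add_norm_pos s
    rcases le_total 0 a with ha | ha
    · calc ‖s‖ ^ a ≤ 1 * (1 + ‖s‖) ^ a := by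
            rw [one_mul]; exact Real.rpow_le_rpow hpos.le (by linarith) ha
        _ ≤ _ := by gcongr; exact le_max_left _ _
    · calc ‖s‖ ^ a ≤ (ρ / (1 + ρ)) ^ a * (1 + ‖s‖) ^ a := by
            rw [← Real.mul_rpow (by positivity) (by positivity)]
            refine Real.rpow_le_rpow_of_nonpos (by positivity) ?_ ha
            rw [div_mul_eq_mul_div, div_le_iff₀ (by positivity)]
            nlinarith
        _ ≤ _ := by gcongr; exact le_max_right _ _
  induction n generalizing a with
  | zero => exact hz a
  | succ n ih =>
    refine (tameOn_succ_iff hΩ).2 ⟨hz a, ?_⟩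
    refine (((ih (a - 1)).const_mul hΩ (a : ℂ)).congr hΩ fun s hs => ?_).mono_exponent
      (by linarith)
    exact deriv_cpow_const_of_re_pos (h0 s hs) a

/-- Near `0`, the derivatives of `s ^ a` of order at most `a` are bounded. -/
lemma tameOn_cpow_of_norm_lt (hΩ : IsOpen Ω) {ρ : ℝ} (h0 : ∀ s ∈ Ω, 0 < s.re)
    (h1 : ∀ s ∈ Ω, ‖s‖ < ρ) (n : ℕ) {a : ℝ} (ha : n ≤ a) :
    TameOn Ω n 0 (fun s => s ^ (a : ℂ)) := by
  induction n generalizing a with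
  | zero =>
    refine tameOn_zero_iff.2 ⟨differentiableOn_cpow_const h0 a, ρ ^ a, fun s hs => ?_⟩
    rw [Complex.norm_cpow_real, Real.rpow_zero, mul_one]
    exact Real.rpow_le_rpow (norm_nonneg _) (h1 s hs).le (by simpa using ha)
  | succ n ih =>
    push_cast at ha
    refine (tameOn_succ_iff hΩ).2 ⟨(ih (by linarith)).mono_order (Nat.zero_le _), ?_⟩
    refine ((ih (a := a - 1) (by linarith)).const_mul hΩ (a : ℂ)).congr hΩ fun s hs => ?_
    exact deriv_cpow_const_of_re_pos (h0 s hs) a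

/-- On a bounded set the exponent is irrelevant. -/
lemma TameOn.of_bounded (hf : TameOn Ω n A f) {ρ : ℝ} (h1 : ∀ s ∈ Ω, ‖s‖ < ρ) (B : ℝ) :
    TameOn Ω n B f := by
  have hb : ∃ D : ℝ, 0 ≤ D ∧ ∀ s ∈ Ω, (1 + ‖s‖) ^ A ≤ D * (1 + ‖s‖) ^ B := by
    refine ⟨(1 + |ρ|) ^ |A - B|, by positivity, fun s hs => ?_⟩
    have hs := one_add_norm_pos s
    have e : (1 + ‖s‖) ^ A = (1 + ‖s‖) ^ (A - B) * (1 + ‖s‖) ^ B := by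
      rw [← Real.rpow_add hs]; ring_nf
    rw [e]
    have h2 : (1 + ‖s‖) ^ (A - B) ≤ (1 + ‖s‖) ^ |A - B| :=
      Real.rpow_le_rpow_of_exponent_le (by linarith [norm_nonneg s]) (le_abs_self _)
    have h3 : (1 + ‖s‖) ^ |A - B| ≤ (1 + |ρ|) ^ |A - B| := by
      refine Real.rpow_le_rpow hs.le ?_ (abs_nonneg _)
      have := h1 s ‹_›
      have := le_abs_self ρ
      linarith
    gcongr
    exact h2.trans h3
  obtain ⟨D, hD0, hD⟩ := hb
  refine ⟨hf.1, fun k hk => ?_⟩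
  obtain ⟨C, hC⟩ := hf.2 k hk
  refine ⟨|C| * D, fun s hs => (hC s hs).trans ?_⟩
  have := one_add_norm_pos s
  calc C * (1 + ‖s‖) ^ A ≤ |C| * (1 + ‖s‖) ^ A := by gcongr; exact le_abs_self C
    _ ≤ |C| * (D * (1 + ‖s‖) ^ B) := by gcongr; exact hD s hs
    _ = _ := by ring

/-- A function that is analytic at `0` has bounded derivatives on small discs. -/
lemma exists_tameOn_ball_of_analyticAt (hg : AnalyticAt ℂ g 0) (n : ℕ) :
    ∃ ρ > 0, ∀ r ≤ ρ, TameOn (Metric.ball 0 r) n 0 g := by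
  obtain ⟨r, hr, hd⟩ := Metric.eventually_nhds_iff_ball.1 hg.eventually_analyticAt
  have hK : IsCompact (Metric.closedBall (0 : ℂ) (r / 2)) := isCompact_closedBall _ _
  have hsub : Metric.closedBall (0 : ℂ) (r / 2) ⊆ Metric.ball 0 r :=
    Metric.closedBall_subset_ball (by linarith)
  refine ⟨r / 2, by linarith, fun r' hr' => ⟨fun s hs => ?_, fun k _ => ?_⟩⟩
  · exact (hd s (hsub (Metric.ball_subset_closedBall
      (Metric.ball_subset_ball hr' hs)))).differentiableAt.differentiableWithinAt
  · have hc : ContinuousOn (iteratedDeriv k g) (Metric.closedBall (0 : ℂ) (r / 2)) := fun s hs =>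
      by
      rw [iteratedDeriv_eq_iterate]
      exact ((hd s (hsub hs)).iterated_deriv k).continuousAt.continuousWithinAt
    obtain ⟨C, hC⟩ := hK.exists_bound_of_continuousOn hc
    refine ⟨C, fun s hs => ?_⟩
    rw [Real.rpow_zero, mul_one]
    exact hC s (Metric.ball_subset_closedBall (Metric.ball_subset_ball hr' hs))

/-- Division by `s ^ β` on the strip: if the function vanishes to order `N` at `0`, its first
`N - β` derivatives stay bounded near `0`. -/
lemma TameOn.cpow_mul (hf : TameOn strip n A f) (hg : AnalyticAt ℂ g 0)
    (hfg : ∀ᶠ s in 𝓝[strip] 0, f s = g s) {N : ℕ} (hN : ∀ i < N, iteratedDeriv i g 0 = 0)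
    {β : ℝ} (hβ : n + β ≤ N) :
    TameOn strip n (A - β) (fun s => f s * s ^ ((-β : ℝ) : ℂ)) := by
  obtain ⟨V, hV, hgV⟩ := (natCast_le_analyticOrderAt hg).1
    ((natCast_le_analyticOrderAt_iff_iteratedDeriv_eq_zero hg).2 hN)
  obtain ⟨ρ₁, hρ₁, hVt⟩ := exists_tameOn_ball_of_analyticAt hV n
  obtain ⟨ρ₂, hρ₂, hgV'⟩ := Metric.eventually_nhds_iff_ball.1 hgV
  obtain ⟨ρ₃, hρ₃, hfg'⟩ := Metric.eventually_nhds_iff_ball.1 (eventually_nhdsWithin_iff.1 hfg)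
  set ρ := min ρ₁ (min ρ₂ ρ₃)
  have hρ : 0 < ρ := by positivity
  -- the strip is covered by a part away from `0` and a bounded part
  set Ω₁ : Set ℂ := strip ∩ {s | ρ / 2 < ‖s‖}
  set Ω₂ : Set ℂ := strip ∩ Metric.ball 0 ρ
  have ho1 : IsOpen Ω₁ := isOpen_strip.inter (isOpen_lt continuous_const continuous_norm)
  have ho2 : IsOpen Ω₂ := isOpen_strip.inter Metric.isOpen_ball
  have hsub : strip ⊆ Ω₁ ∪ Ω₂ := by
    intro s hs
    by_cases h : ρ / 2 < ‖s‖
    · exact Or.inl ⟨hs, h⟩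
    · refine Or.inr ⟨hs, ?_⟩
      rw [mem_ball_zero_iff]; linarith
  refine TameOn.mono_set (TameOn.union ?_ ?_ ho1 ho2) hsub
  · have h1 := tameOn_cpow_of_norm_gt ho1 (ρ := ρ / 2) (by positivity) (fun s hs => hs.1.1)
      (fun s hs => hs.2) n (-β)
    have := (hf.mono_set (Set.inter_subset_left : Ω₁ ⊆ strip)).mul ho1 h1
    rwa [← sub_eq_add_neg] at this
  · have hb : ∀ s ∈ Ω₂, ‖s‖ < ρ := fun s hs => mem_ball_zero_iff.1 hs.2
    have h1 := tameOn_cpow_of_norm_lt ho2 (fun s hs => hs.1.1) hb n (a := N - β) (by linarith)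
    have h2 := (hVt ρ (min_le_left _ _)).mono_set (Set.inter_subset_right : Ω₂ ⊆ _)
    -- near `0`, `f(s) s ^ (-β) = s ^ (N - β) V(s)` with `V` analytic and `N - β ≥ n`
    refine TameOn.of_bounded ((h1.mul ho2 h2).congr ho2 fun s hs => ?_) hb _
    have hs0 : s ≠ 0 := by
      rintro rfl
      simpa using hs.1.1
    have e1 : f s = g s := hfg' s (Metric.ball_subset_ball
      ((min_le_right _ _).trans (min_le_right _ _)) hs.2) hs.1
    have e2 := hgV' s (Metric.ball_subset_ball ((min_le_right _ _).trans (min_le_left _ _)) hs.2)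
    have e3 : s ^ (((N : ℝ) - β : ℝ) : ℂ) = s ^ N * s ^ ((-β : ℝ) : ℂ) := by
      rw [sub_eq_add_neg, Complex.ofReal_add, Complex.cpow_add _ _ hs0, Complex.ofReal_natCast,
        Complex.cpow_natCast]
    simp only [e1, e2, sub_zero, smul_eq_mul, e3]
    ring

/-- The Mellin transform of `√(-log x)`, which is supported on `0 < x < 1` because `√` vanishes on
the negative numbers. The substitution `x = e ^ (-t)` turns it into a Gamma integral. -/
lemma mellin_sqrt_neg_log_of_real {r : ℝ} (hr : 0 < r) :
    mellin (fun x : ℝ => ((Real.sqrt (-Real.log x) : ℝ) : ℂ)) r =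
      Complex.Gamma (3 / 2) * (r : ℂ) ^ ((-(3 / 2) : ℝ) : ℂ) := by
  -- as a Fourier integral the Mellin transform is an integral over `u = -log x`
  rw [mellin_eq_fourier, Real.fourier_eq']
  have e : ∀ u : ℝ, Complex.exp (↑(-2 * Real.pi * inner ℝ u ((r : ℂ).im / (2 * Real.pi))) *
      Complex.I) •
      (Real.exp (-(r : ℂ).re * u) • ((Real.sqrt (-Real.log (Real.exp (-u))) : ℝ) : ℂ)) =
      Set.indicator (Set.Ioi 0)
        (fun t : ℝ => (t : ℂ) ^ ((3 / 2 : ℂ) - 1) * Complex.exp (-(r * t))) u := by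
    intro u
    rw [Real.log_exp, neg_neg]
    by_cases hu : 0 < u
    · rw [Set.indicator_of_mem (by exact hu), Real.sqrt_eq_rpow, Complex.ofReal_cpow hu.le]
      have e1 : (((1 / 2 : ℝ)) : ℂ) = 3 / 2 - 1 := by push_cast; norm_num
      rw [e1, Complex.real_smul, smul_eq_mul, Complex.ofReal_exp, ← mul_assoc, ← Complex.exp_add,
        mul_comm]
      congr 2
      simp
    · rw [Set.indicator_of_notMem (by exact hu), Real.sqrt_eq_zero_of_nonpos (not_lt.1 hu)]
      simp
  rw [MeasureTheory.integral_congr_ae (Eventually.of_forall e),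
    MeasureTheory.integral_indicator measurableSet_Ioi,
    Complex.integral_cpow_mul_exp_neg_mul_Ioi (by norm_num) hr, mul_comm]
  congr 1
  have harg : (r : ℂ).arg ≠ Real.pi := by
    rw [Complex.arg_ofReal_of_nonneg hr.le]; exact Real.pi_ne_zero.symm
  rw [one_div, Complex.inv_cpow _ _ harg, ← Complex.cpow_neg]
  congr 1
  push_cast; norm_num

lemma continuousOn_sqrt_neg_log :
    ContinuousOn (fun x : ℝ => ((Real.sqrt (-Real.log x) : ℝ) : ℂ)) (Set.Ioi 0) :=
  Complex.continuous_ofReal.comp_continuousOn (Real.continuous_sqrt.comp_continuousOn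
    (Real.continuousOn_log.mono fun x (hx : 0 < x) => hx.ne').neg)

lemma sqrt_neg_log_isBigO_atTop (a : ℝ) :
    (fun x : ℝ => ((Real.sqrt (-Real.log x) : ℝ) : ℂ)) =O[atTop] fun x : ℝ => x ^ (-a) := by
  refine IsBigO.of_bound 1 ?_
  filter_upwards [eventually_gt_atTop 1] with x hx
  rw [Real.sqrt_eq_zero_of_nonpos (by linarith [Real.log_pos hx])]
  simp only [Complex.ofReal_zero, norm_zero]
  positivity

lemma sqrt_neg_log_isBigO_zero {c : ℝ} (hc : 0 < c) :
    (fun x : ℝ => ((Real.sqrt (-Real.log x) : ℝ) : ℂ)) =O[𝓝[>] 0] fun x : ℝ => x ^ (-(c / 2)) := by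
  have h1 : (fun x : ℝ => Real.log x) =o[𝓝[>] 0] fun x => x ^ (-c) :=
    isLittleO_log_rpow_nhdsGT_zero (by linarith)
  obtain ⟨C, hC⟩ := h1.isBigO.bound
  refine IsBigO.of_bound (Real.sqrt |C|) ?_
  filter_upwards [hC, self_mem_nhdsWithin] with x hx (hx0 : 0 < x)
  rw [Complex.norm_real, Real.norm_of_nonneg (Real.sqrt_nonneg _),
    Real.norm_of_nonneg (by positivity)]
  have e3 : x ^ (-(c / 2)) = Real.sqrt (x ^ (-c)) := by
    rw [Real.sqrt_eq_rpow, ← Real.rpow_mul hx0.le]; ring_nf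
  rw [e3, ← Real.sqrt_mul (abs_nonneg C)]
  refine Real.sqrt_le_sqrt ?_
  rw [Real.norm_of_nonneg (by positivity : 0 ≤ x ^ (-c))] at hx
  calc -Real.log x ≤ ‖Real.log x‖ := neg_le_abs _
    _ ≤ C * x ^ (-c) := hx
    _ ≤ |C| * x ^ (-c) := by gcongr; exact le_abs_self C

lemma isPreconnected_re_pos : IsPreconnected {s : ℂ | 0 < s.re} :=
  (convex_halfSpace_re_gt 0).isPreconnected

lemma isOpen_re_pos : IsOpen {s : ℂ | 0 < s.re} := isOpen_lt continuous_const Complex.continuous_re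

lemma tendsto_ofReal_nhdsGT (x : ℝ) :
    Tendsto (fun r : ℝ => (r : ℂ)) (𝓝[>] x) (𝓝[≠] (x : ℂ)) := by
  refine tendsto_nhdsWithin_iff.2 ⟨(Complex.continuous_ofReal.tendsto x).mono_left
    nhdsWithin_le_nhds, ?_⟩
  filter_upwards [self_mem_nhdsWithin] with r (hr : x < r)
  simpa using hr.ne'

/-- The formula of `mellin_sqrt_neg_log_of_real` on the half-plane, by the identity theorem. -/
lemma mellin_sqrt_neg_log {s : ℂ} (hs : 0 < s.re) :
    mellin (fun x : ℝ => ((Real.sqrt (-Real.log x) : ℝ) : ℂ)) s =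
      Complex.Gamma (3 / 2) * s ^ ((-(3 / 2) : ℝ) : ℂ) := by
  set F : ℝ → ℂ := fun x : ℝ => ((Real.sqrt (-Real.log x) : ℝ) : ℂ)
  have h1 : AnalyticOnNhd ℂ (mellin F) {s : ℂ | 0 < s.re} := by
    refine DifferentiableOn.analyticOnNhd (fun z (hz : 0 < z.re) => ?_) isOpen_re_pos
    exact (mellin_differentiableAt_of_isBigO_rpow
      (continuousOn_sqrt_neg_log.locallyIntegrableOn measurableSet_Ioi)
      (sqrt_neg_log_isBigO_atTop (z.re + 1)) (by linarith) (sqrt_neg_log_isBigO_zero hz)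
      (by linarith)).differentiableWithinAt
  have h2 : AnalyticOnNhd ℂ (fun s : ℂ => Complex.Gamma (3 / 2) * s ^ ((-(3 / 2) : ℝ) : ℂ))
      {s : ℂ | 0 < s.re} :=
    ((differentiableOn_cpow_const (fun s hs => hs) _).const_mul _).analyticOnNhd isOpen_re_pos
  refine h1.eqOn_of_preconnected_of_frequently_eq h2 isPreconnected_re_pos
    (z₀ := ((1 : ℝ) : ℂ)) (by simp) ?_ hs
  refine (tendsto_ofReal_nhdsGT 1).frequently (Eventually.frequently ?_)
  filter_upwards [self_mem_nhdsWithin] with r (hr : 1 < r)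
  exact mellin_sqrt_neg_log_of_real (by linarith)

lemma continuous_cpow_vline {c : ℝ} (hc : 0 < c) (a : ℝ) :
    Continuous (fun t => vline c t ^ (a : ℂ)) := by
  refine continuous_iff_continuousAt.2 fun t => ?_
  have h1 : vline c t ∈ Complex.slitPlane := Or.inl (by simpa using hc)
  exact (continuousAt_cpow_const h1).comp (f := vline c) (continuous_vline c).continuousAt

lemma integrable_cpow_vline {c : ℝ} (hc : 0 < c) :
    MeasureTheory.Integrable (fun t => vline c t ^ ((-(3 / 2) : ℝ) : ℂ)) := by
  refine integrable_of_vline_bound (C := (c / (1 + c)) ^ (-(3 / 2) : ℝ))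
    (continuous_cpow_vline hc _) fun t => ?_
  rw [Complex.norm_cpow_real, ← Real.mul_rpow (by positivity) (by positivity)]
  refine Real.rpow_le_rpow_of_nonpos (by positivity) ?_ (by norm_num)
  have h1 : |t| ≤ ‖vline c t‖ := by simpa using Complex.abs_im_le_norm (vline c t)
  have h2 : c ≤ ‖vline c t‖ := by
    have := Complex.abs_re_le_norm (vline c t)
    rw [vline_re, abs_of_pos hc] at this
    exact this
  rw [div_mul_eq_mul_div, div_le_iff₀ (by positivity), Real.norm_eq_abs]
  nlinarith

/-- The inverse Laplace transform of `s ^ (-3 / 2)`. It vanishes for `M ≤ 0`, in agreement with the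
convention `√M = 0`. -/
lemma integral_cpow_mul_exp {c : ℝ} (hc : 0 < c) (M : ℝ) :
    ∫ t : ℝ, vline c t ^ ((-(3 / 2) : ℝ) : ℂ) * Complex.exp (M * vline c t) =
      2 * Real.pi * (Real.sqrt M : ℝ) / Complex.Gamma (3 / 2) := by
  have hG : Complex.Gamma (3 / 2) ≠ 0 := Complex.Gamma_ne_zero_of_re_pos (by norm_num)
  set F : ℝ → ℂ := fun x : ℝ => ((Real.sqrt (-Real.log x) : ℝ) : ℂ)
  have hcont : ContinuousOn F (Set.Ioi 0) := continuousOn_sqrt_neg_log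
  have hm : ∀ t : ℝ, mellin F (c + t * Complex.I) =
      Complex.Gamma (3 / 2) * vline c t ^ ((-(3 / 2) : ℝ) : ℂ) := fun t =>
    mellin_sqrt_neg_log (s := vline c t) (by simpa using hc)
  have key := mellinInv_mellin_eq c F (x := Real.exp (-M)) (Real.exp_pos _) ?_ ?_ ?_
  · simp only [mellinInv, hm] at key
    have e1 : ∀ y : ℝ, ((Real.exp (-M) : ℝ) : ℂ) ^ (-((c : ℂ) + y * Complex.I)) •
        (Complex.Gamma (3 / 2) * vline c y ^ ((-(3 / 2) : ℝ) : ℂ)) =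
        Complex.Gamma (3 / 2) *
          (vline c y ^ ((-(3 / 2) : ℝ) : ℂ) * Complex.exp (M * vline c y)) := by
      intro y
      rw [Complex.cpow_def_of_ne_zero (by simp), ← Complex.ofReal_log (Real.exp_pos _).le,
        Real.log_exp, smul_eq_mul]
      have : ((-M : ℝ) : ℂ) * -((c : ℂ) + y * Complex.I) = M * vline c y := by
        unfold vline; push_cast; ring
      rw [this]; ring
    rw [MeasureTheory.integral_congr_ae (Eventually.of_forall e1),
      MeasureTheory.integral_const_mul] at key
    have e2 : F (Real.exp (-M)) = ((Real.sqrt M : ℝ) : ℂ) := by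
      simp only [F]; rw [Real.log_exp, neg_neg]
    rw [e2, Complex.real_smul] at key
    rw [← key]
    have hpi : (Real.pi : ℂ) ≠ 0 := by exact_mod_cast Real.pi_ne_zero
    push_cast
    field_simp
  · exact mellinConvergent_of_isBigO_rpow (a := c + 1) (b := c / 2)
      (hcont.locallyIntegrableOn measurableSet_Ioi) (sqrt_neg_log_isBigO_atTop _) (by simp)
      (sqrt_neg_log_isBigO_zero hc) (by simp; linarith)
  · have := (integrable_cpow_vline hc).const_mul (Complex.Gamma (3 / 2))
    refine this.congr (Eventually.of_forall fun t => ?_)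
    exact (hm t).symm
  · exact hcont.continuousAt (Ioi_mem_nhds (Real.exp_pos _))

/-! ### Watson's lemma for a singularity of order three halves -/

/-- There are coefficients for which `∑ α_k e ^ (-k s)` has prescribed derivatives of order less
than `N` at `0`. -/
lemma exists_vandermonde_solution (N : ℕ) (b : ℕ → ℂ) :
    ∃ α : Fin N → ℂ, ∀ i < N, ∑ k : Fin N, α k * (-((k : ℕ) : ℂ)) ^ i = b i := by
  set v : Fin N → ℂ := fun k => -((k : ℕ) : ℂ)
  have hv : Function.Injective v := fun a c h => by
    have : ((a : ℕ) : ℂ) = ((c : ℕ) : ℂ) := neg_injective h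
    exact Fin.ext (by exact_mod_cast this)
  have hu : IsUnit (Matrix.vandermonde v).transpose := by
    rw [Matrix.isUnit_transpose, Matrix.isUnit_iff_isUnit_det]
    exact (Matrix.det_vandermonde_ne_zero_iff.2 hv).isUnit
  obtain ⟨α, hα⟩ := (Matrix.mulVec_surjective_iff_isUnit.2 hu) (fun i : Fin N => b i)
  refine ⟨α, fun i hi => ?_⟩
  have := congrFun hα ⟨i, hi⟩
  simp only [Matrix.mulVec, dotProduct, Matrix.transpose_apply, Matrix.vandermonde_apply] at this
  rw [← this]
  exact Finset.sum_congr rfl fun k _ => mul_comm _ _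

lemma tameOn_exp_neg_mul (k : ℝ) (hk : 0 ≤ k) (n : ℕ) :
    TameOn strip n 0 (fun s => Complex.exp (-k * s)) := by
  refine tameOn_of_bound (Ω' := {s : ℂ | -1 < s.re}) (r := 1 / 2) (C := Real.exp k) (by norm_num)
    (by norm_num) ?_ ?_ ?_ n
  · exact (Complex.differentiable_exp.comp (differentiable_id.const_mul _)).differentiableOn
  · intro s hs z hz
    have h1 := Complex.abs_re_le_norm (z - s)
    rw [mem_closedBall_iff_norm] at hz
    have h2 := abs_le.1 (h1.trans hz)
    have := hs.1
    simp only [Complex.sub_re, Set.mem_ofPred_eq] at h2 ⊢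
    linarith
  · intro s hs
    have hs' : -1 < s.re := hs
    rw [Complex.norm_exp, Real.rpow_zero, mul_one, Real.exp_le_exp]
    simp only [Complex.mul_re, Complex.neg_re, Complex.ofReal_re, Complex.neg_im,
      Complex.ofReal_im, neg_zero, zero_mul, sub_zero]
    nlinarith

lemma iteratedDeriv_exp_neg_mul_zero (k : ℂ) (i : ℕ) :
    iteratedDeriv i (fun s : ℂ => Complex.exp (k * s)) 0 = k ^ i := by
  rw [iteratedDeriv_cexp_const_mul]
  simp

/-- The binomial coefficients of `(1 + x) ^ (1 / 2)` in terms of the Gamma function. Since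
`3 / 2 - j` is never a pole, no junk value is involved. -/
lemma factorial_mul_choose_half_div_Gamma (j : ℕ) :
    ((j.factorial : ℂ) * ((Ring.choose (1 / 2 : ℝ) j : ℝ) : ℂ)) / Complex.Gamma (3 / 2) =
      1 / Complex.Gamma (3 / 2 - j) := by
  have hrec : ∀ j : ℕ, ((j + 1).factorial : ℝ) * Ring.choose (1 / 2 : ℝ) (j + 1) =
      (j.factorial : ℝ) * Ring.choose (1 / 2 : ℝ) j * (1 / 2 - j) := by
    intro j
    have h1 := Ring.descPochhammer_eq_factorial_smul_choose (1 / 2 : ℝ) j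
    have h2 := Ring.descPochhammer_eq_factorial_smul_choose (1 / 2 : ℝ) (j + 1)
    rw [nsmul_eq_mul] at h1 h2
    rw [← h1, ← h2, descPochhammer_succ_right, Polynomial.smeval_mul, Polynomial.smeval_sub,
      Polynomial.smeval_X, Polynomial.smeval_natCast]
    simp
  induction j with
  | zero => simp
  | succ j ih =>
    have h := hrec j
    have hC : (((j + 1).factorial : ℂ) * ((Ring.choose (1 / 2 : ℝ) (j + 1) : ℝ) : ℂ)) =
        ((j.factorial : ℂ) * ((Ring.choose (1 / 2 : ℝ) j : ℝ) : ℂ)) * (1 / 2 - j) := by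
      have h' := congrArg (fun x : ℝ => (x : ℂ)) h
      simpa only [Complex.ofReal_mul, Complex.ofReal_sub, Complex.ofReal_natCast,
        Complex.ofReal_div,
        Complex.ofReal_one, Complex.ofReal_ofNat] using h'
    have hne : (1 / 2 - j : ℂ) ≠ 0 := by
      intro hc
      have h3 : ((1 : ℕ) : ℂ) = ((2 * j : ℕ) : ℂ) := by
        push_cast; linear_combination 2 * hc
      have : 1 = 2 * j := by exact_mod_cast h3
      omega
    have hG := Complex.Gamma_add_one (1 / 2 - j : ℂ) hne
    rw [show (1 / 2 - j + 1 : ℂ) = 3 / 2 - j by ring] at hG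
    rw [hC, mul_div_right_comm, ih, hG,
      show (3 / 2 - ((j + 1 : ℕ) : ℂ)) = 1 / 2 - j by push_cast; ring, div_mul_eq_mul_div, one_mul,
      div_mul_cancel_left₀ hne]
    simp

/-- The expansion of `√(L - k)` in descending powers of `L`. -/
lemma sqrt_sub_isBigO (k : ℝ) (J : ℕ) :
    (fun L : ℝ => Real.sqrt (L - k) -
      ∑ j ∈ Finset.range (J + 1), Ring.choose (1 / 2 : ℝ) j * (-k) ^ j * L ^ ((1 : ℝ) / 2 - j))
      =O[atTop] fun L => L ^ (-(1 : ℝ) / 2 - J) := by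
  have h := (Real.one_add_rpow_hasFPowerSeriesAt_zero (a :=
      1 / 2)).isBigO_sub_partialSum_pow (J + 1)
  have ht : Tendsto (fun L : ℝ => -k * L⁻¹) atTop (𝓝 0) := by
    simpa using tendsto_inv_atTop_zero.const_mul (-k)
  have h1 := h.comp_tendsto ht
  have h2 := (isBigO_refl (fun L : ℝ => L ^ (1 / 2 : ℝ)) atTop).mul h1
  have h3 : (fun L : ℝ => L ^ (1 / 2 : ℝ) * ((fun y => ‖y‖ ^ (J + 1)) ∘ fun L : ℝ => -k * L⁻¹) L)
      =O[atTop] fun L => L ^ (-(1 : ℝ) / 2 - J) := by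
    refine IsBigO.of_bound (|k| ^ (J + 1)) ?_
    filter_upwards [eventually_gt_atTop 0] with L hL
    have : L ^ (-(1 : ℝ) / 2 - J) = L ^ (1 / 2 : ℝ) * L⁻¹ ^ (J + 1) := by
      rw [inv_pow, ← Real.rpow_natCast, ← Real.rpow_neg hL.le, ← Real.rpow_add hL]
      congr 1; push_cast; ring
    rw [this]
    simp only [Function.comp, norm_mul, norm_neg, norm_pow, abs_of_pos (Real.rpow_pos_of_pos hL _),
      Real.norm_eq_abs, mul_pow,
      abs_of_pos (inv_pos.2 hL), abs_abs]
    apply le_of_eq; ring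
  refine (h2.trans h3).congr' ?_ EventuallyEq.rfl
  filter_upwards [eventually_gt_atTop 0, eventually_gt_atTop k] with L hL hLk
  simp only [Function.comp, zero_add, FormalMultilinearSeries.partialSum, binomialSeries_apply]
  rw [mul_sub, ← Real.mul_rpow hL.le (by
    have : k / L < 1 := (div_lt_one hL).2 hLk
    rw [div_eq_mul_inv] at this
    linarith), Real.sqrt_eq_rpow, Finset.mul_sum]
  congr 1
  · congr 1; field_simp; ring
  · refine Finset.sum_congr rfl fun j _ => ?_
    simp only [List.ofFn_const, List.prod_replicate, smul_eq_mul]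
    have : L ^ ((1 : ℝ) / 2 - j) = L ^ (1 / 2 : ℝ) * L⁻¹ ^ j := by
      rw [inv_pow, ← Real.rpow_natCast, ← Real.rpow_neg hL.le, ← Real.rpow_add hL]
      congr 1
    rw [this, mul_pow]; ring

/-- **Watson's lemma** for a singularity `s ^ (-3 / 2)`. If `R` is tame on the strip and agrees near
`0` with an analytic function `g`, the inverse Laplace transform of `R(s) s ^ (-3 / 2)` has an
asymptotic expansion with coefficients read off from the Taylor series of `g`. Subtracting
`∑ α_k e ^ (-k s)` with the same Taylor polynomial leaves a function that is smooth up to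
`Re s = 0`. -/
lemma inverseLaplace_three_halves (hR : ∀ n, TameOn strip n 0 R) (hg : AnalyticAt ℂ g 0)
    (hRg : ∀ᶠ s in 𝓝[strip] 0, R s = g s) (J : ℕ) :
    (fun L : ℝ => (1 / (2 * Real.pi) : ℂ) * (∫ t : ℝ, (R (vline (1 / L) t) *
        vline (1 / L) t ^ ((-(3 / 2) : ℝ) : ℂ)) * Complex.exp (L * vline (1 / L) t)) -
      ∑ j ∈ Finset.range (J + 1), (iteratedDeriv j g 0 / (j.factorial : ℂ)) /
        Complex.Gamma (3 / 2 - (j : ℂ)) * ((L ^ ((1 : ℝ) / 2 - j) : ℝ) : ℂ))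
      =O[atTop] fun L => L ^ (-(1 : ℝ) / 2 - J) := by
  -- `J + 1` derivatives of `(R - P)(s) s ^ (-3 / 2)` have to stay bounded, and `J + 1 + 3 / 2 ≤ N`
  set N := J + 3
  obtain ⟨α, hα⟩ := exists_vandermonde_solution N (fun i => iteratedDeriv i g 0)
  set P : ℂ → ℂ := fun s => ∑ k : Fin N, α k * Complex.exp (-((k : ℕ) : ℝ) * s)
  have hPt : ∀ n, TameOn strip n 0 P := fun n => TameOn.sum isOpen_strip _ le_rfl fun k _ =>
    (tameOn_exp_neg_mul _ (Nat.cast_nonneg _) n).const_mul isOpen_strip _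
  have hexp : ∀ k : ℂ, AnalyticAt ℂ (fun s => Complex.exp (k * s)) 0 := fun k =>
    (analyticAt_const.mul analyticAt_id).cexp
  have hPa : AnalyticAt ℂ P 0 := by
    refine Finset.analyticAt_fun_sum _ fun k _ => analyticAt_const.mul (hexp _)
  have hPd : ∀ i < N, iteratedDeriv i (fun s => g s - P s) 0 = 0 := by
    intro i hi
    rw [iteratedDeriv_fun_sub hg.contDiffAt hPa.contDiffAt, sub_eq_zero, ← hα i hi]
    simp only [P]
    have hcd : ∀ k ∈ (Finset.univ : Finset (Fin N)), ContDiffAt ℂ i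
        (fun s : ℂ => α k * Complex.exp (-((k : ℕ) : ℝ) * s)) 0 := fun k _ =>
      (analyticAt_const.mul (hexp _)).contDiffAt
    rw [iteratedDeriv_fun_sum hcd]
    refine Finset.sum_congr rfl fun k _ => ?_
    rw [iteratedDeriv_const_mul_field, iteratedDeriv_exp_neg_mul_zero]
    push_cast; rfl
  have hU : TameOn strip (J + 1) (-(3 / 2))
      (fun s => (R s - P s) * s ^ ((-(3 / 2) : ℝ) : ℂ)) := by
    have := ((hR (J + 1)).sub isOpen_strip (hPt (J + 1))).cpow_mul (hg.sub hPa)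
      (by filter_upwards [hRg] with s hs; rw [hs]; rfl) hPd (β := 3 / 2)
      (by simp only [N]; push_cast; linarith)
    simpa using this
  have hmain := hU.integral_isBigO.const_mul_left (1 / (2 * Real.pi) : ℂ)
  have hpow : (fun L : ℝ => L ^ (-((J + 1 : ℕ) : ℝ))) =O[atTop]
      fun L : ℝ => L ^ (-(1 : ℝ) / 2 - J) := by
    refine IsBigO.of_bound 1 ?_
    filter_upwards [eventually_ge_atTop 1] with L hL
    rw [one_mul, Real.norm_of_nonneg (by positivity), Real.norm_of_nonneg (by positivity)]
    exact Real.rpow_le_rpow_of_exponent_le hL (by push_cast; linarith)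
  have hmain' := hmain.trans hpow
  -- the exponentials contribute multiples of `√(L - k)`, which are expanded in powers of `L`
  have hsq : ∀ k : Fin N, (fun L : ℝ => α k / Complex.Gamma (3 / 2) *
      ((Real.sqrt (L - (k : ℕ)) - ∑ j ∈ Finset.range (J + 1), Ring.choose (1 / 2 : ℝ) j *
        (-((k : ℕ) : ℝ)) ^ j * L ^ ((1 : ℝ) / 2 - j) : ℝ) : ℂ)) =O[atTop]
      fun L => L ^ (-(1 : ℝ) / 2 - J) := fun k => by
    refine IsBigO.const_mul_left ?_ _
    exact IsBigO.of_norm_left (by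
      simpa only [Complex.norm_real] using (sqrt_sub_isBigO ((k : ℕ) : ℝ) J).norm_left)
  have hsum := IsBigO.sum (s := Finset.univ) fun k _ => hsq k
  refine (hmain'.add hsum).congr' ?_ EventuallyEq.rfl
  filter_upwards [eventually_gt_atTop 3] with L hL
  have hc : 0 < 1 / L := by positivity
  have hc2 : 1 / L < 1 / 2 := by
    rw [div_lt_div_iff₀ (by linarith) two_pos]; linarith
  set c := 1 / L
  have hint := hU.integrable_vline L hc hc2
  have hk : ∀ k : Fin N, ∀ t, (α k * Complex.exp (-((k : ℕ) : ℝ) * vline c t)) *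
      vline c t ^ ((-(3 / 2) : ℝ) : ℂ) * Complex.exp (L * vline c t) =
      α k * (vline c t ^ ((-(3 / 2) : ℝ) : ℂ) *
        Complex.exp (((L - (k : ℕ) : ℝ) : ℂ) * vline c t)) := by
    intro k t
    have : ((L - (k : ℕ) : ℝ) : ℂ) * vline c t =
        -((k : ℕ) : ℝ) * vline c t + L * vline c t := by push_cast; ring
    rw [this, Complex.exp_add]; ring
  have hki : ∀ k : Fin N, MeasureTheory.Integrable (fun t => α k *
      (vline c t ^ ((-(3 / 2) : ℝ) : ℂ) * Complex.exp (((L - (k : ℕ) : ℝ) : ℂ) * vline c t))) := by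
    intro k
    refine (MeasureTheory.Integrable.mul_bdd (c := Real.exp ((L - (k : ℕ)) * c))
      (integrable_cpow_vline hc) ?_ (Eventually.of_forall fun t => ?_)).const_mul (α k)
    · exact (Complex.continuous_exp.comp
        (continuous_const.mul (continuous_vline c))).aestronglyMeasurable
    · exact (norm_exp_mul_vline _ _ _).le
  have e1 : ∫ t : ℝ, (R (vline c t) * vline c t ^ ((-(3 / 2) : ℝ) : ℂ)) *
      Complex.exp (L * vline c t) =
      (∫ t : ℝ, ((R (vline c t) - P (vline c t)) * vline c t ^ ((-(3 / 2) : ℝ) : ℂ)) *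
        Complex.exp (L * vline c t)) + ∑ k : Fin N, α k *
        (2 * Real.pi * (Real.sqrt (L - (k : ℕ)) : ℝ) / Complex.Gamma (3 / 2)) := by
    simp only [← integral_cpow_mul_exp hc, ← MeasureTheory.integral_const_mul]
    rw [← MeasureTheory.integral_finsetSum _ (fun k _ => hki k),
      ← MeasureTheory.integral_add hint (MeasureTheory.integrable_finsetSum _ fun k _ => hki k)]
    congr 1
    ext t
    simp only [← hk, ← Finset.sum_mul]
    simp only [P]
    ring
  rw [e1, mul_add, add_sub_assoc]
  congr 1
  have hpi : (Real.pi : ℂ) ≠ 0 := by exact_mod_cast Real.pi_ne_zero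
  have e2 : ∀ k : Fin N, (1 / (2 * Real.pi) : ℂ) * (α k *
      (2 * Real.pi * (Real.sqrt (L - (k : ℕ)) : ℝ) / Complex.Gamma (3 / 2))) =
      α k / Complex.Gamma (3 / 2) * (Real.sqrt (L - (k : ℕ)) : ℝ) := by
    intro k; field_simp
  -- for `j < N` the moments `∑ α_k (-k) ^ j` are the derivatives of `g` at `0`
  have e3 : ∀ j ∈ Finset.range (J + 1), (iteratedDeriv j g 0 / (j.factorial : ℂ)) /
      Complex.Gamma (3 / 2 - (j : ℂ)) * ((L ^ ((1 : ℝ) / 2 - j) : ℝ) : ℂ) =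
      ∑ k : Fin N, α k / Complex.Gamma (3 / 2) * ((Ring.choose (1 / 2 : ℝ) j *
        (-((k : ℕ) : ℝ)) ^ j * L ^ ((1 : ℝ) / 2 - j) : ℝ) : ℂ) := by
    intro j hj
    have hjN : j < N := by simp only [Finset.mem_range] at hj; omega
    have hfac : (j.factorial : ℂ) ≠ 0 := by exact_mod_cast j.factorial_ne_zero
    have h5 := factorial_mul_choose_half_div_Gamma j
    rw [div_eq_mul_one_div (iteratedDeriv j g 0 / (j.factorial : ℂ)), ← h5, ← hα j hjN,
      Finset.sum_div, Finset.sum_mul, Finset.sum_mul]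
    refine Finset.sum_congr rfl fun k _ => ?_
    push_cast
    field_simp
  rw [Finset.mul_sum, Finset.sum_congr rfl e3, Finset.sum_comm, ← Finset.sum_sub_distrib,
    Finset.sum_apply]
  refine Finset.sum_congr rfl fun k _ => ?_
  rw [e2, ← Finset.mul_sum, ← mul_sub]
  push_cast
  rfl

/-! ### Growth of holomorphic functions and the gamma function -/

/-- `f = O((1 + |s|) ^ A)` on `S`. -/
def GrowthOn (S : Set ℂ) (A : ℝ) (f : ℂ → ℂ) : Prop :=
  ∃ C : ℝ, ∀ s ∈ S, ‖f s‖ ≤ C * (1 + ‖s‖) ^ A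

lemma GrowthOn.exists_nonneg (hf : GrowthOn S A f) :
    ∃ C : ℝ, 0 ≤ C ∧ ∀ s ∈ S, ‖f s‖ ≤ C * (1 + ‖s‖) ^ A := by
  obtain ⟨C, hC⟩ := hf
  refine ⟨|C|, abs_nonneg C, fun s hs => (hC s hs).trans ?_⟩
  gcongr
  exact le_abs_self C

lemma GrowthOn.mono_exponent (hf : GrowthOn S A f) (h : A ≤ B) : GrowthOn S B f := by
  obtain ⟨C, hC0, hC⟩ := hf.exists_nonneg
  refine ⟨C, fun s hs => (hC s hs).trans ?_⟩
  gcongr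
  linarith [norm_nonneg s]

lemma GrowthOn.mono_set (hf : GrowthOn S A f) {T : Set ℂ} (h : T ⊆ S) : GrowthOn T A f :=
  let ⟨C, hC⟩ := hf; ⟨C, fun s hs => hC s (h hs)⟩

lemma GrowthOn.mul (hf : GrowthOn S A f) (hg : GrowthOn S B g) :
    GrowthOn S (A + B) (fun s => f s * g s) := by
  obtain ⟨C, hC0, hC⟩ := hf.exists_nonneg
  obtain ⟨D, hD0, hD⟩ := hg.exists_nonneg
  refine ⟨C * D, fun s hs => ?_⟩
  rw [norm_mul, Real.rpow_add (one_add_norm_pos s)]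
  calc ‖f s‖ * ‖g s‖ ≤ (C * (1 + ‖s‖) ^ A) * (D * (1 + ‖s‖) ^ B) := by
        gcongr
        · exact hC s hs
        · exact hD s hs
    _ = _ := by ring

lemma GrowthOn.add (hf : GrowthOn S A f) (hg : GrowthOn S A g) :
    GrowthOn S A (fun s => f s + g s) := by
  obtain ⟨C, hC⟩ := hf
  obtain ⟨D, hD⟩ := hg
  exact ⟨C + D, fun s hs => (norm_add_le _ _).trans (by rw [add_mul]; exact add_le_add (hC s hs) (hD s hs))⟩

lemma GrowthOn.congr (hf : GrowthOn S A f) (h : Set.EqOn g f S) : GrowthOn S A g :=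
  let ⟨C, hC⟩ := hf; ⟨C, fun s hs => by rw [h hs]; exact hC s hs⟩

lemma growthOn_const (c : ℂ) : GrowthOn S 0 (fun _ => c) := ⟨‖c‖, fun s _ => by simp⟩

lemma GrowthOn.const_mul (c : ℂ) (hf : GrowthOn S A f) : GrowthOn S A (fun s => c * f s) := by
  simpa using (growthOn_const (S := S) c).mul hf

lemma GrowthOn.sum {ι : Type*} (T : Finset ι) {F : ι → ℂ → ℂ} (h : ∀ i ∈ T, GrowthOn S A (F i)) :
    GrowthOn S A (fun s => ∑ i ∈ T, F i s) := by
  classical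
  induction T using Finset.induction_on with
  | empty => exact ⟨0, fun s _ => by simp⟩
  | insert a T ha ih =>
    simp only [Finset.sum_insert ha]
    exact (h a (Finset.mem_insert_self _ _)).add (ih fun i hi => h i (Finset.mem_insert_of_mem hi))

lemma growthOn_add_const (c : ℂ) : GrowthOn S 1 (fun s => s + c) := by
  refine ⟨1 + ‖c‖, fun s _ => (norm_add_le _ _).trans ?_⟩
  rw [Real.rpow_one]
  nlinarith [norm_nonneg s, norm_nonneg c]

/-- An exponential is bounded on a vertical strip. -/
lemma growthOn_const_cpow {c a b : ℝ} (hc : 0 < c) (h : ∀ s ∈ S, a ≤ s.re ∧ s.re ≤ b) :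
    GrowthOn S 0 (fun s => (c : ℂ) ^ s) := by
  refine ⟨max (c ^ a) (c ^ b), fun s hs => ?_⟩
  rw [Complex.norm_cpow_eq_rpow_re_of_pos hc, Real.rpow_zero, mul_one]
  rcases le_total 1 c with h1 | h1
  · exact (Real.rpow_le_rpow_of_exponent_le h1 (h s hs).2).trans (le_max_right _ _)
  · exact (Real.rpow_le_rpow_of_exponent_ge hc h1 (h s hs).1).trans (le_max_left _ _)

/-- The bound `|Γ(s)| ≤ Γ(Re s)` is applied at `s + m`, and carried back to `s` by the functional
equation, which gains a factor `|s|` in each step. -/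
lemma norm_Gamma_mul_pow_le {a b : ℝ} (ha : 0 < a) (m : ℕ) :
    ∃ C : ℝ, ∀ s : ℂ, a ≤ s.re → s.re ≤ b → ‖Complex.Gamma s‖ * ‖s‖ ^ m ≤ C := by
  induction m generalizing a b with
  | zero =>
    have hc : ContinuousOn Real.Gamma (Set.Icc a b) := fun x hx =>
      (Real.differentiableAt_Gamma fun k => by
        have : 0 < x := ha.trans_le hx.1
        have := Nat.cast_nonneg (α := ℝ) k
        linarith).continuousAt.continuousWithinAt
    obtain ⟨C, hC⟩ := isCompact_Icc.exists_bound_of_continuousOn hc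
    refine ⟨C, fun s h1 h2 => ?_⟩
    rw [pow_zero, mul_one]
    refine le_trans ?_ ((le_abs_self _).trans (hC s.re ⟨h1, h2⟩))
    have hs : 0 < s.re := ha.trans_le h1
    rw [Complex.Gamma_eq_integral hs, Real.Gamma_eq_integral hs, Complex.GammaIntegral]
    refine (MeasureTheory.norm_integral_le_integral_norm _).trans (le_of_eq ?_)
    refine MeasureTheory.setIntegral_congr_fun measurableSet_Ioi fun x hx => ?_
    have hx : 0 < x := hx
    simp only [norm_mul, Complex.norm_real, Real.norm_eq_abs, Real.abs_exp]
    rw [Complex.norm_cpow_eq_rpow_re_of_pos hx]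
    simp
  | succ m ih =>
    obtain ⟨C, hC⟩ := ih (a := a + 1) (b := b + 1) (by linarith)
    refine ⟨C, fun s h1 h2 => ?_⟩
    have hs0 : s ≠ 0 := by
      rintro rfl
      simp at h1; linarith
    -- this uses `Re s > 0`
    have hn : ‖s‖ ≤ ‖s + 1‖ := by
      rw [Complex.norm_def, Complex.norm_def]
      refine Real.sqrt_le_sqrt ?_
      simp only [Complex.normSq_apply, Complex.add_re, Complex.one_re, Complex.add_im,
        Complex.one_im, add_zero]
      nlinarith
    have := hC (s + 1) (by simpa using h1) (by simpa using h2)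
    rw [Complex.Gamma_add_one s hs0, norm_mul] at this
    refine le_trans ?_ this
    rw [pow_succ]
    calc ‖Complex.Gamma s‖ * (‖s‖ ^ m * ‖s‖) = ‖s‖ * ‖Complex.Gamma s‖ * ‖s‖ ^ m := by ring
      _ ≤ _ := by gcongr

/-- The Gamma function decays faster than any power on vertical strips to the right of `0`. -/
lemma growthOn_Gamma {a b : ℝ} (ha : 0 < a) (h : ∀ s ∈ S, a ≤ s.re ∧ s.re ≤ b) (A : ℝ) :
    GrowthOn S A Complex.Gamma := by
  obtain ⟨m, hm⟩ := exists_nat_ge (-A)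
  obtain ⟨C, hC⟩ := norm_Gamma_mul_pow_le (b := b) ha m
  refine GrowthOn.mono_exponent (A := -m) ⟨C * (1 + 1 / a) ^ m, fun s hs => ?_⟩ (by linarith)
  have h1 := hC s (h s hs).1 (h s hs).2
  have hs := one_add_norm_pos s
  have h2 : 1 + ‖s‖ ≤ (1 + 1 / a) * ‖s‖ := by
    have : a ≤ ‖s‖ := (h s ‹_›).1.trans (Complex.re_le_norm s)
    have : 1 ≤ 1 / a * ‖s‖ := by rw [div_mul_eq_mul_div, one_mul]; exact (one_le_div ha).2 this
    linarith
  rw [Real.rpow_neg hs.le, Real.rpow_natCast, ← div_eq_mul_inv, le_div_iff₀ (by positivity)]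
  calc ‖Complex.Gamma s‖ * (1 + ‖s‖) ^ m ≤ ‖Complex.Gamma s‖ * ((1 + 1 / a) * ‖s‖) ^ m := by gcongr
    _ = (‖Complex.Gamma s‖ * ‖s‖ ^ m) * (1 + 1 / a) ^ m := by rw [mul_pow]; ring
    _ ≤ _ := by gcongr

lemma differentiableOn_Gamma_re_pos : DifferentiableOn ℂ Complex.Gamma {s | 0 < s.re} := fun s hs =>
  (Complex.differentiableAt_Gamma s fun k hk => by
    have hs : 0 < s.re := hs
    rw [hk] at hs
    simp at hs
    have := Nat.cast_nonneg (α := ℝ) k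
    linarith).differentiableWithinAt

/-- Cauchy's estimates with discs of radius `1 / 4`, which lie in the closed strip
`-1 / 4 ≤ Re s ≤ 3 / 4` if their centre lies in `strip`. -/
lemma tameOn_strip_of_growthOn (hd : DifferentiableOn ℂ f {s | -(1 / 4) ≤ s.re ∧ s.re ≤ 3 / 4})
    (hf : GrowthOn {s | -(1 / 4) ≤ s.re ∧ s.re ≤ 3 / 4} A f) (n : ℕ) : TameOn strip n A f := by
  obtain ⟨C, hC⟩ := hf
  refine tameOn_of_bound (r := 1 / 4) (by norm_num) (by norm_num) hd (fun s hs z hz => ?_) hC n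
  have h1 := Complex.abs_re_le_norm (z - s)
  rw [mem_closedBall_iff_norm] at hz
  have h2 := abs_le.1 (h1.trans hz)
  obtain ⟨h3, h4⟩ : 0 < s.re ∧ s.re < 1 / 2 := hs
  simp only [Complex.sub_re] at h2
  exact ⟨by linarith, by linarith⟩

lemma rapidOn_Gamma_add_one : RapidOn strip (fun s => Complex.Gamma (s + 1)) := fun n A => by
  refine tameOn_strip_of_growthOn ?_ ?_ n
  · refine differentiableOn_Gamma_re_pos.comp (by fun_prop) fun s hs => ?_
    have := hs.1
    simp only [Set.mem_ofPred_eq, Complex.add_re, Complex.one_re]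
    linarith
  · obtain ⟨C, hC0, hC⟩ := (growthOn_Gamma (S := {s : ℂ | 3 / 4 ≤ s.re ∧ s.re ≤ 7 / 4}) (a := 3 / 4)
      (by norm_num) (fun s hs => hs) A).exists_nonneg
    refine ⟨C * 2 ^ |A|, fun s hs => (hC (s + 1) ?_).trans ?_⟩
    · have h1 : -(1 / 4) ≤ s.re ∧ s.re ≤ 3 / 4 := hs
      simp only [Set.mem_ofPred_eq, Complex.add_re, Complex.one_re]
      constructor <;> linarith
    · rw [mul_assoc]
      gcongr
      exact rpow_one_add_norm_le (by simp) A

/-- Division by `s` on the strip of a function that vanishes at `0`. Unlike `TameOn.cpow_mul`, it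
asks only for a simple zero, whatever the number of derivatives. -/
lemma TameOn.div_id (hf : TameOn strip n A f) (hg : AnalyticAt ℂ g 0)
    (hfg : ∀ᶠ s in 𝓝[strip] 0, f s = g s) (h0 : g 0 = 0) :
    TameOn strip n (A - 1) (fun s => f s / s) := by
  obtain ⟨V, hV, hgV⟩ := (natCast_le_analyticOrderAt hg).1
    ((natCast_le_analyticOrderAt_iff_iteratedDeriv_eq_zero hg (n := 1)).2
      (fun i hi => by obtain rfl : i = 0 := by omega
                      simpa using h0))
  obtain ⟨ρ₁, hρ₁, hVt⟩ := exists_tameOn_ball_of_analyticAt hV n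
  obtain ⟨ρ₂, hρ₂, hgV'⟩ := Metric.eventually_nhds_iff_ball.1 hgV
  obtain ⟨ρ₃, hρ₃, hfg'⟩ := Metric.eventually_nhds_iff_ball.1 (eventually_nhdsWithin_iff.1 hfg)
  set ρ := min ρ₁ (min ρ₂ ρ₃)
  have hρ : 0 < ρ := by positivity
  set Ω₁ : Set ℂ := strip ∩ {s | ρ / 2 < ‖s‖}
  set Ω₂ : Set ℂ := strip ∩ Metric.ball 0 ρ
  have ho1 : IsOpen Ω₁ := isOpen_strip.inter (isOpen_lt continuous_const continuous_norm)
  have ho2 : IsOpen Ω₂ := isOpen_strip.inter Metric.isOpen_ball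
  have hsub : strip ⊆ Ω₁ ∪ Ω₂ := by
    intro s hs
    by_cases h : ρ / 2 < ‖s‖
    · exact Or.inl ⟨hs, h⟩
    · refine Or.inr ⟨hs, ?_⟩
      rw [mem_ball_zero_iff]; linarith
  refine TameOn.mono_set (TameOn.union ?_ ?_ ho1 ho2) hsub
  · have h1 := tameOn_cpow_of_norm_gt ho1 (ρ := ρ / 2) (by positivity) (fun s hs => hs.1.1)
      (fun s hs => hs.2) n (-1)
    have := (hf.mono_set (Set.inter_subset_left : Ω₁ ⊆ strip)).mul ho1 h1
    rw [← sub_eq_add_neg] at this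
    refine this.congr ho1 fun s _ => ?_
    simp [Complex.cpow_neg_one, div_eq_mul_inv]
  · have hb : ∀ s ∈ Ω₂, ‖s‖ < ρ := fun s hs => mem_ball_zero_iff.1 hs.2
    have h2 := (hVt ρ (min_le_left _ _)).mono_set (Set.inter_subset_right : Ω₂ ⊆ _)
    -- near `0` the quotient is the analytic function `V`
    refine TameOn.of_bounded (h2.congr ho2 fun s hs => ?_) hb _
    have hs0 : s ≠ 0 := by
      rintro rfl
      simpa using hs.1.1
    have e1 : f s = g s := hfg' s (Metric.ball_subset_ball
      ((min_le_right _ _).trans (min_le_right _ _)) hs.2) hs.1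
    have e2 := hgV' s (Metric.ball_subset_ball ((min_le_right _ _).trans (min_le_left _ _)) hs.2)
    simp only [e1, e2, sub_zero, smul_eq_mul, pow_one]
    field_simp

lemma GrowthOn.integrable_vline {c : ℝ} (hf : GrowthOn S (-(3 / 2)) f)
    (hS : ∀ t, vline c t ∈ S) (hc : Continuous fun t => f (vline c t)) :
    MeasureTheory.Integrable (fun t => f (vline c t)) := by
  obtain ⟨C, hC0, hC⟩ := hf.exists_nonneg
  refine integrable_of_vline_bound (C := C) hc fun t => (hC _ (hS t)).trans ?_
  exact mul_le_mul_of_nonneg_left (rpow_norm_vline_le (A := -(3 / 2)) (by norm_num)) hC0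

lemma integrable_Gamma_vline {c : ℝ} (hc : 0 < c) :
    MeasureTheory.Integrable (fun t => Complex.Gamma (vline c t)) :=
  (growthOn_Gamma (S := {s : ℂ | c ≤ s.re ∧ s.re ≤ c}) hc (fun s hs => hs) _).integrable_vline
    (fun t => by simp)
    (differentiableOn_Gamma_re_pos.continuousOn.comp_continuous (continuous_vline c)
      fun t => by simpa using hc)

/-- Cahen--Mellin integral. -/
lemma integral_Gamma_mul_exp {c : ℝ} (hc : 0 < c) (L : ℝ) :
    ∫ t : ℝ, Complex.Gamma (vline c t) * Complex.exp (L * vline c t) =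
      2 * Real.pi * (Real.exp (-Real.exp (-L)) : ℝ) := by
  set F : ℝ → ℂ := fun x : ℝ => ((Real.exp (-x) : ℝ) : ℂ)
  have hm : ∀ t : ℝ, mellin F (c + t * Complex.I) = Complex.Gamma (vline c t) := fun t => by
    rw [← Complex.GammaIntegral_eq_mellin, Complex.Gamma_eq_integral (by simpa using hc)]; rfl
  have key := mellinInv_mellin_eq c F (x := Real.exp (-L)) (Real.exp_pos _) ?_ ?_ ?_
  · simp only [mellinInv, hm] at key
    have e1 : ∀ y : ℝ, ((Real.exp (-L) : ℝ) : ℂ) ^ (-((c : ℂ) + y * Complex.I)) •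
        Complex.Gamma (vline c y) =
        Complex.Gamma (vline c y) * Complex.exp (L * vline c y) := by
      intro y
      rw [Complex.cpow_def_of_ne_zero (by simp), ← Complex.ofReal_log (Real.exp_pos _).le,
        Real.log_exp, smul_eq_mul]
      have : ((-L : ℝ) : ℂ) * -((c : ℂ) + y * Complex.I) = L * vline c y := by
        unfold vline; push_cast; ring
      rw [this]; ring
    rw [MeasureTheory.integral_congr_ae (Eventually.of_forall e1), Complex.real_smul] at key
    rw [show ((Real.exp (-Real.exp (-L)) : ℝ) : ℂ) = F (Real.exp (-L)) from rfl, ← key]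
    have hpi : (Real.pi : ℂ) ≠ 0 := by exact_mod_cast Real.pi_ne_zero
    push_cast
    field_simp
  · have := Complex.GammaIntegral_convergent (s := c) (by simpa using hc)
    refine this.congr_fun (fun x _ => ?_) measurableSet_Ioi
    simp [F, mul_comm]
  · refine (integrable_Gamma_vline hc).congr (Eventually.of_forall fun t => ?_)
    exact (hm t).symm
  · exact (by fun_prop : Continuous F).continuousAt

/-- The inverse Laplace transform of `R(s) / s` tends to the value of `R` at `0` faster than any
power of `L`. The difference from `R(0) Γ(s)`, whose transform is known, is smooth up to
`Re s = 0`. -/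
lemma inverseLaplace_one (hR : ∀ n, TameOn strip n (-1) R) (hg : AnalyticAt ℂ g 0)
    (hRg : ∀ᶠ s in 𝓝[strip] 0, R s = g s) (n : ℕ) :
    (fun L : ℝ => (1 / (2 * Real.pi) : ℂ) * (∫ t : ℝ, (R (vline (1 / L) t) /
        vline (1 / L) t) * Complex.exp (L * vline (1 / L) t)) - g 0)
      =O[atTop] fun L => L ^ (-(n : ℝ)) := by
  have hGa : AnalyticAt ℂ (fun s => Complex.Gamma (s + 1)) 0 := by
    have h1 : AnalyticAt ℂ Complex.Gamma (0 + 1) :=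
      (differentiableOn_Gamma_re_pos.analyticAt (isOpen_re_pos.mem_nhds (by simp)))
    exact h1.fun_comp_of_eq (analyticAt_id.fun_add analyticAt_const) rfl
  -- since `Γ(s + 1) / s = Γ(s)` has residue `1` at `0`, this difference has no pole
  have hU : TameOn strip n (-(3 / 2)) (fun s => (R s - g 0 * Complex.Gamma (s + 1)) / s) := by
    refine TameOn.mono_exponent (TameOn.div_id ((hR n).sub isOpen_strip
      ((rapidOn_Gamma_add_one n (-1)).const_mul isOpen_strip (g 0)))
      (hg.sub (analyticAt_const.mul hGa)) (by filter_upwards [hRg] with s hs; rw [hs]; rfl)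
      (by simp)) (by norm_num)
  have hmain := hU.integral_isBigO.const_mul_left (1 / (2 * Real.pi) : ℂ)
  -- the transform of `Γ(s)` is `e ^ (-e ^ (-L))`, which is `1` up to an exponentially small error
  have hexp : (fun L : ℝ => g 0 * ((Real.exp (-Real.exp (-L)) - 1 : ℝ) : ℂ)) =O[atTop]
      fun L => L ^ (-(n : ℝ)) := by
    refine IsBigO.const_mul_left ?_ _
    have h1 : (fun L : ℝ => ((Real.exp (-Real.exp (-L)) - 1 : ℝ) : ℂ)) =O[atTop]
        fun L => Real.exp (-L) := by
      refine IsBigO.of_bound 1 (Eventually.of_forall fun L => ?_)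
      rw [Complex.norm_real, Real.norm_eq_abs, Real.norm_of_nonneg (Real.exp_pos _).le, one_mul,
        abs_le]
      have := Real.exp_pos (-L)
      have h2 := Real.add_one_le_exp (-Real.exp (-L))
      have h3 : Real.exp (-Real.exp (-L)) ≤ 1 := Real.exp_le_one_iff.2 (by linarith)
      constructor <;> linarith
    refine h1.trans ?_
    have := isLittleO_exp_neg_mul_rpow_atTop (a := 1) one_pos (-(n : ℝ))
    simpa using this.isBigO
  refine (hmain.add hexp).congr' ?_ EventuallyEq.rfl
  filter_upwards [eventually_gt_atTop 3] with L hL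
  have hc : 0 < 1 / L := by positivity
  have hc2 : 1 / L < 1 / 2 := by
    rw [div_lt_div_iff₀ (by linarith) two_pos]; linarith
  set c := 1 / L
  have hint := hU.integrable_vline L hc hc2
  have hgi : MeasureTheory.Integrable (fun t => g 0 * (Complex.Gamma (vline c t) *
      Complex.exp (L * vline c t))) := by
    refine (MeasureTheory.Integrable.mul_bdd (c := Real.exp (L * c))
      (integrable_Gamma_vline hc) ?_ (Eventually.of_forall fun t => ?_)).const_mul (g 0)
    · exact (Complex.continuous_exp.comp
        (continuous_const.mul (continuous_vline c))).aestronglyMeasurable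
    · exact (norm_exp_mul_vline _ _ _).le
  have e1 : ∫ t : ℝ, (R (vline c t) / vline c t) * Complex.exp (L * vline c t) =
      (∫ t : ℝ, ((R (vline c t) - g 0 * Complex.Gamma (vline c t + 1)) / vline c t) *
        Complex.exp (L * vline c t)) +
      g 0 * (2 * Real.pi * (Real.exp (-Real.exp (-L)) : ℝ)) := by
    rw [← integral_Gamma_mul_exp hc, ← MeasureTheory.integral_const_mul,
      ← MeasureTheory.integral_add hint hgi]
    congr 1
    ext t
    have h0 : vline c t ≠ 0 := fun h => by
      have := congrArg Complex.re h
      simp at this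
      exact hc.ne' this
    rw [Complex.Gamma_add_one _ h0]
    field_simp
    ring
  rw [e1, mul_add, add_sub_assoc]
  congr 1
  have hpi : (Real.pi : ℂ) ≠ 0 := by exact_mod_cast Real.pi_ne_zero
  push_cast
  field_simp

/-! ### Decay of the gamma function times an L-function -/

/-- A single point may be added to the set, whatever the value of `f` there. -/
lemma GrowthOn.insert (hf : GrowthOn S A f) (a : ℂ) : GrowthOn (insert a S) A f := by
  obtain ⟨C, hC0, hC⟩ := hf.exists_nonneg
  refine ⟨C + ‖f a‖ / (1 + ‖a‖) ^ A, fun s hs => ?_⟩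
  have hs0 := one_add_norm_pos s
  have ha0 := one_add_norm_pos a
  rcases hs with rfl | hs
  · rw [add_mul, div_mul_cancel₀ _ (by positivity)]
    have : 0 ≤ C * (1 + ‖s‖) ^ A := by positivity
    linarith
  · refine (hC s hs).trans ?_
    gcongr
    have : 0 ≤ ‖f a‖ / (1 + ‖a‖) ^ A := by positivity
    linarith

/-- Growth conditions are stable under affine substitutions, because `1 + |u s + v|` and `1 + |s|`
differ by bounded factors. -/
lemma GrowthOn.comp_affine (hf : GrowthOn S A f) {u : ℂ} (hu : u ≠ 0) (v : ℂ) {T : Set ℂ}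
    (hT : ∀ s ∈ T, u * s + v ∈ S) : GrowthOn T A (fun s => f (u * s + v)) := by
  obtain ⟨C, hC0, hC⟩ := hf.exists_nonneg
  have h1 : ∃ D : ℝ, 0 ≤ D ∧ ∀ s : ℂ, (1 + ‖u * s + v‖) ^ A ≤ D * (1 + ‖s‖) ^ A := by
    have hu' : 0 < ‖u‖ := norm_pos_iff.2 hu
    set M := 1 + ‖u‖ + ‖v‖
    set M' := 1 + (1 + ‖v‖) / ‖u‖
    have hM : 0 < M := by positivity
    have hM' : 0 < M' := by positivity
    refine ⟨max (M ^ A) (M'⁻¹ ^ A), by positivity, fun s => ?_⟩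
    have hs := one_add_norm_pos s
    have hz := one_add_norm_pos (u * s + v)
    rcases le_total 0 A with hA | hA
    · refine le_trans ?_ (mul_le_mul_of_nonneg_right (le_max_left _ _) (by positivity))
      rw [← Real.mul_rpow hM.le hs.le]
      refine Real.rpow_le_rpow hz.le ?_ hA
      have := norm_add_le (u * s) v
      rw [norm_mul] at this
      have := norm_nonneg s
      have := norm_nonneg v
      simp only [M]
      nlinarith
    · refine le_trans ?_ (mul_le_mul_of_nonneg_right (le_max_right _ _) (by positivity))
      rw [← Real.mul_rpow (inv_pos.2 hM').le hs.le]
      refine Real.rpow_le_rpow_of_nonpos (by positivity) ?_ hA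
      rw [inv_mul_le_iff₀ hM']
      have h2 : ‖s‖ ≤ (‖u * s + v‖ + ‖v‖) / ‖u‖ := by
        rw [le_div_iff₀ hu', mul_comm, ← norm_mul]
        have := norm_sub_le (u * s + v) v
        simpa using this
      have h3 : M' * (1 + ‖u * s + v‖) = 1 + ‖u * s + v‖ + (‖u * s + v‖ + ‖v‖) / ‖u‖ +
          (1 + ‖v‖ * ‖u * s + v‖) / ‖u‖ := by
        simp only [M']; field_simp; ring
      rw [h3]
      have : 0 ≤ (1 + ‖v‖ * ‖u * s + v‖) / ‖u‖ := by positivity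
      have := norm_nonneg (u * s + v)
      linarith
  obtain ⟨D, hD0, hD⟩ := h1
  refine ⟨C * D, fun s hs => (hC _ (hT s hs)).trans ?_⟩
  rw [mul_assoc]
  gcongr
  exact hD s

/-- A Mellin transform is bounded on a closed vertical strip if it converges on both edges, since
`t ^ (Re s) ≤ t ^ a + t ^ b` for `a ≤ Re s ≤ b`. -/
lemma growthOn_mellin {F : ℝ → ℂ} {a b : ℝ} (ha : MellinConvergent F a) (hb : MellinConvergent F b)
    (hS : ∀ s ∈ S, a ≤ s.re ∧ s.re ≤ b) : GrowthOn S 0 (mellin F) := by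
  refine ⟨(∫ t in Set.Ioi (0 : ℝ), ‖(t : ℂ) ^ ((a : ℂ) - 1) • F t‖) +
    ∫ t in Set.Ioi (0 : ℝ), ‖(t : ℂ) ^ ((b : ℂ) - 1) • F t‖, fun s hs => ?_⟩
  rw [Real.rpow_zero, mul_one, mellin, ← MeasureTheory.integral_add ha.norm hb.norm]
  refine (MeasureTheory.norm_integral_le_integral_norm _).trans ?_
  by_cases hi : MeasureTheory.IntegrableOn (fun t : ℝ => ‖(t : ℂ) ^ (s - 1) • F t‖) (Set.Ioi 0)
  · refine MeasureTheory.setIntegral_mono_on hi (ha.norm.add hb.norm) measurableSet_Ioi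
      fun t ht => ?_
    have ht : 0 < t := ht
    simp only [norm_smul, Complex.norm_cpow_eq_rpow_re_of_pos ht, Complex.sub_re, Complex.ofReal_re,
      Complex.one_re, ← add_mul]
    gcongr
    have hp := Real.rpow_pos_of_pos ht (a - 1)
    have hq := Real.rpow_pos_of_pos ht (b - 1)
    rcases le_total 1 t with h1 | h1
    · have := Real.rpow_le_rpow_of_exponent_le h1 (sub_le_sub_right (hS s hs).2 1)
      linarith
    · have := Real.rpow_le_rpow_of_exponent_ge ht h1 (sub_le_sub_right (hS s hs).1 1)
      linarith
  · rw [MeasureTheory.integral_undef hi]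
    positivity

lemma growthOn_strongFEPair {P : WeakFEPair ℂ} (hP : IsStrongFEPair P) {a b : ℝ}
    (hS : ∀ s ∈ S, a ≤ s.re ∧ s.re ≤ b) : GrowthOn S 0 P.Λ := by
  rw [hP.Λ_eq]
  exact growthOn_mellin (hP.hasMellin a).1 (hP.hasMellin b).1 hS

lemma growthOn_weakFEPair (P : WeakFEPair ℂ) {a b : ℝ}
    (hS : ∀ s ∈ S, a ≤ s.re ∧ s.re ≤ b) : GrowthOn S 0 P.Λ₀ :=
  growthOn_mellin (P.isStrongFEPair_toStrongFEPair.hasMellin a).1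
    (P.isStrongFEPair_toStrongFEPair.hasMellin b).1 hS

/-- A vertical strip on which the continued `L`-functions are estimated. -/
def wideStrip : Set ℂ := {s : ℂ | -(1 / 4) ≤ s.re ∧ s.re ≤ 5 / 2}

/-- The completed Hurwitz zeta function without its poles is a Mellin transform that converges
everywhere. -/
lemma growthOn_completedHurwitzZetaEven₀ (a : UnitAddCircle) :
    GrowthOn wideStrip 0 (HurwitzZeta.completedHurwitzZetaEven₀ a) := by
  have h1 := ((growthOn_weakFEPair (HurwitzZeta.hurwitzEvenFEPair a) (a := -1) (b := 2)
    (S := {s : ℂ | -1 ≤ s.re ∧ s.re ≤ 2}) (fun s hs => hs)).comp_affine (u := 1 / 2) (by norm_num) 0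
    (T := wideStrip) ?_).const_mul (1 / 2)
  · refine h1.congr fun s _ => ?_
    simp only [HurwitzZeta.completedHurwitzZetaEven₀]
    rw [add_zero, one_div_mul_eq_div, one_div_mul_eq_div]
  · rintro s ⟨h1, h2⟩
    have : ((1 / 2 : ℂ) * s + 0).re = s.re / 2 := by
      rw [add_zero, show (1 / 2 : ℂ) * s = ((1 / 2 : ℝ) : ℂ) * s by push_cast; ring,
        Complex.re_ofReal_mul]; ring
    simp only [Set.mem_ofPred_eq, this]
    constructor <;> linarith

/-- The completed odd Hurwitz zeta function is a Mellin transform that converges everywhere. -/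
lemma growthOn_completedHurwitzZetaOdd (a : UnitAddCircle) :
    GrowthOn wideStrip 0 (HurwitzZeta.completedHurwitzZetaOdd a) := by
  have h1 := ((growthOn_strongFEPair (HurwitzZeta.isStrong_hurwitzOddFEPair a) (a := -1) (b := 2)
    (S := {s : ℂ | -1 ≤ s.re ∧ s.re ≤ 2}) (fun s hs => hs)).comp_affine (u := 1 / 2) (by norm_num)
    (1 / 2) (T := wideStrip) ?_).const_mul (1 / 2)
  · refine h1.congr fun s _ => ?_
    simp only [HurwitzZeta.completedHurwitzZetaOdd]
    rw [← mul_add_one, one_div_mul_eq_div, one_div_mul_eq_div]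
  · rintro s ⟨h1, h2⟩
    have : ((1 / 2 : ℂ) * s + 1 / 2).re = s.re / 2 + 1 / 2 := by
      rw [show (1 / 2 : ℂ) * s + 1 / 2 = ((1 / 2 : ℝ) : ℂ) * s +
        ((1 / 2 : ℝ) : ℂ) by push_cast; ring,
        Complex.add_re, Complex.re_ofReal_mul, Complex.ofReal_re]; ring
    simp only [Set.mem_ofPred_eq, this]
    constructor <;> linarith

lemma growthOn_Gamma_half (r : ℝ) (hr : 1 / 4 ≤ r) (A : ℝ) :
    GrowthOn wideStrip A (fun s => Complex.Gamma (1 / 2 * s + r)) := by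
  refine (growthOn_Gamma (S := {s : ℂ | 1 / 8 ≤ s.re ∧ s.re ≤ 2 + r}) (a := 1 / 8) (by norm_num)
    (fun s hs => hs) A).comp_affine (by norm_num) r ?_
  rintro s ⟨h1, h2⟩
  have : ((1 / 2 : ℂ) * s + r).re = s.re / 2 + r := by
    rw [show (1 / 2 : ℂ) * s + r = ((1 / 2 : ℝ) : ℂ) * s + r by push_cast; ring,
      Complex.add_re, Complex.re_ofReal_mul, Complex.ofReal_re]; ring
  simp only [Set.mem_ofPred_eq, this]
  constructor <;> linarith

lemma growthOn_wideStrip_cpow {c : ℝ} (hc : 0 < c) : GrowthOn wideStrip 0 (fun s => (c : ℂ) ^ s) :=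
  growthOn_const_cpow hc fun _ hs => hs

lemma growthOn_wideStrip_cpow_neg_half {c : ℝ} (hc : 0 < c) (r : ℝ) :
    GrowthOn wideStrip 0 (fun s => (c : ℂ) ^ (-(1 / 2) * s + r)) := by
  refine (growthOn_const_cpow (S := {s : ℂ | -2 + r ≤ s.re ∧ s.re ≤ 2 + r}) hc
    (fun s hs => hs)).comp_affine (by norm_num) r ?_
  rintro s ⟨h1, h2⟩
  have : (-(1 / 2 : ℂ) * s + r).re = -s.re / 2 + r := by
    rw [show -(1 / 2 : ℂ) * s + r = ((-(1 / 2) : ℝ) : ℂ) * s + r by push_cast; ring,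
      Complex.add_re, Complex.re_ofReal_mul, Complex.ofReal_re]; ring
  simp only [Set.mem_ofPred_eq, this]
  constructor <;> linarith

/-- The duplication formula for the Gamma function. -/
lemma Gamma_eq_half_mul_Gammaℝ (s : ℂ) : Complex.Gamma s =
    1 / 2 * ((2 * Real.pi : ℝ) : ℂ) ^ s * (Complex.Gammaℝ s * Complex.Gammaℝ (s + 1)) := by
  have h0 : ((2 * Real.pi : ℝ) : ℂ) ≠ 0 := by
    exact_mod_cast (by positivity : (2 * Real.pi : ℝ) ≠ 0)
  rw [Complex.Gammaℝ_mul_Gammaℝ_add_one, Complex.Gammaℂ_def]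
  have h2 : (2 * Real.pi : ℂ) = ((2 * Real.pi : ℝ) : ℂ) := by push_cast; rfl
  rw [h2, Complex.cpow_neg]
  have : ((2 * Real.pi : ℝ) : ℂ) ^ s ≠ 0 := by
    rw [Ne, Complex.cpow_eq_zero_iff]; tauto
  field_simp

/-- Rapid decay of `Γ(s + 1) (s - 1) ζ(s, a)`. The duplication formula writes `Γ(s)` as a product of
two Gamma factors; one of them completes the even part, or the odd part, of the Hurwitz zeta
function to a function of polynomial growth, and the other one decays rapidly. -/
lemma growthOn_Gamma_mul_hurwitzZeta (a : UnitAddCircle) (A : ℝ) :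
    GrowthOn wideStrip A
      (fun s => Complex.Gamma (s + 1) * ((s - 1) * HurwitzZeta.hurwitzZeta a s)) := by
  -- at `0` and `1` the formulas used below involve poles; single points do not affect growth
  have hsub : wideStrip ⊆ insert 0 (insert 1 (wideStrip \ {0, 1})) := by
    intro s hs
    by_cases h0 : s = 0
    · exact Or.inl h0
    by_cases h1 : s = 1
    · exact Or.inr (Or.inl h1)
    · exact Or.inr (Or.inr ⟨hs, by simp [h0, h1]⟩)
  refine GrowthOn.mono_set (GrowthOn.insert (GrowthOn.insert ?_ 1) 0) hsub
  set T := wideStrip \ {0, 1}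
  have hT : T ⊆ wideStrip := Set.sdiff_subset
  have hpi : (0 : ℝ) < Real.pi := Real.pi_pos
  -- the poles at `0` and `1` of the completed even part are cancelled by the factor `s (s - 1)`
  have e1 : GrowthOn wideStrip 2 (fun s =>
      (s + 0) * (s + -1) * HurwitzZeta.completedHurwitzZetaEven₀ a s +
      ((-(if a = 0 then 1 else 0)) * (s + -1) + 1 * (s + 0))) := by
    refine GrowthOn.add ?_ (GrowthOn.mono_exponent (((growthOn_add_const (-1)).const_mul _).add
      ((growthOn_add_const 0).const_mul _)) (by norm_num))
    have := ((growthOn_add_const (S := wideStrip) 0).mul (growthOn_add_const (-1))).mul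
      (growthOn_completedHurwitzZetaEven₀ a)
    norm_num at this ⊢
    exact this
  have e2 := (((growthOn_wideStrip_cpow (c := 2 * Real.pi) (by positivity)).mul
    ((growthOn_wideStrip_cpow_neg_half hpi (-(1 / 2))).mul
      (growthOn_Gamma_half (1 / 2) (by norm_num) (A - 2)))).mul e1).const_mul (1 / 2)
  have e3 := ((((growthOn_wideStrip_cpow (c := 2 * Real.pi) (by positivity)).mul
    ((growthOn_wideStrip_cpow_neg_half hpi 0).mul
      (growthOn_Gamma_half 1 (by norm_num) (A - 1)))).mul
    (growthOn_add_const (-1))).mul (growthOn_completedHurwitzZetaOdd a))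
  have e2' := e2.mono_exponent (B := A) (by linarith)
  have e3' := e3.mono_exponent (B := A) (by linarith)
  refine ((e2'.mono_set hT).add (e3'.mono_set hT)).congr fun s hs => ?_
  have hs0 : s ≠ 0 := fun h => hs.2 (by simp [h])
  have hs1 : s ≠ 1 := fun h => hs.2 (by simp [h])
  have hre : -(1 / 4) ≤ s.re := hs.1.1
  have hg1 : Complex.Gammaℝ (s + 1) ≠ 0 := Complex.Gammaℝ_ne_zero_of_re_pos (by
    simp only [Complex.add_re, Complex.one_re]; linarith)
  have hg0 : Complex.Gammaℝ s ≠ 0 := by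
    rw [Ne, Complex.Gammaℝ_eq_zero_iff]
    rintro ⟨k, hk⟩
    rcases Nat.eq_zero_or_pos k with rfl | hk0
    · simp at hk; exact hs0 hk
    · rw [hk] at hre
      simp at hre
      have : (1 : ℝ) ≤ k := by exact_mod_cast hk0
      linarith
  have he : HurwitzZeta.hurwitzZetaEven a s =
      HurwitzZeta.completedHurwitzZetaEven a s / Complex.Gammaℝ s :=
    HurwitzZeta.hurwitzZetaEven_def_of_ne_or_ne (Or.inr hs0)
  have hG1 : Complex.Gammaℝ (s + 1) = (Real.pi : ℂ) ^ (-(1 / 2) * s + ((-(1 / 2) : ℝ) : ℂ)) *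
      Complex.Gamma (1 / 2 * s + ((1 / 2 : ℝ) : ℂ)) := by
    rw [Complex.Gammaℝ_def]; push_cast; ring_nf
  have hG0 : s * Complex.Gammaℝ s = 2 * ((Real.pi : ℂ) ^ (-(1 / 2) * s + ((0 : ℝ) : ℂ)) *
      Complex.Gamma (1 / 2 * s + ((1 : ℝ) : ℂ))) := by
    rw [Complex.Gammaℝ_def, Complex.ofReal_one, Complex.Gamma_add_one _ (by simpa using hs0)]
    push_cast
    rw [show -(1 / 2) * s + 0 = -s / 2 by ring, show 1 / 2 * s = s / 2 by ring]
    ring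
  have hrew : Complex.Gamma (s + 1) * ((s - 1) * HurwitzZeta.hurwitzZeta a s) =
      1 / 2 * ((2 * Real.pi : ℝ) : ℂ) ^ s * ((s - 1) * (s * Complex.Gammaℝ (s + 1) *
        HurwitzZeta.completedHurwitzZetaEven a s + (s * Complex.Gammaℝ s) *
        HurwitzZeta.completedHurwitzZetaOdd a s)) := by
    rw [Complex.Gamma_add_one s hs0, Gamma_eq_half_mul_Gammaℝ, HurwitzZeta.hurwitzZeta, he,
      HurwitzZeta.hurwitzZetaOdd]
    field_simp
  simp only
  rw [hrew, hG0, ← hG1, HurwitzZeta.completedHurwitzZetaEven_eq]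
  have h1s : 1 - s ≠ 0 := sub_ne_zero.2 (Ne.symm hs1)
  have h1s' : 1 / (1 - s) = -(1 / (s - 1)) := by rw [← neg_sub s 1, div_neg]
  have hs1' : s - 1 ≠ 0 := sub_ne_zero.2 hs1
  rw [h1s']
  field_simp
  ring

/-- The function `Γ(s + 1) (s - 1) L(s, χ)` decays faster than any power on the wide strip, since
`L(s, χ)` is a combination of Hurwitz zeta functions. -/
lemma growthOn_Gamma_mul_LFunction {N : ℕ} [NeZero N] (χ : DirichletCharacter ℂ N) (A : ℝ) :
    GrowthOn wideStrip A (fun s => Complex.Gamma (s + 1) * ((s - 1) * χ.LFunction s)) := by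
  have hN : (0 : ℝ) < N := Nat.cast_pos.2 (NeZero.pos N)
  have h1 : GrowthOn wideStrip 0 (fun s => ((N : ℝ) : ℂ) ^ (-1 * s + 0)) := by
    refine (growthOn_const_cpow (S := {s : ℂ | -5 / 2 ≤ s.re ∧ s.re ≤ 1}) hN
      (fun s hs => hs)).comp_affine (by norm_num) 0 ?_
    rintro s ⟨h1, h2⟩
    simp only [Set.mem_ofPred_eq, neg_mul, one_mul, add_zero, Complex.neg_re]
    constructor <;> linarith
  have h2 := h1.mul (GrowthOn.sum Finset.univ fun j _ =>
    (growthOn_Gamma_mul_hurwitzZeta (ZMod.toAddCircle j) A).const_mul (χ (j : ZMod N)))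
  rw [zero_add] at h2
  refine h2.congr fun s _ => ?_
  simp only [DirichletCharacter.LFunction, ZMod.LFunction, Finset.mul_sum]
  refine Finset.sum_congr rfl fun j _ => ?_
  rw [neg_one_mul, add_zero, Complex.ofReal_natCast]
  ring

/-! ### Growth of L-functions to the right of the line one half -/

/-- The mean value of a Dirichlet character. -/
def charMean (χ : DirichletCharacter ℂ N) : ℂ := (∑ k ∈ Finset.range N, χ (k : ZMod N)) / N

/-- The difference between the partial sums of a character and their main term. -/
def partialSumError (χ : DirichletCharacter ℂ N) (n : ℕ) : ℂ :=
  ∑ k ∈ Finset.Icc 1 n, χ (k : ZMod N) - charMean χ * n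

lemma sum_range_add_period (χ : DirichletCharacter ℂ N) (n : ℕ) :
    ∑ k ∈ Finset.range N, χ ((n + 1 + k : ℕ) : ZMod N) = ∑ k ∈ Finset.range N, χ (k : ZMod N) := by
  generalize n + 1 = a
  induction a with
  | zero => simp
  | succ a ih =>
    rw [← ih]
    rcases Nat.eq_zero_or_pos N with rfl | hN
    · simp
    obtain ⟨M, rfl⟩ : ∃ M, N = M + 1 := ⟨N - 1, by omega⟩
    rw [Finset.sum_range_succ, Finset.sum_range_succ' (fun k => χ ((a + k : ℕ) : ZMod (M + 1)))]
    congr 1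
    · exact Finset.sum_congr rfl fun k _ => by rw [show a + 1 + k = a + (k + 1) by ring]
    · rw [show a + 1 + M = a + (M + 1) by ring, Nat.cast_add, ZMod.natCast_self]; simp

/-- The error term of the partial sums of a periodic function is periodic, hence bounded. -/
lemma partialSumError_add_period (χ : DirichletCharacter ℂ N) (hN : N ≠ 0) (n : ℕ) :
    partialSumError χ (n + N) = partialSumError χ n := by
  have h1 : ∑ k ∈ Finset.Icc 1 (n + N), χ (k : ZMod N) =
      ∑ k ∈ Finset.Icc 1 n, χ (k : ZMod N) + ∑ k ∈ Finset.range N,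
        χ ((n + 1 + k : ℕ) : ZMod N) := by
    have e : ∀ m : ℕ, Finset.Icc 1 m = Finset.Ico 1 (m + 1) := fun m => by ext; simp
    rw [e, e, ← Finset.sum_Ico_consecutive _ (by omega : 1 ≤ n + 1) (by omega : n + 1 ≤ n + N + 1),
      Finset.sum_Ico_eq_sum_range _ (n + 1)]
    congr 2
    congr 1
    omega
  have hN' : (N : ℂ) ≠ 0 := by exact_mod_cast hN
  rw [partialSumError, partialSumError, h1, sum_range_add_period, charMean]
  push_cast
  field_simp
  ring

lemma exists_partialSumError_le (χ : DirichletCharacter ℂ N) (hN : N ≠ 0) :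
    ∃ C : ℝ, ∀ n, ‖partialSumError χ n‖ ≤ C := by
  refine ⟨∑ k ∈ Finset.range N, ‖partialSumError χ k‖, fun n => ?_⟩
  have hmod : ∀ q r : ℕ, partialSumError χ (r + q * N) = partialSumError χ r := by
    intro q r
    induction q with
    | zero => simp
    | succ q ih => rw [show r + (q + 1) * N = r + q * N + N by ring,
      partialSumError_add_period χ hN, ih]
  have : partialSumError χ n = partialSumError χ (n % N) := by
    conv_lhs => rw [← Nat.mod_add_div' n N]
    exact hmod _ _
  rw [this]
  exact Finset.single_le_sum (f := fun k => ‖partialSumError χ k‖) (fun _ _ => norm_nonneg _)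
    (Finset.mem_range.2 (Nat.mod_lt _ (Nat.pos_of_ne_zero hN)))

/-- The truncated error term of the partial sums, as a function of a real variable. -/
def errorFun (χ : DirichletCharacter ℂ N) (t : ℝ) : ℂ :=
  (Set.Ioi (1 : ℝ)).indicator (fun t => ∑ k ∈ Finset.Icc 1 ⌊t⌋₊, χ (k : ZMod N) - charMean χ * t) t

lemma exists_errorFun_le (χ : DirichletCharacter ℂ N) (hN : N ≠ 0) :
    ∃ C : ℝ, 0 ≤ C ∧ ∀ t, ‖errorFun χ t‖ ≤ C := by
  obtain ⟨C, hC⟩ := exists_partialSumError_le χ hN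
  have hC0 : 0 ≤ C := (norm_nonneg _).trans (hC 0)
  refine ⟨C + ‖charMean χ‖, by positivity, fun t => ?_⟩
  rw [errorFun]
  by_cases ht : t ∈ Set.Ioi (1 : ℝ)
  · rw [Set.indicator_of_mem ht]
    have ht : 1 < t := ht
    have e : ∑ k ∈ Finset.Icc 1 ⌊t⌋₊, χ (k : ZMod N) - charMean χ * t =
        partialSumError χ ⌊t⌋₊ + charMean χ * ((⌊t⌋₊ - t : ℝ) : ℂ) := by
      rw [partialSumError]; push_cast; ring
    rw [e]
    refine (norm_add_le _ _).trans (add_le_add (hC _) ?_)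
    rw [norm_mul, Complex.norm_real, Real.norm_eq_abs]
    refine mul_le_of_le_one_right (norm_nonneg _) (abs_le.2 ⟨?_, ?_⟩)
    · have := Nat.lt_floor_add_one t; linarith
    · have := Nat.floor_le (zero_le_one.trans ht.le); linarith
  · rw [Set.indicator_of_notMem ht]; simp; positivity

lemma measurable_errorFun (χ : DirichletCharacter ℂ N) : Measurable (errorFun χ) := by
  refine Measurable.indicator ?_ measurableSet_Ioi
  refine Measurable.sub ?_ (by fun_prop)
  exact (measurable_from_nat (f := fun n => ∑ k ∈ Finset.Icc 1 n, χ (k : ZMod N))).comp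
    Nat.measurable_floor

/-- The integral `∫ E(t) t ^ (-s - 1) dt` over `t > 1`, where `E` is the error term of the partial
sums of `χ`. -/
def errorMellin (χ : DirichletCharacter ℂ N) (s : ℂ) : ℂ := mellin (errorFun χ) (-s)

lemma differentiableOn_errorMellin (χ : DirichletCharacter ℂ N) (hN : N ≠ 0) :
    DifferentiableOn ℂ (errorMellin χ) {s | 0 < s.re} := by
  obtain ⟨C, hC0, hC⟩ := exists_errorFun_le χ hN
  intro s hs
  have hs : 0 < s.re := hs
  have h1 : DifferentiableAt ℂ (mellin (errorFun χ)) (-s) := by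
    refine mellin_differentiableAt_of_isBigO_rpow (a := 0)
      (b := -s.re - 1) ?_ ?_ (by simpa using hs)
      ?_ (by simp)
    · refine MeasureTheory.LocallyIntegrable.locallyIntegrableOn ?_ _
      intro x
      refine ⟨Metric.ball x 1, Metric.ball_mem_nhds _ one_pos, ?_⟩
      refine MeasureTheory.IntegrableOn.of_bound (by simp)
        (measurable_errorFun χ).aestronglyMeasurable
        C (Eventually.of_forall hC)
    · exact IsBigO.of_bound C (Eventually.of_forall fun t => by simpa using hC t)
    · refine (EventuallyEq.trans_isBigO ?_ (isBigO_zero _ _))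
      filter_upwards [nhdsWithin_le_nhds (Iio_mem_nhds (zero_lt_one (α := ℝ)))] with t ht
      exact Set.indicator_of_notMem (fun h => lt_asymm ht h) _
  exact (h1.comp s differentiable_neg.differentiableAt).differentiableWithinAt

/-- The integral `∫ E(t) t ^ (-s - 1) dt` converges absolutely, uniformly for `Re s ≥ 1 / 2`. -/
lemma growthOn_errorMellin (χ : DirichletCharacter ℂ N) (hN : N ≠ 0) :
    GrowthOn {s | 1 / 2 ≤ s.re} 0 (errorMellin χ) := by
  obtain ⟨C, hC0, hC⟩ := exists_errorFun_le χ hN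
  refine ⟨∫ t in Set.Ioi (0 : ℝ),
    (Set.Ioi (1 : ℝ)).indicator (fun t : ℝ => C * t ^ (-(3 / 2) : ℝ)) t,
    fun s hs => ?_⟩
  have hs : 1 / 2 ≤ s.re := hs
  rw [Real.rpow_zero, mul_one, errorMellin, mellin]
  refine MeasureTheory.norm_integral_le_of_norm_le ?_ ?_
  · refine MeasureTheory.Integrable.restrict ?_
    rw [MeasureTheory.integrable_indicator_iff measurableSet_Ioi]
    exact (integrableOn_Ioi_rpow_of_lt (by norm_num) one_pos).const_mul C
  · refine (MeasureTheory.ae_restrict_iff' measurableSet_Ioi).2 (Eventually.of_forall fun t ht => ?_)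
    have ht : 0 < t := ht
    by_cases h1 : t ∈ Set.Ioi (1 : ℝ)
    · rw [Set.indicator_of_mem h1, norm_smul, Complex.norm_cpow_eq_rpow_re_of_pos ht, mul_comm]
      refine mul_le_mul (hC t) ?_ (by positivity) hC0
      refine Real.rpow_le_rpow_of_exponent_le (le_of_lt h1) ?_
      simp; linarith
    · have : errorFun χ t = 0 := Set.indicator_of_notMem h1 _
      rw [Set.indicator_of_notMem h1, this, smul_zero, norm_zero]

/-- Abel summation. -/
lemma LSeries_eq_charMean_add (χ : DirichletCharacter ℂ N) (hN : N ≠ 0) {s : ℂ} (hs : 1 < s.re) :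
    LSeries (fun n => χ (n : ZMod N)) s = charMean χ * s / (s - 1) + s * errorMellin χ s := by
  have hs0 : s ≠ 0 := Complex.ne_zero_of_re_pos (by linarith)
  have hs1 : s - 1 ≠ 0 := fun h => by
    have := congrArg Complex.re h
    simp at this; linarith
  obtain ⟨C, hC⟩ := exists_partialSumError_le χ hN
  have hO : (fun n : ℕ => ∑ k ∈ Finset.Icc 1 n, χ (k : ZMod N)) =O[atTop]
      fun n => (n : ℝ) ^ (1 : ℝ) := by
    refine IsBigO.of_bound 1 (Eventually.of_forall fun n => ?_)
    rw [Real.rpow_one, one_mul, Real.norm_of_nonneg (Nat.cast_nonneg n)]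
    refine (norm_sum_le _ _).trans ((Finset.sum_le_sum fun k _ => χ.norm_le_one _).trans ?_)
    simp
  rw [LSeries_eq_mul_integral _ zero_le_one hs (χ.LSeriesSummable_of_one_lt_re hs) hO]
  obtain ⟨D, hD0, hD⟩ := exists_errorFun_le χ hN
  have hpow : MeasureTheory.IntegrableOn (fun t : ℝ => (t : ℂ) ^ (-s)) (Set.Ioi 1) :=
    (integrableOn_Ioi_cpow_of_lt (by simpa using hs) one_pos)
  have hpow' : MeasureTheory.IntegrableOn (fun t : ℝ => (t : ℂ) ^ (-s - 1)) (Set.Ioi 1) :=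
    (integrableOn_Ioi_cpow_of_lt (by simp; linarith) one_pos)
  have herr : MeasureTheory.IntegrableOn (fun t : ℝ => (t : ℂ) ^ (-s - 1) * errorFun χ t)
      (Set.Ioi 1) :=
    MeasureTheory.Integrable.mul_bdd (c := D) hpow' (measurable_errorFun χ).aestronglyMeasurable
      (Eventually.of_forall hD)
  have e1 : ∫ t in Set.Ioi (1 : ℝ),
      (∑ k ∈ Finset.Icc 1 ⌊t⌋₊, χ (k : ZMod N)) * (t : ℂ) ^ (-(s + 1)) =
      ∫ t in Set.Ioi (1 : ℝ), (charMean χ * (t : ℂ) ^ (-s) + (t : ℂ) ^ (-s - 1) *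
        errorFun χ t) := by
    refine MeasureTheory.setIntegral_congr_fun measurableSet_Ioi fun t ht => ?_
    have ht0 : (t : ℂ) ≠ 0 := by
      have : (0 : ℝ) < t := zero_lt_one.trans ht
      exact_mod_cast this.ne'
    have e2 : (t : ℂ) ^ (-s) = (t : ℂ) ^ (-s - 1) * t := by
      rw [Complex.cpow_sub _ _ ht0, Complex.cpow_one, div_mul_cancel₀ _ ht0]
    simp only [errorFun]
    rw [Set.indicator_of_mem ht, e2, neg_add']
    ring
  rw [e1, MeasureTheory.integral_add (hpow.const_mul _) herr, MeasureTheory.integral_const_mul,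
    integral_Ioi_cpow_of_lt (by simpa using hs) one_pos]
  have e3 : ∫ t in Set.Ioi (1 : ℝ), (t : ℂ) ^ (-s - 1) * errorFun χ t = errorMellin χ s := by
    rw [errorMellin, mellin]
    refine (MeasureTheory.setIntegral_eq_of_subset_of_forall_sdiff_eq_zero measurableSet_Ioi
      (Set.Ioi_subset_Ioi zero_le_one) fun t ht => ?_).symm
    simp [errorFun, Set.indicator_of_notMem ht.2]
  rw [e3]
  have hs1' : -s + 1 ≠ 0 := fun h => hs1 (by linear_combination -h)
  simp only [Complex.ofReal_one, Complex.one_cpow]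
  rw [show -1 / (-s + 1) = 1 / (s - 1) by field_simp; ring]
  ring

lemma charMean_of_ne_one [NeZero N] {χ : DirichletCharacter ℂ N} (hχ : χ ≠ 1) : charMean χ = 0 := by
  have : ∑ k ∈ Finset.range N, χ (k : ZMod N) = ∑ a : ZMod N, χ a := by
    refine Finset.sum_bij (fun k _ => (k : ZMod N))
      (fun _ _ => Finset.mem_univ _) ?_ ?_ fun _ _ => rfl
    · intro a ha b hb hab
      rw [Finset.mem_range] at ha hb
      have := (ZMod.natCast_eq_natCast_iff' a b N).1 hab
      rwa [Nat.mod_eq_of_lt ha, Nat.mod_eq_of_lt hb] at this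
    · intro b _
      exact ⟨b.val, Finset.mem_range.2 (ZMod.val_lt b), ZMod.natCast_zmod_val b⟩
  rw [charMean, this, MulChar.sum_eq_zero_of_ne_one hχ, zero_div]

lemma eqOn_re_pos_of_eqOn_one_lt_re {U : Set ℂ} (hU : IsPreconnected U) (hUo : IsOpen U)
    (h2 : (2 : ℂ) ∈ U) (hf : DifferentiableOn ℂ f U) (hg : DifferentiableOn ℂ g U)
    (hfg : ∀ s : ℂ, 1 < s.re → f s = g s) : Set.EqOn f g U := by
  refine (hf.analyticOnNhd hUo).eqOn_of_preconnected_of_eventuallyEq (hg.analyticOnNhd hUo)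
    hU h2 ?_
  filter_upwards [(isOpen_lt continuous_const Complex.continuous_re).mem_nhds
    (show (1 : ℝ) < (2 : ℂ).re by norm_num)] with s hs
  exact hfg s hs

/-- Abel summation continues `L(s, χ)` to `Re s > 0`. -/
lemma LFunction_eq_mul_errorMellin [NeZero N] {χ : DirichletCharacter ℂ N} (hχ : χ ≠ 1) {s : ℂ}
    (hs : 0 < s.re) : χ.LFunction s = s * errorMellin χ s := by
  refine eqOn_re_pos_of_eqOn_one_lt_re isPreconnected_re_pos isOpen_re_pos (by simp)
    (DirichletCharacter.differentiable_LFunction hχ).differentiableOn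
    (differentiableOn_id.mul (differentiableOn_errorMellin χ (NeZero.ne N))) (fun s hs => ?_) hs
  rw [DirichletCharacter.LFunction_eq_LSeries χ hs, LSeries_eq_charMean_add χ (NeZero.ne N) hs,
    charMean_of_ne_one hχ]
  simp

/-- For a non-principal character `L(s, χ)` grows at most linearly on `Re s ≥ 1 / 2`. -/
lemma growthOn_LFunction [NeZero N] {χ : DirichletCharacter ℂ N} (hχ : χ ≠ 1) :
    GrowthOn {s | 1 / 2 ≤ s.re} 1 χ.LFunction := by
  have h := (growthOn_add_const (S := {s : ℂ | 1 / 2 ≤ s.re}) 0).mul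
    (growthOn_errorMellin χ (NeZero.ne N))
  rw [add_zero] at h
  refine h.congr fun s hs => ?_
  have hs : 1 / 2 ≤ s.re := hs
  simp [LFunction_eq_mul_errorMellin hχ (by linarith : 0 < s.re)]

lemma riemannZeta₁_eq_mul {s : ℂ} (hs : s ≠ 1) : riemannZeta₁ s = (s - 1) * riemannZeta s := by
  have := sub_ne_zero.2 hs
  rw [riemannZeta_eq_inv_sub_mul hs]
  field_simp

/-- The entire function `(s - 1) ζ(s)` grows at most quadratically on `Re s ≥ 1 / 2`. -/
lemma growthOn_riemannZeta₁ : GrowthOn {s | 1 / 2 ≤ s.re} 2 riemannZeta₁ := by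
  set χ : DirichletCharacter ℂ 1 := 1
  have hm : charMean χ = 1 := by
    have : χ (0 : ZMod 1) = 1 := map_one χ
    simp [charMean, this]
  -- multiplying by `s - 1` clears the pole, so the formula extends to the half-plane
  have key : Set.EqOn riemannZeta₁ (fun s => s + s * (s - 1) * errorMellin χ s)
      {s | 0 < s.re} := by
    refine eqOn_re_pos_of_eqOn_one_lt_re isPreconnected_re_pos isOpen_re_pos (by simp)
      differentiable_riemannZeta₁.differentiableOn
      (differentiableOn_id.add (((differentiableOn_id.mul (differentiableOn_id.sub_const 1))).mul
        (differentiableOn_errorMellin χ one_ne_zero))) (fun s hs => ?_)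
    have hs1 : s ≠ 1 := fun h => by simp [h] at hs
    rw [riemannZeta₁_eq_mul hs1, ← DirichletCharacter.LFunction_modOne_eq (χ := χ),
      DirichletCharacter.LFunction_eq_LSeries χ hs, LSeries_eq_charMean_add χ one_ne_zero hs, hm]
    have := sub_ne_zero.2 hs1
    field_simp
  have h1 := (growthOn_add_const (S := {s : ℂ | 1 / 2 ≤ s.re}) 0).mono_exponent
    (show (1 : ℝ) ≤ 2 by norm_num)
  have h2 := ((growthOn_add_const (S := {s : ℂ | 1 / 2 ≤ s.re}) 0).mul
    (growthOn_add_const (-1))).mul (growthOn_errorMellin χ one_ne_zero)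
  norm_num at h2
  refine (h1.add h2).congr fun s hs => ?_
  have hs : 1 / 2 ≤ s.re := hs
  simp only
  rw [key (by simp; linarith : s ∈ {s : ℂ | 0 < s.re})]
  ring

/-! ### Lower bounds for L-functions near the line one -/

/-- The L-series of the principal character has at most a simple pole at `1`. -/
lemma exists_norm_LSeries_one_le (hN : N ≠ 0) : ∃ M : ℝ, 0 < M ∧ ∀ x : ℝ, 0 < x → x ≤ 1 / 2 →
    ‖LSeries (fun n => (1 : DirichletCharacter ℂ N) (n : ZMod N)) (1 + x)‖ ≤ M / x := by
  set χ := (1 : DirichletCharacter ℂ N)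
  obtain ⟨C, hC0, hC⟩ := (growthOn_errorMellin χ hN).exists_nonneg
  refine ⟨2 * ‖charMean χ‖ + 2 * C + 1, by positivity, fun x hx hx2 => ?_⟩
  rw [LSeries_eq_charMean_add χ hN (by simpa using hx), add_sub_cancel_left, le_div_iff₀ hx]
  have h1 : ‖(1 + x : ℂ)‖ ≤ 2 := by
    rw [show (1 + x : ℂ) = ((1 + x : ℝ) : ℂ) by push_cast; rfl, Complex.norm_real,
      Real.norm_of_nonneg (by positivity)]
    linarith
  have h2 := hC (1 + x) (by simp; linarith)
  rw [Real.rpow_zero, mul_one] at h2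
  have h3 : ‖charMean χ * (1 + x : ℂ) / x‖ ≤ ‖charMean χ‖ * 2 / x := by
    rw [norm_div, norm_mul, Complex.norm_real, Real.norm_of_nonneg hx.le]
    gcongr
  have h4 : ‖(1 + x : ℂ) * errorMellin χ (1 + x)‖ ≤ 2 * C := by
    rw [norm_mul]; gcongr
  calc _ ≤ (‖charMean χ‖ * 2 / x + 2 * C) * x := by
        gcongr
        exact (norm_add_le _ _).trans (add_le_add h3 h4)
    _ = ‖charMean χ‖ * 2 + 2 * C * x := by field_simp
    _ ≤ _ := by nlinarith

/-- Away from the real axis the L-series of any character, principal or not, grows at most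
linearly. -/
lemma exists_norm_LSeries_le (χ : DirichletCharacter ℂ N) (hN : N ≠ 0) :
    ∃ M : ℝ, 0 < M ∧ ∀ s : ℂ, 1 < s.re → 1 ≤ |s.im| →
      ‖LSeries (fun n => χ (n : ZMod N)) s‖ ≤ M * ‖s‖ := by
  obtain ⟨C, hC0, hC⟩ := (growthOn_errorMellin χ hN).exists_nonneg
  refine ⟨‖charMean χ‖ + C + 1, by positivity, fun s hs hi => ?_⟩
  have h1 : 1 ≤ ‖s - 1‖ := hi.trans (by simpa using Complex.abs_im_le_norm (s - 1))
  have h2 := hC s (by simp; linarith)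
  rw [Real.rpow_zero, mul_one] at h2
  rw [LSeries_eq_charMean_add χ hN hs]
  have h3 : ‖charMean χ * s / (s - 1)‖ ≤ ‖charMean χ‖ * ‖s‖ := by
    rw [norm_div, norm_mul]
    exact div_le_self (by positivity) h1
  have h4 : ‖s * errorMellin χ s‖ ≤ ‖s‖ * C := by rw [norm_mul]; gcongr
  refine (norm_add_le _ _).trans ((add_le_add h3 h4).trans ?_)
  nlinarith [norm_nonneg s]

/-- The `3-4-1` inequality, made quantitative. -/
lemma exists_le_norm_LSeries_pow_four (χ : DirichletCharacter ℂ N) (hN : N ≠ 0) :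
    ∃ c : ℝ, 0 < c ∧ ∀ x y : ℝ, 0 < x → x ≤ 1 / 2 → 1 ≤ |y| →
      c * x ^ 3 / (1 + |y|) ≤ ‖LSeries (fun n => χ (n : ZMod N)) (1 + x + Complex.I * y)‖ ^ 4 := by
  obtain ⟨M, hM0, hM⟩ := exists_norm_LSeries_one_le hN
  obtain ⟨M', hM0', hM'⟩ := exists_norm_LSeries_le (χ ^ 2) hN
  refine ⟨1 / (M ^ 3 * (2 * M')), by positivity, fun x y hx hx2 hy => ?_⟩
  have h1 := DirichletCharacter.norm_LSeries_product_ge_one χ hx y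
  have h2 := hM x hx hx2
  have h3 := hM' (1 + x + 2 * Complex.I * y) (by simpa using hx) (by simp [abs_mul]; linarith)
  have h4 : ‖(1 + x + 2 * Complex.I * y : ℂ)‖ ≤ 2 * (1 + |y|) := by
    calc _ ≤ ‖((1 + x : ℝ) : ℂ)‖ + ‖2 * Complex.I * y‖ := by push_cast; exact norm_add_le _ _
      _ ≤ _ := by
        rw [Complex.norm_real, Real.norm_of_nonneg (by positivity)]
        simp
        linarith
  rw [norm_mul, norm_mul, norm_pow, norm_pow] at h1
  set a := ‖LSeries (fun n => χ (n : ZMod N)) (1 + x + Complex.I * y)‖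
  have h5 : 1 ≤ (M / x) ^ 3 * a ^ 4 * (M' * (2 * (1 + |y|))) := by
    refine h1.le.trans ?_
    gcongr
    exact h3.trans (by gcongr)
  have hT : 0 < 1 + |y| := by positivity
  rw [div_mul_eq_mul_div, one_mul, div_div, div_le_iff₀ (by positivity)]
  have : (M / x) ^ 3 * a ^ 4 * (M' * (2 * (1 + |y|))) =
      (a ^ 4 * (M ^ 3 * (2 * M') * (1 + |y|))) / x ^ 3 := by field_simp
  rw [this, le_div_iff₀ (by positivity)] at h5
  linarith

/-- A polynomial lower bound for `L`-functions just to the right of `Re s = 1`. The `3-4-1`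
inequality gives it at distance `≫ (1 + |Im s|) ^ (-9)` from the line, and the mean value inequality
carries it to the points closer to the line. The function `h` stands for `L(s, χ)`, or for
`(s - 1) ζ(s)` if `χ` is trivial. -/
lemma growthOn_inv_of_three_four_one (χ : DirichletCharacter ℂ N) (hN : N ≠ 0)
    (hd : DifferentiableOn ℂ h {s | 0 < s.re}) (hg : GrowthOn {s | 1 / 2 ≤ s.re} 2 h)
    (h0 : ∀ s : ℂ, 1 ≤ s.re → h s ≠ 0)
    (hL : ∀ s : ℂ, 1 < s.re → 1 ≤ |s.im| → ‖LSeries (fun n => χ (n : ZMod N)) s‖ ≤ ‖h s‖) :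
    GrowthOn {s | 1 < s.re ∧ s.re < 3 / 2} 7 (fun s => (h s)⁻¹) := by
  obtain ⟨c, hc0, hc⟩ := exists_le_norm_LSeries_pow_four χ hN
  -- a bound for the derivative
  have hder : ∃ D : ℝ, 1 ≤ D ∧ ∀ s : ℂ, 1 ≤ s.re → s.re ≤ 3 / 2 →
      ‖deriv h s‖ ≤ D * (1 + |s.im|) ^ 2 := by
    obtain ⟨C, hC⟩ := hg
    obtain ⟨-, hT⟩ := tameOn_of_bound (Ω := {s : ℂ | 1 ≤ s.re}) (Ω' := {s : ℂ | 1 / 2 ≤ s.re})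
      (r := 1 / 2) (by norm_num) (by norm_num)
      (hd.mono fun s hs => by
        have : 1 / 2 ≤ s.re := hs
        simp; linarith)
      (fun s hs z hz => by
        have h1 := Complex.abs_re_le_norm (z - s)
        rw [mem_closedBall_iff_norm] at hz
        have h2 := abs_le.1 (h1.trans hz)
        have : 1 ≤ s.re := hs
        simp only [Complex.sub_re] at h2
        simp only [Set.mem_ofPred_eq]; linarith) hC 1
    obtain ⟨D, hD⟩ := hT 1 le_rfl
    refine ⟨|D| * 9 + 1, by linarith [abs_nonneg D], fun s h1 h2 => ?_⟩
    have h3 := hD s h1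
    rw [iteratedDeriv_one] at h3
    refine h3.trans ?_
    have h4 : 1 + ‖s‖ ≤ 3 * (1 + |s.im|) := by
      have := Complex.norm_le_abs_re_add_abs_im s
      rw [abs_of_nonneg (by linarith : 0 ≤ s.re)] at this
      have := abs_nonneg s.im
      linarith
    have := norm_nonneg s
    calc D * (1 + ‖s‖) ^ (2 : ℝ) ≤ |D| * (3 * (1 + |s.im|)) ^ 2 := by
          rw [Real.rpow_two]; gcongr; exact le_abs_self D
      _ ≤ _ := by nlinarith [sq_nonneg (1 + |s.im|)]
  obtain ⟨D, hD1, hD⟩ := hder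
  -- chosen so that `(2 D δ) ^ 4 ≤ c δ ^ 3`
  set δ := min (1 / 2) (c / (16 * D ^ 4))
  have hD0 : 0 < D := by linarith
  have hδ : 0 < δ := by positivity
  have hδ2 : δ ≤ 1 / 2 := min_le_left _ _
  have hδc : (2 * D * δ) ^ 4 ≤ c * δ ^ 3 := by
    have : δ ≤ c / (16 * D ^ 4) := min_le_right _ _
    rw [le_div_iff₀ (by positivity)] at this
    calc (2 * D * δ) ^ 4 = (δ * (16 * D ^ 4)) * δ ^ 3 := by ring
      _ ≤ _ := by gcongr
  -- At distance at least `x₀ = δ / T ^ 9` from the line, where `T = 1 + |y|`, the `3-4-1`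
  -- inequality gives `|h| ≥ (c x₀ ^ 3 / T) ^ (1 / 4) ≥ 2 D δ / T ^ 7`. The derivative is at most
  -- `D T ^ 2`, so `h` changes by at most `D T ^ 2 x₀ = D δ / T ^ 7` between that point and the
  -- line.
  have hfar : ∀ x y : ℝ, x ≤ 1 / 2 → 1 ≤ |y| → δ / (1 + |y|) ^ 9 ≤ x →
      2 * D * δ / (1 + |y|) ^ 7 ≤ ‖h (1 + x + Complex.I * y)‖ := by
    intro x y hx2 hy hx
    have hT : 0 < 1 + |y| := by positivity
    have hx0 : 0 < x := lt_of_lt_of_le (by positivity) hx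
    have h1 := hc x y hx0 hx2 hy
    have h2 := hL (1 + x + Complex.I * y) (by simpa using hx0) (by simpa using hy)
    refine le_of_pow_le_pow_left₀ (n := 4) (by norm_num) (norm_nonneg _) ?_
    calc (2 * D * δ / (1 + |y|) ^ 7) ^ 4 = (2 * D * δ) ^ 4 / (1 + |y|) ^ 28 := by
          rw [div_pow, ← pow_mul]
      _ ≤ c * δ ^ 3 / (1 + |y|) ^ 28 := by gcongr
      _ = c * (δ / (1 + |y|) ^ 9) ^ 3 / (1 + |y|) := by field_simp
      _ ≤ c * x ^ 3 / (1 + |y|) := by gcongr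
      _ ≤ _ := h1.trans (by gcongr)
  have hnear : ∀ x y : ℝ, 0 < x → x ≤ 1 / 2 → 1 ≤ |y| →
      D * δ / (1 + |y|) ^ 7 ≤ ‖h (1 + x + Complex.I * y)‖ := by
    intro x y hx0 hx2 hy
    have hT : 1 ≤ 1 + |y| := by linarith
    have hT0 : 0 < 1 + |y| := by linarith
    rcases le_total (δ / (1 + |y|) ^ 9) x with hx | hx
    · refine le_trans ?_ (hfar x y hx2 hy hx)
      gcongr
      linarith
    · set x₀ := δ / (1 + |y|) ^ 9
      have hx₀ : x₀ ≤ 1 / 2 := (div_le_self hδ.le (one_le_pow₀ hT)).trans hδ2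
      have h1 := hfar x₀ y hx₀ hy le_rfl
      have h2 : ‖h (1 + x₀ + Complex.I * y) - h (1 + x + Complex.I * y)‖ ≤
          D * (1 + |y|) ^ 2 * ‖(1 + x₀ + Complex.I * y) - (1 + x + Complex.I * y)‖ := by
        refine Convex.norm_image_sub_le_of_norm_deriv_le
          (s := {s : ℂ | 1 ≤ s.re ∧ s.re ≤ 3 / 2 ∧ s.im = y}) (fun s hs => ?_)
            (fun s hs => ?_) ?_ ?_ ?_
        · refine hd.differentiableAt (isOpen_re_pos.mem_nhds ?_)
          have := hs.1
          simp only [Set.mem_ofPred_eq]; linarith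
        · rw [← hs.2.2]
          exact hD s hs.1 hs.2.1
        · have e : {s : ℂ | 1 ≤ s.re ∧ s.re ≤ 3 / 2 ∧ s.im = y} =
              {s : ℂ | 1 ≤ s.re} ∩ ({s : ℂ | s.re ≤ 3 / 2} ∩
                ({s : ℂ | s.im ≤ y} ∩ {s : ℂ | y ≤ s.im})) := by
            ext s
            simp [le_antisymm_iff]
          rw [e]
          exact (convex_halfSpace_re_ge 1).inter ((convex_halfSpace_re_le _).inter
            ((convex_halfSpace_im_le y).inter (convex_halfSpace_im_ge y)))
        · simp; exact ⟨hx0.le, by linarith⟩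
        · simp; exact ⟨hx0.le.trans hx, by linarith⟩
      have h3 : ‖(1 + x₀ + Complex.I * y : ℂ) - (1 + x + Complex.I * y)‖ ≤ x₀ := by
        rw [show (1 + x₀ + Complex.I * y : ℂ) - (1 + x + Complex.I * y) = ((x₀ - x : ℝ) : ℂ) by
          push_cast; ring, Complex.norm_real, Real.norm_of_nonneg (by linarith)]
        linarith
      have h4 : D * (1 + |y|) ^ 2 * x₀ = D * δ / (1 + |y|) ^ 7 := by
        simp only [x₀]; field_simp
      have h5 : ‖h (1 + x₀ + Complex.I * y)‖ ≤ ‖h (1 + x + Complex.I * y)‖ + D *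
          δ / (1 + |y|) ^ 7 := by
        have h6 := norm_add_le (h (1 + x + Complex.I * y))
          (h (1 + x₀ + Complex.I * y) - h (1 + x + Complex.I * y))
        rw [add_sub_cancel] at h6
        refine h6.trans (add_le_add le_rfl (h2.trans ?_))
        rw [← h4]
        gcongr
      have h6 : 2 * D * δ / (1 + |y|) ^ 7 = D * δ / (1 + |y|) ^ 7 + D * δ / (1 + |y|) ^ 7 := by ring
      linarith
  -- for `|Im s| ≤ 1` the inverse is bounded by compactness
  have hcpt : IsCompact (Set.Icc (1 : ℝ) (3 / 2) ×ℂ Set.Icc (-1 : ℝ) 1) :=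
    isCompact_Icc.reProdIm isCompact_Icc
  have hcont : ContinuousOn (fun s => (h s)⁻¹) (Set.Icc (1 : ℝ) (3 / 2) ×ℂ Set.Icc (-1 : ℝ) 1) := by
    refine ContinuousOn.inv₀ (hd.continuousOn.mono fun s hs => ?_) fun s hs => ?_
    · have := (Complex.mem_reProdIm.1 hs).1.1
      simp only [Set.mem_ofPred_eq]; linarith
    · exact h0 s (Complex.mem_reProdIm.1 hs).1.1
  obtain ⟨E, hE⟩ := hcpt.exists_bound_of_continuousOn hcont
  refine ⟨max E (1 / (D * δ)), fun s hs => ?_⟩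
  have hs1 := one_add_norm_pos s
  have hpow : 1 ≤ (1 + ‖s‖) ^ (7 : ℝ) :=
    Real.one_le_rpow (by linarith [norm_nonneg s]) (by norm_num)
  rcases le_total 1 |s.im| with hi | hi
  · have hse : s = 1 + ((s.re - 1 : ℝ) : ℂ) + Complex.I * s.im := by
      apply Complex.ext <;> simp
    have h1 := hnear (s.re - 1) s.im (by linarith [hs.1]) (by linarith [hs.2]) hi
    rw [← hse] at h1
    have hT0 : 0 < 1 + |s.im| := by positivity
    rw [norm_inv]
    calc ‖h s‖⁻¹ ≤ (D * δ / (1 + |s.im|) ^ 7)⁻¹ := by gcongr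
      _ = 1 / (D * δ) * (1 + |s.im|) ^ 7 := by rw [inv_div]; ring
      _ ≤ 1 / (D * δ) * (1 + ‖s‖) ^ (7 : ℝ) := by
        rw [show (7 : ℝ) = ((7 : ℕ) : ℝ) by norm_num, Real.rpow_natCast]
        gcongr
        exact Complex.abs_im_le_norm s
      _ ≤ _ := by gcongr; exact le_max_right _ _
  · have h1 := hE s (Complex.mem_reProdIm.2 ⟨⟨hs.1.le, hs.2.le⟩, abs_le.1 hi⟩)
    calc _ ≤ max E (1 / (D * δ)) * 1 := by rw [mul_one]; exact h1.trans (le_max_left _ _)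
      _ ≤ _ := by gcongr

/-- The shifted function `h(s + 1)` is tame on the strip. -/
lemma polyTameOn_shift (hd : DifferentiableOn ℂ h {s | 0 < s.re})
    (hg : GrowthOn {s | 1 / 2 ≤ s.re} 2 h) : PolyTameOn strip (fun s => h (s + 1)) := fun n => by
  refine ⟨2, tameOn_strip_of_growthOn ?_ ?_ n⟩
  · refine hd.comp (by fun_prop) fun s hs => ?_
    have := hs.1
    simp only [Set.mem_ofPred_eq, Complex.add_re, Complex.one_re]
    linarith
  · have := hg.comp_affine one_ne_zero 1 (T := {s : ℂ | -(1 / 4) ≤ s.re ∧ s.re ≤ 3 / 4})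
      (fun s hs => by
      have : -(1 / 4) ≤ s.re := hs.1
      simp only [one_mul, Set.mem_ofPred_eq, Complex.add_re, Complex.one_re]; linarith)
    simpa only [one_mul] using this

lemma polyTameOn_shift_inv (hd : DifferentiableOn ℂ h {s | 0 < s.re})
    (hg : GrowthOn {s | 1 / 2 ≤ s.re} 2 h) (h0 : ∀ s : ℂ, 1 ≤ s.re → h s ≠ 0)
    (hi : GrowthOn {s | 1 < s.re ∧ s.re < 3 / 2} 7 (fun s => (h s)⁻¹)) :
    PolyTameOn strip (fun s => (h (s + 1))⁻¹) := by
  obtain ⟨C, hC⟩ := hi.comp_affine one_ne_zero 1 (T := strip) (fun s hs => by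
      have h1 : 0 < s.re := hs.1
      have h2 : s.re < 1 / 2 := hs.2
      simp only [one_mul, Set.mem_ofPred_eq, Complex.add_re, Complex.one_re]
      constructor <;> linarith)
  simp only [one_mul] at hC
  refine (polyTameOn_shift hd hg).inv isOpen_strip (fun s hs => h0 _ ?_) hC
  have h1 : 0 < s.re := hs.1
  simp only [Complex.add_re, Complex.one_re]; linarith

lemma growthOn_LFunction_inv [NeZero N] {χ : DirichletCharacter ℂ N} (hχ : χ ≠ 1) :
    GrowthOn {s | 1 < s.re ∧ s.re < 3 / 2} 7 (fun s => (χ.LFunction s)⁻¹) := by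
  refine growthOn_inv_of_three_four_one χ (NeZero.ne N)
    (DirichletCharacter.differentiable_LFunction hχ).differentiableOn
    ((growthOn_LFunction hχ).mono_exponent (by norm_num))
    (fun s hs => DirichletCharacter.LFunction_ne_zero_of_one_le_re χ (Or.inl hχ) hs) fun s hs _ => ?_
  rw [DirichletCharacter.LFunction_eq_LSeries χ hs]

lemma riemannZeta₁_ne_zero {s : ℂ} (hs : 1 ≤ s.re) : riemannZeta₁ s ≠ 0 := by
  rcases eq_or_ne s 1 with rfl | h1
  · simp
  · rw [riemannZeta₁_eq_mul h1]
    exact mul_ne_zero (sub_ne_zero.2 h1) (riemannZeta_ne_zero_of_one_le_re hs)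

lemma growthOn_riemannZeta₁_inv :
    GrowthOn {s | 1 < s.re ∧ s.re < 3 / 2} 7 (fun s => (riemannZeta₁ s)⁻¹) := by
  refine growthOn_inv_of_three_four_one (1 : DirichletCharacter ℂ 1) one_ne_zero
    differentiable_riemannZeta₁.differentiableOn growthOn_riemannZeta₁
    (fun s hs => riemannZeta₁_ne_zero hs) fun s hs hi => ?_
  have hs1 : s ≠ 1 := fun h => by simp [h] at hs
  rw [riemannZeta₁_eq_mul hs1, ← DirichletCharacter.LFunction_eq_LSeries _ hs,
    DirichletCharacter.LFunction_modOne_eq, norm_mul]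
  have h1 : 1 ≤ ‖s - 1‖ := hi.trans (by simpa using Complex.abs_im_le_norm (s - 1))
  exact le_mul_of_one_le_left (norm_nonneg _) h1

/-! ### Square roots of Euler products -/

section LogSum

variable {ι : Type*} {P : ι → ℕ} {a : ι → ℂ}

lemma norm_mul_cpow_neg_le {p : ℕ} (hp : 2 ≤ p) {z : ℂ} (hz : ‖z‖ ≤ 1) {σ : ℝ} {s : ℂ}
    (hs : σ ≤ s.re) : ‖z * (p : ℂ) ^ (-s)‖ ≤ (p : ℝ) ^ (-σ) := by
  have hp0 : (0 : ℝ) < p := by exact_mod_cast (by omega : 0 < p)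
  rw [norm_mul, show (p : ℂ) = ((p : ℝ) : ℂ) by push_cast; rfl,
    Complex.norm_cpow_eq_rpow_re_of_pos hp0, Complex.neg_re]
  have h1 : (p : ℝ) ^ (-s.re) ≤ (p : ℝ) ^ (-σ) :=
    Real.rpow_le_rpow_of_exponent_le (by exact_mod_cast (by omega : 1 ≤ p)) (by linarith)
  calc _ ≤ 1 * (p : ℝ) ^ (-s.re) := by gcongr
    _ ≤ _ := by rw [one_mul]; exact h1

lemma rpow_neg_le_half {p : ℕ} (hp : 2 ≤ p) {σ : ℝ} (hσ : 1 ≤ σ) : (p : ℝ) ^ (-σ) ≤ 1 / 2 := by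
  have hp1 : (2 : ℝ) ≤ p := by exact_mod_cast hp
  calc (p : ℝ) ^ (-σ) ≤ (p : ℝ) ^ (-1 : ℝ) :=
        Real.rpow_le_rpow_of_exponent_le (by linarith) (by linarith)
    _ ≤ 1 / 2 := by
        rw [Real.rpow_neg_one, one_div]
        exact inv_anti₀ two_pos hp1

lemma norm_log_one_sub_le {p : ℕ} (hp : 2 ≤ p) {z : ℂ} (hz : ‖z‖ ≤ 1) {σ : ℝ} (hσ : 1 ≤ σ) {s : ℂ}
    (hs : σ ≤ s.re) : ‖Complex.log (1 - z * (p : ℂ) ^ (-s))‖ ≤ 3 / 2 * (p : ℝ) ^ (-σ) := by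
  have h1 := norm_mul_cpow_neg_le hp hz hs
  have h2 := rpow_neg_le_half hp hσ
  have h3 := Complex.norm_log_one_add_half_le_self (z := -(z * (p : ℂ) ^ (-s)))
    (by rw [norm_neg]; linarith)
  rw [norm_neg, ← sub_eq_add_neg] at h3
  linarith

lemma one_sub_mem_slitPlane {p : ℕ} (hp : 2 ≤ p) {z : ℂ} (hz : ‖z‖ ≤ 1) {s : ℂ}
    (hs : 1 ≤ s.re) : 1 - z * (p : ℂ) ^ (-s) ∈ Complex.slitPlane := by
  rw [sub_eq_add_neg]
  refine Complex.mem_slitPlane_of_norm_lt_one ?_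
  rw [norm_neg]
  have h1 := norm_mul_cpow_neg_le hp hz hs
  have h2 := rpow_neg_le_half hp (le_refl (1 : ℝ))
  linarith

lemma summable_rpow_neg (hP : Function.Injective P) {σ : ℝ} (hσ : 1 < σ) :
    Summable (fun i => ((P i : ℕ) : ℝ) ^ (-σ)) :=
  (Real.summable_nat_rpow.2 (by linarith : -σ < -1)).comp_injective hP

lemma summable_log_one_sub (hP : Function.Injective P) (hP2 : ∀ i, 2 ≤ P i) (ha : ∀ i, ‖a i‖ ≤ 1)
    {s : ℂ} (hs : 1 < s.re) : Summable (fun i => Complex.log (1 - a i * (P i : ℂ) ^ (-s))) :=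
  Summable.of_norm_bounded ((summable_rpow_neg hP hs).mul_left (3 / 2)) fun i =>
    norm_log_one_sub_le (hP2 i) (ha i) hs.le le_rfl

lemma differentiableOn_tsum_log_one_sub (hP : Function.Injective P) (hP2 : ∀ i, 2 ≤ P i)
    (ha : ∀ i, ‖a i‖ ≤ 1) :
    DifferentiableOn ℂ (fun s => ∑' i,
      Complex.log (1 - a i * (P i : ℂ) ^ (-s))) {s : ℂ | 1 < s.re} := by
  intro s hs
  have hs : 1 < s.re := hs
  set σ := (1 + s.re) / 2
  have hσ : 1 < σ := by simp only [σ]; linarith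
  have hU : IsOpen {z : ℂ | σ < z.re} := isOpen_lt continuous_const Complex.continuous_re
  have hd := Complex.differentiableOn_tsum_of_summable_norm ((summable_rpow_neg hP hσ).mul_left (3 / 2))
    (F := fun i s => Complex.log (1 - a i * (P i : ℂ) ^ (-s))) (U := {z : ℂ | σ < z.re})
    (fun i z hz => ?_) hU fun i w hw => norm_log_one_sub_le (hP2 i) (ha i) hσ.le (le_of_lt hw)
  · exact (hd.differentiableAt (hU.mem_nhds (by simp [σ]; linarith))).differentiableWithinAt
  · refine DifferentiableAt.differentiableWithinAt ?_
    have hp : (P i : ℂ) ≠ 0 := by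
      have := hP2 i
      exact_mod_cast (by omega : P i ≠ 0)
    refine DifferentiableAt.clog ?_ (one_sub_mem_slitPlane (hP2 i) (ha i)
      (hσ.le.trans (le_of_lt hz)))
    exact ((differentiableAt_id.neg.const_cpow (Or.inl hp)).const_mul (a i)).const_sub 1

/-- A bound that is uniform on a closed half-plane to the right of `Re s = 1`. -/
lemma norm_tsum_log_one_sub_le (hP : Function.Injective P) (hP2 : ∀ i, 2 ≤ P i)
    (ha : ∀ i, ‖a i‖ ≤ 1) {σ : ℝ} (hσ : 1 < σ) {s : ℂ} (hs : σ ≤ s.re) :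
    ‖∑' i, Complex.log (1 - a i * (P i : ℂ) ^ (-s))‖ ≤ ∑' i, 3 / 2 * ((P i : ℕ) : ℝ) ^ (-σ) :=
  tsum_of_norm_bounded ((summable_rpow_neg hP hσ).mul_left (3 / 2)).hasSum fun i =>
    norm_log_one_sub_le (hP2 i) (ha i) hσ.le hs

lemma tprod_one_sub_cpow (hP : Function.Injective P) (hP2 : ∀ i, 2 ≤ P i) (ha : ∀ i, ‖a i‖ ≤ 1)
    {s : ℂ} (hs : 1 < s.re) (r : ℂ) :
    ∏' i, (1 - a i * (P i : ℂ) ^ (-s)) ^ r =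
      Complex.exp (r * ∑' i, Complex.log (1 - a i * (P i : ℂ) ^ (-s))) := by
  have h := ((summable_log_one_sub hP hP2 ha hs).hasSum.mul_left r).cexp.tprod_eq
  rw [← h]
  refine tprod_congr fun i => ?_
  rw [Complex.cpow_def_of_ne_zero (Complex.slitPlane_ne_zero
    (one_sub_mem_slitPlane (hP2 i) (ha i) hs.le)), mul_comm]
  rfl

end LogSum

/-- The branch of `L(s, χ) ^ (1 / 2)` on `Re s > 1` that tends to `1` as `s → ∞`. -/
def sqrtSeries (χ : DirichletCharacter ℂ N) (s : ℂ) : ℂ :=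
  Complex.exp ((1 / 2) *
    ∑' p : Nat.Primes, -Complex.log (1 - χ ((p : ℕ) : ZMod N) * ((p : ℕ) : ℂ) ^ (-s)))

/-- The exponential of the sum of the logarithms of the Euler factors is the Euler product. -/
lemma sqrtSeries_sq (χ : DirichletCharacter ℂ N) {s : ℂ} (hs : 1 < s.re) :
    sqrtSeries χ s ^ 2 = LSeries (fun n => χ (n : ZMod N)) s := by
  rw [← DirichletCharacter.LSeries_eulerProduct_exp_log χ hs, sqrtSeries, ← Complex.exp_nat_mul]
  congr 1
  push_cast
  ring

lemma sqrtSeries_ne_zero (χ : DirichletCharacter ℂ N) (s : ℂ) : sqrtSeries χ s ≠ 0 :=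
  Complex.exp_ne_zero _

lemma injective_coe_primes : Function.Injective (fun p : Nat.Primes => (p : ℕ)) :=
  Subtype.val_injective

lemma injective_coe_primesThree : Function.Injective (fun p : PrimesThree => (p : ℕ)) :=
  Subtype.val_injective

lemma differentiableOn_sqrtSeries (χ : DirichletCharacter ℂ N) :
    DifferentiableOn ℂ (sqrtSeries χ) {s | 1 < s.re} := by
  unfold sqrtSeries
  simp_rw [tsum_neg]
  exact ((differentiableOn_tsum_log_one_sub injective_coe_primes (fun p => p.2.two_le)
    (fun p => χ.norm_le_one _)).neg.const_mul _).cexp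

/-- The factor `∏ (1 - χ(p) ^ 2 p ^ (-2 s - 2)) ^ (-1 / 2)` over the primes `p ≡ 3` modulo `4`. -/
def factorThree (χ : DirichletCharacter ℂ N) (s : ℂ) : ℂ :=
  Complex.exp (-(1 / 2) * ∑' p : PrimesThree,
    Complex.log (1 - χ ((p : ℕ) : ZMod N) ^ 2 * ((p : ℕ) : ℂ) ^ (-(2 * (s + 1)))))

lemma norm_char_sq_le (χ : DirichletCharacter ℂ N) (a : ZMod N) : ‖χ a ^ 2‖ ≤ 1 := by
  rw [norm_pow]; exact pow_le_one₀ (norm_nonneg _) (χ.norm_le_one _)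

lemma re_two_mul_add_one (s : ℂ) : (2 * (s + 1)).re = 2 * (s.re + 1) := by simp

/-- The product over `p ≡ 3` modulo `4` of principal powers, written as the exponential of a sum of
logarithms. -/
lemma tprod_eq_factorThree (χ : DirichletCharacter ℂ N) {s : ℂ} (hs : -(1 / 2) < s.re) :
    ∏' p : PrimesThree, (1 - χ ((p : ℕ) : ZMod N) ^ 2 * ((p : ℕ) : ℂ) ^ (-(2 * (s + 1)))) ^
      (-(1 / 2) : ℂ) = factorThree χ s :=
  tprod_one_sub_cpow (P := fun p : PrimesThree => (p : ℕ)) injective_coe_primesThree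
    (fun p => p.2.1.two_le) (fun p => norm_char_sq_le χ _)
    (by rw [re_two_mul_add_one]; linarith) _

lemma differentiableOn_factorThree (χ : DirichletCharacter ℂ N) :
    DifferentiableOn ℂ (factorThree χ) {s | -(1 / 2) < s.re} := by
  have h := (differentiableOn_tsum_log_one_sub injective_coe_primesThree (fun p => p.2.1.two_le)
    (fun p => norm_char_sq_le χ ((p : ℕ) : ZMod N)))
  refine ((h.comp (g := fun s : ℂ => _) (f := fun s : ℂ => 2 * (s + 1)) (by fun_prop)
    fun s hs => ?_).const_mul (-(1 / 2))).cexp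
  have hs : -(1 / 2) < s.re := hs
  simp only [Set.mem_ofPred_eq, re_two_mul_add_one]
  linarith

lemma growthOn_factorThree (χ : DirichletCharacter ℂ N) :
    GrowthOn {s | -(1 / 4) ≤ s.re} 0 (factorThree χ) := by
  refine ⟨Real.exp (1 / 2 * ∑' p : PrimesThree, 3 / 2 * ((p : ℕ) : ℝ) ^ (-(3 / 2 : ℝ))),
    fun s hs => ?_⟩
  have hs : -(1 / 4) ≤ s.re := hs
  rw [Real.rpow_zero, mul_one, factorThree]
  refine (Complex.norm_exp_le_exp_norm _).trans (Real.exp_le_exp.2 ?_)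
  rw [norm_mul]
  have := norm_tsum_log_one_sub_le injective_coe_primesThree (fun p => p.2.1.two_le)
    (fun p => norm_char_sq_le χ ((p : ℕ) : ZMod N)) (σ := 3 / 2) (by norm_num) (s := 2 * (s + 1))
    (by rw [re_two_mul_add_one]; linarith)
  have h2 : ‖(-(1 / 2) : ℂ)‖ = 1 / 2 := by norm_num
  rw [h2]
  gcongr

lemma polyTameOn_factorThree (χ : DirichletCharacter ℂ N) : PolyTameOn strip (factorThree χ) :=
  fun n => ⟨0, tameOn_strip_of_growthOn
    ((differentiableOn_factorThree χ).mono fun s hs => by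
      have := hs.1; simp only [Set.mem_ofPred_eq]; linarith)
    ((growthOn_factorThree χ).mono_set fun s hs => hs.1) n⟩

/-- The Dirichlet series `∑ χ(d) d ^ (-s - 1)` over the `d` without prime factors congruent to `1`
modulo `4`. -/
def restrictedSeries (χ : DirichletCharacter ℂ N) (s : ℂ) : ℂ :=
  LSeries (fun d => χ (d : ZMod N) * restrictedInv d) s

lemma norm_char_mul_restrictedInv_le (χ : DirichletCharacter ℂ N) (d : ℕ) :
    ‖χ (d : ZMod N) * restrictedInv d‖ ≤ 1 / d := by
  rw [norm_mul, Complex.norm_real, Real.norm_of_nonneg (restrictedInv_nonneg d)]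
  calc _ ≤ 1 * restrictedInv d := by
        gcongr
        · exact restrictedInv_nonneg d
        · exact χ.norm_le_one _
    _ ≤ _ := by rw [one_mul]; exact restrictedInv_le d

lemma norm_term_restrictedSeries_le (χ : DirichletCharacter ℂ N) {σ : ℝ} {s : ℂ} (hs : σ ≤ s.re)
    (d : ℕ) : ‖LSeries.term (fun d => χ (d : ZMod N) * restrictedInv d) s d‖ ≤
      (d : ℝ) ^ (-(1 + σ)) := by
  rcases eq_or_ne d 0 with rfl | hd
  · simp only [LSeries.term_zero, norm_zero]; positivity
  · have hd1 : (1 : ℝ) ≤ d := by exact_mod_cast Nat.one_le_iff_ne_zero.2 hd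
    have hd0 : (0 : ℝ) < d := by linarith
    rw [LSeries.norm_term_eq, if_neg hd]
    calc _ ≤ 1 / (d : ℝ) / (d : ℝ) ^ σ := by
          gcongr
          exact norm_char_mul_restrictedInv_le χ d
      _ = _ := by rw [Real.rpow_neg hd0.le, Real.rpow_add hd0, Real.rpow_one]; field_simp

lemma summable_restrictedSeries (χ : DirichletCharacter ℂ N) {s : ℂ} (hs : 0 < s.re) :
    LSeriesSummable (fun d => χ (d : ZMod N) * restrictedInv d) s :=
  Summable.of_norm_bounded (Real.summable_nat_rpow.2 (by linarith))
    (norm_term_restrictedSeries_le χ le_rfl)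

lemma differentiableOn_restrictedSeries (χ : DirichletCharacter ℂ N) :
    DifferentiableOn ℂ (restrictedSeries χ) {s | 0 < s.re} := by
  intro s hs
  have hs : 0 < s.re := hs
  have habs : LSeries.abscissaOfAbsConv (fun d => χ (d : ZMod N) * restrictedInv d) ≤
      ((s.re / 2 : ℝ) : EReal) := by
    have := (summable_restrictedSeries χ (s := ((s.re / 2 : ℝ) : ℂ))
        (by simp; linarith)).abscissaOfAbsConv_le
    simpa using this
  refine ((LSeries_hasDerivAt (habs.trans_lt ?_)).differentiableAt).differentiableWithinAt
  exact_mod_cast (by linarith : s.re / 2 < s.re)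

lemma growthOn_restrictedSeries (χ : DirichletCharacter ℂ N) {σ : ℝ} (hσ : 0 < σ) :
    GrowthOn {s | σ ≤ s.re} 0 (restrictedSeries χ) := by
  refine ⟨∑' d : ℕ, (d : ℝ) ^ (-(1 + σ)), fun s hs => ?_⟩
  rw [Real.rpow_zero, mul_one, restrictedSeries, LSeries]
  exact tsum_of_norm_bounded (Real.summable_nat_rpow.2 (by linarith)).hasSum
    (norm_term_restrictedSeries_le χ hs)

/-- The summands of `restrictedSeries` as a completely multiplicative function. -/
def restrictedHom (χ : DirichletCharacter ℂ N) (s : ℂ) : ℕ →*₀ ℂ where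
  toFun d := χ (d : ZMod N) * restrictedInv d * (d : ℂ) ^ (-s)
  map_zero' := by simp
  map_one' := by simp
  map_mul' m n := by
    push_cast
    rw [map_mul, map_mul, Complex.natCast_mul_natCast_cpow]
    push_cast
    ring

/-- The Euler product of the restricted series, in logarithmic form. -/
lemma restrictedSeries_eq_exp (χ : DirichletCharacter ℂ N) {s : ℂ} (hs : 0 < s.re) :
    restrictedSeries χ s = Complex.exp (∑' p : Nat.Primes,
      -Complex.log (1 - restrictedHom χ s p)) := by
  have hf : ∀ d : ℕ, LSeries.term (fun d => χ (d : ZMod N) * restrictedInv d) s d =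
      restrictedHom χ s d := by
    intro d
    rcases eq_or_ne d 0 with rfl | hd
    · simp
    · rw [LSeries.term_of_ne_zero hd]
      simp [restrictedHom, Complex.cpow_neg, div_eq_mul_inv]
  have hsum : Summable (fun d => ‖restrictedHom χ s d‖) := by
    have := (summable_restrictedSeries χ hs).norm
    simpa only [hf] using this
  rw [EulerProduct.exp_tsum_primes_log_eq_tsum hsum, restrictedSeries, LSeries]
  exact tsum_congr hf

/-- The character `ψ` behaves like `χ χ₄` at all primes. The moduli are left free, so that `χ = 1`
modulo `1`, `ψ = χ₄` is an instance as well as `ψ = mulChiFour χ`. -/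
def IsTwistByFour (χ : DirichletCharacter ℂ N) (ψ : DirichletCharacter ℂ N') : Prop :=
  ∀ p : ℕ, p.Prime → ψ (p : ZMod N') =
    if p % 4 = 1 then χ (p : ZMod N) else if p % 4 = 3 then -χ (p : ZMod N) else 0

/-- The Euler product for the restricted series, in terms of the square roots of `L(s + 1, χ)` and
`L(s + 1, χ χ₄)`. In the ratio of the square roots the primes `p ≡ 1` cancel, a prime `p ≡ 3`
contributes `((1 + z) / (1 - z)) ^ (1 / 2) = (1 - z ^ 2) ^ (1 / 2) / (1 - z)` with
`z = χ(p) p ^ (-s - 1)` (`factorThree` cancels the numerator), and `2` contributes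
`(1 - z) ^ (-1 / 2)`. -/
lemma restrictedSeries_eq {χ : DirichletCharacter ℂ N} {ψ : DirichletCharacter ℂ N'}
    (hψ : IsTwistByFour χ ψ) {s : ℂ} (hs : 0 < s.re) :
    restrictedSeries χ s = sqrtSeries χ (s + 1) * (sqrtSeries ψ (s + 1))⁻¹ *
      (1 - χ 2 * (2 : ℂ) ^ (-(s + 1))) ^ (-(1 / 2) : ℂ) * factorThree χ s := by
  have hs1 : 1 < (s + 1).re := by simp; linarith
  have hA := restrictedSeries_eq_exp χ hs
  set z : Nat.Primes → ℂ := fun p => χ ((p : ℕ) : ZMod N) * ((p : ℕ) : ℂ) ^ (-(s + 1))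
  set w : Nat.Primes → ℂ := fun p => ψ ((p : ℕ) : ZMod N') * ((p : ℕ) : ℂ) ^ (-(s + 1))
  have hSz : Summable (fun p => Complex.log (1 - z p)) :=
    summable_log_one_sub injective_coe_primes (fun p => p.2.two_le) (fun p => χ.norm_le_one _) hs1
  have hSw : Summable (fun p => Complex.log (1 - w p)) :=
    summable_log_one_sub injective_coe_primes (fun p => p.2.two_le) (fun p => ψ.norm_le_one _) hs1
  set P2 : Nat.Primes := ⟨2, Nat.prime_two⟩
  set u2 : Nat.Primes → ℂ := fun p => if p = P2 then Complex.log (1 - z p) else 0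
  set u3 : Nat.Primes → ℂ := fun p => if (p : ℕ) % 4 = 3 then Complex.log (1 - z p ^ 2) else 0
  have hz2 : ∀ p : Nat.Primes, z p ^ 2 =
      χ ((p : ℕ) : ZMod N) ^ 2 * ((p : ℕ) : ℂ) ^ (-(2 * (s + 1))) := by
    intro p
    simp only [z]
    rw [mul_pow, ← Complex.cpow_nat_mul]
    congr 2
    push_cast; ring
  have hu2 : HasSum u2 (Complex.log (1 - z P2)) := by
    have := hasSum_ite_eq P2 (Complex.log (1 - z P2))
    refine this.congr_fun fun p => ?_
    simp only [u2]
    split_ifs with h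
    · rw [h]
    · rfl
  set j : PrimesThree → Nat.Primes := fun p => ⟨p, p.2.1⟩
  have hj : Function.Injective j := fun p q h =>
      Subtype.ext (congrArg (fun r : Nat.Primes => (r : ℕ)) h)
  have hS3 : Summable (fun p : PrimesThree => Complex.log (1 - χ ((p : ℕ) : ZMod N) ^ 2 *
      ((p : ℕ) : ℂ) ^ (-(2 * (s + 1))))) :=
    summable_log_one_sub injective_coe_primesThree (fun p => p.2.1.two_le)
      (fun p => norm_char_sq_le χ _) (by rw [re_two_mul_add_one]; linarith)
  have hu3 : HasSum u3 (∑' p : PrimesThree, Complex.log (1 - χ ((p : ℕ) : ZMod N) ^ 2 *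
      ((p : ℕ) : ℂ) ^ (-(2 * (s + 1))))) := by
    refine (hj.hasSum_iff ?_).1 ?_
    · intro p hp
      refine if_neg fun h3 => hp ⟨⟨p, p.2, h3⟩, rfl⟩
    · refine hS3.hasSum.congr_fun fun p => ?_
      have h3 : ((j p : Nat.Primes) : ℕ) % 4 = 3 := p.2.2
      simp only [u3, Function.comp, if_pos h3, hz2]
      rfl
  -- the identity of Euler factors, in logarithmic form
  have hlocal : ∀ p : Nat.Primes, -Complex.log (1 - restrictedHom χ s p) =
      1 / 2 * -Complex.log (1 - z p) + -(1 / 2 * -Complex.log (1 - w p)) + -(1 / 2) * u2 p +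
        -(1 / 2) * u3 p := by
    intro p
    have hp0 : ((p : ℕ) : ℂ) ≠ 0 := by exact_mod_cast p.2.ne_zero
    have hne : (p : ℕ) % 4 ≠ 1 → restrictedHom χ s p = z p := by
      intro h
      simp only [restrictedHom, z, MonoidWithZeroHom.coe_mk, ZeroHom.coe_mk]
      rw [restrictedInv_prime_of_ne p.2 h, neg_add, Complex.cpow_add _ _ hp0, Complex.cpow_neg_one]
      push_cast
      ring
    have hψp := hψ p p.2
    rcases p.2.eq_two_or_odd with h2 | hodd
    · have hpP : p = P2 := Subtype.ext h2
      have h4 : (p : ℕ) % 4 = 2 := by rw [h2]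
      have hw : w p = 0 := by
        simp only [w]; rw [hψp]; simp [h4]
      rw [hne (by omega), hw]
      simp only [u2, u3, if_pos hpP, h4]
      norm_num
      ring
    · have hpP : p ≠ P2 := fun h => by
        rw [h] at hodd; simp [P2] at hodd
      have h13 : (p : ℕ) % 4 = 1 ∨ (p : ℕ) % 4 = 3 := by omega
      rcases h13 with h1 | h3
      · have hw : w p = z p := by
          simp only [w, z]; rw [hψp, if_pos h1]
        have h0 : restrictedHom χ s p = 0 := by
          simp [restrictedHom, restrictedInv_prime_of_eq p.2 h1]
        rw [h0, hw]
        simp [u2, u3, if_neg hpP, h1]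
      · have hw : w p = -z p := by
          simp only [w, z]; rw [hψp, if_neg (by omega), if_pos h3]; ring
        have hz1 : ‖z p‖ < 1 := by
          have h5 := norm_mul_cpow_neg_le p.2.two_le (χ.norm_le_one ((p : ℕ) : ZMod N)) hs1.le
          have h6 := rpow_neg_le_half p.2.two_le (le_refl (1 : ℝ))
          exact (h5.trans h6).trans_lt (by norm_num)
        -- both factors have positive real part, so the principal logarithms add up
        have hlog : Complex.log (1 - z p ^ 2) = Complex.log (1 - z p) + Complex.log (1 + z p) := by
          have a1 := Complex.mem_slitPlane_of_norm_lt_one (z := -z p) (by rwa [norm_neg])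
          have a2 := Complex.mem_slitPlane_of_norm_lt_one hz1
          rw [← sub_eq_add_neg] at a1
          have b1 : |(1 - z p).arg| < Real.pi / 2 := by
            rw [Complex.abs_arg_lt_pi_div_two_iff]
            left
            have := (Complex.re_le_norm (z p)).trans_lt hz1
            simp; exact this
          have b2 : |(1 + z p).arg| < Real.pi / 2 := by
            rw [Complex.abs_arg_lt_pi_div_two_iff]
            left
            have := (Complex.abs_re_le_norm (z p)).trans_lt hz1
            rw [abs_lt] at this
            simp; linarith [this.1]
          rw [abs_lt] at b1 b2
          rw [← Complex.log_mul (Complex.slitPlane_ne_zero a1) (Complex.slitPlane_ne_zero a2)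
            ⟨by linarith, by linarith⟩]
          congr 1; ring
        rw [hne (by omega), hw]
        simp only [u2, u3, if_neg hpP, if_pos h3, hlog, sub_neg_eq_add]
        ring
  have hT := (((hSz.hasSum.neg.mul_left (1 / 2)).add
    (hSw.hasSum.neg.mul_left (1 / 2)).neg).add (hu2.mul_left (-(1 / 2)))).add
    (hu3.mul_left (-(1 / 2)))
  rw [hA, tsum_congr hlocal, hT.tsum_eq, Complex.exp_add, Complex.exp_add, Complex.exp_add,
    Complex.exp_neg, sqrtSeries, sqrtSeries, tsum_neg, tsum_neg]
  congr 2
  have h2ne : 1 - z P2 ≠ 0 := Complex.slitPlane_ne_zero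
    (one_sub_mem_slitPlane le_rfl (χ.norm_le_one _) hs1.le)
  have hzP : z P2 = χ 2 * (2 : ℂ) ^ (-(s + 1)) := by simp [z, P2]
  rw [← hzP, Complex.cpow_def_of_ne_zero h2ne, mul_comm]

/-! ### Tameness of the factors of the Dirichlet series -/

lemma chiFour_natCast (n : ℕ) : chiFour (n : ZMod 4) =
    if n % 4 = 1 then 1 else if n % 4 = 3 then -1 else 0 := by
  have h := ZMod.χ₄_nat_eq_if_mod_four n
  simp only [chiFour, MulChar.ringHomComp_apply, h]
  have : n % 4 < 4 := Nat.mod_lt _ (by norm_num)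
  split_ifs <;> simp <;> omega

lemma chiFour_ne_one : chiFour ≠ 1 := by
  intro h
  have h3 := chiFour_natCast 3
  rw [h, MulChar.one_apply (by decide)] at h3
  norm_num at h3

lemma isTwistByFour_chiFour : IsTwistByFour (1 : DirichletCharacter ℂ 1) chiFour := by
  intro p _
  rw [chiFour_natCast, MulChar.one_apply (isUnit_of_subsingleton _)]

lemma mulChiFour_natCast {q : ℕ} (χ : DirichletCharacter ℂ q) (n : ℕ) :
    mulChiFour χ (n : ZMod (4 * q)) = χ (n : ZMod q) * chiFour (n : ZMod 4) := by
  rw [mulChiFour, MulChar.mul_apply]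
  by_cases hn : IsUnit (n : ZMod (4 * q))
  · have hc : IsCoprime (n : ℤ) ((4 * q : ℕ) : ℤ) :=
      Nat.isCoprime_iff_coprime.2 ((ZMod.isUnit_iff_coprime n (4 * q)).1 hn)
    have e1 := DirichletCharacter.changeLevel_eq_cast_of_dvd' χ (dvd_mul_left q 4) hc
    have e2 := DirichletCharacter.changeLevel_eq_cast_of_dvd' chiFour (dvd_mul_right 4 q) hc
    simp only [Int.cast_natCast] at e1 e2
    rw [e1, e2]
  · rw [MulChar.map_nonunit _ hn, zero_mul]
    rw [ZMod.isUnit_iff_coprime, Nat.coprime_mul_iff_right, not_and_or, ← ZMod.isUnit_iff_coprime,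
      ← ZMod.isUnit_iff_coprime] at hn
    rcases hn with h | h
    · rw [MulChar.map_nonunit chiFour h, mul_zero]
    · rw [MulChar.map_nonunit χ h, zero_mul]

lemma isTwistByFour_mulChiFour {q : ℕ} (χ : DirichletCharacter ℂ q) :
    IsTwistByFour χ (mulChiFour χ) := by
  intro p _
  rw [mulChiFour_natCast, chiFour_natCast]
  split_ifs <;> simp

lemma mulChiFour_ne_one {q : ℕ} (hq : Nat.Coprime 4 q) (χ : DirichletCharacter ℂ q) :
    mulChiFour χ ≠ 1 := by
  intro h
  obtain ⟨n, h1, h2⟩ := Nat.chineseRemainder hq 3 1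
  have h3 := mulChiFour_natCast χ n
  have h4 : ((n : ℕ) : ZMod 4) = ((3 : ℕ) : ZMod 4) := (ZMod.natCast_eq_natCast_iff _ _ _).2 h1
  have h5 : ((n : ℕ) : ZMod q) = ((1 : ℕ) : ZMod q) := (ZMod.natCast_eq_natCast_iff _ _ _).2 h2
  have hu : IsUnit ((n : ℕ) : ZMod (4 * q)) := by
    rw [ZMod.isUnit_iff_coprime, Nat.coprime_mul_iff_right, ← ZMod.isUnit_iff_coprime,
      ← ZMod.isUnit_iff_coprime, h4, h5]
    exact ⟨by decide, by simp⟩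
  rw [h, MulChar.one_apply hu, h4, h5, chiFour_natCast] at h3
  norm_num at h3

lemma polyTameOn_one_sub_cpow (c : ℂ) (hc : ‖c‖ ≤ 1) :
    PolyTameOn strip (fun s => 1 - c * (2 : ℂ) ^ (-(s + 1))) := fun n => by
  refine ⟨0, tameOn_strip_of_growthOn ?_ ?_ n⟩
  · refine DifferentiableOn.const_sub (DifferentiableOn.const_mul ?_ _) _
    exact fun s _ => ((by fun_prop : DifferentiableAt ℂ (fun s : ℂ => -(s + 1)) s).const_cpow
      (Or.inl two_ne_zero)).differentiableWithinAt
  · refine ⟨2, fun s hs => ?_⟩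
    have h1 : -(1 / 4) ≤ s.re := hs.1
    rw [Real.rpow_zero, mul_one]
    refine (norm_sub_le _ _).trans ?_
    have h2 := norm_mul_cpow_neg_le (p := 2) le_rfl hc (σ := 0) (s := s + 1) (by simp; linarith)
    norm_num at h2 ⊢
    linarith

lemma polyTameOn_one_sub_cpow_inv_sqrt (c : ℂ) (hc : ‖c‖ ≤ 1) :
    PolyTameOn strip (fun s => (1 - c * (2 : ℂ) ^ (-(s + 1))) ^ (-(1 / 2) : ℂ)) := by
  have hs1 : ∀ s ∈ strip, 1 ≤ (s + 1).re := fun s hs => by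
    have : 0 < s.re := hs.1
    simp; linarith
  have hsl : ∀ s ∈ strip, 1 - c * (2 : ℂ) ^ (-(s + 1)) ∈ Complex.slitPlane := fun s hs =>
    one_sub_mem_slitPlane (p := 2) le_rfl hc (hs1 s hs)
  have h1 := polyTameOn_one_sub_cpow c hc
  have h2 : PolyTameOn strip (fun s => (1 - c * (2 : ℂ) ^ (-(s + 1)))⁻¹) := by
    refine h1.inv isOpen_strip (fun s hs => Complex.slitPlane_ne_zero (hsl s hs)) (B := 0) (C := 2)
      fun s hs => ?_
    rw [Real.rpow_zero, mul_one, norm_inv]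
    have h3 : ‖c * (2 : ℂ) ^ (-(s + 1))‖ ≤ 1 / 2 :=
      (norm_mul_cpow_neg_le (p := 2) le_rfl hc (σ := 1) (hs1 s hs)).trans (by norm_num)
    have h4 := norm_sub_norm_le (1 : ℂ) (c * (2 : ℂ) ^ (-(s + 1)))
    rw [norm_one] at h4
    exact inv_le_of_inv_le₀ two_pos (by linarith)
  refine PolyTameOn.of_sq isOpen_strip h2 (by simpa only [inv_inv] using h1)
    (fun s hs => inv_ne_zero (Complex.slitPlane_ne_zero (hsl s hs))) ?_ fun s hs => ?_
  · obtain ⟨_, hd⟩ := h1 0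
    exact hd.1.cpow_const hsl
  · rw [← Complex.cpow_nat_mul, ← Complex.cpow_neg_one]
    norm_num

/-- For a non-principal character the square root of `L(s + 1, χ)` and its inverse are tame on the
strip, since `L(s, χ)` has no zeros with `Re s ≥ 1`, and its inverse has polynomial growth. -/
lemma polyTameOn_sqrtSeries_shift [NeZero N] {χ : DirichletCharacter ℂ N} (hχ : χ ≠ 1) :
    PolyTameOn strip (fun s => sqrtSeries χ (s + 1)) ∧
      PolyTameOn strip (fun s => (sqrtSeries χ (s + 1))⁻¹) := by
  have hs1 : ∀ s ∈ strip, 1 < (s + 1).re := fun s hs => by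
    have : 0 < s.re := hs.1
    simp; linarith
  have hd := (DirichletCharacter.differentiable_LFunction hχ).differentiableOn (s := {s | 0 < s.re})
  have hg := (growthOn_LFunction hχ).mono_exponent (show (1 : ℝ) ≤ 2 by norm_num)
  have h0 : ∀ s : ℂ, 1 ≤ s.re → χ.LFunction s ≠ 0 := fun s hs =>
    DirichletCharacter.LFunction_ne_zero_of_one_le_re χ (Or.inl hχ) hs
  have h1 := polyTameOn_shift hd hg
  have h2 := polyTameOn_shift_inv hd hg h0 (growthOn_LFunction_inv hχ)
  have hdiff : DifferentiableOn ℂ (fun s => sqrtSeries χ (s + 1)) strip :=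
    (differentiableOn_sqrtSeries χ).comp (by fun_prop) hs1
  have hne : ∀ s ∈ strip, χ.LFunction (s + 1) ≠ 0 := fun s hs => h0 _ (hs1 s hs).le
  have hsq : ∀ s ∈ strip, sqrtSeries χ (s + 1) ^ 2 = χ.LFunction (s + 1) := fun s hs => by
    rw [sqrtSeries_sq χ (hs1 s hs), DirichletCharacter.LFunction_eq_LSeries χ (hs1 s hs)]
  refine ⟨PolyTameOn.of_sq isOpen_strip h1 h2 hne hdiff hsq, ?_⟩
  refine PolyTameOn.of_sq isOpen_strip h2 (by simpa only [inv_inv] using h1)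
    (fun s hs => inv_ne_zero (hne s hs))
      (hdiff.inv fun s _ => sqrtSeries_ne_zero χ _) fun s hs => ?_
  rw [inv_pow, hsq s hs]

/-- Multiplication by `s ^ (1 / 2)` removes the singularity of `ζ(s + 1) ^ (1 / 2)` at `0`: the
product is a square root of `s ζ(s + 1)`. -/
lemma polyTameOn_sqrtSeries_one :
    PolyTameOn strip (fun s => s ^ (1 / 2 : ℂ) * sqrtSeries (1 : DirichletCharacter ℂ 1)
      (s + 1)) := by
  have hs1 : ∀ s ∈ strip, 1 < (s + 1).re := fun s hs => by
    have : 0 < s.re := hs.1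
    simp; linarith
  have hs0 : ∀ s ∈ strip, s ≠ 0 := fun s hs => Complex.ne_zero_of_re_pos hs.1
  have hd := differentiable_riemannZeta₁.differentiableOn (s := {s | 0 < s.re})
  have h1 := polyTameOn_shift hd growthOn_riemannZeta₁
  have h2 := polyTameOn_shift_inv hd growthOn_riemannZeta₁ (fun s hs => riemannZeta₁_ne_zero hs)
    growthOn_riemannZeta₁_inv
  refine PolyTameOn.of_sq isOpen_strip h1 h2 (fun s hs => riemannZeta₁_ne_zero (hs1 s hs).le) ?_
    fun s hs => ?_
  · refine DifferentiableOn.mul (DifferentiableOn.cpow_const differentiableOn_id fun s hs =>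
      Or.inl hs.1) ?_
    exact (differentiableOn_sqrtSeries _).comp (by fun_prop) hs1
  · have hne : s + 1 ≠ 1 := fun h => hs0 s hs (by linear_combination h)
    rw [mul_pow, sqrtSeries_sq _ (hs1 s hs), ← DirichletCharacter.LFunction_eq_LSeries _ (hs1 s hs),
      DirichletCharacter.LFunction_modOne_eq, ← Complex.cpow_nat_mul, riemannZeta₁_eq_mul hne]
    norm_num

/-- The Euler factor correction `1 - χ(2) 2 ^ (-s) + χ(4) 2 ^ (-2 s)` at the prime `2`. -/
def twoFactor (χ : DirichletCharacter ℂ N) (s : ℂ) : ℂ :=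
  1 - χ 2 * (2 : ℂ) ^ (-s) + χ 4 * (2 : ℂ) ^ (-(2 * s))

lemma differentiable_twoFactor (χ : DirichletCharacter ℂ N) : Differentiable ℂ (twoFactor χ) := by
  unfold twoFactor
  have h1 : Differentiable ℂ fun s : ℂ => (2 : ℂ) ^ (-s) := fun s =>
    differentiableAt_id.neg.const_cpow (Or.inl two_ne_zero)
  have h2 : Differentiable ℂ fun s : ℂ => (2 : ℂ) ^ (-(2 * s)) := fun s =>
    (differentiableAt_id.const_mul 2).neg.const_cpow (Or.inl two_ne_zero)
  fun_prop

lemma growthOn_twoFactor (χ : DirichletCharacter ℂ N) :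
    GrowthOn {s | -(1 / 4) ≤ s.re} 0 (twoFactor χ) := by
  refine ⟨1 + 2 + 2, fun s hs => ?_⟩
  have hs : -(1 / 4) ≤ s.re := hs
  rw [Real.rpow_zero, mul_one, twoFactor]
  have h1 := norm_mul_cpow_neg_le (p := 2) le_rfl (χ.norm_le_one 2) (σ := -1) (s := s) (by linarith)
  have h2 := norm_mul_cpow_neg_le (p := 2) le_rfl (χ.norm_le_one 4) (σ := -1) (s := 2 * s)
    (by simp; linarith)
  norm_num at h1 h2
  refine (norm_add_le _ _).trans (add_le_add ((norm_sub_le _ _).trans ?_) ?_)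
  · rw [norm_one]; gcongr
    simpa using h1
  · simpa using h2

lemma polyTameOn_twoFactor (χ : DirichletCharacter ℂ N) : PolyTameOn strip (twoFactor χ) := fun n =>
  ⟨0, tameOn_strip_of_growthOn (differentiable_twoFactor χ).differentiableOn
    ((growthOn_twoFactor χ).mono_set fun _ hs => hs.1) n⟩

/-- The restricted series is tame on the strip for a non-principal character. -/
lemma polyTameOn_restrictedSeries [NeZero N] [NeZero N'] {χ : DirichletCharacter ℂ N}
    {ψ : DirichletCharacter ℂ N'} (hψ : IsTwistByFour χ ψ) (hχ : χ ≠ 1) (hψ1 : ψ ≠ 1) :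
    PolyTameOn strip (restrictedSeries χ) := by
  refine ((((polyTameOn_sqrtSeries_shift hχ).1.mul isOpen_strip
    (polyTameOn_sqrtSeries_shift hψ1).2).mul isOpen_strip
    (polyTameOn_one_sub_cpow_inv_sqrt (χ 2) (χ.norm_le_one 2))).mul isOpen_strip
    (polyTameOn_factorThree χ)).congr isOpen_strip fun s hs => ?_
  exact restrictedSeries_eq hψ hs.1

/-- For the trivial character the restricted series is tame on the strip after multiplication by
`s ^ (1 / 2)`. -/
lemma polyTameOn_restrictedSeries_one :
    PolyTameOn strip (fun s => s ^ (1 / 2 : ℂ) *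
      restrictedSeries (1 : DirichletCharacter ℂ 1) s) := by
  refine (((polyTameOn_sqrtSeries_one.mul isOpen_strip
    (polyTameOn_sqrtSeries_shift chiFour_ne_one).2).mul isOpen_strip
    (polyTameOn_one_sub_cpow_inv_sqrt _ ((1 : DirichletCharacter ℂ 1).norm_le_one 2))).mul
    isOpen_strip (polyTameOn_factorThree (1 : DirichletCharacter ℂ 1))).congr isOpen_strip fun s hs => ?_
  simp only
  rw [restrictedSeries_eq isTwistByFour_chiFour hs.1]
  ring

/-! ### The twisted sums as inverse Mellin transforms -/

/-- The smoothed sum of `χ(h) F(h)`, where `F` is the arithmetic factor of the singular series. The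
term `h = 0` vanishes because `F(0) = 0`. -/
def twistedSum (χ : DirichletCharacter ℂ N) (H : ℝ) : ℂ :=
  ∑' h : ℕ, χ (h : ZMod N) * pairArith h * Real.exp (-(h : ℝ) / H)

lemma four_cpow (s : ℂ) : (4 : ℂ) ^ s = (2 : ℂ) ^ (2 * s) := by
  have h := Complex.natCast_mul_natCast_cpow 2 2 s
  rw [two_mul, Complex.cpow_add _ _ two_ne_zero]
  norm_num at h ⊢
  exact h

lemma LSeriesHasSum_twoCorrection (χ : DirichletCharacter ℂ N) (s : ℂ) :
    LSeriesHasSum (fun n => χ (n : ZMod N) * twoCorrection n) s (twoFactor χ s) := by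
  have h0 : ∀ n ∉ ({1, 2, 4} : Finset ℕ),
      LSeries.term (fun n => χ (n : ZMod N) * twoCorrection n) s n = 0 := by
    intro n hn
    simp only [Finset.mem_insert, Finset.mem_singleton, not_or] at hn
    rcases eq_or_ne n 0 with rfl | h
    · simp
    · rw [LSeries.term_of_ne_zero h, twoCorrection_apply]
      simp [hn.1, hn.2.1, hn.2.2]
  have h : HasSum (LSeries.term (fun n => χ (n : ZMod N) * twoCorrection n) s) _ :=
    hasSum_sum_of_ne_finset_zero h0
  have e : ∑ n ∈ ({1, 2, 4} : Finset ℕ),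
      LSeries.term (fun n => χ (n : ZMod N) * twoCorrection n) s n = twoFactor χ s := by
    rw [Finset.sum_insert (by simp), Finset.sum_insert (by simp), Finset.sum_singleton]
    simp only [LSeries.term_of_ne_zero one_ne_zero, LSeries.term_of_ne_zero two_ne_zero,
      LSeries.term_of_ne_zero (four_ne_zero (α := ℕ)), twoCorrection_apply, twoFactor]
    simp [four_cpow, Complex.cpow_neg]
    ring
  rw [e] at h
  exact h

/-- The Dirichlet series of `χ F`: a twist by a completely multiplicative function distributes over
the three convolution factors of `F`. -/
lemma LSeriesHasSum_pairArith [NeZero N] (χ : DirichletCharacter ℂ N) {s : ℂ} (hs : 1 < s.re) :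
    LSeriesHasSum (fun h => χ (h : ZMod N) * pairArith h) s
      (χ.LFunction s * restrictedSeries χ s * twoFactor χ s) := by
  have h1 : LSeriesHasSum (fun n => χ (n : ZMod N)) s (χ.LFunction s) := by
    rw [DirichletCharacter.LFunction_eq_LSeries χ hs]
    exact (χ.LSeriesSummable_of_one_lt_re hs).LSeriesHasSum
  have h2 : LSeriesHasSum (fun d => χ (d : ZMod N) * restrictedInv d) s (restrictedSeries χ s) :=
    (summable_restrictedSeries χ (by linarith)).LSeriesHasSum
  have h3 := LSeriesHasSum_twoCorrection χ s
  have h := (h1.convolution h2).convolution h3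
  have d1 : LSeries.convolution (fun n : ℕ => χ (n : ZMod N))
      (fun d : ℕ => χ (d : ZMod N) * restrictedInv d) =
      fun n : ℕ => χ (n : ZMod N) * LSeries.convolution (fun _ => (1 : ℂ))
        (fun d => (restrictedInv d : ℂ)) n := by
    have := DirichletCharacter.mul_convolution_distrib χ (fun _ => (1 : ℂ))
      (fun d => (restrictedInv d : ℂ))
    convert! this using 1
    congr 1
    ext n
    simp
  have d2 : LSeries.convolution (fun n : ℕ =>
      χ (n : ZMod N) * LSeries.convolution (fun _ => (1 : ℂ))
        (fun d => (restrictedInv d : ℂ)) n) (fun d : ℕ => χ (d : ZMod N) * twoCorrection d) =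
      fun n : ℕ => χ (n : ZMod N) * LSeries.convolution (LSeries.convolution (fun _ => (1 : ℂ))
        (fun d => (restrictedInv d : ℂ))) (fun d => (twoCorrection d : ℂ)) n :=
    DirichletCharacter.mul_convolution_distrib χ _ _
  have d3 : LSeries.convolution (LSeries.convolution (fun _ => (1 : ℂ))
        (fun d => (restrictedInv d : ℂ))) (fun d => (twoCorrection d : ℂ)) =
      fun n => ((pairArith n : ℝ) : ℂ) := by
    ext n
    simp only [LSeries.convolution_def, pairArith, ArithmeticFunction.mul_apply, Complex.ofReal_sum,
      Complex.ofReal_mul]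
    refine Finset.sum_congr rfl fun p _ => ?_
    congr 1
    refine Finset.sum_congr rfl fun r hr => ?_
    have hr0 : r.1 ≠ 0 := (Nat.ne_zero_of_mem_divisorsAntidiagonal hr).1
    simp [restrictedInvArith, ArithmeticFunction.natCoe_apply,
      ArithmeticFunction.zeta_apply_ne hr0]
  rwa [d1, d2, d3] at h

/-- The Mellin transform of the smoothing weight, times the Dirichlet series of `χ F`. -/
def mellinIntegrand (χ : DirichletCharacter ℂ N) [NeZero N] (s : ℂ) : ℂ :=
  Complex.Gamma s * (χ.LFunction s * restrictedSeries χ s * twoFactor χ s)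

/-- Mellin inversion for the weight `e ^ (-h / H)` at `H = e ^ L`, summed over `h` on the line
`Re s = 2` of absolute convergence. -/
lemma twistedSum_eq_integral [NeZero N] (χ : DirichletCharacter ℂ N) (L : ℝ) :
    twistedSum χ (Real.exp L) = (1 / (2 * Real.pi) : ℂ) *
      ∫ t : ℝ, mellinIntegrand χ (vline 2 t) * Complex.exp (L * vline 2 t) := by
  have hre : ∀ t, 1 < (vline 2 t).re := fun t => by simp
  set a : ℕ → ℂ := fun h => χ (h : ZMod N) * pairArith h
  set F : ℕ → ℝ → ℂ := fun h t =>
    Complex.Gamma (vline 2 t) * Complex.exp (L * vline 2 t) * LSeries.term a (vline 2 t) h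
  have hterm : ∀ h t, ‖LSeries.term a (vline 2 t) h‖ = ‖LSeries.term a (2 : ℂ) h‖ := by
    intro h t
    rw [LSeries.norm_term_eq, LSeries.norm_term_eq]
    simp
  have hF : ∀ h : ℕ, h ≠ 0 → ∀ t, F h t = a h *
      (Complex.Gamma (vline 2 t) * Complex.exp (((L - Real.log h : ℝ) : ℂ) * vline 2 t)) := by
    intro h hh t
    have hh0 : (h : ℂ) ≠ 0 := by exact_mod_cast hh
    simp only [F]
    rw [LSeries.term_of_ne_zero hh, Complex.ofReal_sub, sub_mul, Complex.exp_sub,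
      Complex.cpow_def_of_ne_zero hh0, ← Complex.natCast_log]
    ring
  have hint : ∀ M : ℝ, MeasureTheory.Integrable
      (fun t => Complex.Gamma (vline 2 t) * Complex.exp (M * vline 2 t)) := fun M =>
    MeasureTheory.Integrable.mul_bdd (c := Real.exp (M * 2)) (integrable_Gamma_vline two_pos)
      (Complex.continuous_exp.comp
        (continuous_const.mul (continuous_vline 2))).aestronglyMeasurable
      (Eventually.of_forall fun t => (norm_exp_mul_vline _ _ _).le)
  have hFint : ∀ h, MeasureTheory.Integrable (F h) := by
    intro h
    rcases eq_or_ne h 0 with rfl | hh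
    · simp [F]
    · exact ((hint _).const_mul (a h)).congr (Eventually.of_forall fun t => (hF h hh t).symm)
  have hnorm : ∀ h, ∫ t, ‖F h t‖ = (∫ t, ‖Complex.Gamma (vline 2 t) *
      Complex.exp (L * vline 2 t)‖) * ‖LSeries.term a (2 : ℂ) h‖ := by
    intro h
    rw [← MeasureTheory.integral_mul_const]
    congr 1
    ext t
    rw [norm_mul, hterm]
  -- `|h ^ (-s)|` is constant on the line, so absolute convergence at `s = 2` suffices
  have hsumm : Summable fun h => ∫ t, ‖F h t‖ := by
    simp only [hnorm]
    exact ((LSeriesHasSum_pairArith χ (s := 2) (by norm_num)).summable.norm).mul_left _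
  have key := MeasureTheory.hasSum_integral_of_summable_integral_norm hFint hsumm
  have e1 : ∀ t, ∑' h, F h t = mellinIntegrand χ (vline 2 t) * Complex.exp (L * vline 2 t) := by
    intro t
    simp only [F]
    rw [tsum_mul_left, show ∑' h, LSeries.term a (vline 2 t) h = LSeries a (vline 2 t) from rfl,
      (LSeriesHasSum_pairArith χ (hre t)).LSeries_eq, mellinIntegrand]
    ring
  have hpi : (Real.pi : ℂ) ≠ 0 := by exact_mod_cast Real.pi_ne_zero
  have e2 : ∀ h : ℕ, (1 / (2 * Real.pi) : ℂ) * ∫ t, F h t =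
      χ (h : ZMod N) * pairArith h * Real.exp (-(h : ℝ) / Real.exp L) := by
    intro h
    rcases eq_or_ne h 0 with rfl | hh
    · simp [F]
    · rw [MeasureTheory.integral_congr_ae (Eventually.of_forall (hF h hh)),
        MeasureTheory.integral_const_mul, integral_Gamma_mul_exp two_pos]
      have hh0 : (0 : ℝ) < h := by exact_mod_cast Nat.pos_of_ne_zero hh
      have : Real.exp (-(L - Real.log h)) = h / Real.exp L := by
        rw [neg_sub, Real.exp_sub, Real.exp_log hh0]
      rw [this, ← neg_div]
      simp only [a]
      field_simp
  simp only [e1] at key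
  have h2 := key.mul_left (1 / (2 * Real.pi) : ℂ)
  simp only [e2] at h2
  exact h2.tsum_eq

/-- A growth condition on a vertical strip only has to be checked for `|Im s| ≥ 1`. -/
lemma growthOn_of_im {c d : ℝ} (hf : ContinuousOn f {s | c ≤ s.re ∧ s.re ≤ d})
    (hg : GrowthOn {s | (c ≤ s.re ∧ s.re ≤ d) ∧ 1 ≤ |s.im|} A f) :
    GrowthOn {s | c ≤ s.re ∧ s.re ≤ d} A f := by
  obtain ⟨C, hC0, hC⟩ := hg.exists_nonneg
  have hcpt : IsCompact (Set.Icc c d ×ℂ Set.Icc (-1 : ℝ) 1) := isCompact_Icc.reProdIm isCompact_Icc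
  have hcont : ContinuousOn (fun s => ‖f s‖ / (1 + ‖s‖) ^ A)
      (Set.Icc c d ×ℂ Set.Icc (-1 : ℝ) 1) := by
    refine ContinuousOn.div (hf.mono fun s hs => (Complex.mem_reProdIm.1 hs).1).norm ?_ fun s _ =>
      (Real.rpow_pos_of_pos (one_add_norm_pos s) A).ne'
    exact ContinuousOn.rpow_const (by fun_prop) fun s _ => Or.inl (one_add_norm_pos s).ne'
  obtain ⟨E, hE⟩ := hcpt.exists_bound_of_continuousOn hcont
  refine ⟨max C E, fun s hs => ?_⟩
  have hs1 := one_add_norm_pos s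
  rcases le_total 1 |s.im| with hi | hi
  · exact (hC s ⟨hs, hi⟩).trans (by gcongr; exact le_max_left _ _)
  · have h1 := (le_abs_self _).trans (hE s (Complex.mem_reProdIm.2 ⟨hs, abs_le.1 hi⟩))
    rw [div_le_iff₀ (by positivity)] at h1
    exact h1.trans (by gcongr; exact le_max_right _ _)

/-- Shifting a line of integration, by Cauchy's theorem on rectangles whose height tends to
infinity. -/
lemma integral_vline_eq {c d : ℝ} (hcd : c ≤ d)
    (hd : DifferentiableOn ℂ f {s | c ≤ s.re ∧ s.re ≤ d})
    (hf : GrowthOn {s | c ≤ s.re ∧ s.re ≤ d} (-(3 / 2)) f) :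
    ∫ t, f (vline c t) = ∫ t, f (vline d t) := by
  have hcont : ∀ x, c ≤ x → x ≤ d → Continuous fun t => f (vline x t) := fun x h1 h2 =>
    hd.continuousOn.comp_continuous (continuous_vline x) fun t => by simp [h1, h2]
  have hic := hf.integrable_vline (c := c) (fun t => by simp [hcd]) (hcont c le_rfl hcd)
  have hid := hf.integrable_vline (c := d) (fun t => by simp [hcd]) (hcont d hcd le_rfl)
  obtain ⟨C, hC0, hC⟩ := hf.exists_nonneg
  have hrect : ∀ T : ℝ, 0 ≤ T → (∫ x in c..d, f (x + (-T : ℝ) * Complex.I)) -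
      (∫ x in c..d, f (x + T * Complex.I)) + Complex.I • (∫ t in (-T)..T, f (vline d t)) -
      Complex.I • (∫ t in (-T)..T, f (vline c t)) = 0 := by
    intro T hT
    have := Complex.integral_boundary_rect_eq_zero_of_differentiableOn f
      (c + (-T : ℝ) * Complex.I) (d + T * Complex.I) (hd.mono fun s hs => by
        have := (Complex.mem_reProdIm.1 hs).1
        simpa [Set.uIcc_of_le hcd] using this)
    simpa [vline] using this
  have hhor : ∀ ε : ℝ, (ε = 1 ∨ ε = -1) →
      Tendsto (fun T : ℝ => ∫ x in c..d, f (x + (ε * T : ℝ) * Complex.I)) atTop (𝓝 0) := by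
    intro ε hε
    have hb : ∀ T : ℝ, 0 < T → ‖∫ x in c..d, f (x + (ε * T : ℝ) * Complex.I)‖ ≤
        C * T ^ (-(3 / 2) : ℝ) * |d - c| := by
      intro T hT
      refine intervalIntegral.norm_integral_le_of_norm_le_const fun x hx => ?_
      rw [Set.uIoc_of_le hcd] at hx
      refine (hC _ (by simp; exact ⟨hx.1.le, hx.2⟩)).trans ?_
      refine mul_le_mul_of_nonneg_left ?_ hC0
      refine Real.rpow_le_rpow_of_nonpos hT ?_ (by norm_num)
      have h1 := Complex.abs_im_le_norm (x + (ε * T : ℝ) * Complex.I)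
      have h2 : |(x + (ε * T : ℝ) * Complex.I : ℂ).im| = T := by
        rcases hε with rfl | rfl <;> simp [abs_of_pos hT]
      linarith
    have hlim : Tendsto (fun T : ℝ => C * T ^ (-(3 / 2) : ℝ) * |d - c|) atTop (𝓝 0) := by
      have := ((tendsto_rpow_neg_atTop (show (0 : ℝ) < 3 / 2 by norm_num)).const_mul C).mul_const
        |d - c|
      simpa using this
    refine squeeze_zero_norm' ?_ hlim
    filter_upwards [eventually_gt_atTop 0] with T hT using hb T hT
  have h1 := hhor (-1) (Or.inr rfl)
  have h2 := hhor 1 (Or.inl rfl)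
  have h3 := MeasureTheory.intervalIntegral_tendsto_integral hid tendsto_neg_atTop_atBot tendsto_id
  have h4 := MeasureTheory.intervalIntegral_tendsto_integral hic tendsto_neg_atTop_atBot tendsto_id
  have h5 := ((h1.sub h2).add (h3.const_smul Complex.I)).sub (h4.const_smul Complex.I)
  have h6 : Tendsto (fun _ : ℝ => (0 : ℂ)) atTop (𝓝 (0 - 0 + Complex.I • (∫ t, f (vline d t)) -
      Complex.I • ∫ t, f (vline c t))) := by
    refine h5.congr' ?_
    filter_upwards [eventually_ge_atTop 0] with T hT
    have := hrect T hT
    simpa using this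
  have h7 := tendsto_nhds_unique h6 tendsto_const_nhds
  rw [sub_zero, zero_add, ← smul_sub, smul_eq_mul] at h7
  have h8 := (mul_eq_zero.1 h7).resolve_left Complex.I_ne_zero
  exact (sub_eq_zero.1 h8).symm

/-! ### Shifting the line of integration -/

lemma norm_ge_one_of_im {s : ℂ} (h : 1 ≤ |s.im|) : 1 ≤ ‖s‖ ∧ 1 ≤ ‖s - 1‖ :=
  ⟨h.trans (Complex.abs_im_le_norm s), h.trans (by simpa using Complex.abs_im_le_norm (s - 1))⟩

lemma growthOn_inv_of_im : GrowthOn {s | 1 ≤ |s.im|} 0 (fun s => s⁻¹) :=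
  ⟨1, fun s hs => by
    rw [Real.rpow_zero, mul_one, norm_inv]; exact inv_le_one_of_one_le₀ (norm_ge_one_of_im hs).1⟩

lemma growthOn_sub_one_inv_of_im : GrowthOn {s | 1 ≤ |s.im|} 0 (fun s => (s - 1)⁻¹) :=
  ⟨1, fun s hs => by
    rw [Real.rpow_zero, mul_one, norm_inv]; exact inv_le_one_of_one_le₀ (norm_ge_one_of_im hs).2⟩

lemma growthOn_exp_mul {d : ℝ} (L : ℝ) (hS : ∀ s ∈ S, 0 ≤ s.re ∧ s.re ≤ d) :
    GrowthOn S 0 (fun s => Complex.exp (L * s)) := by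
  refine ⟨Real.exp (|L| * d), fun s hs => ?_⟩
  rw [Real.rpow_zero, mul_one, Complex.norm_exp, Real.exp_le_exp, Complex.re_ofReal_mul]
  obtain ⟨h1, h2⟩ := hS s hs
  calc L * s.re ≤ |L| * s.re := by gcongr; exact le_abs_self L
    _ ≤ _ := by gcongr

lemma growthOn_mellinIntegrand [NeZero N] (χ : DirichletCharacter ℂ N) {c : ℝ} (hc : 0 < c)
    (A : ℝ) :
    GrowthOn {s | (c ≤ s.re ∧ s.re ≤ 2) ∧ 1 ≤ |s.im|} A (mellinIntegrand χ) := by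
  set T : Set ℂ := {s | (c ≤ s.re ∧ s.re ≤ 2) ∧ 1 ≤ |s.im|}
  have h1 := (growthOn_Gamma_mul_LFunction χ A).mono_set (T := T) fun s hs =>
    ⟨by linarith [hs.1.1], by linarith [hs.1.2]⟩
  have h2 := (growthOn_restrictedSeries χ hc).mono_set (T := T) fun s hs => hs.1.1
  have h3 := (growthOn_twoFactor χ).mono_set (T := T) fun s hs => by
    have := hs.1.1
    simp only [Set.mem_ofPred_eq]; linarith
  have h4 := growthOn_inv_of_im.mono_set (T := T) fun s hs => hs.2
  have h5 := growthOn_sub_one_inv_of_im.mono_set (T := T) fun s hs => hs.2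
  have h6 := (h1.mul (h2.mul h3)).mul (h4.mul h5)
  norm_num at h6
  refine h6.congr fun s hs => ?_
  obtain ⟨h7, h8⟩ := norm_ge_one_of_im hs.2
  have hs0 : s ≠ 0 := fun h => by rw [h] at h7; norm_num at h7
  have hs1 : s - 1 ≠ 0 := fun h => by rw [h] at h8; norm_num at h8
  simp only [mellinIntegrand]
  rw [Complex.Gamma_add_one s hs0]
  field_simp

lemma growthOn_Gamma_div {c : ℝ} (hc : 0 < c) (A : ℝ) :
    GrowthOn {s | (c ≤ s.re ∧ s.re ≤ 2) ∧ 1 ≤ |s.im|} A (fun s => Complex.Gamma s / (s - 1)) := by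
  set T : Set ℂ := {s | (c ≤ s.re ∧ s.re ≤ 2) ∧ 1 ≤ |s.im|}
  have h1 := growthOn_Gamma (S := T) hc (fun s hs => hs.1) A
  have h2 := h1.mul (growthOn_sub_one_inv_of_im.mono_set (T := T) fun s hs => hs.2)
  rw [add_zero] at h2
  exact h2

lemma continuous_exp_vline (L x : ℝ) : Continuous fun t => Complex.exp (L * vline x t) :=
  Complex.continuous_exp.comp (continuous_const.mul (continuous_vline x))

lemma integrable_vline_of_growthOn {x : ℝ} (hx2 : x ≤ 2)
    (hf : ∀ s : ℂ, s.re = x → DifferentiableAt ℂ f s)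
    (hg : GrowthOn {s | (x ≤ s.re ∧ s.re ≤ 2) ∧ 1 ≤ |s.im|} (-(3 / 2)) f) (L : ℝ) :
    MeasureTheory.Integrable fun t => f (vline x t) * Complex.exp (L * vline x t) := by
  have hcont : ContinuousOn f {s : ℂ | x ≤ s.re ∧ s.re ≤ x} := fun s hs =>
    (hf s (le_antisymm hs.2 hs.1)).continuousAt.continuousWithinAt
  have h1 := growthOn_of_im hcont (hg.mono_set fun s hs => ⟨⟨hs.1.1, hs.1.2.trans hx2⟩, hs.2⟩)
  have h2 := h1.integrable_vline (c := x) (fun t => by simp)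
    (hcont.comp_continuous (continuous_vline x) fun t => by simp)
  exact h2.mul_bdd (c := Real.exp (L * x)) (continuous_exp_vline L x).aestronglyMeasurable
    (Eventually.of_forall fun t => (norm_exp_mul_vline _ _ _).le)

lemma differentiableAt_Gamma_of_re_pos {s : ℂ} (hs : 0 < s.re) :
    DifferentiableAt ℂ Complex.Gamma s :=
  differentiableOn_Gamma_re_pos.differentiableAt (isOpen_re_pos.mem_nhds hs)

lemma differentiableAt_mellinIntegrand [NeZero N] (χ : DirichletCharacter ℂ N) {s : ℂ}
    (hs : 0 < s.re) (hs1 : s ≠ 1) : DifferentiableAt ℂ (mellinIntegrand χ) s := by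
  have h1 := (differentiableOn_restrictedSeries χ).differentiableAt (isOpen_re_pos.mem_nhds hs)
  exact (differentiableAt_Gamma_of_re_pos hs).mul
    (((DirichletCharacter.differentiableAt_LFunction χ s (Or.inl hs1)).mul h1).mul
      (differentiable_twoFactor χ s))

lemma differentiableAt_Gamma_div {s : ℂ} (hs : 0 < s.re) (hs1 : s ≠ 1) :
    DifferentiableAt ℂ (fun s => Complex.Gamma s / (s - 1)) s :=
  (differentiableAt_Gamma_of_re_pos hs).div (by fun_prop) (sub_ne_zero.2 hs1)

/-- The residue at `1` of the Dirichlet series of `χ F`; `Z` stands for the function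
`(s - 1) L(s, χ)` with its singularity at `1` removed. -/
def mainCoeff (χ : DirichletCharacter ℂ N) (Z : ℂ → ℂ) : ℂ :=
  Z 1 * restrictedSeries χ 1 * twoFactor χ 1

/-- Shifting the line of integration past the pole at `1`. Subtracting a multiple of
`Γ(s - 1) = Γ(s) / (s - 1)`, whose inverse transform is known, removes the pole. -/
lemma twistedSum_eq_add [NeZero N] (χ : DirichletCharacter ℂ N) (hZ : Differentiable ℂ Z)
    (hZL : ∀ s, s ≠ 1 → Z s = (s - 1) * χ.LFunction s) (L : ℝ) {c : ℝ} (hc : 0 < c) (hc1 : c < 1) :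
    twistedSum χ (Real.exp L) =
      mainCoeff χ Z * (Real.exp L * Real.exp (-Real.exp (-L)) : ℝ) +
      (1 / (2 * Real.pi) : ℂ) * (∫ t : ℝ, mellinIntegrand χ (vline c t) *
        Complex.exp (L * vline c t)) -
      mainCoeff χ Z * ((1 / (2 * Real.pi) : ℂ) * ∫ t : ℝ, Complex.Gamma (vline c t) /
        (vline c t - 1) * Complex.exp (L * vline c t)) := by
  set κ := mainCoeff χ Z
  set u : ℂ → ℂ := fun s => Z s * restrictedSeries χ s * twoFactor χ s
  have hu : DifferentiableOn ℂ u {s | 0 < s.re} :=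
    (hZ.differentiableOn.mul (differentiableOn_restrictedSeries χ)).mul
      (differentiable_twoFactor χ).differentiableOn
  have hu' : DifferentiableOn ℂ (dslope u 1) {s | 0 < s.re} :=
    (Complex.differentiableOn_dslope (isOpen_re_pos.mem_nhds (by simp))).2 hu
  -- the divided difference `dslope u 1` is holomorphic at `1`, so that `f` has no pole to the right
  -- of `0`
  set f : ℂ → ℂ := fun s => Complex.Gamma s * dslope u 1 s * Complex.exp (L * s)
  have hf : ∀ s, s ≠ 1 → f s = mellinIntegrand χ s * Complex.exp (L * s) -
      κ * (Complex.Gamma s / (s - 1) * Complex.exp (L * s)) := by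
    intro s hs
    simp only [f]
    rw [dslope_of_ne _ hs, slope_def_field]
    have hs1 := sub_ne_zero.2 hs
    simp only [u, κ, mainCoeff, hZL s hs, mellinIntegrand]
    field_simp
  have hsub : {s : ℂ | c ≤ s.re ∧ s.re ≤ 2} ⊆ {s : ℂ | 0 < s.re} := fun s hs => hc.trans_le hs.1
  have hfd : DifferentiableOn ℂ f {s | c ≤ s.re ∧ s.re ≤ 2} :=
    (((differentiableOn_Gamma_re_pos.mul hu').mono hsub)).mul (by fun_prop)
  have hfg : GrowthOn {s | c ≤ s.re ∧ s.re ≤ 2} (-(3 / 2)) f := by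
    refine growthOn_of_im hfd.continuousOn ?_
    have hE := growthOn_exp_mul (S := {s : ℂ | (c ≤ s.re ∧ s.re ≤ 2) ∧ 1 ≤ |s.im|}) (d := 2) L
      fun s hs => ⟨hc.le.trans hs.1.1, hs.1.2⟩
    have h1 := (growthOn_mellinIntegrand χ hc (-(3 / 2))).mul hE
    have h2 := ((growthOn_Gamma_div hc (-(3 / 2))).mul hE).const_mul (-κ)
    rw [add_zero] at h1 h2
    refine (h1.add h2).congr fun s hs => ?_
    have hs1 : s ≠ 1 := fun h => by
      have := hs.2
      rw [h] at this; norm_num at this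
    rw [hf s hs1]
    ring
  have hne : ∀ x : ℝ, x ≠ 1 → ∀ t, vline x t ≠ 1 := fun x hx t h => hx (by
    have := congrArg Complex.re h
    simpa using this)
  have hI1 : ∀ x : ℝ, c ≤ x → x ≤ 2 → x ≠ 1 → MeasureTheory.Integrable fun t =>
      mellinIntegrand χ (vline x t) * Complex.exp (L * vline x t) := fun x h1 h2 h3 =>
    integrable_vline_of_growthOn h2 (fun s hs =>
      differentiableAt_mellinIntegrand χ (by rw [hs]; linarith) (fun h => h3 (by rw [← hs, h]; simp)))
      (growthOn_mellinIntegrand χ (hc.trans_le h1) _) L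
  have hI2 : ∀ x : ℝ, c ≤ x → x ≤ 2 → x ≠ 1 → MeasureTheory.Integrable fun t =>
      Complex.Gamma (vline x t) / (vline x t - 1) * Complex.exp (L * vline x t) := fun x h1 h2 h3 =>
    integrable_vline_of_growthOn (f := fun s => Complex.Gamma s / (s - 1)) h2
      (fun s hs => differentiableAt_Gamma_div (by rw [hs]; linarith)
        (fun h => h3 (by rw [← hs, h]; simp)))
      (growthOn_Gamma_div (hc.trans_le h1) _) L
  have hline : ∀ x : ℝ, c ≤ x → x ≤ 2 → x ≠ 1 → ∫ t, f (vline x t) =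
      (∫ t, mellinIntegrand χ (vline x t) * Complex.exp (L * vline x t)) -
      κ * ∫ t, Complex.Gamma (vline x t) / (vline x t - 1) * Complex.exp (L * vline x t) := by
    intro x h1 h2 h3
    rw [← MeasureTheory.integral_const_mul, ← MeasureTheory.integral_sub (hI1 x h1 h2 h3)
      ((hI2 x h1 h2 h3).const_mul κ)]
    congr 1
    ext t
    exact hf _ (hne x h3 t)
  -- the substitution `s ↦ s + 1` turns `Γ(s - 1)` on the line `Re s = 2` into `Γ(s)` on `Re s = 1`
  have h2 : ∫ t, Complex.Gamma (vline 2 t) / (vline 2 t - 1) * Complex.exp (L * vline 2 t) =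
      2 * Real.pi * ((Real.exp L * Real.exp (-Real.exp (-L)) : ℝ) : ℂ) := by
    have e : ∀ t, Complex.Gamma (vline 2 t) / (vline 2 t - 1) * Complex.exp (L * vline 2 t) =
        (Real.exp L : ℂ) * (Complex.Gamma (vline 1 t) * Complex.exp (L * vline 1 t)) := by
      intro t
      have h0 : vline 1 t ≠ 0 := fun h => by
        have := congrArg Complex.re h
        simp at this
      have h21 : vline 2 t = vline 1 t + 1 := by simp [vline]; ring
      rw [h21, Complex.Gamma_add_one _ h0, add_sub_cancel_right, mul_add, Complex.exp_add,
        mul_div_cancel_left₀ _ h0, Complex.ofReal_exp, mul_one]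
      ring
    rw [MeasureTheory.integral_congr_ae (Eventually.of_forall e), MeasureTheory.integral_const_mul,
      integral_Gamma_mul_exp one_pos]
    push_cast
    ring
  have hshift := integral_vline_eq (by linarith : c ≤ 2) hfd hfg
  rw [hline c le_rfl (by linarith) hc1.ne, hline 2 (by linarith) le_rfl (by norm_num), h2] at hshift
  have hpi : (Real.pi : ℂ) ≠ 0 := by exact_mod_cast Real.pi_ne_zero
  rw [twistedSum_eq_integral, sub_eq_iff_eq_add.1 hshift.symm]
  field_simp
  ring

lemma growthOn_exp_const_mul (l : ℝ) :
    GrowthOn {s : ℂ | -(1 / 4) ≤ s.re ∧ s.re ≤ 3 / 4} 0 (fun s => Complex.exp (-l * s)) := by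
  refine ⟨Real.exp |l|, fun s hs => ?_⟩
  rw [Real.rpow_zero, mul_one, Complex.norm_exp, Real.exp_le_exp, ← Complex.ofReal_neg,
    Complex.re_ofReal_mul]
  have h1 : |s.re| ≤ 1 := abs_le.2 ⟨by linarith [hs.1], by linarith [hs.2]⟩
  calc -l * s.re ≤ |-l * s.re| := le_abs_self _
    _ = |l| * |s.re| := by rw [abs_mul, abs_neg]
    _ ≤ |l| * 1 := by gcongr
    _ = _ := mul_one _

lemma polyTameOn_exp_const_mul (l : ℝ) : PolyTameOn strip (fun s => Complex.exp (-l * s)) :=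
  fun n => ⟨0, tameOn_strip_of_growthOn (by fun_prop) (growthOn_exp_const_mul l) n⟩

/-- Evaluating at `H = e ^ (L - l)` on the line that belongs to `L` multiplies the integrand by the
tame factor `e ^ (-l s)`. -/
lemma exp_shift_mul (l L : ℝ) (s : ℂ) :
    Complex.exp ((L - l : ℝ) * s) = Complex.exp (-l * s) * Complex.exp (L * s) := by
  rw [← Complex.exp_add]
  congr 1
  push_cast
  ring

/-- The contribution of the subtracted pole on a line close to `Re s = 0`. -/
lemma inverseLaplace_Gamma_div (l : ℝ) (n : ℕ) :
    (fun L : ℝ => (1 / (2 * Real.pi) : ℂ) * (∫ t : ℝ, Complex.Gamma (vline (1 / L) t) /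
        (vline (1 / L) t - 1) * Complex.exp ((L - l : ℝ) * vline (1 / L) t)) + 1)
      =O[atTop] fun L => L ^ (-(n : ℝ)) := by
  set R : ℂ → ℂ := fun s => Complex.exp (-l * s) * ((s - 1)⁻¹ * Complex.Gamma (s + 1))
  have hp : PolyTameOn strip (fun s => s - 1) := fun n =>
    ⟨1, tameOn_strip_of_growthOn (by fun_prop) (growthOn_add_const (-1)) n⟩
  have hne : ∀ s ∈ strip, s - 1 ≠ 0 := fun s hs h => by
    have h1 := hs.2
    have := congrArg Complex.re h
    simp at this
    linarith
  have hi : PolyTameOn strip (fun s => (s - 1)⁻¹) := by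
    refine hp.inv isOpen_strip hne (B := 0) (C := 2) fun s hs => ?_
    rw [Real.rpow_zero, mul_one, norm_inv]
    refine inv_le_of_inv_le₀ two_pos ?_
    have h1 := Complex.abs_re_le_norm (s - 1)
    have h2 := (abs_le.1 h1).1
    have h3 := hs.2
    simp only [Complex.sub_re, Complex.one_re] at h2
    linarith
  have hR : RapidOn strip R := (polyTameOn_exp_const_mul l).mul_rapid isOpen_strip
    (hi.mul_rapid isOpen_strip rapidOn_Gamma_add_one)
  have hRa : AnalyticAt ℂ R 0 := by
    have hd : DifferentiableOn ℂ R {s | -1 < s.re ∧ s.re < 1} := by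
      refine DifferentiableOn.mul (by fun_prop)
        (DifferentiableOn.mul (DifferentiableOn.inv (by fun_prop) fun s hs h => ?_)
        (differentiableOn_Gamma_re_pos.comp (by fun_prop) fun s hs => ?_))
      · have h1 := hs.2
        have := congrArg Complex.re h
        simp at this
        linarith
      · have := hs.1
        simp only [Set.mem_ofPred_eq, Complex.add_re, Complex.one_re]; linarith
    refine hd.analyticAt (IsOpen.mem_nhds ?_ (by simp))
    exact (isOpen_lt continuous_const Complex.continuous_re).inter
      (isOpen_lt Complex.continuous_re continuous_const)
  have key := inverseLaplace_one (fun n => hR n (-1)) hRa (Eventually.of_forall fun _ => rfl) n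
  refine key.congr' ?_ EventuallyEq.rfl
  filter_upwards [eventually_gt_atTop 0] with L hL
  have hc : 0 < 1 / L := by positivity
  -- the value at `0` of `e ^ (-l s) Γ(s + 1) / (s - 1)` is `-1`
  have hR0 : R 0 = -1 := by simp [R]
  rw [hR0, sub_neg_eq_add]
  congr 3
  ext t
  have h0 : vline (1 / L) t ≠ 0 := fun h => by
    have := congrArg Complex.re h
    rw [vline_re] at this
    exact hc.ne' this
  simp only [R]
  rw [Complex.Gamma_add_one _ h0, exp_shift_mul]
  field_simp

/-! ### Analytic continuation of the square roots to the origin -/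

lemma convex_strip : Convex ℝ strip :=
  (convex_halfSpace_re_gt 0).inter (convex_halfSpace_re_lt (1 / 2))

/-- The principal square root squares to its argument, also at `0`. -/
lemma cpow_half_sq (z : ℂ) : (z ^ (1 / 2 : ℂ)) ^ 2 = z := by
  rw [← Complex.cpow_nat_mul]
  norm_num

lemma analyticAt_cpow_half (hh : AnalyticAt ℂ h 0) (h0 : h 0 ∈ Complex.slitPlane) (a : ℂ) :
    AnalyticAt ℂ (fun s => h s ^ a) 0 := hh.cpow analyticAt_const h0

/-- Two square roots of the same function, one of them analytic and nonzero at `0`, agree up to a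
global sign on the part of the strip near `0`, which is connected. -/
lemma eventually_eq_or_eq_neg_of_sq_eq (hg : DifferentiableOn ℂ g strip) (hh : AnalyticAt ℂ h 0)
    (h0 : h 0 ≠ 0) (hsq : ∀ s ∈ strip, g s ^ 2 = h s ^ 2) :
    ∃ ρ > 0, Set.EqOn g h (strip ∩ Metric.ball 0 ρ) ∨
      Set.EqOn g (-h) (strip ∩ Metric.ball 0 ρ) := by
  obtain ⟨ρ, hρ, hb⟩ := Metric.eventually_nhds_iff_ball.1
    (hh.eventually_analyticAt.and (hh.continuousAt.eventually_ne h0))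
  refine ⟨ρ, hρ, ?_⟩
  refine IsPreconnected.eq_or_eq_neg_of_sq_eq
    (convex_strip.inter (convex_ball 0 ρ)).isPreconnected
    (hg.continuousOn.mono Set.inter_subset_left)
    (fun s hs => (hb s hs.2).1.continuousAt.continuousWithinAt) (fun s hs => ?_)
    fun hs => (hb _ hs.2).2
  simpa using hsq _ hs.1

/-- A holomorphic square root on the strip of a function that is analytic and nonzero at `0`
extends analytically to `0`. -/
lemma exists_analyticAt_of_sq (hg : DifferentiableOn ℂ g strip) (hh : AnalyticAt ℂ h 0)
    (h0 : h 0 ≠ 0) (hsq : ∀ s ∈ strip, g s ^ 2 = h s) :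
    ∃ u : ℂ → ℂ, AnalyticAt ℂ u 0 ∧ u 0 ≠ 0 ∧ ∀ᶠ s in 𝓝[strip] 0, g s = u s := by
  -- dividing by `h 0` moves the value to `1`, off the branch cut of the power
  set v : ℂ → ℂ := fun s => h 0 ^ (1 / 2 : ℂ) * (h s / h 0) ^ (1 / 2 : ℂ)
  have hva : AnalyticAt ℂ v 0 := analyticAt_const.mul
    (analyticAt_cpow_half (hh.div analyticAt_const h0) (by simp [h0]) _)
  have hvsq : ∀ s, v s ^ 2 = h s := fun s => by
    simp only [v]
    rw [mul_pow, cpow_half_sq, cpow_half_sq, mul_div_cancel₀ _ h0]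
  have hv0 : v 0 ≠ 0 := fun hv => h0 (by rw [← hvsq, hv]; norm_num)
  obtain ⟨ρ, hρ, h1 | h1⟩ := eventually_eq_or_eq_neg_of_sq_eq hg hva hv0
    fun s hs => by rw [hsq s hs, hvsq]
  · exact ⟨v, hva, hv0, mem_of_superset (inter_mem_nhdsWithin _ (Metric.ball_mem_nhds _ hρ)) h1⟩
  · exact ⟨-v, hva.neg, neg_ne_zero.2 hv0,
      mem_of_superset (inter_mem_nhdsWithin _ (Metric.ball_mem_nhds _ hρ)) h1⟩

/-- The principal square root has positive real part off the negative axis. -/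
lemma re_cpow_half_pos {z : ℂ} (hz : z ∈ Complex.slitPlane) : 0 < (z ^ (1 / 2 : ℂ)).re := by
  have h0 := Complex.slitPlane_ne_zero hz
  have h1 := Complex.neg_pi_lt_arg z
  have h2 := (Complex.mem_slitPlane_iff_arg.1 hz).1
  have h3 := (Complex.arg_le_pi z).lt_of_ne h2
  rw [Complex.cpow_def_of_ne_zero h0, Complex.exp_re]
  refine mul_pos (Real.exp_pos _) (Real.cos_pos_of_mem_Ioo ?_)
  have e : (Complex.log z * (1 / 2)).im = z.arg / 2 := by
    rw [show (1 / 2 : ℂ) = ((1 / 2 : ℝ) : ℂ) by push_cast; rfl, Complex.im_mul_ofReal,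
      Complex.log_im]
    ring
  rw [e]
  exact ⟨by linarith, by linarith⟩

/-- A holomorphic square root on the strip that has positive real part on the real axis is the
principal one near `0`. -/
lemma eventually_eq_cpow_half (hg : DifferentiableOn ℂ g strip) (hh : AnalyticAt ℂ h 0)
    (h0 : h 0 ∈ Complex.slitPlane) (hsq : ∀ s ∈ strip, g s ^ 2 = h s)
    (hpos : ∀ x : ℝ, 0 < x → x < 1 / 2 → 0 < (g x).re) :
    ∀ᶠ s in 𝓝[strip] 0, g s = h s ^ (1 / 2 : ℂ) := by
  have hva := analyticAt_cpow_half hh h0 (1 / 2 : ℂ)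
  have hv0 : h 0 ^ (1 / 2 : ℂ) ≠ 0 := fun hv => by
    have := re_cpow_half_pos h0
    rw [hv] at this; simp at this
  obtain ⟨ρ, hρ, h1 | h1⟩ := eventually_eq_or_eq_neg_of_sq_eq hg hva hv0
    fun s hs => by rw [hsq s hs, cpow_half_sq]
  · exact mem_of_superset (inter_mem_nhdsWithin _ (Metric.ball_mem_nhds _ hρ)) h1
  · exfalso
    obtain ⟨r, hr, hb⟩ := Metric.eventually_nhds_iff_ball.1
      (hh.continuousAt.eventually_mem (Complex.isOpen_slitPlane.mem_nhds h0))
    -- at a small positive real point both roots have positive real part, so they are not opposite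
    set x : ℝ := min (min r ρ) (1 / 2) / 2
    have hm : 0 < min (min r ρ) (1 / 2) := by positivity
    have hx0 : 0 < x := by positivity
    have hx1 := min_le_right (min r ρ) (1 / 2)
    have hx2 := (min_le_left (min r ρ) (1 / 2)).trans (min_le_left r ρ)
    have hx3 := (min_le_left (min r ρ) (1 / 2)).trans (min_le_right r ρ)
    have hxr : x < r := by simp only [x]; linarith
    have hxρ : x < ρ := by simp only [x]; linarith
    have hx2 : x < 1 / 2 := by simp only [x]; linarith
    have hn : ‖(x : ℂ)‖ = x := by rw [Complex.norm_real, Real.norm_of_nonneg hx0.le]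
    have hxs : (x : ℂ) ∈ strip := ⟨by simpa using hx0, by rw [Complex.ofReal_re]; exact hx2⟩
    have h2 := h1 ⟨hxs, by rw [Metric.mem_ball, dist_zero_right, hn]; exact hxρ⟩
    have h3 := hpos x hx0 hx2
    have h4 := re_cpow_half_pos (hb x (by rw [Metric.mem_ball, dist_zero_right, hn]; exact hxr))
    rw [h2] at h3
    simp only [Pi.neg_apply, Complex.neg_re] at h3
    linarith

/-- For a real character the square root of the Euler product is real and positive on the real
axis. -/
lemma sqrtSeries_re_pos (χ : DirichletCharacter ℂ N) (hχ : ∀ p : ℕ, (χ (p : ZMod N)).im = 0)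
    {x : ℝ} (hx : 1 < x) : ∃ r : ℝ, 0 < r ∧ sqrtSeries χ x = r := by
  have e : ∀ p : Nat.Primes, -Complex.log (1 - χ ((p : ℕ) : ZMod N) *
      ((p : ℕ) : ℂ) ^ (-(x : ℂ))) =
      ((-Real.log (1 - (χ ((p : ℕ) : ZMod N)).re * ((p : ℕ) : ℝ) ^ (-x)) : ℝ) : ℂ) := by
    intro p
    have h1 : χ ((p : ℕ) : ZMod N) = ((χ ((p : ℕ) : ZMod N)).re : ℂ) :=
      Complex.ext (by simp) (by simp [hχ])
    have h2 : ((p : ℕ) : ℂ) ^ (-(x : ℂ)) = (((p : ℕ) : ℝ) ^ (-x) : ℝ) := by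
      rw [Complex.ofReal_cpow (Nat.cast_nonneg _)]; push_cast; rfl
    have h3 := one_sub_mem_slitPlane p.2.two_le (χ.norm_le_one ((p : ℕ) : ZMod N))
      (s := (x : ℂ)) (by simpa using hx.le)
    have h4 : (1 : ℂ) - χ ((p : ℕ) : ZMod N) * ((p : ℕ) : ℂ) ^ (-(x : ℂ)) =
        ((1 - (χ ((p : ℕ) : ZMod N)).re * ((p : ℕ) : ℝ) ^ (-x) : ℝ) : ℂ) := by
      rw [h2, h1]; push_cast [Complex.ofReal_re]; rfl
    rw [h4] at h3 ⊢
    have h5 := Complex.ofReal_mem_slitPlane.1 h3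
    rw [← Complex.ofReal_log h5.le]
    push_cast; rfl
  refine ⟨_, Real.exp_pos (1 / 2 * ∑' p : Nat.Primes,
    (-Real.log (1 - (χ ((p : ℕ) : ZMod N)).re * ((p : ℕ) : ℝ) ^ (-x)))), ?_⟩
  rw [sqrtSeries, tsum_congr e, ← Complex.ofReal_tsum]
  push_cast; rfl

/-- The limit that defines `sqrtLOne χ` is the value at `0` of any continuous extension of the
square root from the strip. -/
lemma sqrtLOne_eq {χ : DirichletCharacter ℂ N} (hg : ContinuousAt g 0)
    (h : ∀ᶠ s in 𝓝[strip] 0, sqrtSeries χ (s + 1) = g s) : sqrtLOne χ = g 0 := by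
  have h1 : Tendsto (fun x : ℝ => ((x : ℂ) - 1)) (𝓝[>] (1 : ℝ)) (𝓝[strip] 0) := by
    refine tendsto_nhdsWithin_iff.2 ⟨?_, ?_⟩
    · have : Tendsto (fun x : ℝ => ((x : ℂ) - 1)) (𝓝 (1 : ℝ)) (𝓝 (((1 : ℝ) : ℂ) - 1)) :=
        (Continuous.tendsto (by fun_prop) _)
      rw [Complex.ofReal_one, sub_self] at this
      exact this.mono_left nhdsWithin_le_nhds
    · filter_upwards [Ioo_mem_nhdsGT (show (1 : ℝ) < 3 / 2 by norm_num)] with x hx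
      exact ⟨by simpa using hx.1, by have := hx.2; simp; linarith⟩
  have h2 : Tendsto (fun x : ℝ => sqrtSeries χ x) (𝓝[>] (1 : ℝ)) (𝓝 (g 0)) := by
    refine ((hg.tendsto.mono_left nhdsWithin_le_nhds).comp h1).congr' ?_
    filter_upwards [h1.eventually h] with x hx
    rw [Function.comp, ← hx, sub_add_cancel]
  exact h2.limUnder_eq

lemma analyticAt_of_differentiable_shift (hf : DifferentiableOn ℂ f {s | -(1 / 2) < s.re}) :
    AnalyticAt ℂ f 0 :=
  hf.analyticAt ((isOpen_lt continuous_const Complex.continuous_re).mem_nhds (by simp))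

lemma analyticAt_one_sub_cpow_inv_sqrt {c : ℂ} (hc : ‖c‖ ≤ 1) :
    AnalyticAt ℂ (fun s : ℂ => (1 - c * (2 : ℂ) ^ (-(s + 1))) ^ (-(1 / 2) : ℂ)) 0 := by
  refine analyticAt_cpow_half ?_ ?_ _
  · have : Differentiable ℂ fun s : ℂ => 1 - c * (2 : ℂ) ^ (-(s + 1)) := fun s =>
      (((by fun_prop : DifferentiableAt ℂ (fun s : ℂ => -(s + 1)) s).const_cpow
        (Or.inl two_ne_zero)).const_mul c).const_sub 1
    exact this.analyticAt 0
  · exact one_sub_mem_slitPlane (p := 2) le_rfl hc (s := 0 + 1) (by simp)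

lemma analyticAt_Gamma_add_one : AnalyticAt ℂ (fun s => Complex.Gamma (s + 1)) 0 :=
  analyticAt_of_differentiable_shift (differentiableOn_Gamma_re_pos.comp (by fun_prop) fun s hs => by
    have hs : -(1 / 2) < s.re := hs
    simp only [Set.mem_ofPred_eq, Complex.add_re, Complex.one_re]
    linarith)

/-- The square root of `L(s + 1, χ)` extends analytically to `0`, with the value `L(1, χ) ^ (1 / 2)`
there, because `L(1, χ) ≠ 0`. -/
lemma exists_analyticAt_sqrtSeries [NeZero N] {χ : DirichletCharacter ℂ N} (hχ : χ ≠ 1) :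
    ∃ u : ℂ → ℂ, AnalyticAt ℂ u 0 ∧ u 0 ≠ 0 ∧ u 0 = sqrtLOne χ ∧
      ∀ᶠ s in 𝓝[strip] 0, sqrtSeries χ (s + 1) = u s := by
  have hs1 : ∀ s ∈ strip, 1 < (s + 1).re := fun s hs => by
    have : 0 < s.re := hs.1
    simp; linarith
  have hd : Differentiable ℂ fun s => χ.LFunction (s + 1) :=
    (DirichletCharacter.differentiable_LFunction hχ).comp (by fun_prop)
  obtain ⟨u, h1, h2, h3⟩ := exists_analyticAt_of_sq (g := fun s => sqrtSeries χ (s + 1))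
    (h := fun s => χ.LFunction (s + 1))
    ((differentiableOn_sqrtSeries χ).comp (by fun_prop) hs1) (hd.analyticAt 0)
    (by simpa using DirichletCharacter.LFunction_apply_one_ne_zero hχ)
    fun s hs => by
      rw [sqrtSeries_sq χ (hs1 s hs), DirichletCharacter.LFunction_eq_LSeries χ (hs1 s hs)]
  exact ⟨u, h1, h2, (sqrtLOne_eq h1.continuousAt h3).symm, h3⟩

/-- The analytic continuation to `0` of the integrand for a non-principal character. -/
lemma exists_analyticAt_nonprincipal {q : ℕ} [NeZero q] (hq : Nat.Coprime 4 q)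
    {χ : DirichletCharacter ℂ q} (hχ : χ ≠ 1) :
    ∃ g : ℂ → ℂ, AnalyticAt ℂ g 0 ∧ g 0 = charConst χ ∧ ∀ᶠ s in 𝓝[strip] 0,
      Complex.Gamma (s + 1) * (χ.LFunction s * restrictedSeries χ s * twoFactor χ s) = g s := by
  obtain ⟨u, hu, hu0, hu1, hu2⟩ := exists_analyticAt_sqrtSeries hχ
  obtain ⟨v, hv, hv0, hv1, hv2⟩ := exists_analyticAt_sqrtSeries (mulChiFour_ne_one hq χ)
  refine ⟨fun s => Complex.Gamma (s + 1) * (χ.LFunction s * (u s * (v s)⁻¹ *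
    (1 - χ 2 * (2 : ℂ) ^ (-(s + 1))) ^ (-(1 / 2) : ℂ) * factorThree χ s) * twoFactor χ s),
    analyticAt_Gamma_add_one.mul ((((DirichletCharacter.differentiable_LFunction hχ).analyticAt 0).mul
      (((hu.mul (hv.inv hv0)).mul (analyticAt_one_sub_cpow_inv_sqrt (χ.norm_le_one 2))).mul
        (analyticAt_of_differentiable_shift (differentiableOn_factorThree χ)))).mul
      ((differentiable_twoFactor χ).analyticAt 0)), ?_, ?_⟩
  · have h3 := tprod_eq_factorThree χ (s := 0) (by norm_num)
    rw [charConst]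
    simp only [hu1, hv1, ← h3, twoFactor, zero_add, mul_one, neg_zero, mul_zero, Complex.cpow_zero,
      Complex.Gamma_one, one_mul, Complex.cpow_neg_one, ← div_eq_mul_inv]
    ring
  · filter_upwards [hu2, hv2, self_mem_nhdsWithin] with s h1 h2 hs
    rw [restrictedSeries_eq (isTwistByFour_mulChiFour χ) hs.1, h1, h2]

lemma chiFour_im (n : ℕ) : (chiFour (n : ZMod 4)).im = 0 := by
  rw [chiFour_natCast]; split_ifs <;> simp

/-! ### Special values -/

lemma sum_range_four_mul (F : ℕ → ℂ) (K : ℕ) : ∑ n ∈ Finset.range (4 * K), F n =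
    ∑ k ∈ Finset.range K, (F (4 * k) + F (4 * k + 1) + F (4 * k + 2) + F (4 * k + 3)) := by
  induction K with
  | zero => simp
  | succ K ih =>
    rw [Finset.sum_range_succ, ← ih, show 4 * (K + 1) = 4 * K + 3 + 1 by ring]
    simp only [Finset.sum_range_succ]
    ring

/-- The terms of Leibniz's series, taken in pairs, are nonnegative and `O(k ^ (-2))`, uniformly in
`1 ≤ s ≤ 2`. -/
lemma rpow_sub_rpow_nonneg_le {x : ℝ} (hx : 1 ≤ x) {s : ℝ} (hs : 1 ≤ s) (hs2 : s ≤ 2) :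
    0 ≤ x ^ (-s) - (x + 2) ^ (-s) ∧ x ^ (-s) - (x + 2) ^ (-s) ≤ 4 * x ^ (-2 : ℝ) := by
  have hx0 : 0 < x := by linarith
  refine ⟨sub_nonneg.2 (Real.rpow_le_rpow_of_nonpos hx0 (by linarith) (by linarith)), ?_⟩
  have hy : 0 < 2 / x := by positivity
  -- Bernoulli's inequality, applied to `(1 + y)⁻¹ = 1 - y / (1 + y)` with `y = 2 / x`
  have h1 : 1 + (-s) * (2 / x) ≤ (1 + 2 / x) ^ (-s) := by
    have hb := one_add_mul_self_le_rpow_one_add (s := -(2 / x / (1 + 2 / x))) (p := s)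
      (by rw [neg_le_neg_iff, div_le_one (by positivity)]; linarith) hs
    have e : 1 + -(2 / x / (1 + 2 / x)) = (1 + 2 / x)⁻¹ := by field_simp; ring
    rw [e, Real.inv_rpow (by positivity), ← Real.rpow_neg (by positivity)] at hb
    have h5 : 2 / x / (1 + 2 / x) ≤ 2 / x := div_le_self hy.le (by linarith)
    nlinarith
  have h2 : (x + 2) ^ (-s) = x ^ (-s) * (1 + 2 / x) ^ (-s) := by
    rw [← Real.mul_rpow hx0.le (by positivity)]
    congr 1; field_simp
  have h3 : x ^ (-s) ≤ x ^ (-1 : ℝ) := Real.rpow_le_rpow_of_exponent_le hx (by linarith)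
  have h4 : x ^ (-2 : ℝ) = x ^ (-1 : ℝ) * (1 / x) := by
    rw [show (-2 : ℝ) = -1 + -1 by norm_num, Real.rpow_add hx0, Real.rpow_neg_one]; field_simp
  rw [h2, h4]
  have h5 : 0 < x ^ (-s) := by positivity
  calc x ^ (-s) - x ^ (-s) * (1 + 2 / x) ^ (-s) = x ^ (-s) * (1 - (1 + 2 / x) ^ (-s)) := by ring
    _ ≤ x ^ (-s) * (s * (2 / x)) := by gcongr; linarith
    _ ≤ x ^ (-1 : ℝ) * (2 * (2 / x)) := by gcongr
    _ = _ := by ring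

/-- The value `L(1, χ₄) = π / 4`, from Leibniz's series by dominated convergence as `s → 1`. -/
lemma LFunction_chiFour_one : chiFour.LFunction 1 = (Real.pi / 4 : ℝ) := by
  set a : ℝ → ℕ → ℝ := fun s k => (4 * k + 1 : ℝ) ^ (-s) - (4 * k + 1 + 2 : ℝ) ^ (-s)
  set bd : ℕ → ℝ := fun k => 4 * (4 * k + 1 : ℝ) ^ (-2 : ℝ)
  have hbd : Summable bd := by
    refine Summable.mul_left 4 ?_
    refine Summable.of_nonneg_of_le (fun k => by positivity) (fun k => ?_)
      ((summable_nat_add_iff 1).2 (Real.summable_nat_rpow.2 (by norm_num : (-2 : ℝ) < -1)))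
    refine Real.rpow_le_rpow_of_nonpos (by positivity) ?_ (by norm_num)
    push_cast
    have : (0 : ℝ) ≤ k := Nat.cast_nonneg k
    linarith
  have hle : ∀ s, 1 ≤ s → s ≤ 2 → ∀ k, ‖a s k‖ ≤ bd k := fun s h1 h2 k => by
    have := rpow_sub_rpow_nonneg_le (x := 4 * k + 1)
      (by have : (0 : ℝ) ≤ k := Nat.cast_nonneg k
          linarith) h1 h2
    rw [Real.norm_of_nonneg this.1]
    exact this.2
  have hsum : ∀ s, 1 ≤ s → s ≤ 2 → Summable (a s) := fun s h1 h2 =>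
    Summable.of_norm_bounded hbd (hle s h1 h2)
  have hone : ∑' k, a 1 k = Real.pi / 4 := by
    have h1 := (hsum 1 le_rfl (by norm_num)).hasSum.tendsto_sum_nat
    have h2 := Real.tendsto_sum_pi_div_four.comp
      (tendsto_id.const_mul_atTop' (show 0 < 2 by norm_num) : Tendsto (fun k : ℕ =>
        2 * k) atTop atTop)
    refine tendsto_nhds_unique h1 (h2.congr fun K => ?_)
    simp only [Function.comp]
    induction K with
    | zero => simp
    | succ K ih =>
      rw [show 2 * (K + 1) = 2 * K + 1 + 1 by ring, Finset.sum_range_succ, Finset.sum_range_succ,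
        Finset.sum_range_succ, ih]
      simp only [a, Real.rpow_neg_one, pow_add, pow_mul]
      push_cast
      norm_num
      rw [add_assoc]
      congr 1
      rw [sub_eq_add_neg, div_eq_mul_inv, neg_one_mul]
      congr 3 <;> ring
  -- for `s > 1` the series may be summed in blocks of four terms
  have hL : ∀ s : ℝ, 1 < s → s ≤ 2 → chiFour.LFunction s = ((∑' k, a s k : ℝ) : ℂ) := by
    intro s hs hs2
    have hs' : 1 < (s : ℂ).re := by simpa using hs
    rw [DirichletCharacter.LFunction_eq_LSeries chiFour hs']
    have h1 := ((chiFour.LSeriesSummable_of_one_lt_re hs').LSeriesHasSum.tendsto_sum_nat).comp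
      (tendsto_id.const_mul_atTop' (show 0 < 4 by norm_num) : Tendsto (fun k : ℕ =>
        4 * k) atTop atTop)
    have h2 := (Complex.continuous_ofReal.tendsto _).comp
      ((hsum s hs.le hs2).hasSum.tendsto_sum_nat)
    refine tendsto_nhds_unique h1 (h2.congr fun K => ?_)
    simp only [Function.comp, sum_range_four_mul, Complex.ofReal_sum]
    refine Finset.sum_congr rfl fun k _ => ?_
    have hs0 : (s : ℂ) ≠ 0 := Complex.ne_zero_of_one_lt_re hs'
    have hterm : ∀ n : ℕ, LSeries.term (fun n => chiFour (n : ZMod 4)) s n =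
        chiFour (n : ZMod 4) * (((n : ℝ) ^ (-s) : ℝ) : ℂ) := fun n => by
      rcases eq_or_ne n 0 with rfl | hn
      · rw [LSeries.term_zero, chiFour_natCast]; simp
      · rw [LSeries.term_of_ne_zero hn, Complex.ofReal_cpow (Nat.cast_nonneg _)]
        push_cast
        rw [Complex.cpow_neg, div_eq_mul_inv]
    simp only [hterm]
    simp only [chiFour_natCast]
    have e0 : 4 * k % 4 = 0 := by omega
    have e1 : (4 * k + 1) % 4 = 1 := by omega
    have e2 : (4 * k + 2) % 4 = 2 := by omega
    have e3 : (4 * k + 3) % 4 = 3 := by omega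
    simp only [e0, e1, e2, e3, a]
    push_cast
    norm_num
    rw [add_assoc, show (1 : ℝ) + 2 = 3 by norm_num, ← sub_eq_add_neg]
  have hT : Tendsto (fun s : ℝ => ∑' k, a s k) (𝓝[>] 1) (𝓝 (∑' k, a 1 k)) := by
    refine tendsto_tsum_of_dominated_convergence hbd (fun k => ?_) ?_
    · have hp : ∀ x : ℝ, 0 < x → Continuous fun s : ℝ => x ^ (-s) := fun x hx =>
        Real.continuous_const_rpow hx.ne' |>.comp continuous_neg
      exact (((hp _ (by positivity)).sub (hp _ (by positivity))).tendsto 1).mono_left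
        nhdsWithin_le_nhds
    · filter_upwards [Ioo_mem_nhdsGT (show (1 : ℝ) < 2 by norm_num)] with s hs
      exact hle s hs.1.le hs.2.le
  rw [hone] at hT
  have hT2 := (Complex.continuous_ofReal.tendsto _).comp hT
  have hT3 : Tendsto (fun s : ℝ => chiFour.LFunction s) (𝓝[>] 1) (𝓝 (chiFour.LFunction 1)) := by
    have := ((DirichletCharacter.differentiable_LFunction chiFour_ne_one).continuous.comp
      Complex.continuous_ofReal).tendsto (1 : ℝ)
    rw [Function.comp, Complex.ofReal_one] at this
    exact this.mono_left nhdsWithin_le_nhds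
  refine tendsto_nhds_unique hT3 (hT2.congr' ?_)
  filter_upwards [Ioo_mem_nhdsGT (show (1 : ℝ) < 2 by norm_num)] with s hs
  exact (hL s hs.1 hs.2.le).symm

lemma one_apply_modOne (a : ZMod 1) : (1 : DirichletCharacter ℂ 1) a = 1 :=
  MulChar.one_apply (isUnit_of_subsingleton _)

/-- The Euler product of the restricted series at `s = 1`. -/
lemma restrictedSeries_one_one :
    restrictedSeries (1 : DirichletCharacter ℂ 1) 1 =
      ((4 / 3 * (2 * landauRamanujan ^ 2) : ℝ) : ℂ) := by
  set j : PrimesThree → Nat.Primes := fun p => ⟨p, p.2.1⟩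
  have hj : Function.Injective j := fun p q h =>
    Subtype.ext (congrArg (fun r : Nat.Primes => (r : ℕ)) h)
  set P2 : Nat.Primes := ⟨2, Nat.prime_two⟩
  set u3 : Nat.Primes → ℝ := fun p =>
    if (p : ℕ) % 4 = 3 then Real.log (1 - ((p : ℕ) : ℝ) ^ (-2 : ℝ)) else 0
  set u2 : Nat.Primes → ℝ := fun p => if p = P2 then Real.log (3 / 4) else 0
  have hu3 : HasSum u3 (∑' p : PrimesThree, Real.log (1 - ((p : ℕ) : ℝ) ^ (-2 : ℝ))) := by
    refine (hj.hasSum_iff ?_).1 ?_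
    · intro p hp
      exact if_neg fun h3 => hp ⟨⟨p, p.2, h3⟩, rfl⟩
    · refine summable_log_primesThree.hasSum.congr_fun fun p => ?_
      have h3 : ((j p : Nat.Primes) : ℕ) % 4 = 3 := p.2.2
      simp only [u3, Function.comp, if_pos h3]
      rfl
  have hu2 : HasSum u2 (Real.log (3 / 4)) := hasSum_ite_eq P2 _
  have e : ∀ p : Nat.Primes,
      -Complex.log (1 - restrictedHom (1 : DirichletCharacter ℂ 1) 1 p) =
        ((-(u2 p + u3 p) : ℝ) : ℂ) := by
    intro p
    have hp0 : (0 : ℝ) < ((p : ℕ) : ℝ) := by exact_mod_cast p.2.pos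
    simp only [restrictedHom, MonoidWithZeroHom.coe_mk, ZeroHom.coe_mk, one_apply_modOne, one_mul]
    by_cases h1 : (p : ℕ) % 4 = 1
    · have h2 : p ≠ P2 := fun h => by rw [h] at h1; simp [P2] at h1
      rw [restrictedInv_prime_of_eq p.2 h1]
      simp [u2, u3, h2, h1]
    · have e1 : (1 : ℂ) - (restrictedInv p : ℂ) * ((p : ℕ) : ℂ) ^ (-1 : ℂ) =
          ((1 - ((p : ℕ) : ℝ) ^ (-2 : ℝ) : ℝ) : ℂ) := by
        rw [restrictedInv_prime_of_ne p.2 h1, Complex.cpow_neg_one,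
          show (-2 : ℝ) = -1 + -1 by norm_num, Real.rpow_add hp0, Real.rpow_neg_one]
        push_cast
        simp
      have hpos : 0 ≤ 1 - ((p : ℕ) : ℝ) ^ (-2 : ℝ) := sub_nonneg.2
        (Real.rpow_le_one_of_one_le_of_nonpos (by exact_mod_cast p.2.one_le) (by norm_num))
      rw [e1, ← Complex.ofReal_log hpos, ← Complex.ofReal_neg]
      congr 2
      rcases p.2.eq_two_or_odd with h2 | h2
      · have hpP : p = P2 := Subtype.ext h2
        simp only [u2, u3, if_pos hpP]
        rw [hpP, if_neg (by simp [P2])]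
        simp only [P2]
        norm_num [Real.rpow_neg, Real.rpow_two]
      · have hpP : p ≠ P2 := fun h => by rw [h] at h2; simp [P2] at h2
        simp only [u2, u3, if_neg hpP]
        rw [if_pos (by omega), zero_add]
  rw [restrictedSeries_eq_exp _ (by simp), tsum_congr e, ← Complex.ofReal_tsum,
    ← Complex.ofReal_exp,
    (hu2.add hu3).neg.tsum_eq, neg_add, Real.exp_add, Real.exp_neg, Real.exp_neg,
    exp_tsum_log_primesThree, Real.exp_log (by norm_num)]
  congr 1
  rw [one_div, inv_inv]
  norm_num

/-- The residue at `1` for the trivial character; it gives the main term `H` of the sum of the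
singular series. -/
lemma mainCoeff_one :
    mainCoeff (1 : DirichletCharacter ℂ 1) riemannZeta₁ = 2 * (landauRamanujan : ℂ) ^ 2 := by
  have h1 : riemannZeta₁ 1 = 1 := by simp [riemannZeta₁]
  have h4 : (2 : ℂ) ^ (-(2 * 1) : ℂ) = 1 / 4 := by
    rw [mul_one, show (-2 : ℂ) = ((-2 : ℤ) : ℂ) by norm_num, Complex.cpow_intCast]; norm_num
  rw [mainCoeff, h1, restrictedSeries_one_one, twoFactor, one_apply_modOne, one_apply_modOne, h4,
    Complex.cpow_neg_one]
  push_cast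
  ring

lemma zetaShift_eq (s : ℂ) : zetaShift s = riemannZeta₁ (s + 1) := by
  rcases eq_or_ne s 0 with rfl | hs
  · simp [zetaShift, riemannZeta₁]
  · rw [zetaShift, Function.update_of_ne hs, riemannZeta₁_eq_mul (by simpa using hs),
      add_sub_cancel_right]

/-! ### The regular part at the origin -/

lemma LFunction_chiFour_one_mem_slitPlane : chiFour.LFunction (0 + 1) ∈ Complex.slitPlane := by
  rw [zero_add, LFunction_chiFour_one, Complex.ofReal_mem_slitPlane]
  positivity

lemma zetaShift_zero : zetaShift 0 = 1 := by simp [zetaShift]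

lemma differentiable_zetaShift : Differentiable ℂ zetaShift := by
  rw [show zetaShift = fun s => riemannZeta₁ (s + 1) from funext zetaShift_eq]
  exact differentiable_riemannZeta₁.comp (by fun_prop)

lemma differentiable_LFunction_chiFour_shift :
    Differentiable ℂ fun s => chiFour.LFunction (s + 1) :=
  (DirichletCharacter.differentiable_LFunction chiFour_ne_one).comp (by fun_prop)

/-- Near `0` the square root of the Euler product of `s ζ(s + 1)` is the principal one. -/
lemma eventually_sqrtSeries_one : ∀ᶠ s in 𝓝[strip] 0,
    s ^ (1 / 2 : ℂ) * sqrtSeries (1 : DirichletCharacter ℂ 1) (s + 1) =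
      zetaShift s ^ (1 / 2 : ℂ) := by
  have hs1 : ∀ s ∈ strip, 1 < (s + 1).re := fun s hs => by
    have : 0 < s.re := hs.1
    simp; linarith
  refine eventually_eq_cpow_half (h := zetaShift) ?_ (differentiable_zetaShift.analyticAt 0)
    (by rw [zetaShift_zero]; exact Complex.one_mem_slitPlane) (fun s hs => ?_) fun x hx hx2 => ?_
  · refine DifferentiableOn.mul (fun s hs => ?_)
      ((differentiableOn_sqrtSeries _).comp (by fun_prop) hs1)
    exact ((differentiableAt_id (𝕜 := ℂ)).cpow_const (Or.inl hs.1)).differentiableWithinAt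
  · have hs0 : s ≠ 0 := Complex.ne_zero_of_re_pos hs.1
    rw [mul_pow, cpow_half_sq, sqrtSeries_sq _ (hs1 s hs),
      ← DirichletCharacter.LFunction_eq_LSeries _ (hs1 s hs),
        DirichletCharacter.LFunction_modOne_eq,
      zetaShift, Function.update_of_ne hs0]
  · obtain ⟨r, hr, hr2⟩ := sqrtSeries_re_pos (1 : DirichletCharacter ℂ 1)
      (fun p => by rw [one_apply_modOne]; simp) (show 1 < x + 1 by linarith)
    push_cast at hr2
    rw [hr2, show (1 / 2 : ℂ) = ((1 / 2 : ℝ) : ℂ) by push_cast; rfl, ← Complex.ofReal_cpow hx.le,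
      ← Complex.ofReal_mul, Complex.ofReal_re]
    positivity

/-- Near `0` the square root of the Euler product of `L(s + 1, χ₄)` is the principal one. -/
lemma eventually_sqrtSeries_chiFour : ∀ᶠ s in 𝓝[strip] 0,
    (sqrtSeries chiFour (s + 1))⁻¹ = chiFour.LFunction (s + 1) ^ (-(1 / 2) : ℂ) := by
  have hs1 : ∀ s ∈ strip, 1 < (s + 1).re := fun s hs => by
    have : 0 < s.re := hs.1
    simp; linarith
  have := eventually_eq_cpow_half (g := fun s => sqrtSeries chiFour (s + 1))
    (h := fun s => chiFour.LFunction (s + 1))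
    ((differentiableOn_sqrtSeries _).comp (by fun_prop) hs1)
    (differentiable_LFunction_chiFour_shift.analyticAt 0) LFunction_chiFour_one_mem_slitPlane
    (fun s hs => by
      rw [sqrtSeries_sq _ (hs1 s hs), DirichletCharacter.LFunction_eq_LSeries _ (hs1 s hs)])
    (fun x hx hx2 => by
      obtain ⟨r, hr, hr2⟩ := sqrtSeries_re_pos chiFour chiFour_im (show 1 < x + 1 by linarith)
      push_cast at hr2
      rw [hr2, Complex.ofReal_re]
      exact hr)
  filter_upwards [this] with s hs
  rw [hs, Complex.cpow_neg]

lemma auxM_eq {s : ℂ} (hs : -(1 / 2) < s.re) :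
    auxM s = twoFactor (1 : DirichletCharacter ℂ 1) s * chiFour.LFunction (s + 1) ^ (-(1 / 2) : ℂ) *
      (1 - 1 * (2 : ℂ) ^ (-(s + 1))) ^ (-(1 / 2) : ℂ) *
        factorThree (1 : DirichletCharacter ℂ 1) s := by
  have h := tprod_eq_factorThree (1 : DirichletCharacter ℂ 1) hs
  simp only [one_apply_modOne, one_pow, one_mul] at h
  simp only [auxM, twoFactor, one_apply_modOne, one_mul, h]

lemma eventually_re_gt : ∀ᶠ s in 𝓝 (0 : ℂ), -(1 / 2) < s.re :=
  (isOpen_lt continuous_const Complex.continuous_re).mem_nhds (by simp)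

/-- The integrand for the trivial character near `0`, with the singularity `s ^ (-3 / 2)`
removed. -/
lemma eventually_eq_regularPart : ∀ᶠ s in 𝓝[strip] 0,
    Complex.Gamma (s + 1) * riemannZeta s * twoFactor (1 : DirichletCharacter ℂ 1) s *
      (s ^ (1 / 2 : ℂ) * restrictedSeries (1 : DirichletCharacter ℂ 1) s) = regularPart s := by
  filter_upwards [eventually_sqrtSeries_one, eventually_sqrtSeries_chiFour,
    eventually_re_gt.filter_mono nhdsWithin_le_nhds, self_mem_nhdsWithin] with s h1 h2 h3 hs
  rw [regularPart, auxM_eq h3, ← h1, ← h2, restrictedSeries_eq isTwistByFour_chiFour hs.1,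
    one_apply_modOne]
  ring

lemma regularPart_eq {s : ℂ} (hs : -(1 / 2) < s.re) : regularPart s =
    Complex.Gamma (s + 1) * riemannZeta s * zetaShift s ^ (1 / 2 : ℂ) *
      (twoFactor (1 : DirichletCharacter ℂ 1) s * chiFour.LFunction (s + 1) ^ (-(1 / 2) : ℂ) *
      (1 - 1 * (2 : ℂ) ^ (-(s + 1))) ^ (-(1 / 2) : ℂ) *
      factorThree (1 : DirichletCharacter ℂ 1) s) := by rw [regularPart, auxM_eq hs]

lemma analyticAt_riemannZeta_zero : AnalyticAt ℂ riemannZeta 0 := by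
  refine DifferentiableOn.analyticAt (s := {1}ᶜ) (fun s hs => ?_)
    (isOpen_compl_singleton.mem_nhds (by simp))
  exact (differentiableAt_riemannZeta hs).differentiableWithinAt

lemma analyticAt_regularPart : AnalyticAt ℂ regularPart 0 := by
  refine AnalyticAt.congr ?_ (eventually_re_gt.mono fun s hs => (regularPart_eq hs).symm)
  exact ((analyticAt_Gamma_add_one.mul analyticAt_riemannZeta_zero).mul
    (analyticAt_cpow_half (differentiable_zetaShift.analyticAt 0)
      (by rw [zetaShift_zero]; exact Complex.one_mem_slitPlane) _)).mul
    (((((differentiable_twoFactor _).analyticAt 0).mul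
      (analyticAt_cpow_half (differentiable_LFunction_chiFour_shift.analyticAt 0)
        LFunction_chiFour_one_mem_slitPlane _)).mul
      (analyticAt_one_sub_cpow_inv_sqrt (by simp))).mul
      (analyticAt_of_differentiable_shift (differentiableOn_factorThree _)))

lemma factorThree_one_zero : factorThree (1 : DirichletCharacter ℂ 1) 0 =
    ((Real.sqrt 2 * landauRamanujan : ℝ) : ℂ) := by
  have e : ∀ p : PrimesThree, Complex.log (1 - (1 : DirichletCharacter ℂ 1) ((p : ℕ) : ZMod 1) ^ 2 *
      ((p : ℕ) : ℂ) ^ (-(2 * (0 + 1)) : ℂ)) =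
      ((Real.log (1 - ((p : ℕ) : ℝ) ^ (-2 : ℝ)) : ℝ) : ℂ) := by
    intro p
    have hpos : 0 ≤ 1 - ((p : ℕ) : ℝ) ^ (-2 : ℝ) := sub_nonneg.2
      (Real.rpow_le_one_of_one_le_of_nonpos (by exact_mod_cast p.2.1.one_le) (by norm_num))
    rw [Complex.ofReal_log hpos, Complex.ofReal_sub, Complex.ofReal_cpow (Nat.cast_nonneg _),
      one_apply_modOne]
    push_cast
    norm_num
  rw [factorThree, tsum_congr e, ← Complex.ofReal_tsum, landauRamanujan_eq]
  have h2 : Real.sqrt 2 ≠ 0 := by positivity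
  rw [← mul_assoc, mul_one_div_cancel h2, one_mul]
  push_cast
  rfl

lemma twoFactor_one_zero : twoFactor (1 : DirichletCharacter ℂ 1) 0 = 1 := by
  simp [twoFactor, one_apply_modOne]

lemma one_sub_two_cpow : (1 : ℂ) - 1 * (2 : ℂ) ^ (-(0 + 1) : ℂ) = ((1 / 2 : ℝ) : ℂ) := by
  rw [zero_add, Complex.cpow_neg_one]; push_cast; norm_num

/-- The leading coefficient, from `ζ(0) = -1 / 2` and `L(1, χ₄) = π / 4`. -/
lemma regularPart_zero :
    regularPart 0 = ((-(2 * landauRamanujan / Real.sqrt Real.pi) : ℝ) : ℂ) := by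
  have e4 : (((Real.pi / 4 : ℝ)) : ℂ) ^ (-(1 / 2) : ℂ) = ((2 / Real.sqrt Real.pi : ℝ) : ℂ) := by
    rw [show (-(1 / 2) : ℂ) = ((-(1 / 2) : ℝ) : ℂ) by push_cast; rfl,
      ← Complex.ofReal_cpow (by positivity), Real.rpow_neg (by positivity), ← Real.sqrt_eq_rpow,
      Real.sqrt_div' _ (by norm_num), show (4 : ℝ) = 2 ^ 2 by norm_num,
      Real.sqrt_sq (by norm_num), inv_div]
  have e2 : (((1 / 2 : ℝ)) : ℂ) ^ (-(1 / 2) : ℂ) = ((Real.sqrt 2 : ℝ) : ℂ) := by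
    rw [show (-(1 / 2) : ℂ) = ((-(1 / 2) : ℝ) : ℂ) by push_cast; rfl,
      ← Complex.ofReal_cpow (by positivity), Real.rpow_neg (by positivity), ← Real.sqrt_eq_rpow,
      Real.sqrt_div' _ (by norm_num), Real.sqrt_one, inv_div, div_one]
  rw [regularPart_eq (by simp), twoFactor_one_zero, factorThree_one_zero, one_sub_two_cpow, e2,
    zero_add, LFunction_chiFour_one, e4, zetaShift_zero, Complex.one_cpow, Complex.Gamma_one,
    riemannZeta_zero]
  have h2 : Real.sqrt 2 * Real.sqrt 2 = 2 := Real.mul_self_sqrt (by norm_num)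
  have h2' : ((Real.sqrt 2 : ℝ) : ℂ) * ((Real.sqrt 2 : ℝ) : ℂ) = 2 := by exact_mod_cast h2
  push_cast
  linear_combination (-(1 : ℂ) / (Real.sqrt Real.pi : ℂ) * (landauRamanujan : ℂ)) * h2'

/-- Logarithmic derivatives add. Writing derivatives as `f x * a` keeps track of them without
division. -/
lemma hasDerivAt_mul_logDeriv {x a b : ℂ} (hf : HasDerivAt f (f x * a) x)
    (hg : HasDerivAt g (g x * b) x) :
    HasDerivAt (fun s => f s * g s) (f x * g x * (a + b)) x := by
  refine (hf.mul hg).congr_deriv ?_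
  ring

/-- The logarithmic derivative of a principal power. -/
lemma hasDerivAt_cpow_logDeriv {x a c : ℂ} (hf : HasDerivAt f (f x * a) x)
    (hx : f x ∈ Complex.slitPlane) :
    HasDerivAt (fun s => f s ^ c) (f x ^ c * (c * a)) x := by
  refine (hf.cpow_const hx).congr_deriv ?_
  have h0 := Complex.slitPlane_ne_zero hx
  rw [Complex.cpow_sub _ _ h0, Complex.cpow_one]
  field_simp

/-- Termwise logarithmic differentiation of the product over `p ≡ 3` modulo `4`. -/
lemma hasDerivAt_factorThree_one : HasDerivAt (factorThree (1 : DirichletCharacter ℂ 1))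
    (factorThree (1 : DirichletCharacter ℂ 1) 0 *
      -((∑' p : PrimesThree, Real.log (p : ℕ) / (((p : ℕ) : ℝ) ^ 2 - 1) : ℝ) : ℂ)) 0 := by
  set F : PrimesThree → ℂ → ℂ := fun p s => Complex.log (1 - 1 * ((p : ℕ) : ℂ) ^ (-s))
  have hU : IsOpen {z : ℂ | 3 / 2 < z.re} := isOpen_lt continuous_const Complex.continuous_re
  have hp0 : ∀ p : PrimesThree, ((p : ℕ) : ℂ) ≠ 0 := fun p => by exact_mod_cast p.2.1.ne_zero
  have hF : ∀ p, ∀ s : ℂ, 1 ≤ s.re → HasDerivAt (F p)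
      (Complex.log (p : ℕ) * ((p : ℕ) : ℂ) ^ (-s) / (1 - 1 * ((p : ℕ) : ℂ) ^ (-s))) s := by
    intro p s hs
    have h1 : HasDerivAt (fun s : ℂ => 1 - 1 * ((p : ℕ) : ℂ) ^ (-s))
        (Complex.log (p : ℕ) * ((p : ℕ) : ℂ) ^ (-s)) s := by
      refine ((((hasDerivAt_neg' s).const_cpow (Or.inl (hp0 p))).const_mul 1).const_sub 1
        ).congr_deriv ?_
      ring
    exact h1.clog (one_sub_mem_slitPlane p.2.1.two_le (by simp) hs)
  have hbound : ∀ p : PrimesThree, ∀ w ∈ {z : ℂ | 3 / 2 < z.re},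
      ‖F p w‖ ≤ 3 / 2 * ((p : ℕ) : ℝ) ^ (-(3 / 2 : ℝ)) := fun p w hw =>
    norm_log_one_sub_le p.2.1.two_le (by simp) (by norm_num) (le_of_lt hw)
  have hu : Summable fun p : PrimesThree => 3 / 2 * ((p : ℕ) : ℝ) ^ (-(3 / 2 : ℝ)) :=
    (summable_rpow_neg injective_coe_primesThree (by norm_num)).mul_left _
  have hFd : ∀ p, DifferentiableOn ℂ (F p) {z : ℂ | 3 / 2 < z.re} := fun p z hz =>
    (hF p z (by have : 3 / 2 < z.re := hz
                linarith)).differentiableAt.differentiableWithinAt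
  have h2 : (2 : ℂ) ∈ {z : ℂ | 3 / 2 < z.re} := by norm_num
  have hd := (Complex.hasSum_deriv_of_summable_norm hu hFd hU hbound h2).tsum_eq
  have hdiff := (Complex.differentiableOn_tsum_of_summable_norm hu hFd hU hbound).differentiableAt
    (hU.mem_nhds h2)
  have hterm : ∀ p : PrimesThree, deriv (F p) 2 =
      ((Real.log (p : ℕ) / (((p : ℕ) : ℝ) ^ 2 - 1) : ℝ) : ℂ) := by
    intro p
    have hp2 : (2 : ℝ) ≤ (p : ℕ) := by exact_mod_cast p.2.1.two_le
    have h1 : (((p : ℕ) : ℂ) ^ 2 - 1) ≠ 0 := by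
      have : (((p : ℕ) : ℝ) ^ 2 - 1) ≠ 0 := by nlinarith
      exact_mod_cast this
    have h3 : ((p : ℕ) : ℂ) ^ (-2 : ℂ) = (((p : ℕ) : ℂ) ^ 2)⁻¹ := by
      rw [Complex.cpow_neg]; norm_num
    have h4 := hp0 p
    rw [(hF p 2 (by norm_num)).deriv, h3]
    push_cast
    rw [one_mul]
    have h5 : (1 : ℂ) - (((p : ℕ) : ℂ) ^ 2)⁻¹ = (((p : ℕ) : ℂ) ^ 2 - 1) / ((p : ℕ) : ℂ) ^ 2 := by
      field_simp
    rw [h5]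
    field_simp
  have hsum : HasDerivAt (fun s => ∑' p, F p s)
      ((∑' p : PrimesThree, Real.log (p : ℕ) / (((p : ℕ) : ℝ) ^ 2 - 1) : ℝ) : ℂ) (2 * (0 + 1)) := by
    rw [Complex.ofReal_tsum, ← tsum_congr hterm, hd, zero_add, mul_one]
    exact hdiff.hasDerivAt
  have hlin : HasDerivAt (fun s : ℂ => 2 * (s + 1)) 2 0 := by
    simpa using ((hasDerivAt_id (0 : ℂ)).add_const 1).const_mul 2
  have hcomp := ((hsum.comp (0 : ℂ) hlin).const_mul (-(1 / 2) : ℂ)).cexp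
  have e : factorThree (1 : DirichletCharacter ℂ 1) =
      fun s => Complex.exp (-(1 / 2) * ((fun s => ∑' p, F p s) ∘ fun s : ℂ => 2 * (s + 1)) s) := by
    ext s
    simp only [factorThree, F, one_apply_modOne, one_pow, Function.comp]
  rw [e]
  refine hcomp.congr_deriv ?_
  ring

lemma hasDerivAt_two_cpow (a b : ℂ) :
    HasDerivAt (fun s : ℂ => (2 : ℂ) ^ (a * s + b)) ((2 : ℂ) ^ b * Complex.log 2 * a) 0 := by
  have h : HasDerivAt (fun s : ℂ => a * s + b) a 0 := by
    simpa using ((hasDerivAt_id (0 : ℂ)).const_mul a).add_const b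
  simpa using h.const_cpow (c := 2) (Or.inl two_ne_zero)

/-- The logarithmic derivative at `0`, which produces the constant `ω + γ`. -/
lemma hasDerivAt_regularPart : HasDerivAt regularPart
    (regularPart 0 * (-(omegaConst + Real.eulerMascheroniConstant) / 2)) 0 := by
  have hlog2 : Complex.log 2 = (Real.log 2 : ℝ) := by
    rw [Complex.ofReal_log (by norm_num)]; push_cast; rfl
  have d1 : HasDerivAt (fun s => Complex.Gamma (s + 1))
      (Complex.Gamma (0 + 1) * -(Real.eulerMascheroniConstant : ℂ)) 0 := by
    have h : HasDerivAt Complex.Gamma (-(Real.eulerMascheroniConstant : ℂ)) (0 + 1) := by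
      rw [zero_add]; exact Complex.hasDerivAt_Gamma_one
    simpa using h.comp_add_const 0 1
  have d2 : HasDerivAt riemannZeta (riemannZeta 0 * (Real.log (2 * Real.pi) : ℝ)) 0 := by
    have h := analyticAt_riemannZeta_zero.differentiableAt.hasDerivAt
    rw [deriv_riemannZeta_zero] at h
    refine h.congr_deriv ?_
    rw [riemannZeta_zero, Complex.ofReal_log (by positivity)]
    push_cast
    ring
  have d3 : HasDerivAt zetaShift (zetaShift 0 * (Real.eulerMascheroniConstant : ℂ)) 0 := by
    rw [zetaShift_zero, one_mul, show zetaShift = fun s =>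
      riemannZeta₁ (s + 1) from funext zetaShift_eq]
    have h := (differentiable_riemannZeta₁ 1).hasDerivAt
    rw [deriv_riemannZeta₁_one] at h
    have h' : HasDerivAt riemannZeta₁ (Real.eulerMascheroniConstant : ℂ) (0 + 1) :=
        by rwa [zero_add]
    exact h'.comp_add_const 0 1
  have d3' := hasDerivAt_cpow_logDeriv (c := (1 / 2 : ℂ)) d3
    (by rw [zetaShift_zero]; exact Complex.one_mem_slitPlane)
  have d4 : HasDerivAt (twoFactor (1 : DirichletCharacter ℂ 1))
      (twoFactor (1 : DirichletCharacter ℂ 1) 0 * -(Real.log 2 : ℝ)) 0 := by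
    have h := (hasDerivAt_const (0 : ℂ) (1 : ℂ)).sub (hasDerivAt_two_cpow (-1) 0) |>.add
      (hasDerivAt_two_cpow (-2) 0)
    have e : twoFactor (1 : DirichletCharacter ℂ 1) = fun s : ℂ =>
        (1 - (2 : ℂ) ^ (-1 * s + 0)) + (2 : ℂ) ^ (-2 * s + 0) := by
      ext s
      simp only [twoFactor, one_apply_modOne, one_mul]
      ring_nf
    rw [twoFactor_one_zero, e]
    refine h.congr_deriv ?_
    rw [hlog2, Complex.cpow_zero]
    ring
  have d5 : HasDerivAt (fun s => chiFour.LFunction (s + 1)) (chiFour.LFunction (0 + 1) *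
      (deriv chiFour.LFunction 1 / chiFour.LFunction 1)) 0 := by
    have h0 : chiFour.LFunction 1 ≠ 0 :=
        DirichletCharacter.LFunction_apply_one_ne_zero chiFour_ne_one
    rw [zero_add, mul_div_cancel₀ _ h0]
    have h := (DirichletCharacter.differentiable_LFunction chiFour_ne_one 1).hasDerivAt
    have h' : HasDerivAt chiFour.LFunction (deriv chiFour.LFunction 1) (0 + 1) := by rwa [zero_add]
    exact h'.comp_add_const 0 1
  have d5' := hasDerivAt_cpow_logDeriv (c := (-(1 / 2) : ℂ)) d5 LFunction_chiFour_one_mem_slitPlane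
  have d6 : HasDerivAt (fun s : ℂ => 1 - 1 * (2 : ℂ) ^ (-(s + 1)))
      ((1 - 1 * (2 : ℂ) ^ (-(0 + 1) : ℂ)) * (Real.log 2 : ℝ)) 0 := by
    have h := (hasDerivAt_const (0 : ℂ) (1 : ℂ)).sub (hasDerivAt_two_cpow (-1) (-1))
    have e : (fun s : ℂ => 1 - 1 * (2 : ℂ) ^ (-(s + 1))) =
        fun s => (1 : ℂ) - (2 : ℂ) ^ (-1 * s + -1) := by
      ext s
      ring_nf
    rw [one_sub_two_cpow, e]
    refine h.congr_deriv ?_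
    rw [hlog2, Complex.cpow_neg_one]
    push_cast
    ring
  have d6' := hasDerivAt_cpow_logDeriv (c := (-(1 / 2) : ℂ)) d6
    (by rw [one_sub_two_cpow, Complex.ofReal_mem_slitPlane]; norm_num)
  have hprod := hasDerivAt_mul_logDeriv (hasDerivAt_mul_logDeriv (hasDerivAt_mul_logDeriv d1 d2) d3')
    (hasDerivAt_mul_logDeriv (hasDerivAt_mul_logDeriv (hasDerivAt_mul_logDeriv d4 d5') d6')
      hasDerivAt_factorThree_one)
  refine (hprod.congr_of_eventuallyEq
    (eventually_re_gt.mono fun s hs => regularPart_eq hs)).congr_deriv ?_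
  rw [← regularPart_eq (by simp)]
  congr 1
  rw [omegaConst, Real.log_div (by norm_num) (by positivity), Real.log_pow,
    Real.log_mul (by norm_num) (by positivity)]
  push_cast
  ring

/-! ### Expansions of the twisted sums -/

/-- The zeta or `L` factor, damped by the gamma factor, decays rapidly on the strip. -/
lemma rapidOn_Gamma_mul_LFunction [NeZero N] (χ : DirichletCharacter ℂ N) :
    RapidOn strip (fun s => Complex.Gamma (s + 1) * χ.LFunction s) := fun n A => by
  have hne : ∀ s : ℂ, s.re ≤ 3 / 4 → s ≠ 1 := fun s hs h => by rw [h] at hs; norm_num at hs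
  refine tameOn_strip_of_growthOn (fun s hs => ?_) ?_ n
  · refine DifferentiableAt.differentiableWithinAt (DifferentiableAt.mul ?_
      (DirichletCharacter.differentiableAt_LFunction χ s (Or.inl (hne s hs.2))))
    have : 0 < (s + 1).re := by
      have := hs.1
      simp only [Complex.add_re, Complex.one_re]; linarith
    exact (differentiableAt_Gamma_of_re_pos this).comp s (by fun_prop)
  · obtain ⟨C, hC0, hC⟩ := (growthOn_Gamma_mul_LFunction χ A).exists_nonneg
    refine ⟨C * 4, fun s hs => ?_⟩
    have h1 := hC s ⟨hs.1, by linarith [hs.2]⟩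
    -- the strip stays away from `1`, so the factor `s - 1` can be dropped
    have h2 : 1 / 4 ≤ ‖s - 1‖ := by
      have h3 := (abs_le.1 (Complex.abs_re_le_norm (s - 1))).1
      have h4 := hs.2
      simp only [Complex.sub_re, Complex.one_re] at h3
      linarith
    have e : Complex.Gamma (s + 1) * ((s - 1) * χ.LFunction s) =
        (s - 1) * (Complex.Gamma (s + 1) * χ.LFunction s) := by ring
    rw [e, norm_mul] at h1
    nlinarith [norm_nonneg (Complex.Gamma (s + 1) * χ.LFunction s)]

lemma isBigO_rpow_neg_of_nat (J : ℕ) :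
    (fun L : ℝ => L ^ (-((J + 1 : ℕ) : ℝ))) =O[atTop] fun L => L ^ (-(1 : ℝ) / 2 - J) := by
  refine IsBigO.of_bound 1 ?_
  filter_upwards [eventually_ge_atTop 1] with L hL
  rw [one_mul, Real.norm_of_nonneg (by positivity), Real.norm_of_nonneg (by positivity)]
  refine Real.rpow_le_rpow_of_exponent_le hL ?_
  push_cast
  linarith

lemma vline_ne_zero {c t : ℝ} (hc : 0 < c) : vline c t ≠ 0 := fun h => by
  have := congrArg Complex.re h
  rw [vline_re] at this
  exact hc.ne' this

/-- For a non-principal character the smoothed sum converges to `C_{q,χ}`, faster than any power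
of the logarithm. -/
lemma twistedSum_nonprincipal {q : ℕ} [NeZero q] (hq : Nat.Coprime 4 q)
    {χ : DirichletCharacter ℂ q} (hχ : χ ≠ 1) (J : ℕ) :
    (fun L : ℝ => twistedSum χ (Real.exp L) - charConst χ)
      =O[atTop] fun L => L ^ (-(1 : ℝ) / 2 - J) := by
  obtain ⟨g, hg, hg0, hRg⟩ := exists_analyticAt_nonprincipal hq hχ
  set R : ℂ → ℂ := fun s =>
    Complex.Gamma (s + 1) * (χ.LFunction s * restrictedSeries χ s * twoFactor χ s)
  have hR : RapidOn strip R := fun n A => by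
    have h1 := (((polyTameOn_restrictedSeries (isTwistByFour_mulChiFour χ) hχ
      (mulChiFour_ne_one hq χ)).mul isOpen_strip (polyTameOn_twoFactor χ)).mul_rapid isOpen_strip
      (rapidOn_Gamma_mul_LFunction χ)) n A
    exact h1.congr isOpen_strip fun s _ => by simp only [R]; ring
  refine IsBigO.trans ?_ (isBigO_rpow_neg_of_nat J)
  refine (inverseLaplace_one (fun n => hR n (-1)) hg hRg (J + 1)).congr' ?_ EventuallyEq.rfl
  filter_upwards [eventually_gt_atTop 1] with L hL
  have hc : 0 < 1 / L := by positivity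
  -- as `L(s, χ)` is entire, the function `(s - 1) L(s, χ)` vanishes at `1`, and there is no main
  -- term
  have hZ : Differentiable ℂ fun s => (s - 1) * χ.LFunction s :=
    (by fun_prop : Differentiable ℂ fun s : ℂ => s - 1).mul
      (DirichletCharacter.differentiable_LFunction hχ)
  rw [twistedSum_eq_add χ hZ (fun s _ =>
    rfl) L hc (by rw [div_lt_one (by linarith)]; exact hL), hg0,
    mainCoeff]
  simp only [sub_self, zero_mul, zero_add, sub_zero]
  congr 3
  ext t
  have h0 := vline_ne_zero (t := t) hc
  simp only [R, mellinIntegrand]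
  rw [Complex.Gamma_add_one _ h0]
  field_simp

lemma abs_exp_neg_sub_le {x : ℝ} (h0 : 0 ≤ x) (h1 : x ≤ 1) : |Real.exp (-x) - (1 - x)| ≤ x ^ 2 := by
  have h := Real.abs_exp_sub_one_sub_id_le (x := -x) (by rw [abs_neg, abs_of_nonneg h0]; exact h1)
  rw [neg_sq] at h
  convert h using 2
  ring

/-- The weight `e^{-1/H}` in the main term contributes `H - 1` up to a negligible error. -/
lemma exp_mul_exp_neg_exp_isBigO (l : ℝ) (n : ℕ) :
    (fun L : ℝ => Real.exp (L - l) * Real.exp (-Real.exp (-(L - l))) - (Real.exp (L - l) - 1))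
      =O[atTop] fun L => L ^ (-(n : ℝ)) := by
  have h1 : (fun L : ℝ => Real.exp (L - l) * Real.exp (-Real.exp (-(L - l))) -
      (Real.exp (L - l) - 1)) =O[atTop] fun L => Real.exp (-L) := by
    refine IsBigO.of_bound (Real.exp l) ?_
    filter_upwards [eventually_ge_atTop l] with L hL
    have hx : 0 < Real.exp (-(L - l)) := Real.exp_pos _
    have hx1 : Real.exp (-(L - l)) ≤ 1 := Real.exp_le_one_iff.2 (by linarith)
    have h2 := abs_exp_neg_sub_le hx.le hx1
    have e : Real.exp (L - l) * Real.exp (-(L - l)) = 1 := by rw [← Real.exp_add]; simp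
    have e2 : Real.exp (L - l) * Real.exp (-Real.exp (-(L - l))) - (Real.exp (L - l) - 1) =
        Real.exp (L - l) * (Real.exp (-Real.exp (-(L - l))) - (1 - Real.exp (-(L - l)))) := by
      linear_combination -e
    rw [e2, norm_mul, Real.norm_of_nonneg (Real.exp_pos _).le, Real.norm_eq_abs,
      Real.norm_of_nonneg (Real.exp_pos _).le, ← Real.exp_add, show l + -L = -(L - l) by ring]
    calc _ ≤ Real.exp (L - l) * Real.exp (-(L - l)) ^ 2 := by gcongr
      _ = _ := by rw [sq, ← mul_assoc, e, one_mul]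
  refine h1.trans ?_
  have h3 := (isLittleO_exp_neg_mul_rpow_atTop one_pos (-(n : ℝ))).isBigO
  simpa using h3

/-- The expansion of the smoothed sum over all `h`, at `H = e^{L - l}`, in powers of `L`. -/
lemma twistedSum_principal (l : ℝ) (J : ℕ) :
    (fun L : ℝ => twistedSum (1 : DirichletCharacter ℂ 1) (Real.exp (L - l)) -
      (2 * (landauRamanujan : ℂ) ^ 2 * (Real.exp (L - l) : ℝ) +
      ∑ j ∈ Finset.range (J + 1),
        (iteratedDeriv j (fun s => Complex.exp (-l * s) * regularPart s) 0 / (j.factorial : ℂ)) /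
          Complex.Gamma (3 / 2 - (j : ℂ)) * ((L ^ ((1 : ℝ) / 2 - j) : ℝ) : ℂ)))
      =O[atTop] fun L => L ^ (-(1 : ℝ) / 2 - J) := by
  set χ := (1 : DirichletCharacter ℂ 1)
  set R₀ : ℂ → ℂ := fun s => Complex.Gamma (s + 1) * riemannZeta s * twoFactor χ s *
    (s ^ (1 / 2 : ℂ) * restrictedSeries χ s)
  set R : ℂ → ℂ := fun s => Complex.exp (-l * s) * R₀ s
  have hL1 : χ.LFunction = riemannZeta := DirichletCharacter.LFunction_modOne_eq
  have hR₀ : RapidOn strip R₀ := fun n A => by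
    have h1 := ((polyTameOn_restrictedSeries_one.mul isOpen_strip (polyTameOn_twoFactor χ)).mul_rapid
      isOpen_strip (rapidOn_Gamma_mul_LFunction χ)) n A
    exact h1.congr isOpen_strip fun s _ => by simp only [R₀, hL1]; ring
  have hR : RapidOn strip R := (polyTameOn_exp_const_mul l).mul_rapid isOpen_strip hR₀
  have hg : AnalyticAt ℂ (fun s => Complex.exp (-l * s) * regularPart s) 0 :=
    ((by fun_prop : Differentiable ℂ fun s : ℂ => Complex.exp (-l * s)).analyticAt 0).mul
      analyticAt_regularPart
  have hRg : ∀ᶠ s in 𝓝[strip] 0, R s = Complex.exp (-l * s) * regularPart s :=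
    eventually_eq_regularPart.mono fun s hs => by simp only [R, R₀, hs, χ]
  have k1 := inverseLaplace_three_halves (fun n => hR n 0) hg hRg J
  have k2 := ((inverseLaplace_Gamma_div l (J + 1)).trans (isBigO_rpow_neg_of_nat J)).const_mul_left
    (2 * (landauRamanujan : ℂ) ^ 2)
  have k3 := (((exp_mul_exp_neg_exp_isBigO l (J +
      1)).trans (isBigO_rpow_neg_of_nat J)).norm_left.congr_left
    (fun L => (Complex.norm_real _).symm)).of_norm_left.const_mul_left (2 *
      (landauRamanujan : ℂ) ^ 2)
  -- the contribution `-1` of the subtracted pole cancels the `-1` in the expansion of the main term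
  refine ((k1.sub k2).add k3).congr' ?_ EventuallyEq.rfl
  filter_upwards [eventually_gt_atTop 1] with L hL
  have hc : 0 < 1 / L := by positivity
  have hI : ∫ t : ℝ, (R (vline (1 / L) t) * vline (1 / L) t ^ ((-(3 / 2) : ℝ) : ℂ)) *
      Complex.exp (L * vline (1 / L) t) = ∫ t : ℝ, mellinIntegrand χ (vline (1 / L) t) *
        Complex.exp ((L - l : ℝ) * vline (1 / L) t) := by
    congr 1
    ext t
    have h0 := vline_ne_zero (t := t) hc
    have e : vline (1 / L) t ^ (1 / 2 : ℂ) * vline (1 / L) t ^ ((-(3 / 2) : ℝ) : ℂ) =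
        (vline (1 / L) t)⁻¹ := by
      rw [← Complex.cpow_add _ _ h0, ← Complex.cpow_neg_one]
      congr 1; push_cast; norm_num
    simp only [R, R₀, mellinIntegrand, hL1]
    rw [Complex.Gamma_add_one _ h0, exp_shift_mul]
    calc _ = Complex.exp (-l * vline (1 / L) t) *
        (vline (1 / L) t * Complex.Gamma (vline (1 / L) t) *
          riemannZeta (vline (1 / L) t) * twoFactor χ (vline (1 / L) t) *
          restrictedSeries χ (vline (1 / L) t)) * (vline (1 / L) t ^ (1 / 2 : ℂ) *
          vline (1 / L) t ^ ((-(3 / 2) : ℝ) : ℂ)) * Complex.exp (L * vline (1 / L) t) := by ring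
      _ = _ := by rw [e]; field_simp
  rw [hI, twistedSum_eq_add χ differentiable_riemannZeta₁ (fun s hs => by
    rw [riemannZeta₁_eq_mul hs, hL1]) (L - l) hc (by rw [div_lt_one (by linarith)]; exact hL),
    mainCoeff_one]
  push_cast
  ring

/-! ### Residue classes and the coefficients of the expansions -/

/-- The smoothed sum of the arithmetic factor of the singular series over all `h`, as a real
number. -/
def smoothSum (H : ℝ) : ℝ := ∑' h : ℕ, pairArith h * Real.exp (-(h : ℝ) / H)

lemma exp_neg_div_le {H : ℝ} (hH : 0 < H) {h : ℕ} (hh : h ≠ 0) :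
    Real.exp (-(h : ℝ) / H) ≤ 2 * H ^ 2 * (1 / (h : ℝ) ^ 2) := by
  have hh0 : (0 : ℝ) < h := by exact_mod_cast Nat.pos_of_ne_zero hh
  have h1 := Real.pow_div_factorial_le_exp ((h : ℝ) / H) (by positivity) 2
  rw [neg_div, Real.exp_neg, inv_le_comm₀ (Real.exp_pos _) (by positivity)]
  refine le_trans (le_of_eq ?_) h1
  simp only [Nat.factorial]
  field_simp
  norm_num

lemma summable_smoothSum {H : ℝ} (hH : 0 < H) :
    Summable fun h : ℕ => pairArith h * Real.exp (-(h : ℝ) / H) := by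
  have h1 := (LSeriesHasSum_pairArith (1 : DirichletCharacter ℂ 1) (s := 2)
    (by norm_num)).LSeriesSummable.norm
  refine Summable.of_norm_bounded (h1.mul_left (2 * H ^ 2)) fun h => ?_
  rcases eq_or_ne h 0 with rfl | hh
  · simp
  · rw [LSeries.term_of_ne_zero hh, one_apply_modOne, one_mul, norm_mul, norm_div,
      Complex.norm_real,
      Real.norm_of_nonneg (Real.exp_pos _).le]
    have h2 := exp_neg_div_le hH hh
    have h3 : ‖((h : ℂ)) ^ (2 : ℂ)‖ = (h : ℝ) ^ 2 := by
      rw [show (2 : ℂ) = ((2 : ℕ) : ℂ) by norm_num, Complex.cpow_natCast, norm_pow,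
        Complex.norm_natCast]
    rw [h3]
    calc _ ≤ ‖pairArith h‖ * (2 * H ^ 2 * (1 / (h : ℝ) ^ 2)) := by gcongr
      _ = _ := by ring

lemma smoothSum_eq_twistedSum (H : ℝ) :
    ((smoothSum H : ℝ) : ℂ) = twistedSum (1 : DirichletCharacter ℂ 1) H := by
  rw [smoothSum, twistedSum, Complex.ofReal_tsum]
  refine tsum_congr fun h => ?_
  rw [one_apply_modOne, one_mul]
  push_cast
  rfl

/-- The weighted sum of the singular series over a set of positive integers; the summand at `0` has
to be excluded because of `singularSeries_pair`. -/
lemma weightedSum_eq {A : Set ℕ} (hA : ∀ h ∈ A, h ≠ 0) (H : ℝ) :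
    weightedSum A H = 1 / (2 * landauRamanujan ^ 2) *
      ∑' h : ℕ, A.indicator (fun h : ℕ => pairArith h * Real.exp (-(h : ℝ) / H)) h := by
  rw [weightedSum, ← tsum_subtype, ← tsum_mul_left]
  refine tsum_congr fun h => ?_
  rw [singularSeries_pair (hA h h.2), mul_assoc]

lemma weightedSum_all (H : ℝ) :
    weightedSum {h : ℕ | 1 ≤ h} H = 1 / (2 * landauRamanujan ^ 2) * smoothSum H := by
  rw [weightedSum_eq (A := {h : ℕ | 1 ≤ h}) (fun h hh => Nat.one_le_iff_ne_zero.1 hh), smoothSum]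
  congr 1
  refine tsum_congr fun h => ?_
  by_cases hh : h ∈ {h : ℕ | 1 ≤ h}
  · rw [Set.indicator_of_mem hh]
  · have h0 : h = 0 := by
      simp only [Set.mem_ofPred_eq] at hh; omega
    rw [Set.indicator_of_notMem hh, h0]
    simp

/-- Multiples of a prime `q ≡ 1` modulo `4`: the singular series does not see the factor `q`. -/
lemma tsum_indicator_dvd {q : ℕ} (hq : q.Prime) (h1 : q % 4 = 1) (H : ℝ) :
    ∑' h : ℕ, {h : ℕ | (h : ZMod q) = 0}.indicator
      (fun h : ℕ => pairArith h * Real.exp (-(h : ℝ) / H)) h = smoothSum (H / q) := by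
  have hinj : Function.Injective (fun m : ℕ => q * m) := mul_right_injective₀ hq.ne_zero
  rw [smoothSum, ← hinj.tsum_eq]
  · refine tsum_congr fun m => ?_
    rw [Set.indicator_of_mem (by simp), pairArith_mul_of_one_mod_four hq h1]
    congr 2
    have : (q : ℝ) ≠ 0 := by exact_mod_cast hq.ne_zero
    push_cast
    rw [neg_div, neg_div, div_div_eq_mul_div, mul_comm]
  · intro h hh
    have := Set.mem_of_indicator_ne_zero hh
    obtain ⟨m, hm⟩ := (ZMod.natCast_eq_zero_iff h q).1 this
    exact ⟨m, hm.symm⟩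

/-- The sum over the multiples of `q` is the sum over all `h` with `H` replaced by `H / q`. -/
lemma weightedSum_zero_class {q : ℕ} (hq : q.Prime) (h1 : q % 4 = 1) (H : ℝ) :
    weightedSum {h : ℕ | 1 ≤ h ∧ (h : ZMod q) = 0} H =
      1 / (2 * landauRamanujan ^ 2) * smoothSum (H / q) := by
  rw [weightedSum_eq (fun h hh => (Nat.one_le_iff_ne_zero.1 hh.1)), ← tsum_indicator_dvd hq h1]
  congr 1
  refine tsum_congr fun h => ?_
  rcases eq_or_ne h 0 with rfl | hh
  · rw [Set.indicator_of_notMem (by simp), Set.indicator_of_mem (by simp)]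
    simp
  · have e : (h ∈ {h : ℕ | 1 ≤ h ∧ (h : ZMod q) = 0}) ↔ h ∈ {h : ℕ | (h : ZMod q) = 0} := by
      simp only [Set.mem_ofPred_eq, and_iff_right_iff_imp]
      intro; omega
    by_cases hm : h ∈ {h : ℕ | (h : ZMod q) = 0}
    · rw [Set.indicator_of_mem hm, Set.indicator_of_mem (e.2 hm)]
    · rw [Set.indicator_of_notMem hm, Set.indicator_of_notMem (mt e.1 hm)]

lemma summable_twistedSum (χ : DirichletCharacter ℂ N) {H : ℝ} (hH : 0 < H) :
    Summable fun h : ℕ => χ (h : ZMod N) * pairArith h * Real.exp (-(h : ℝ) / H) := by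
  refine Summable.of_norm_bounded (summable_smoothSum hH).norm fun h => ?_
  rw [mul_assoc, norm_mul, ← Complex.ofReal_mul, Complex.norm_real]
  exact mul_le_of_le_one_left (norm_nonneg _) (χ.norm_le_one _)

/-- The principal character modulo `q` removes the multiples of `q`. -/
lemma twistedSum_one_of_prime {q : ℕ} [Fact q.Prime] (h1 : q % 4 = 1) {H : ℝ} (hH : 0 < H) :
    twistedSum (1 : DirichletCharacter ℂ q) H = ((smoothSum H - smoothSum (H / q) : ℝ) : ℂ) := by
  have hs := summable_smoothSum hH
  rw [← tsum_indicator_dvd Fact.out h1, smoothSum, ← hs.tsum_sub (hs.indicator _),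
    Complex.ofReal_tsum, twistedSum]
  refine tsum_congr fun h => ?_
  by_cases hm : (h : ZMod q) = 0
  · rw [Set.indicator_of_mem (by exact hm), hm, MulChar.map_zero]
    simp
  · rw [Set.indicator_of_notMem (by exact hm), MulChar.one_apply (isUnit_iff_ne_zero.2 hm)]
    push_cast
    ring

/-- Orthogonality of the characters modulo `q`. -/
lemma star_character_mul_sum {q : ℕ} [Fact q.Prime] {v : ZMod q} (hv : v ≠ 0) (a : ZMod q) :
    ∑ χ : DirichletCharacter ℂ q, starRingEnd ℂ (χ v) * χ a =
      if v = a then (q.totient : ℂ) else 0 := by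
  rw [← DirichletCharacter.sum_char_inv_mul_char_eq ℂ (isUnit_iff_ne_zero.2 hv) a]
  refine Finset.sum_congr rfl fun χ _ => ?_
  congr 1
  rw [← MulChar.inv_apply', ← MulChar.star_apply']
  rfl

/-- The sum over a nonzero residue class in terms of the twisted sums. -/
lemma weightedSum_class {q : ℕ} [Fact q.Prime] (h1 : q % 4 = 1) {v : ZMod q} (hv : v ≠ 0) {H : ℝ}
    (hH : 0 < H) :
    (weightedSum {h : ℕ | 1 ≤ h ∧ (h : ZMod q) = v} H : ℂ) =
      1 / (2 * (landauRamanujan : ℂ) ^ 2 * (q.totient : ℂ)) *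
        (((smoothSum H - smoothSum (H / q) : ℝ) : ℂ) +
          ∑ χ ∈ (Finset.univ : Finset (DirichletCharacter ℂ q)).filter (fun χ => χ ≠ 1),
            starRingEnd ℂ (χ v) * twistedSum χ H) := by
  have hφ : (q.totient : ℂ) ≠ 0 := by
    exact_mod_cast (Nat.totient_pos.2 (Fact.out : q.Prime).pos).ne'
  have hsum : ∑ χ : DirichletCharacter ℂ q, starRingEnd ℂ (χ v) * twistedSum χ H =
      (q.totient : ℂ) * ((∑' h : ℕ, {h : ℕ | 1 ≤ h ∧ (h : ZMod q) = v}.indicator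
        (fun h : ℕ => pairArith h * Real.exp (-(h : ℝ) / H)) h : ℝ) : ℂ) := by
    simp only [twistedSum, ← tsum_mul_left]
    rw [← Summable.tsum_finsetSum fun χ _ => (summable_twistedSum χ hH).mul_left _,
      Complex.ofReal_tsum, ← tsum_mul_left]
    refine tsum_congr fun h => ?_
    have e : ∑ χ : DirichletCharacter ℂ q, starRingEnd ℂ (χ v) * (χ (h : ZMod q) * pairArith h *
        Real.exp (-(h : ℝ) / H)) = (if v = (h : ZMod q) then (q.totient : ℂ) else 0) *
          (pairArith h * Real.exp (-(h : ℝ) / H)) := by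
      rw [← star_character_mul_sum hv, Finset.sum_mul]
      exact Finset.sum_congr rfl fun χ _ => by ring
    rw [e]
    by_cases hm : v = h
    · have hh : h ∈ {h : ℕ | 1 ≤ h ∧ (h : ZMod q) = v} := by
        refine ⟨Nat.one_le_iff_ne_zero.2 fun h0 => hv ?_, hm.symm⟩
        rw [hm, h0, Nat.cast_zero]
      rw [if_pos hm, Set.indicator_of_mem hh]
      push_cast
      rfl
    · rw [if_neg hm, Set.indicator_of_notMem fun hh => hm hh.2.symm]
      simp
  have hsplit : ∑ χ : DirichletCharacter ℂ q, starRingEnd ℂ (χ v) * twistedSum χ H =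
      ((smoothSum H - smoothSum (H / q) : ℝ) : ℂ) +
        ∑ χ ∈ (Finset.univ : Finset (DirichletCharacter ℂ q)).filter (fun χ => χ ≠ 1),
            starRingEnd ℂ (χ v) * twistedSum χ H := by
    rw [← Finset.sum_filter_add_sum_filter_not _ (fun χ : DirichletCharacter ℂ q => χ = 1)]
    congr 1
    rw [Finset.filter_eq', if_pos (Finset.mem_univ _), Finset.sum_singleton,
      MulChar.one_apply (isUnit_iff_ne_zero.2 hv), map_one, one_mul, twistedSum_one_of_prime h1 hH]
  rw [← hsplit, hsum, weightedSum_eq (fun h hh => (Nat.one_le_iff_ne_zero.1 hh.1))]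
  push_cast
  field_simp

/-- If a real function has an expansion in descending powers of `L` with complex coefficients, then
the coefficients are real: the first one that is not would dominate the imaginary part. -/
lemma im_eq_zero_of_expansion {F : ℝ → ℝ} {a : ℕ → ℂ} (hF : ∀ J : ℕ,
    (fun L : ℝ => (F L : ℂ) - ∑ j ∈ Finset.range (J + 1), a j * ((L ^ ((1 : ℝ) / 2 - j) : ℝ) : ℂ))
      =O[atTop] fun L => L ^ (-(1 : ℝ) / 2 - J)) (j : ℕ) : (a j).im = 0 := by
  induction j using Nat.strong_induction_on with
  | _ j ih =>
    have h1 : (fun L : ℝ => (a j).im * L ^ ((1 : ℝ) / 2 - j)) =O[atTop]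
        fun L => L ^ (-(1 : ℝ) / 2 - j) := by
      refine IsBigO.trans (IsBigO.of_bound 1 (Eventually.of_forall fun L => ?_)) (hF j)
      rw [one_mul]
      refine le_trans (le_of_eq ?_) (Complex.abs_im_le_norm _)
      rw [Real.norm_eq_abs, Complex.sub_im, Complex.ofReal_im, Complex.im_sum,
        Finset.sum_range_succ, Finset.sum_eq_zero fun i hi => ?_, zero_add, zero_sub, abs_neg,
        Complex.im_mul_ofReal]
      rw [Complex.im_mul_ofReal, ih i (Finset.mem_range.1 hi), zero_mul]
    have h2 : (fun _ : ℝ => (a j).im) =O[atTop] fun L : ℝ => L ^ (-(1 : ℝ)) := by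
      have h3 := h1.mul (isBigO_refl (fun L : ℝ => L ^ (-((1 : ℝ) / 2 - j))) atTop)
      refine h3.congr' ?_ ?_ <;> filter_upwards [eventually_gt_atTop 0] with L hL
      · rw [mul_assoc, ← Real.rpow_add hL, add_neg_cancel, Real.rpow_zero, mul_one]
      · rw [← Real.rpow_add hL]; congr 1; ring
    have h4 := h2.trans_tendsto (tendsto_rpow_neg_atTop one_pos)
    exact tendsto_nhds_unique tendsto_const_nhds h4

lemma expansionCoeff_eq (g : ℂ → ℂ) (j : ℕ) : expansionCoeff g j =
    1 / (2 * (landauRamanujan : ℂ) ^ 2) *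
      ((iteratedDeriv j g 0 / (j.factorial : ℂ)) / Complex.Gamma (3 / 2 - (j : ℂ))) := by
  rw [expansionCoeff, div_mul_eq_div_div_swap]
  ring

lemma landauRamanujan_ne_zero : (landauRamanujan : ℂ) ≠ 0 := by
  exact_mod_cast landauRamanujan_pos.ne'

/-- The expansion of the sum over all `h` at `H = e ^ (L - l)`; the main term is `H` because the
residue `2 K ^ 2` cancels the factor `1 / (2 K ^ 2)` of the singular series. -/
lemma expansion_complex (l : ℝ) (J : ℕ) :
    (fun L : ℝ => ((1 / (2 * landauRamanujan ^ 2) * smoothSum (Real.exp (L - l)) -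
      Real.exp (L - l) : ℝ) : ℂ) - ∑ j ∈ Finset.range (J + 1),
        expansionCoeff (fun s => Complex.exp (-l * s) * regularPart s) j *
          ((L ^ ((1 : ℝ) / 2 - j) : ℝ) : ℂ))
      =O[atTop] fun L => L ^ (-(1 : ℝ) / 2 - J) := by
  refine ((twistedSum_principal l J).const_mul_left (1 / (2 *
    (landauRamanujan : ℂ) ^ 2))).congr_left
    fun L => ?_
  have hK := landauRamanujan_ne_zero
  rw [← smoothSum_eq_twistedSum, mul_sub, mul_add, Finset.mul_sum]
  simp only [expansionCoeff_eq, mul_assoc]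
  push_cast
  rw [sub_sub]
  congr 2
  field_simp

/-- The expansion of the sum over all `h` at `H e ^ (-l)` in powers of `log H`, with real
coefficients. -/
lemma expansion_real (l : ℝ) : ∃ a : ℕ → ℝ,
    (∀ j, (a j : ℂ) = expansionCoeff (fun s => Complex.exp (-l * s) * regularPart s) j) ∧
    ∀ J : ℕ, (fun H : ℝ => 1 / (2 * landauRamanujan ^ 2) * smoothSum (H / Real.exp l) -
      (H / Real.exp l + ∑ j ∈ Finset.range (J + 1), a j * Real.log H ^ ((1 : ℝ) / 2 - j)))
      =O[atTop] fun H => Real.log H ^ (-(1 : ℝ) / 2 - J) := by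
  have him := im_eq_zero_of_expansion (fun J => expansion_complex l J)
  refine ⟨fun j => (expansionCoeff (fun s => Complex.exp (-l * s) * regularPart s) j).re,
    fun j => Complex.ext (Complex.ofReal_re _) ((Complex.ofReal_im _).trans (him j).symm),
      fun J => ?_⟩
  have h1 := ((expansion_complex l J).comp_tendsto Real.tendsto_log_atTop)
  refine IsBigO.of_norm_left ((h1.norm_left).congr' ?_ EventuallyEq.rfl)
  filter_upwards [eventually_gt_atTop 0] with H hH
  simp only [Function.comp, Real.exp_sub, Real.exp_log hH]
  rw [← Complex.norm_real, sub_add_eq_sub_sub, Complex.ofReal_sub _ (Finset.sum _ _),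
    Complex.ofReal_sum]
  congr 2
  refine Finset.sum_congr rfl fun j _ => ?_
  rw [Complex.ofReal_mul]
  congr 1
  exact (Complex.ext (Complex.ofReal_re _) ((Complex.ofReal_im _).trans (him j).symm)).symm

lemma hasDerivAt_exp_mul_regularPart (l : ℝ) :
    HasDerivAt (fun s => Complex.exp (-l * s) * regularPart s)
      (regularPart 0 * (-(omegaConst + Real.eulerMascheroniConstant) / 2 - l)) 0 := by
  have h1 : HasDerivAt (fun s : ℂ => Complex.exp (-l * s)) (-l) 0 := by
    simpa using ((hasDerivAt_id (0 : ℂ)).const_mul (-l : ℂ)).cexp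
  refine (h1.mul hasDerivAt_regularPart).congr_deriv ?_
  simp
  ring

lemma Gamma_half : Complex.Gamma (1 / 2) = ((Real.sqrt Real.pi : ℝ) : ℂ) := by
  rw [← Real.Gamma_one_half_eq, ← Complex.Gamma_ofReal]
  push_cast
  rfl

lemma sqrt_pi_sq : ((Real.sqrt Real.pi : ℝ) : ℂ) ^ 2 = (Real.pi : ℂ) := by
  exact_mod_cast Real.sq_sqrt Real.pi_pos.le

lemma sqrt_pi_ne_zero : ((Real.sqrt Real.pi : ℝ) : ℂ) ≠ 0 := by
  exact_mod_cast (Real.sqrt_pos.2 Real.pi_pos).ne'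

/-- The coefficient of `(log H) ^ (1 / 2)`. -/
lemma expansionCoeff_zero (l : ℝ) :
    expansionCoeff (fun s => Complex.exp (-l * s) * regularPart s) 0 =
      ((-(2 / (landauRamanujan * Real.pi)) : ℝ) : ℂ) := by
  have hK := landauRamanujan_ne_zero
  have hG : Complex.Gamma (3 / 2) = 1 / 2 * ((Real.sqrt Real.pi : ℝ) : ℂ) := by
    rw [show (3 / 2 : ℂ) = 1 / 2 + 1 by norm_num, Complex.Gamma_add_one _ (by norm_num), Gamma_half]
  have hpi := sqrt_pi_ne_zero
  rw [expansionCoeff]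
  simp only [iteratedDeriv_zero, mul_zero, Complex.exp_zero, one_mul, Nat.factorial_zero,
    Nat.cast_one, div_one, Nat.cast_zero, sub_zero, hG, regularPart_zero]
  push_cast
  rw [← sqrt_pi_sq]
  field_simp

/-- The coefficient of `(log H) ^ (-1 / 2)`. -/
lemma expansionCoeff_one (l : ℝ) :
    expansionCoeff (fun s => Complex.exp (-l * s) * regularPart s) 1 =
      1 / ((landauRamanujan : ℂ) * Real.pi) *
        ((omegaConst + Real.eulerMascheroniConstant) / 2 + l) := by
  have hK := landauRamanujan_ne_zero
  have hpi := sqrt_pi_ne_zero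
  rw [expansionCoeff, iteratedDeriv_one, (hasDerivAt_exp_mul_regularPart l).deriv, Nat.cast_one,
    show (3 / 2 - 1 : ℂ) = 1 / 2 by norm_num, Gamma_half, regularPart_zero, ← sqrt_pi_sq]
  push_cast
  field_simp
  simp
  ring

/-- The coefficients are linear in the function; this gives `c₁` as a multiple of `c - c₀`. -/
lemma expansionCoeff_sub (l : ℝ) (j : ℕ) :
    expansionCoeff (fun s => (1 - Complex.exp (-l * s)) * regularPart s) j =
      expansionCoeff regularPart j -
        expansionCoeff (fun s => Complex.exp (-l * s) * regularPart s) j := by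
  have h1 : AnalyticAt ℂ (fun s : ℂ => Complex.exp (-l * s) * regularPart s) 0 :=
    ((by fun_prop : Differentiable ℂ fun s : ℂ => Complex.exp (-l * s)).analyticAt 0).mul
      analyticAt_regularPart
  have e : (fun s : ℂ => (1 - Complex.exp (-l * s)) * regularPart s) =
      fun s => regularPart s - Complex.exp (-l * s) * regularPart s := by ext s; ring
  rw [e]
  simp only [expansionCoeff_eq]
  rw [iteratedDeriv_fun_sub analyticAt_regularPart.contDiffAt h1.contDiffAt]
  ring

lemma sum_range_eq_add_Icc (a : ℕ → ℝ) (x : ℝ) (J : ℕ) :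
    ∑ j ∈ Finset.range (J + 1), a j * x ^ ((1 : ℝ) / 2 - j) =
      a 0 * Real.sqrt x + ∑ j ∈ Finset.Icc 1 J, a j * x ^ ((1 : ℝ) / 2 - j) := by
  rw [Finset.sum_range_eq_add_Ico _ (Nat.succ_pos J), Nat.cast_zero, sub_zero, ← Real.sqrt_eq_rpow]
  rfl

end TwoSquares

end

theorem theorem1p2 :
    ∃ c : ℕ → ℝ,
      -- the coefficients `c j` are absolute and explicit
      (∀ j : ℕ, 1 ≤ j → (c j : ℂ) = TwoSquares.expansionCoeff TwoSquares.regularPart j) ∧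
      (c 1 : ℂ) = (TwoSquares.omegaConst + (Real.eulerMascheroniConstant : ℂ)) /
        (2 * (Real.pi : ℂ) * (TwoSquares.landauRamanujan : ℂ)) ∧
      -- the full sum
      (∀ J : ℕ, 1 ≤ J →
        (fun H : ℝ => TwoSquares.weightedSum {h : ℕ | 1 ≤ h} H -
            (H - 2 / (TwoSquares.landauRamanujan * Real.pi) * Real.sqrt (Real.log H) +
              ∑ j ∈ Finset.Icc 1 J, c j * Real.log H ^ ((1 : ℝ) / 2 - (j : ℝ))))
          =O[atTop] (fun H : ℝ => Real.log H ^ (-(1 : ℝ) / 2 - (J : ℝ)))) ∧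
      ∀ (q : ℕ) [Fact q.Prime], q % 4 = 1 →
        ∃ c₀ c₁ : ℕ → ℝ,
          -- the coefficients `c₀ j`, `c₁ j` depend only on `q` and are explicit
          (∀ j : ℕ, 1 ≤ j → (c₀ j : ℂ) =
            TwoSquares.expansionCoeff (fun s => (q : ℂ) ^ (-s) * TwoSquares.regularPart s) j) ∧
          (∀ j : ℕ, 1 ≤ j → (c₁ j : ℂ) =
            TwoSquares.expansionCoeff (fun s => (1 - (q : ℂ) ^ (-s)) * TwoSquares.regularPart s) j /
              (Nat.totient q : ℂ)) ∧
          (c₀ 1 : ℂ) = 1 / ((TwoSquares.landauRamanujan : ℂ) * (Real.pi : ℂ)) *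
            ((TwoSquares.omegaConst + (Real.eulerMascheroniConstant : ℂ)) / 2 +
              (Real.log q : ℂ)) ∧
          c₁ 1 = -(Real.log q / (TwoSquares.landauRamanujan * (Nat.totient q : ℝ) * Real.pi)) ∧
          (∀ j : ℕ, 1 ≤ j → c₀ j + (Nat.totient q : ℝ) * c₁ j = c j) ∧
          -- the sum over `h ≡ 0` modulo `q`
          (∀ J : ℕ, 1 ≤ J →
            (fun H : ℝ => TwoSquares.weightedSum {h : ℕ | 1 ≤ h ∧ (h : ZMod q) = 0} H -
                (H / (q : ℝ) -
                  2 / (TwoSquares.landauRamanujan * Real.pi) * Real.sqrt (Real.log H) +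
                  ∑ j ∈ Finset.Icc 1 J, c₀ j * Real.log H ^ ((1 : ℝ) / 2 - (j : ℝ))))
              =O[atTop] (fun H : ℝ => Real.log H ^ (-(1 : ℝ) / 2 - (J : ℝ)))) ∧
          -- the sums over `h ≡ v` modulo `q`, where `v ≢ 0`
          (∀ J : ℕ, 1 ≤ J → ∀ v : ZMod q, v ≠ 0 →
            (fun H : ℝ =>
                (TwoSquares.weightedSum {h : ℕ | 1 ≤ h ∧ (h : ZMod q) = v} H : ℂ) -
                ((H : ℂ) / (q : ℂ) +
                  1 / (2 * (TwoSquares.landauRamanujan : ℂ) ^ 2 * (Nat.totient q : ℂ)) *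
                    ∑ χ ∈ (Finset.univ : Finset (DirichletCharacter ℂ q)).filter (fun χ => χ ≠ 1),
                      starRingEnd ℂ (χ v) * TwoSquares.charConst χ +
                  ((∑ j ∈ Finset.Icc 1 J,
                    c₁ j * Real.log H ^ ((1 : ℝ) / 2 - (j : ℝ)) : ℝ) : ℂ)))
              =O[atTop] (fun H : ℝ => Real.log H ^ (-(1 : ℝ) / 2 - (J : ℝ)))) := by
  -- the expansion for all `h` is the case `l = 0`
  obtain ⟨c, hc, hcJ⟩ := TwoSquares.expansion_real 0
  have e0 : (fun s : ℂ => Complex.exp (-((0 : ℝ) : ℂ) * s) * TwoSquares.regularPart s) =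
      TwoSquares.regularPart := by ext s; simp
  have hK := TwoSquares.landauRamanujan_ne_zero
  have hpi : (Real.pi : ℂ) ≠ 0 := by exact_mod_cast Real.pi_ne_zero
  have hcz : c 0 = -(2 / (TwoSquares.landauRamanujan * Real.pi)) := by
    have h := hc 0
    rw [TwoSquares.expansionCoeff_zero] at h
    exact_mod_cast h
  have hc1 : (c 1 : ℂ) = 1 / ((TwoSquares.landauRamanujan : ℂ) * Real.pi) *
      ((TwoSquares.omegaConst + Real.eulerMascheroniConstant) / 2) := by
    rw [hc 1, TwoSquares.expansionCoeff_one, Complex.ofReal_zero, add_zero]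
  refine ⟨c, fun j _ => by rw [hc j, e0], ?_, fun J _ => ?_, fun q _ hq4 => ?_⟩
  · rw [hc1]
    field_simp
  · refine (hcJ J).congr_left fun H => ?_
    rw [TwoSquares.weightedSum_all, TwoSquares.sum_range_eq_add_Icc, hcz, Real.exp_zero, div_one]
    ring
  have hq : q.Prime := Fact.out
  have hq0 : (0 : ℝ) < q := by exact_mod_cast hq.pos
  -- the multiples of `q` give the sum at `H / q`, which is the case `l = log q`
  obtain ⟨c₀, hc₀, hcJ₀⟩ := TwoSquares.expansion_real (Real.log q)
  have hexp : ∀ s : ℂ, Complex.exp (-((Real.log q : ℝ) : ℂ) * s) = (q : ℂ) ^ (-s) := fun s => by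
    rw [Complex.cpow_def_of_ne_zero (by exact_mod_cast hq.ne_zero), Complex.ofReal_log hq0.le,
      Complex.ofReal_natCast]
    congr 1
    ring
  rw [Real.exp_log hq0] at hcJ₀
  have hφ : (q.totient : ℝ) ≠ 0 := by exact_mod_cast (Nat.totient_pos.2 hq.pos).ne'
  have hφ' : (q.totient : ℂ) ≠ 0 := by exact_mod_cast hφ
  have hcz₀ : c₀ 0 = -(2 / (TwoSquares.landauRamanujan * Real.pi)) := by
    have h := hc₀ 0
    rw [TwoSquares.expansionCoeff_zero] at h
    exact_mod_cast h
  have hc₀1 := hc₀ 1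
  rw [TwoSquares.expansionCoeff_one] at hc₀1
  -- the coefficients `c₁` come from the principal character modulo `q`, that is, from the
  -- difference of the two expansions, divided by `φ(q)`
  refine ⟨c₀, fun j => (c j - c₀ j) / q.totient, fun j _ => ?_, fun j _ => ?_, hc₀1, ?_,
    fun j _ => ?_, fun J _ => ?_, fun J _ v hv => ?_⟩
  · rw [hc₀ j]
    simp only [hexp]
  · have h := TwoSquares.expansionCoeff_sub (Real.log q) j
    rw [← hc₀ j, ← e0, ← hc j] at h
    simp only [hexp] at h
    simp only [Complex.ofReal_zero, neg_zero, zero_mul, Complex.exp_zero, one_mul] at h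
    rw [h]
    push_cast
    rfl
  · have h : (((c 1 - c₀ 1) / q.totient : ℝ) : ℂ) =
        ((-(Real.log q / (TwoSquares.landauRamanujan * (q.totient : ℝ) * Real.pi)) : ℝ) : ℂ) := by
      push_cast
      rw [hc1, hc₀1]
      push_cast
      field_simp
      ring
    exact_mod_cast h
  · field_simp
    ring
  · refine (hcJ₀ J).congr_left fun H => ?_
    rw [TwoSquares.weightedSum_zero_class hq hq4, TwoSquares.sum_range_eq_add_Icc, hcz₀]
    ring
  · have hcop : Nat.Coprime 4 q := by
      rw [show 4 = 2 ^ 2 by norm_num]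
      exact Nat.Coprime.pow_left 2 ((Nat.coprime_primes Nat.prime_two hq).2 fun h => by
        rw [← h] at hq4; norm_num at hq4)
    have hT : (fun H : ℝ => ∑ χ ∈ (Finset.univ : Finset (DirichletCharacter ℂ q)).filter
        (fun χ => χ ≠ 1), starRingEnd ℂ (χ v) *
          (TwoSquares.twistedSum χ (Real.exp (Real.log H)) - TwoSquares.charConst χ)) =O[atTop]
        fun H => Real.log H ^ (-(1 : ℝ) / 2 - (J : ℝ)) :=
      IsBigO.fun_sum fun χ hχ => ((TwoSquares.twistedSum_nonprincipal hcop (Finset.mem_filter.1 hχ).2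
        J).comp_tendsto Real.tendsto_log_atTop).const_mul_left _
    have hS := ((hcJ J).sub (hcJ₀ J)).norm_left.congr_left
      fun H => (Complex.norm_real _).symm
    refine ((hS.of_norm_left.const_mul_left (1 / (q.totient : ℂ))).add
      (hT.const_mul_left (1 / (2 * (TwoSquares.landauRamanujan : ℂ) ^ 2 * q.totient)))).congr' ?_
      EventuallyEq.rfl
    filter_upwards [eventually_gt_atTop 0] with H hH
    have htot : (q.totient : ℝ) = q - 1 := by
      rw [Nat.totient_prime hq, Nat.cast_sub hq.one_le, Nat.cast_one]
    rw [TwoSquares.weightedSum_class hq4 hv hH, Real.exp_log hH, TwoSquares.sum_range_eq_add_Icc,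
      TwoSquares.sum_range_eq_add_Icc, hcz, hcz₀]
    have hsum : ∑ j ∈ Finset.Icc 1 J, (c j - c₀ j) / q.totient * Real.log H ^ ((1 : ℝ) / 2 - j) =
        (∑ j ∈ Finset.Icc 1 J, c j * Real.log H ^ ((1 : ℝ) / 2 - j) -
          ∑ j ∈ Finset.Icc 1 J, c₀ j * Real.log H ^ ((1 : ℝ) / 2 - j)) / q.totient := by
      rw [← Finset.sum_sub_distrib, Finset.sum_div]
      exact Finset.sum_congr rfl fun j _ => by ring
    -- the main terms agree because `φ(q) = q - 1`
    have hmain : (H : ℂ) / q = ((H - H / q : ℝ) : ℂ) / q.totient := by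
      have h : H / q = (H - H / q) / q.totient := by
        rw [htot] at hφ ⊢
        field_simp
      rw [← Complex.ofReal_natCast, ← Complex.ofReal_natCast, ← Complex.ofReal_div,
        ← Complex.ofReal_div, ← h]
    rw [hsum, hmain, Real.exp_zero, div_one]
    simp only [mul_sub, Finset.sum_sub_distrib]
    push_cast
    field_simp
    ring
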